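/- Let $k\ge 1$ and let $X$ be a topological space. All manifolds are smooth, Hausdorff and second countable. A stable framing of an $n$-manifold $M$ is an isomorphism of vector bundles $TM\oplus\mathbb{R}^r\to\mathbb{R}^n\oplus\mathbb{R}^r$ for some $r$. Let $\Omega_n(X)$ (respectively $\Omega_n^{fr}(X)$) be the group of bordism classes of closed $n$-manifolds (respectively stably framed closed $n$-manifolds) with a continuous map to $X$, with disjoint union as addition, and let $\Omega_n=\Omega_n(\ast)$, $\Omega_n^{fr}=\Omega_n^{fr}(\ast)$. *Singularities.* Fix a set $\mathbb{M}$ of closed $k$-manifolds. In the framed case each $P\in\mathbb{M}$ carries a stable framing $st^P$ and $\mathbb{M}$ contains a representative of each isomorphism class (diffeomorphism respecting the stable framings) of stably framed closed $k$-manifolds; in the unoriented case $\mathbb{M}$ contains a representative of each diffeomorphism class of closed $k$-manifolds. A compact manifold with $k$-dimensional Baas–Sullivan singularities ($k$-BS manifold) is a compact manifold with faces $M$ together with compact manifolds with faces $N_P$ ($P\in\mathbb{M}$), only finitely many of them non-empty, and an embedding $\iota:\bigsqcup_P N_P\times P\hookrightarrow M$ onto a boundary face, the singular face; the faces not contained in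 it are called essential. It is closed if it has no essential faces of positive codimension. A continuous map $M\to X$ is compatible with the singularities if on each $\iota(N_P\times P)$ it depends only on the $N_P$-coordinate. A stable framing of $M$ is compatible with the singularities if, writing $n=\dim M$, over each $N_P\times P$ it is the direct sum of $st^P$ and a stable isomorphism $TN_P\oplus\mathbb{R}\sigma\to\mathbb{R}^{n-k}$ over $N_P$ (which is part of the data), $\sigma$ being the inward normal. A bordism between closed $k$-BS manifolds $M,M'$ is a compact $k$-BS manifold whose essential boundary is $M\sqcup M'$, inducing on $M$ and $M'$ their given structures. Let $\Omega_n^{k\text{-}BS}(X)$ (respectively $\Omega_n^{fr;k\text{-}BS}(X)$) be the group of bordism classes of closed $n$-dimensional $k$-BS manifolds (respectively with compatible stable framings) with compatible continuous maps to $X$, where bordisms carry compatible maps (and framings) too. **Proposition.** The natural map $\Omega_{k+1}^{fr}(X)\to\Omega_{k+1}^{fr;k\text{-}BS}(X)$, which regards a manifold as a $k$-BS manifold with all $N_P$ empty, has kernel $\Omega_k^{fr}\cdot\Omega_1^{fr}(X)$, the subgroup generated by the products $[P]\cdot[N\to X]=[P\times N\to N\to X]$. Likewise, in the unoriented case, the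 natural map $\Omega_{k+1}(X)\to\Omega_{k+1}^{k\text{-}BS}(X)$ has kernel $\Omega_k\cdot\Omega_1(X)$. -/

import Mathlib

open scoped Manifold ContDiff

noncomputable section

namespace BaasSullivan

/-! ### Compact manifolds with corners -/

/-- The model `[0,∞)ⁿ ⊆ ℝⁿ` for `n`-manifolds with corners. -/
abbrev Q (n : ℕ) : ModelWithCorners ℝ (EuclideanSpace ℝ (Fin n)) (EuclideanQuadrant n) :=
  modelWithCornersEuclideanQuadrant n

/-- The half-line `[0,∞)`. -/
abbrev Ray : Type := EuclideanQuadrant 1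

/-- A compact smooth `n`-manifold with corners (Hausdorff, second countable).  Every such manifold
has at most the cardinality of the continuum, so the universe `Type` contains them all up to
diffeomorphism. -/
structure CompactManifold (n : ℕ) where
  carrier : Type
  [topology : TopologicalSpace carrier]
  [charted : ChartedSpace (EuclideanQuadrant n) carrier]
  [smooth : IsManifold (Q n) ∞ carrier]
  [compact : CompactSpace carrier]
  [hausdorff : T2Space carrier]
  [secondCountable : SecondCountableTopology carrier]

namespace CompactManifold

instance (n : ℕ) : CoeSort (CompactManifold n) Type := ⟨CompactManifold.carrier⟩

attribute [instance] topology charted smooth compact hausdorff secondCountable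

/-- The boundary: the set of points of positive codimension. -/
def boundary {n : ℕ} (M : CompactManifold n) : Set M := (Q n).boundary M

/-- The tangent space at a point. -/
abbrev Tangent {n : ℕ} (M : CompactManifold n) (x : M) : Type := TangentSpace (Q n) x

/-- The empty `n`-manifold. -/
def empty (n : ℕ) : CompactManifold n :=
  letI : ChartedSpace (EuclideanQuadrant n) Empty := ChartedSpace.empty _ _
  { carrier := Empty }

instance (n : ℕ) : IsEmpty (empty n) := inferInstanceAs (IsEmpty Empty)

end CompactManifold

/-- A closed smooth `n`-manifold: compact, without boundary. -/
structure ClosedManifold (n : ℕ) extends CompactManifold n where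
  boundary_eq : toCompactManifold.boundary = ∅

/-- The inclusion of a boundary face `F` in `W`, together with a collar: an injective local
diffeomorphism `F × [0,∞) → W`, the face inclusion being its restriction to `F × {0}`. -/
structure Collar {n : ℕ} (F : CompactManifold n) (W : CompactManifold (n + 1)) where
  toFun : F × Ray → W
  isLocalDiffeomorph : IsLocalDiffeomorph ((Q n).prod (Q 1)) (Q (n + 1)) ∞ toFun
  injective : Function.Injective toFun

namespace Collar

variable {n : ℕ} {F : CompactManifold n} {W : CompactManifold (n + 1)}

/-- The inclusion of the face. -/
def face (c : Collar F W) (x : F) : W := c.toFun (x, 0)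

/-- The isomorphism `TF ⊕ ℝ → TW` over the face, sending the generator of `ℝ` to the inward
normal given by the collar. -/
def deriv (c : Collar F W) (x : F) (v : F.Tangent x) (t : ℝ) : W.Tangent (c.face x) :=
  mfderiv ((Q n).prod (Q 1)) (Q (n + 1)) c.toFun (x, 0)
    ((v, EuclideanSpace.single 0 t) : EuclideanSpace ℝ (Fin n) × EuclideanSpace ℝ (Fin 1))

end Collar

/-! ### Stable framings -/

/-- For a linear map `g : ℝʳ → V × ℝʳ` (possibly depending on further arguments), its extension
`ℝ^ℕ → V × ℝ^ℕ` by the identity on the coordinates `≥ r`. -/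
def stabilise {V : Type*} (r : ℕ)
    (g : EuclideanSpace ℝ (Fin r) → V × EuclideanSpace ℝ (Fin r)) (s : ℕ → ℝ) : V × (ℕ → ℝ) :=
  let u := g (WithLp.toLp 2 fun i => s i)
  (u.1, fun i => if h : i < r then u.2 ⟨i, h⟩ else s i)

/-- A stable framing of an `n`-manifold: an isomorphism of vector bundles
`TM ⊕ ℝʳ → ℝⁿ ⊕ ℝʳ` for some `r`. -/
structure StableFraming {n : ℕ} (M : CompactManifold n) where
  rank : ℕ
  iso : ∀ x : M, (M.Tangent x × EuclideanSpace ℝ (Fin rank)) ≃L[ℝ]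
    (EuclideanSpace ℝ (Fin n) × EuclideanSpace ℝ (Fin rank))
  continuous_iso : Continuous fun z : TangentBundle (Q n) M × EuclideanSpace ℝ (Fin rank) =>
    iso z.1.proj (z.1.snd, z.2)

/-- The stable framing, extended to arbitrarily large stabilising bundles by the identity. -/
def StableFraming.extend {n : ℕ} {M : CompactManifold n} (φ : StableFraming M) (x : M)
    (v : M.Tangent x) (s : ℕ → ℝ) : EuclideanSpace ℝ (Fin n) × (ℕ → ℝ) :=
  stabilise φ.rank (fun a => φ.iso x (v, a)) s

/-- A stable isomorphism `TN ⊕ ℝ → ℝ^{d+1}`, where `N` has dimension `d`: an isomorphism of vector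
bundles `TN ⊕ ℝ ⊕ ℝʳ → ℝ^{d+1} ⊕ ℝʳ` for some `r`. -/
structure FaceFraming {d : ℕ} (N : CompactManifold d) where
  rank : ℕ
  iso : ∀ x : N, (N.Tangent x × ℝ × EuclideanSpace ℝ (Fin rank)) ≃L[ℝ]
    (EuclideanSpace ℝ (Fin (d + 1)) × EuclideanSpace ℝ (Fin rank))
  continuous_iso : Continuous fun z : TangentBundle (Q d) N × ℝ × EuclideanSpace ℝ (Fin rank) =>
    iso z.1.proj (z.1.snd, z.2)

/-- The stable isomorphism, extended to arbitrarily large stabilising bundles by the identity. -/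
def FaceFraming.extend {d : ℕ} {N : CompactManifold d} (φ : FaceFraming N) (x : N)
    (v : N.Tangent x) (t : ℝ) (s : ℕ → ℝ) : EuclideanSpace ℝ (Fin (d + 1)) × (ℕ → ℝ) :=
  stabilise φ.rank (fun a => φ.iso x (v, t, a)) s

/-- `ℝⁿ ⊕ ℝ = ℝ^{n+1}`. -/
def snoc {n : ℕ} (a : EuclideanSpace ℝ (Fin n)) (t : ℝ) : EuclideanSpace ℝ (Fin (n + 1)) :=
  WithLp.toLp 2 (Fin.snoc (α := fun _ => ℝ) a t)

/-- `ℝᵏ ⊕ ℝᵐ = ℝ^{k+m}`. -/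
def append {k m : ℕ} (a : EuclideanSpace ℝ (Fin k)) (b : EuclideanSpace ℝ (Fin m)) :
    EuclideanSpace ℝ (Fin (k + m)) :=
  WithLp.toLp 2 (Fin.append a b)

/-- The coordinates `≥ r`, which form the orthogonal complement of `ℝʳ`. -/
def tail (r : ℕ) (s : ℕ → ℝ) : ℕ → ℝ := fun i => s (i + r)

/-- The direct sum of a value in `ℝᵏ ⊕ ℝʳ` and one in `ℝᵐ ⊕ (ℝʳ)^⊥`. -/
def directSum {k m : ℕ} (r : ℕ) (u : EuclideanSpace ℝ (Fin k) × (ℕ → ℝ))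
    (u' : EuclideanSpace ℝ (Fin m) × (ℕ → ℝ)) : EuclideanSpace ℝ (Fin (k + m)) × (ℕ → ℝ) :=
  (append u.1 u'.1, fun i => if i < r then u.2 i else u'.2 (i - r))

/-- Compatibility of a framing of `W` with one of a boundary face `F`: over `F` the framing of `W`
is the stable isomorphism `TW = TF ⊕ ℝσ → ℝⁿ ⊕ ℝσ = ℝ^{n+1}` that is the sum of the framing of `F`
and the identity, where `σ` is `ε` times the inward normal.  So `ε = 1` for an incoming face,
and `ε = -1` for an outgoing one. -/
def Collar.Compatible {n : ℕ} {F : CompactManifold n} {W : CompactManifold (n + 1)}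
    (c : Collar F W) (ε : ℝ) (φF : StableFraming F) (φW : StableFraming W) : Prop :=
  ∀ (x : F) (v : F.Tangent x) (t : ℝ) (s : ℕ → ℝ),
    φW.extend (c.face x) (c.deriv x v t) s
      = (snoc (φF.extend x v s).1 (ε * t), (φF.extend x v s).2)

/-- A closed `n`-manifold with a stable framing. -/
structure FramedManifold (n : ℕ) extends ClosedManifold n where
  framing : StableFraming toCompactManifold

/-- An isomorphism of framed manifolds: a diffeomorphism that respects the stable framings. -/
def FramedManifold.Isomorphic {n : ℕ} (P P' : FramedManifold n) : Prop :=
  ∃ Φ : Diffeomorph (Q n) (Q n) P.toCompactManifold P'.toCompactManifold ∞,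
    ∀ (x : P.toCompactManifold) (v : P.toCompactManifold.Tangent x) (s : ℕ → ℝ),
      P'.framing.extend (Φ x) (mfderiv (Q n) (Q n) Φ x v) s = P.framing.extend x v s

/-! ### Bordism groups from a bordism relation -/

/-- The relations `[A] = [B]` for bordant `A`, `B` and `[C] = [A] + [B]` for a disjoint union
`C = A ⊔ B`. -/
def relations {S : Type*} (bordant : S → S → Prop) (union : S → S → S → Prop) :
    Set (FreeAbelianGroup S) :=
  {z | ∃ A B, bordant A B ∧ z = FreeAbelianGroup.of A - FreeAbelianGroup.of B} ∪
  {z | ∃ A B C, union A B C ∧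
    z = FreeAbelianGroup.of C - (FreeAbelianGroup.of A + FreeAbelianGroup.of B)}

/-- The abelian group of bordism classes, with disjoint union as addition: it is generated by the
objects in `S`, with bordant objects identified and disjoint unions turned into sums.  (For
the bordism relations below every element is the class of a single object, and two objects have
the same class iff they are bordant.) -/
abbrev BordismGroup {S : Type*} (bordant : S → S → Prop) (union : S → S → S → Prop) : Type _ :=
  FreeAbelianGroup S ⧸ AddSubgroup.closure (relations bordant union)

/-- The class of an object. -/
def BordismGroup.cls {S : Type*} {bordant : S → S → Prop} {union : S → S → S → Prop} (A : S) :
    BordismGroup bordant union :=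
  QuotientAddGroup.mk (FreeAbelianGroup.of A)

/-- The homomorphism `[A] ↦ [f A]`, for a map `f` that preserves bordism and disjoint unions. -/
def BordismGroup.map {S S' : Type*} {bordant : S → S → Prop} {union : S → S → S → Prop}
    {bordant' : S' → S' → Prop} {union' : S' → S' → S' → Prop} (f : S → S')
    (hb : ∀ A B, bordant A B → bordant' (f A) (f B))
    (hu : ∀ A B C, union A B C → union' (f A) (f B) (f C)) :
    BordismGroup bordant union →+ BordismGroup bordant' union' :=
  QuotientAddGroup.map _ _ (FreeAbelianGroup.map f) <| by
    rw [AddSubgroup.closure_le]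
    rintro z (⟨A, B, h, rfl⟩ | ⟨A, B, C, h, rfl⟩)
    · refine AddSubgroup.subset_closure (Or.inl ⟨f A, f B, hb _ _ h, ?_⟩)
      simp
    · refine AddSubgroup.subset_closure (Or.inr ⟨f A, f B, f C, hu _ _ _ h, ?_⟩)
      simp

theorem BordismGroup.map_cls {S S' : Type*} {bordant : S → S → Prop} {union : S → S → S → Prop}
    {bordant' : S' → S' → Prop} {union' : S' → S' → S' → Prop} (f : S → S')
    (hb : ∀ A B, bordant A B → bordant' (f A) (f B))
    (hu : ∀ A B C, union A B C → union' (f A) (f B) (f C)) (A : S) :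
    BordismGroup.map f hb hu (BordismGroup.cls A : BordismGroup bordant union)
      = (BordismGroup.cls (f A) : BordismGroup bordant' union') := by
  simp [BordismGroup.map, BordismGroup.cls]

/-! ### Bordism of closed manifolds -/

/-- A bordism `W` from `A` to `B`, for `n`-manifolds without boundary: a compact `(n+1)`-manifold
whose boundary is the disjoint union of an incoming face `A` and an outgoing face `B`. -/
structure Bordism {n : ℕ} (A B : CompactManifold n) where
  W : CompactManifold (n + 1)
  cA : Collar A W
  cB : Collar B W
  disjoint : ∀ z z', cA.toFun z ≠ cB.toFun z'
  boundary_eq : W.boundary = Set.range cA.face ∪ Set.range cB.face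

/-- `C` is the disjoint union of `A` and `B`, embedded by `a` and `b`. -/
structure DisjointUnion {n : ℕ} (A B C : CompactManifold n) where
  a : A → C
  b : B → C
  isLocalDiffeomorph_a : IsLocalDiffeomorph (Q n) (Q n) ∞ a
  isLocalDiffeomorph_b : IsLocalDiffeomorph (Q n) (Q n) ∞ b
  bijective : Function.Bijective (Sum.elim a b)

/-- The stable framing of a disjoint union restricts to those of the pieces. -/
def DisjointUnion.Compatible {n : ℕ} {A B C : CompactManifold n} (u : DisjointUnion A B C)
    (φA : StableFraming A) (φB : StableFraming B) (φC : StableFraming C) : Prop :=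
  (∀ (x : A) (v : A.Tangent x) (s : ℕ → ℝ),
    φC.extend (u.a x) (mfderiv (Q n) (Q n) u.a x v) s = φA.extend x v s) ∧
  (∀ (x : B) (v : B.Tangent x) (s : ℕ → ℝ),
    φC.extend (u.b x) (mfderiv (Q n) (Q n) u.b x v) s = φB.extend x v s)

section Unoriented

variable (n : ℕ) (X : Type*) [TopologicalSpace X]

/-- A closed `n`-manifold with a continuous map to `X`. -/
structure Singular extends ClosedManifold n where
  map : C(toCompactManifold, X)

variable {n X}

/-- Two closed manifolds over `X` are bordant over `X`. -/
def Singular.Bordant (A B : Singular n X) : Prop :=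
  ∃ (b : Bordism A.toCompactManifold B.toCompactManifold) (F : C(b.W, X)),
    (∀ x, F (b.cA.face x) = A.map x) ∧ (∀ x, F (b.cB.face x) = B.map x)

/-- `C` is the disjoint union of `A` and `B` over `X`. -/
def Singular.Union (A B C : Singular n X) : Prop :=
  ∃ u : DisjointUnion A.toCompactManifold B.toCompactManifold C.toCompactManifold,
    (∀ x, C.map (u.a x) = A.map x) ∧ (∀ x, C.map (u.b x) = B.map x)

variable (n X)

/-- The unoriented bordism group `Ω_n(X)`. -/
abbrev Omega : Type _ := BordismGroup (Singular.Bordant (n := n) (X := X)) Singular.Union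

/-- A closed `n`-manifold with a stable framing and a continuous map to `X`. -/
structure FramedSingular extends FramedManifold n where
  map : C(toCompactManifold, X)

variable {n X}

/-- Two closed framed manifolds over `X` are framed bordant over `X`. -/
def FramedSingular.Bordant (A B : FramedSingular n X) : Prop :=
  ∃ (b : Bordism A.toCompactManifold B.toCompactManifold) (F : C(b.W, X))
    (φ : StableFraming b.W),
    (∀ x, F (b.cA.face x) = A.map x) ∧ (∀ x, F (b.cB.face x) = B.map x) ∧
    b.cA.Compatible 1 A.framing φ ∧ b.cB.Compatible (-1) B.framing φ

/-- `C` is the disjoint union of `A` and `B`, as framed manifolds over `X`. -/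
def FramedSingular.Union (A B C : FramedSingular n X) : Prop :=
  ∃ u : DisjointUnion A.toCompactManifold B.toCompactManifold C.toCompactManifold,
    (∀ x, C.map (u.a x) = A.map x) ∧ (∀ x, C.map (u.b x) = B.map x) ∧
    u.Compatible A.framing B.framing C.framing

variable (n X)

/-- The framed bordism group `Ω_n^fr(X)`. -/
abbrev FramedOmega : Type _ :=
  BordismGroup (FramedSingular.Bordant (n := n) (X := X)) FramedSingular.Union

end Unoriented

/-! ### Products -/

section Products

variable {k m : ℕ} {X : Type*} [TopologicalSpace X]

/-- `C` is the product of the closed `k`-manifold `P` and the `m`-manifold `N` over `X`, with the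
map to `X` given by that of `N`. -/
def IsProduct (P : ClosedManifold k) (N : Singular m X) (C : Singular (k + m) X) : Prop :=
  ∃ Φ : Diffeomorph ((Q k).prod (Q m)) (Q (k + m))
      (P.toCompactManifold × N.toCompactManifold) C.toCompactManifold ∞,
    ∀ p x, C.map (Φ (p, x)) = N.map x

/-- `C` is the product of the framed closed `k`-manifold `P` and the framed `m`-manifold `N`
over `X`, with the product framing. -/
def IsFramedProduct (P : FramedManifold k) (N : FramedSingular m X)
    (C : FramedSingular (k + m) X) : Prop :=
  ∃ Φ : Diffeomorph ((Q k).prod (Q m)) (Q (k + m))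
      (P.toCompactManifold × N.toCompactManifold) C.toCompactManifold ∞,
    (∀ p x, C.map (Φ (p, x)) = N.map x) ∧
    ∀ (p : P.toCompactManifold) (x : N.toCompactManifold) (w : P.toCompactManifold.Tangent p)
      (v : N.toCompactManifold.Tangent x) (s : ℕ → ℝ),
      C.framing.extend (Φ (p, x)) (mfderiv ((Q k).prod (Q m)) (Q (k + m)) Φ (p, x)
          ((w, v) : EuclideanSpace ℝ (Fin k) × EuclideanSpace ℝ (Fin m))) s
        = directSum P.framing.rank (P.framing.extend p w s)
            (N.framing.extend x v (tail P.framing.rank s))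

variable (k m X)

/-- The subgroup `Ω_k · Ω_m(X)` of `Ω_{k+m}(X)` generated by all products `[P] · [N]`. -/
def products : AddSubgroup (Omega (k + m) X) :=
  AddSubgroup.closure {z | ∃ P N C, IsProduct P N C ∧ z = BordismGroup.cls C}

/-- The subgroup `Ω_k^fr · Ω_m^fr(X)` of `Ω_{k+m}^fr(X)` generated by all products `[P] · [N]`. -/
def framedProducts : AddSubgroup (FramedOmega (k + m) X) :=
  AddSubgroup.closure {z | ∃ P N C, IsFramedProduct P N C ∧ z = BordismGroup.cls C}

end Products

/-! ### Manifolds with Baas–Sullivan singularities -/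

/-- A compact `(k+d+1)`-manifold with `k`-dimensional Baas–Sullivan singularities of the types
`P i`: a compact manifold `M` with corners and `d`-manifolds `N i`, finitely many of
them non-empty, with a boundary face `⨆ i, N i × P i` of `M` (the singular face), given together
with a collar. -/
structure BSManifold {k : ℕ} {J : Type*} (P : J → CompactManifold k) (d : ℕ) where
  M : CompactManifold (k + (d + 1))
  N : J → CompactManifold d
  finite : {i | Nonempty (N i)}.Finite
  ι : ∀ i, N i × P i × Ray → M
  isLocalDiffeomorph : ∀ i,
    IsLocalDiffeomorph ((Q d).prod ((Q k).prod (Q 1))) (Q (k + (d + 1))) ∞ (ι i)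
  injective : Function.Injective fun z : Σ i, N i × P i × Ray => ι z.1 z.2

namespace BSManifold

variable {k d : ℕ} {J : Type*} {P : J → CompactManifold k}

/-- The inclusion of the singular face. -/
def face (A : BSManifold P d) (i : J) (x : A.N i) (p : P i) : A.M := A.ι i (x, p, 0)

/-- The singular face, as a subset. -/
def singularFace (A : BSManifold P d) : Set A.M := {y | ∃ i x p, A.face i x p = y}

/-- The isomorphism `TN ⊕ TP ⊕ ℝσ → TM` over the singular face, where `σ` is sent to the inward
normal given by the collar. -/
def deriv (A : BSManifold P d) (i : J) (x : A.N i) (p : P i) (v : (A.N i).Tangent x)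
    (w : (P i).Tangent p) (t : ℝ) : A.M.Tangent (A.face i x p) :=
  mfderiv ((Q d).prod ((Q k).prod (Q 1))) (Q (k + (d + 1))) (A.ι i) (x, p, 0)
    ((v, w, EuclideanSpace.single 0 t) :
      EuclideanSpace ℝ (Fin d) × EuclideanSpace ℝ (Fin k) × EuclideanSpace ℝ (Fin 1))

/-- A manifold with singularities is closed if every boundary point is on the singular face. -/
def IsClosed (A : BSManifold P d) : Prop := A.M.boundary = A.singularFace

/-- A map is compatible with the singularities if it is constant in the `P i`-directions. -/
def MapCompatible {X : Type*} (A : BSManifold P d) (f : A.M → X) : Prop :=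
  ∀ i (x : A.N i) (p p' : P i), f (A.face i x p) = f (A.face i x p')

/-- A stable framing `TM → ℝ^{k+d+1}` compatible with the singularities, where each `P i` carries a
stable framing `φP i`: over `N i × P i` it is the direct sum of `φP i : TP → ℝᵏ` and of a stable
isomorphism `TN ⊕ ℝσ → ℝ^{d+1}` over `N i`, whose stabilising bundle is the orthogonal complement
of that of `φP i`. -/
structure Framing (A : BSManifold P d) (φP : ∀ i, StableFraming (P i)) where
  total : StableFraming A.M
  normal : ∀ i, FaceFraming (A.N i)
  compatible : ∀ i (x : A.N i) (p : P i) (v : (A.N i).Tangent x) (w : (P i).Tangent p) (t : ℝ)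
    (s : ℕ → ℝ), total.extend (A.face i x p) (A.deriv i x p v w t) s
      = directSum (φP i).rank ((φP i).extend p w s)
          ((normal i).extend x v t (tail (φP i).rank s))

/-- A bordism from `A` to `B`, for closed manifolds with singularities: a compact manifold `W` with
singularities whose essential boundary faces are an incoming face `A` and an outgoing face `B`,
which are disjoint.  The essential faces meet the singular face of `W` in their own
singular faces, with `A.N i` and `B.N i` faces of `W.N i`, and the collars agree there. -/
structure Bordism (A B : BSManifold P d) where
  W : BSManifold P (d + 1)
  cA : Collar A.M W.M
  cB : Collar B.M W.M
  cNA : ∀ i, Collar (A.N i) (W.N i)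
  cNB : ∀ i, Collar (B.N i) (W.N i)
  disjoint : ∀ z z', cA.toFun z ≠ cB.toFun z'
  disjoint_N : ∀ i z z', (cNA i).toFun z ≠ (cNB i).toFun z'
  corner_A : ∀ i (x : A.N i) (p : P i) (s t : Ray),
    cA.toFun (A.ι i (x, p, s), t) = W.ι i ((cNA i).toFun (x, t), p, s)
  corner_B : ∀ i (x : B.N i) (p : P i) (s t : Ray),
    cB.toFun (B.ι i (x, p, s), t) = W.ι i ((cNB i).toFun (x, t), p, s)
  essential_A : ∀ a, cA.face a ∈ W.singularFace ↔ a ∈ A.singularFace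
  essential_B : ∀ b, cB.face b ∈ W.singularFace ↔ b ∈ B.singularFace
  boundary_eq : W.M.boundary = Set.range cA.face ∪ Set.range cB.face ∪ W.singularFace

/-- `C` is the disjoint union of `A` and `B`, as manifolds with singularities. -/
structure DisjointUnion (A B C : BSManifold P d) where
  total : BaasSullivan.DisjointUnion A.M B.M C.M
  sing : ∀ i, BaasSullivan.DisjointUnion (A.N i) (B.N i) (C.N i)
  compatible_a : ∀ i (x : A.N i) (p : P i) (s : Ray),
    total.a (A.ι i (x, p, s)) = C.ι i ((sing i).a x, p, s)
  compatible_b : ∀ i (x : B.N i) (p : P i) (s : Ray),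
    total.b (B.ι i (x, p, s)) = C.ι i ((sing i).b x, p, s)

end BSManifold

section BSGroups

variable {k : ℕ} {J : Type*} (P : J → CompactManifold k) (φP : ∀ i, StableFraming (P i))
  (d : ℕ) (X : Type*) [TopologicalSpace X]

/-- A closed `(k+d+1)`-manifold with singularities of the types `P i`, with a continuous map to `X`
that is compatible with the singularities. -/
structure BSSingular extends BSManifold P d where
  closed : toBSManifold.IsClosed
  map : C(M, X)
  map_compatible : toBSManifold.MapCompatible map

variable {P d X}

/-- Bordism over `X` of closed manifolds with singularities. -/
def BSSingular.Bordant (A B : BSSingular P d X) : Prop :=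
  ∃ (b : A.toBSManifold.Bordism B.toBSManifold) (F : C(b.W.M, X)),
    b.W.MapCompatible F ∧
    (∀ x, F (b.cA.face x) = A.map x) ∧ (∀ x, F (b.cB.face x) = B.map x)

/-- `C` is the disjoint union of `A` and `B` over `X`. -/
def BSSingular.Union (A B C : BSSingular P d X) : Prop :=
  ∃ u : BSManifold.DisjointUnion A.toBSManifold B.toBSManifold C.toBSManifold,
    (∀ x, C.map (u.total.a x) = A.map x) ∧ (∀ x, C.map (u.total.b x) = B.map x)

variable (P d X)

/-- The bordism group of closed `(k+d+1)`-manifolds with singularities over `X`. -/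
abbrev BSOmega : Type _ :=
  BordismGroup (BSSingular.Bordant (P := P) (d := d) (X := X)) BSSingular.Union

variable {P}

/-- A closed `(k+d+1)`-manifold with singularities of the types `(P i, φP i)`, with a compatible
stable framing and a compatible continuous map to `X`. -/
structure FramedBSSingular extends BSSingular P d X where
  framing : toBSManifold.Framing φP

variable {φP d X}

/-- Framed bordism over `X` of closed framed manifolds with singularities. -/
def FramedBSSingular.Bordant (A B : FramedBSSingular φP d X) : Prop :=
  ∃ (b : A.toBSManifold.Bordism B.toBSManifold) (F : C(b.W.M, X)) (φ : b.W.Framing φP),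
    b.W.MapCompatible F ∧
    (∀ x, F (b.cA.face x) = A.map x) ∧ (∀ x, F (b.cB.face x) = B.map x) ∧
    b.cA.Compatible 1 A.framing.total φ.total ∧ b.cB.Compatible (-1) B.framing.total φ.total

/-- `C` is the disjoint union of `A` and `B`, as framed manifolds with singularities over `X`. -/
def FramedBSSingular.Union (A B C : FramedBSSingular φP d X) : Prop :=
  ∃ u : BSManifold.DisjointUnion A.toBSManifold B.toBSManifold C.toBSManifold,
    (∀ x, C.map (u.total.a x) = A.map x) ∧ (∀ x, C.map (u.total.b x) = B.map x) ∧
    u.total.Compatible A.framing.total B.framing.total C.framing.total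

variable (φP d X)

/-- The framed bordism group of closed `(k+d+1)`-manifolds with singularities over `X`. -/
abbrev FramedBSOmega : Type _ :=
  BordismGroup (FramedBSSingular.Bordant (φP := φP) (d := d) (X := X)) FramedBSSingular.Union

end BSGroups

/-! ### The natural maps -/

section NaturalMaps

variable {k : ℕ} {J : Type*} (P : J → CompactManifold k) (φP : ∀ i, StableFraming (P i))
  {d : ℕ} {X : Type*} [TopologicalSpace X]

/-- A collar of the empty manifold. -/
def Collar.ofEmpty (n : ℕ) (W : CompactManifold (n + 1)) :
    Collar (CompactManifold.empty n) W where
  toFun z := isEmptyElim z.1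
  isLocalDiffeomorph z := isEmptyElim z.1
  injective z := isEmptyElim z.1

/-- The empty manifold is the disjoint union of two empty manifolds. -/
def DisjointUnion.ofEmpty (n : ℕ) : DisjointUnion (CompactManifold.empty n)
    (CompactManifold.empty n) (CompactManifold.empty n) where
  a := id
  b := id
  isLocalDiffeomorph_a x := isEmptyElim x
  isLocalDiffeomorph_b x := isEmptyElim x
  bijective := ⟨fun z => by rcases z with z | z <;> exact isEmptyElim z, fun x => isEmptyElim x⟩

/-- The framing of the normal data of an empty manifold. -/
def FaceFraming.ofEmpty (n : ℕ) : FaceFraming (CompactManifold.empty n) where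
  rank := 0
  iso x := isEmptyElim x
  continuous_iso := by
    have : IsEmpty (TangentBundle (Q n) (CompactManifold.empty n)) :=
      ⟨fun z => isEmptyElim z.proj⟩
    exact continuous_of_const fun z => isEmptyElim z.1

/-- A manifold, viewed as a manifold with empty singular face. -/
def nonsingular (M : CompactManifold (k + (d + 1))) : BSManifold P d where
  M := M
  N _ := CompactManifold.empty d
  finite := by
    refine Set.Finite.subset Set.finite_empty ?_
    rintro i ⟨x⟩
    exact isEmptyElim (α := CompactManifold.empty d) x
  ι _ z := isEmptyElim z.1
  isLocalDiffeomorph _ z := isEmptyElim z.1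
  injective z := isEmptyElim z.2.1

theorem nonsingular_singularFace (M : CompactManifold (k + (d + 1))) :
    (nonsingular P M).singularFace = ∅ :=
  Set.eq_empty_of_forall_notMem fun _ ⟨_, x, _⟩ =>
    isEmptyElim (α := CompactManifold.empty d) x

/-- A framed manifold, viewed as a framed manifold with empty singular face. -/
def nonsingularFraming {M : CompactManifold (k + (d + 1))} (φ : StableFraming M) :
    (nonsingular P M).Framing φP where
  total := φ
  normal _ := FaceFraming.ofEmpty d
  compatible _ x := isEmptyElim (α := CompactManifold.empty d) x

/-- A bordism, viewed as a bordism of manifolds with empty singular face. -/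
def nonsingularBordism {A B : CompactManifold (k + (d + 1))} (b : Bordism A B) :
    (nonsingular P A).Bordism (nonsingular P B) where
  W := nonsingular P (d := d + 1) b.W
  cA := b.cA
  cB := b.cB
  cNA _ := Collar.ofEmpty d _
  cNB _ := Collar.ofEmpty d _
  disjoint := b.disjoint
  disjoint_N _ z := isEmptyElim (α := CompactManifold.empty d) z.1
  corner_A _ x := isEmptyElim (α := CompactManifold.empty d) x
  corner_B _ x := isEmptyElim (α := CompactManifold.empty d) x
  essential_A a := by
    rw [nonsingular_singularFace, nonsingular_singularFace]; exact Iff.rfl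
  essential_B a := by
    rw [nonsingular_singularFace, nonsingular_singularFace]; exact Iff.rfl
  boundary_eq := by
    rw [nonsingular_singularFace, Set.union_empty]; exact b.boundary_eq

/-- A disjoint union, viewed as one of manifolds with empty singular face. -/
def nonsingularUnion {A B C : CompactManifold (k + (d + 1))} (u : DisjointUnion A B C) :
    BSManifold.DisjointUnion (nonsingular P A) (nonsingular P B) (nonsingular (d := d) P C) where
  total := u
  sing _ := DisjointUnion.ofEmpty d
  compatible_a _ x := isEmptyElim (α := CompactManifold.empty d) x
  compatible_b _ x := isEmptyElim (α := CompactManifold.empty d) x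

/-- A closed manifold over `X`, viewed as a closed manifold with empty singular face. -/
def Singular.toBS (A : Singular (k + (d + 1)) X) : BSSingular P d X where
  toBSManifold := nonsingular P A.toCompactManifold
  closed := A.boundary_eq.trans (nonsingular_singularFace P _).symm
  map := A.map
  map_compatible _ x := isEmptyElim (α := CompactManifold.empty d) x

variable {P}

/-- Forget the framing. -/
def FramedSingular.toSingular {n : ℕ} (A : FramedSingular n X) : Singular n X where
  toClosedManifold := A.toClosedManifold
  map := A.map

/-- A closed framed manifold over `X`, viewed as one with empty singular face. -/
def FramedSingular.toBS (A : FramedSingular (k + (d + 1)) X) : FramedBSSingular φP d X where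
  toBSSingular := A.toSingular.toBS P
  framing := nonsingularFraming P φP A.framing

variable (P d X)

/-- The natural map from the bordism group `Ω_{k+d+1}(X)` to the bordism group with
singularities, sending `[M, f]` to `[M, f]`. -/
def naturalMap : Omega (k + (d + 1)) X →+ BSOmega P d X :=
  BordismGroup.map (Singular.toBS P)
    (by
      rintro A B ⟨b, F, hA, hB⟩
      exact ⟨nonsingularBordism P b, F,
        fun _ x => isEmptyElim (α := CompactManifold.empty (d + 1)) x, hA, hB⟩)
    (by
      rintro A B C ⟨u, hA, hB⟩
      exact ⟨nonsingularUnion P u, hA, hB⟩)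

variable {P}

/-- The natural map from the framed bordism group `Ω_{k+d+1}^fr(X)` to the framed bordism group with
singularities, sending `[M, f]` to `[M, f]`. -/
def framedNaturalMap : FramedOmega (k + (d + 1)) X →+ FramedBSOmega φP d X :=
  BordismGroup.map (FramedSingular.toBS φP)
    (by
      rintro A B ⟨b, F, φ, hA, hB, hcA, hcB⟩
      exact ⟨nonsingularBordism P b, F, nonsingularFraming (d := d + 1) P φP φ,
        fun _ x => isEmptyElim (α := CompactManifold.empty (d + 1)) x, hA, hB, hcA, hcB⟩)
    (by
      rintro A B C ⟨u, hA, hB, h⟩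
      exact ⟨nonsingularUnion P u, hA, hB, h⟩)

end NaturalMaps

end BaasSullivan

end

open scoped Manifold ContDiff

noncomputable section

namespace BaasSullivan

/-! ### Local diffeomorphisms -/

section LocalDiffeo

variable {E H M E' H' M' E'' H'' M'' : Type*}
  [NormedAddCommGroup E] [NormedSpace ℝ E] [TopologicalSpace H] {I : ModelWithCorners ℝ E H}
  [TopologicalSpace M] [ChartedSpace H M]
  [NormedAddCommGroup E'] [NormedSpace ℝ E'] [TopologicalSpace H'] {I' : ModelWithCorners ℝ E' H'}
  [TopologicalSpace M'] [ChartedSpace H' M']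
  [NormedAddCommGroup E''] [NormedSpace ℝ E''] [TopologicalSpace H'']
  {I'' : ModelWithCorners ℝ E'' H''} [TopologicalSpace M''] [ChartedSpace H'' M'']

/-! Both inclusions are geometric, and they hold in every dimension k + d + 1, with Ω_{d+1} in place
of Ω_1.

A product P × N bounds as a singular manifold: on the cylinder P × N × [0,1] the end P × N × {1} is
declared to be the singular face, with normal manifold N, and what is left is a bordism from P × N
to the empty manifold (`singularCylinderBordism`, `products_le_ker_naturalMap`). In the framed case
P must first be replaced by its representative among the singularity types. An isomorphism preserves
the stabilised framing but not its rank, and the product framing puts the stable coordinates of N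
directly after those of P. The two placements differ by conjugation with an exchange of blocks of
stable coordinates; up to sign this exchange is a rotation, hence joined to the identity, so the
class does not change (`directSum_eq_conj`, `FramedSingular.exists_conj`,
`IsFramedProduct.exists_of_isomorphic`).

Conversely, let [A] - [B] lie in the kernel, and let V be a singular bordism from A to B. As A and B
have no singularities, each normal manifold N_P of V (for nonempty P) is closed. If one forgets that
the singular face is singular, V becomes an ordinary bordism from A to the disjoint union of B and
all P × N_P, and the map to X depends only on N_P there. So [A] - [B] is the sum of the [P]·[N_P]
(`Singular.exists_add_faces`, `ker_naturalMap_le`). In the framed case the framing of TN ⊕ ℝσ over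
the singular face need not split off σ. A rotation of σ in the source, and of the last coordinate in
the target, against a fresh stable coordinate makes the face outgoing and leaves the factor of P
alone (`Collar.exists_outgoing`, `desuspend_directSum`, `exists_factor_framing`).

The existence of V is not immediate, because the bordism groups are given by generators and
relations. A reduction in the free abelian group (`family_pair_of_sub_mem_closure`) shows that it
suffices that the signed families which bound are closed under disjoint union, reversal of signs and
cancellation of a pair of equal objects with opposite signs, and that they contain the relations.
Cancellation means gluing two boundary components of a manifold with corners, together with its
singular face and its framing (`exists_gluing`, `Gluing.exists_framing`, `Cob.glue`); this occupies
most of the file. Framings need only be continuous, so they are treated as families of linear maps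
that are the identity on almost all of the stable coordinates (`IsFraming`), and are pieced together
as such. -/

theorem isLocalDiffeomorphAt_of_eqOn (e : OpenPartialHomeomorph M M')
    (he : ContMDiffOn I I' ∞ e e.source) (he' : ContMDiffOn I' I ∞ e.symm e.target)
    {f : M → M'} {x : M} (hx : x ∈ e.source) (hf : Set.EqOn f e e.source) :
    IsLocalDiffeomorphAt I I' ∞ f x :=
  ⟨⟨e.toPartialEquiv, e.open_source, e.open_target, he, he'⟩, hx, hf⟩

theorem _root_.IsLocalDiffeomorphAt.exists_openPartialHomeomorph {f : M → M'} {x : M}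
    (hf : IsLocalDiffeomorphAt I I' ∞ f x) : ∃ e : OpenPartialHomeomorph M M', x ∈ e.source ∧
      Set.EqOn f e e.source ∧ ContMDiffOn I I' ∞ e e.source ∧
      ContMDiffOn I' I ∞ e.symm e.target := by
  obtain ⟨Φ, hx, h⟩ := hf
  exact ⟨Φ.toOpenPartialHomeomorph, hx, h, Φ.contMDiffOn_toFun, Φ.contMDiffOn_invFun⟩

theorem _root_.IsLocalDiffeomorphAt.congr' {f g : M → M'} {x : M}
    (hf : IsLocalDiffeomorphAt I I' ∞ f x) (h : g =ᶠ[nhds x] f) :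
    IsLocalDiffeomorphAt I I' ∞ g x := by
  obtain ⟨e, hx, hfe, h1, h2⟩ := hf.exists_openPartialHomeomorph
  obtain ⟨s, hs, hso, hxs⟩ := eventually_nhds_iff.1 h
  refine isLocalDiffeomorphAt_of_eqOn (e.restrOpen s hso) (h1.mono ?_) (h2.mono ?_)
    ⟨hx, hxs⟩ ?_
  · exact fun y hy => hy.1
  · exact fun y hy => hy.1
  · intro y hy
    exact (hs y hy.2).trans (hfe hy.1)

theorem _root_.IsLocalDiffeomorphAt.prodMap {N N' G G' F F' : Type*}
    [NormedAddCommGroup F] [NormedSpace ℝ F] [TopologicalSpace G] {J : ModelWithCorners ℝ F G}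
    [TopologicalSpace N] [ChartedSpace G N]
    [NormedAddCommGroup F'] [NormedSpace ℝ F'] [TopologicalSpace G']
    {J' : ModelWithCorners ℝ F' G'} [TopologicalSpace N'] [ChartedSpace G' N']
    {f : M → M'} {g : N → N'} {x : M} {y : N}
    (hf : IsLocalDiffeomorphAt I I' ∞ f x) (hg : IsLocalDiffeomorphAt J J' ∞ g y) :
    IsLocalDiffeomorphAt (I.prod J) (I'.prod J') ∞ (Prod.map f g) (x, y) := by
  obtain ⟨e, hx, hfe, h1, h2⟩ := hf.exists_openPartialHomeomorph
  obtain ⟨e', hx', hfe', h1', h2'⟩ := hg.exists_openPartialHomeomorph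
  refine isLocalDiffeomorphAt_of_eqOn (e.prod e') (h1.prodMap h1') (h2.prodMap h2') ⟨hx, hx'⟩ ?_
  rintro ⟨a, b⟩ ⟨ha, hb⟩
  exact Prod.ext (hfe ha) (hfe' hb)

/-- A local inverse of a local diffeomorphism. -/
theorem _root_.IsLocalDiffeomorphAt.exists_inverse {f : M → M'} {x : M}
    (hf : IsLocalDiffeomorphAt I I' ∞ f x) : ∃ g : M' → M,
      IsLocalDiffeomorphAt I' I ∞ g (f x) ∧ g (f x) = x ∧ (∀ᶠ y in nhds x, g (f y) = y) ∧
      ∀ᶠ y in nhds (f x), f (g y) = y := by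
  obtain ⟨e, hx, hfe, h1, h2⟩ := hf.exists_openPartialHomeomorph
  have hfx : f x = e x := hfe hx
  have hx' : e x ∈ e.target := e.map_source hx
  refine ⟨e.symm, ?_, ?_, ?_, ?_⟩
  · rw [hfx]
    exact isLocalDiffeomorphAt_of_eqOn e.symm h2 h1 hx' fun _ _ => rfl
  · rw [hfx, e.left_inv hx]
  · filter_upwards [e.open_source.mem_nhds hx] with y hy
    rw [hfe hy, e.left_inv hy]
  · rw [hfx]
    filter_upwards [e.open_target.mem_nhds hx'] with y hy
    rw [hfe (e.map_target hy), e.right_inv hy]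

/-- Two out of three: composing with a local inverse of f recovers g. Maps out of sums, products and
glued spaces are recognised as local diffeomorphisms by this, after precomposition with a known one.
-/
theorem _root_.IsLocalDiffeomorphAt.of_comp_right {f : M → M'} {g : M' → M''} {x : M}
    (hgf : IsLocalDiffeomorphAt I I'' ∞ (g ∘ f) x) (hf : IsLocalDiffeomorphAt I I' ∞ f x) :
    IsLocalDiffeomorphAt I' I'' ∞ g (f x) := by
  obtain ⟨f', h1, h2, -, h4⟩ := hf.exists_inverse
  have h5 : IsLocalDiffeomorphAt I' I'' ∞ ((g ∘ f) ∘ f') (f x) := by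
    refine h1.comp _ _ ?_
    rwa [h2]
  refine h5.congr' ?_
  filter_upwards [h4] with y hy
  simp [hy]

/-- Continuity of f keeps f y, for y near x, in the region where the local inverse undoes g. -/
theorem _root_.IsLocalDiffeomorphAt.of_comp_left {f : M → M'} {g : M' → M''} {x : M}
    (hgf : IsLocalDiffeomorphAt I I'' ∞ (g ∘ f) x)
    (hg : IsLocalDiffeomorphAt I' I'' ∞ g (f x)) (hf : ContinuousAt f x) :
    IsLocalDiffeomorphAt I I' ∞ f x := by
  obtain ⟨g', h1, h2, h3, h4⟩ := hg.exists_inverse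
  refine (hgf.comp _ _ h1).congr' ?_
  filter_upwards [hf.eventually h3] with y hy
  exact hy.symm

theorem isLocalDiffeomorph_of_homeomorph (e : M ≃ₜ M') (he : ContMDiff I I' ∞ e)
    (he' : ContMDiff I' I ∞ e.symm) : IsLocalDiffeomorph I I' ∞ e := fun _ =>
  isLocalDiffeomorphAt_of_eqOn e.toOpenPartialHomeomorph he.contMDiffOn he'.contMDiffOn
    trivial fun _ _ => rfl

end LocalDiffeo

/-! ### Manifold structures from compatible patches -/

section Patches

variable {E H M E' H' Y : Type*}
  [NormedAddCommGroup E] [NormedSpace ℝ E] [TopologicalSpace H] {I : ModelWithCorners ℝ E H}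
  [TopologicalSpace M] [ChartedSpace H M] [IsManifold I ∞ M]
  [NormedAddCommGroup E'] [NormedSpace ℝ E'] [TopologicalSpace H'] {I' : ModelWithCorners ℝ E' H'}
  [TopologicalSpace Y]

/-- Read through the models h is the linear map L, and `I'.symm` is smooth on the range of `I'`,
where the values of L ∘ I lie. -/
theorem contMDiff_of_model (h : H → H') (L : E →L[ℝ] E')
    (hL : ∀ z, I' (h z) = L (I z)) : ContMDiff I I' ∞ h := by
  have h1 : ContMDiff I I' ∞ (I'.symm ∘ L ∘ I) :=
    I'.contMDiffOn_symm.comp_contMDiff (L.contMDiff.comp I.contMDiff)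
      fun z => ⟨h z, hL z⟩
  convert h1 using 1
  ext z
  simp [← hL]

/-- The charted space structure on `Y` whose charts are the charts of `M`, transported by the
patches in `𝓔` and by a homeomorphism of the model spaces. -/
@[reducible]
def patchCharts (𝓔 : Set (OpenPartialHomeomorph M Y)) (hcov : ∀ y, ∃ e ∈ 𝓔, y ∈ e.target)
    (h : H ≃ₜ H') : ChartedSpace H' Y where
  atlas := {ψ | ∃ e ∈ 𝓔, ∃ φ ∈ atlas H M, ψ = (e.symm ≫ₕ φ) ≫ₕ h.toOpenPartialHomeomorph}
  chartAt y := ((hcov y).choose.symm ≫ₕ chartAt H ((hcov y).choose.symm y)) ≫ₕ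
    h.toOpenPartialHomeomorph
  mem_chart_source y := by
    have := (hcov y).choose_spec.2
    simp [this]
  chart_mem_atlas y := ⟨_, (hcov y).choose_spec.1, _, chart_mem_atlas _ _, rfl⟩

variable (𝓔 : Set (OpenPartialHomeomorph M Y)) (hcov : ∀ y, ∃ e ∈ 𝓔, y ∈ e.target)
  (h : H ≃ₜ H') (L : E ≃L[ℝ] E')

/-- All patches start in the one manifold M, so a change of charts of Y is a transition between
patches read in charts of M, up to the model map h. This one criterion serves products, the interval
and glued spaces. -/
theorem isManifold_patchCharts (hL : ∀ z, I' (h z) = L (I z))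
    (hcompat : ∀ e ∈ 𝓔, ∀ e' ∈ 𝓔, ContMDiffOn I I ∞ (e ≫ₕ e'.symm) (e ≫ₕ e'.symm).source) :
    let _ := patchCharts 𝓔 hcov h
    IsManifold I' ∞ Y := by
  let _ := patchCharts 𝓔 hcov h
  have hh : ContMDiff I I' ∞ h := contMDiff_of_model h L hL
  have hh' : ContMDiff I' I ∞ h.symm := contMDiff_of_model h.symm
    (L.symm : E' →L[ℝ] E) fun z => by
      have := hL (h.symm z)
      rw [h.apply_symm_apply] at this
      simp [this]
  refine isManifold_of_contDiffOn _ _ _ ?_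
  rintro _ _ ⟨e, he, φ, hφ, rfl⟩ ⟨e', he', φ', hφ', rfl⟩
  have hφm := contMDiffOn_symm_of_mem_maximalAtlas
    (IsManifold.subset_maximalAtlas (I := I) (n := ∞) hφ)
  have hφm' := contMDiffOn_of_mem_maximalAtlas
    (IsManifold.subset_maximalAtlas (I := I) (n := ∞) hφ')
  have key : ContMDiffOn I' I' ∞
      (fun z => h (φ' (e'.symm (e (φ.symm (h.symm z))))))
      ((((e.symm ≫ₕ φ) ≫ₕ h.toOpenPartialHomeomorph).symm ≫ₕ
        ((e'.symm ≫ₕ φ') ≫ₕ h.toOpenPartialHomeomorph)).source) := by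
    intro z hz
    simp only [mfld_simps] at hz
    refine hh.contMDiffAt.comp_contMDiffWithinAt _ ?_
    refine ContMDiffAt.contMDiffWithinAt ?_
    have a1 : ContMDiffAt I' I ∞ (fun z => φ.symm (h.symm z)) z :=
      (hφm.contMDiffAt (φ.open_target.mem_nhds (by tauto))).comp z hh'.contMDiffAt
    have a2 : ContMDiffAt I I ∞ (fun z => e'.symm (e z)) (φ.symm (h.symm z)) := by
      refine (hcompat e he e' he').contMDiffAt ((e ≫ₕ e'.symm).open_source.mem_nhds ?_)
      simp only [mfld_simps]
      tauto
    have a3 : ContMDiffAt I I ∞ φ' (e'.symm (e (φ.symm (h.symm z)))) :=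
      hφm'.contMDiffAt (φ'.open_source.mem_nhds (by tauto))
    exact ContMDiffAt.comp (g := φ') z a3
      (ContMDiffAt.comp (g := fun z => e'.symm (e z)) z a2 a1)
  rw [← contMDiffOn_iff_contDiffOn]
  refine I'.contMDiff.comp_contMDiffOn (key.comp (I'.contMDiffOn_symm.mono ?_) ?_)
  · exact fun z hz => hz.2
  · exact fun z hz => hz.1

/-- Read in a chart φ of M at x, and in the chart of Y that e and φ induce, the patch e is the
identity up to the model map h. -/
theorem isLocalDiffeomorphAt_patch (hL : ∀ z, I' (h z) = L (I z))
    (hcompat : ∀ e ∈ 𝓔, ∀ e' ∈ 𝓔, ContMDiffOn I I ∞ (e ≫ₕ e'.symm) (e ≫ₕ e'.symm).source)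
    {e : OpenPartialHomeomorph M Y} (he : e ∈ 𝓔) {x : M} (hx : x ∈ e.source) :
    let _ := patchCharts 𝓔 hcov h
    IsLocalDiffeomorphAt I I' ∞ e x := by
  let _ := patchCharts 𝓔 hcov h
  have : IsManifold I' ∞ Y := isManifold_patchCharts 𝓔 hcov h L hL hcompat
  have hh : ContMDiff I I' ∞ h := contMDiff_of_model h L hL
  have hh' : ContMDiff I' I ∞ h.symm := contMDiff_of_model h.symm
    (L.symm : E' →L[ℝ] E) fun z => by
      have := hL (h.symm z)
      rw [h.apply_symm_apply] at this
      simp [this]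
  set φ := chartAt H x
  have hφ : φ ∈ atlas H M := chart_mem_atlas H x
  have h1 : (e.symm ≫ₕ φ) ≫ₕ h.toOpenPartialHomeomorph ∈ atlas H' Y := ⟨e, he, φ, hφ, rfl⟩
  have d1 := contMDiffOn_of_mem_maximalAtlas
    (IsManifold.subset_maximalAtlas (I := I') (n := ∞) h1)
  have d2 := contMDiffOn_symm_of_mem_maximalAtlas
    (IsManifold.subset_maximalAtlas (I := I') (n := ∞) h1)
  have d3 := contMDiffOn_of_mem_maximalAtlas
    (IsManifold.subset_maximalAtlas (I := I) (n := ∞) hφ)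
  have d4 := contMDiffOn_symm_of_mem_maximalAtlas
    (IsManifold.subset_maximalAtlas (I := I) (n := ∞) hφ)
  refine isLocalDiffeomorphAt_of_eqOn
    ((φ ≫ₕ h.toOpenPartialHomeomorph) ≫ₕ ((e.symm ≫ₕ φ) ≫ₕ h.toOpenPartialHomeomorph).symm)
    ?_ ?_ ?_ ?_
  · refine d2.comp (t := _) (hh.comp_contMDiffOn (d3.mono ?_)) ?_
    · intro y hy
      simp only [mfld_simps] at hy ⊢
      tauto
    · intro y hy
      simp only [mfld_simps] at hy ⊢
      tauto
  · refine d4.comp (t := _) (hh'.comp_contMDiffOn (d1.mono ?_)) ?_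
    · intro y hy
      simp only [mfld_simps] at hy ⊢
      tauto
    · intro y hy
      simp only [mfld_simps] at hy ⊢
      tauto
  · simp [φ, hx]
  · intro y hy
    simp only [mfld_simps] at hy ⊢
    rw [h.symm_apply_apply, φ.left_inv hy.1]

end Patches

/-! ### The half-line -/

namespace Ray

/-- The coordinate of a point of the half-line. -/
def coord (r : Ray) : ℝ := r.1 0

theorem coord_nonneg (r : Ray) : 0 ≤ coord r := r.2 0

@[ext]
theorem ext {r r' : Ray} (h : coord r = coord r') : r = r' := by
  refine EuclideanQuadrant.ext _ _ ?_
  ext i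
  rw [Subsingleton.elim i 0]
  exact h

/-- The point of the half-line with coordinate `max t 0`. -/
def mk (t : ℝ) : Ray := ⟨EuclideanSpace.single 0 (max t 0), fun i => by
  rw [Subsingleton.elim i 0]; simp⟩

theorem coord_mk (t : ℝ) : coord (mk t) = max t 0 := by simp [coord, mk]

theorem coord_mk_of_nonneg {t : ℝ} (h : 0 ≤ t) : coord (mk t) = t := by simp [coord_mk, h]

@[simp] theorem mk_coord (r : Ray) : mk (coord r) = r := by
  ext; rw [coord_mk_of_nonneg (coord_nonneg r)]

@[simp] theorem coord_zero : coord 0 = 0 := rfl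

theorem coord_eq_zero {r : Ray} : coord r = 0 ↔ r = 0 :=
  ⟨fun h => by ext; simpa using h, fun h => by simp [h]⟩

theorem coord_pos {r : Ray} : 0 < coord r ↔ r ≠ 0 := by
  rw [lt_iff_le_and_ne, ne_comm, ne_eq, coord_eq_zero]
  exact ⟨fun h => h.2, fun h => ⟨coord_nonneg r, h⟩⟩

theorem contMDiff_coord : ContMDiff (Q 1) 𝓘(ℝ, ℝ) ∞ coord :=
  (EuclideanSpace.proj (𝕜 := ℝ) (0 : Fin 1)).contMDiff.comp (Q 1).contMDiff

theorem continuous_coord : Continuous coord := contMDiff_coord.continuous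

theorem continuous_mk : Continuous mk := by
  refine Continuous.subtype_mk ?_ _
  have : (fun t : ℝ => EuclideanSpace.single (0 : Fin 1) (max t 0))
      = fun t => WithLp.toLp 2 fun i : Fin 1 => max t 0 := by
    ext t i; rw [Subsingleton.elim i 0]; simp
  rw [this]
  exact (PiLp.continuous_toLp 2 _).comp (by fun_prop)

variable {E H M : Type*}
  [NormedAddCommGroup E] [NormedSpace ℝ E] [TopologicalSpace H] {I : ModelWithCorners ℝ E H}
  [TopologicalSpace M] [ChartedSpace H M]

/-- The model embeds the half-line in ℝ¹ by its coordinate, and the inverse of the embedding is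
smooth on its range. -/
theorem contMDiffOn_of_coord {f : M → Ray} {s : Set M}
    (h : ContMDiffOn I 𝓘(ℝ, ℝ) ∞ (fun x => coord (f x)) s) : ContMDiffOn I (Q 1) ∞ f s := by
  have h1 : ContMDiffOn I 𝓘(ℝ, EuclideanSpace ℝ (Fin 1)) ∞
      (fun x => (Q 1) (f x)) s := by
    have : (fun x => (Q 1) (f x)) = (ContinuousLinearMap.toSpanSingleton ℝ
        (EuclideanSpace.single (0 : Fin 1) (1 : ℝ))) ∘ fun x => coord (f x) := by
      ext x i
      rw [Subsingleton.elim i 0]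
      simp [coord]
      rfl
    rw [this]
    exact (ContinuousLinearMap.contMDiff _).comp_contMDiffOn h
  have h2 : ContMDiffOn I (Q 1) ∞ (fun x => (Q 1).symm ((Q 1) (f x))) s :=
    (Q 1).contMDiffOn_symm.comp h1 fun x _ => ⟨_, rfl⟩
  simpa using h2

theorem isInteriorPoint_of_ne {r : Ray} (h : r ≠ 0) : (Q 1).IsInteriorPoint r := by
  rw [ModelWithCorners.IsInteriorPoint]
  have : Set.range (Q 1) = {y : EuclideanSpace ℝ (Fin 1) | ∀ i, 0 ≤ y i} :=
    range_euclideanQuadrant 1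
  rw [this, interior_euclideanQuadrant]
  intro i
  rw [Subsingleton.elim i 0]
  exact coord_pos.2 h

theorem isBoundaryPoint_zero : (Q 1).IsBoundaryPoint (0 : Ray) := by
  rw [ModelWithCorners.isBoundaryPoint_iff_not_isInteriorPoint, ModelWithCorners.IsInteriorPoint]
  have : Set.range (Q 1) = {y : EuclideanSpace ℝ (Fin 1) | ∀ i, 0 ≤ y i} :=
    range_euclideanQuadrant 1
  rw [this, interior_euclideanQuadrant]
  intro h
  exact lt_irrefl (0 : ℝ) (h 0)

end Ray

/-! ### Products -/

/-- `ℝᵃ ⊕ ℝᵇ ≃ ℝᵃ⁺ᵇ`. -/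
def appendL (a b : ℕ) : (EuclideanSpace ℝ (Fin a) × EuclideanSpace ℝ (Fin b)) ≃L[ℝ]
    EuclideanSpace ℝ (Fin (a + b)) :=
  LinearEquiv.toContinuousLinearEquiv
    { toFun := fun p => append p.1 p.2
      invFun := fun x => (WithLp.toLp 2 fun i => x (Fin.castAdd b i),
        WithLp.toLp 2 fun i => x (Fin.natAdd a i))
      map_add' := fun p p' => by
        ext i
        refine Fin.addCases (fun i => ?_) (fun i => ?_) i <;> simp [append]
      map_smul' := fun c p => by
        ext i
        refine Fin.addCases (fun i => ?_) (fun i => ?_) i <;> simp [append]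
      left_inv := fun p => by ext i <;> simp [append]
      right_inv := fun x => by
        ext i
        refine Fin.addCases (fun i => ?_) (fun i => ?_) i <;> simp [append] }

theorem appendL_apply {a b : ℕ} (p : EuclideanSpace ℝ (Fin a) × EuclideanSpace ℝ (Fin b)) :
    appendL a b p = append p.1 p.2 := rfl

/-- `[0,∞)ᵃ × [0,∞)ᵇ ≃ [0,∞)ᵃ⁺ᵇ`. -/
def quadrantAppend (a b : ℕ) :
    ModelProd (EuclideanQuadrant a) (EuclideanQuadrant b) ≃ₜ EuclideanQuadrant (a + b) where
  toFun p := ⟨appendL a b (p.1.1, p.2.1), fun i => by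
    refine Fin.addCases (fun i => ?_) (fun i => ?_) i
    · simpa [appendL_apply, append] using p.1.2 i
    · simpa [appendL_apply, append] using p.2.2 i⟩
  invFun x := (⟨((appendL a b).symm x.1).1, fun i => x.2 _⟩,
    ⟨((appendL a b).symm x.1).2, fun i => x.2 _⟩)
  left_inv p := by
    refine Prod.ext (EuclideanQuadrant.ext _ _ ?_) (EuclideanQuadrant.ext _ _ ?_) <;> simp
  right_inv x := EuclideanQuadrant.ext _ _ <| by simp
  continuous_toFun := by
    refine Continuous.subtype_mk ((appendL a b).continuous.comp ?_) _
    exact (continuous_subtype_val.comp continuous_fst).prodMk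
      (continuous_subtype_val.comp continuous_snd)
  continuous_invFun := by
    refine Continuous.prodMk (Continuous.subtype_mk ?_ _) (Continuous.subtype_mk ?_ _)
    · exact continuous_fst.comp ((appendL a b).symm.continuous.comp continuous_subtype_val)
    · exact continuous_snd.comp ((appendL a b).symm.continuous.comp continuous_subtype_val)

/-- M × M' is already a manifold over a product of quadrants; one identity patch rebases it on a
single quadrant. -/
theorem patches_refl_cover {M : Type*} [TopologicalSpace M] (y : M) :
    ∃ e ∈ ({OpenPartialHomeomorph.refl M} : Set (OpenPartialHomeomorph M M)), y ∈ e.target :=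
  ⟨_, rfl, trivial⟩

theorem patches_refl_compat {a b : ℕ} (M : CompactManifold a) (M' : CompactManifold b) :
    ∀ e ∈ ({OpenPartialHomeomorph.refl (M × M')} : Set (OpenPartialHomeomorph (M × M') (M × M'))),
    ∀ e' ∈ ({OpenPartialHomeomorph.refl (M × M')} : Set (OpenPartialHomeomorph (M × M') (M × M'))),
    ContMDiffOn ((Q a).prod (Q b)) ((Q a).prod (Q b)) ∞ (e ≫ₕ e'.symm) (e ≫ₕ e'.symm).source := by
  rintro _ rfl _ rfl
  exact contMDiffOn_id

/-- The product of two compact manifolds, of dimension the sum of the dimensions. -/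
def CompactManifold.prod {a b : ℕ} (M : CompactManifold a) (M' : CompactManifold b) :
    CompactManifold (a + b) :=
  letI : ChartedSpace (EuclideanQuadrant (a + b)) (M × M') :=
    patchCharts {OpenPartialHomeomorph.refl (M × M')} patches_refl_cover (quadrantAppend a b)
  { carrier := M × M'
    smooth := isManifold_patchCharts (I := (Q a).prod (Q b)) _ _ _ (appendL a b) (fun _ => rfl)
      (patches_refl_compat M M') }

/-- The identity, as a map from the product of two manifolds. -/
def CompactManifold.toProd {a b : ℕ} (M : CompactManifold a) (M' : CompactManifold b) :
    M × M' ≃ₜ M.prod M' := Homeomorph.refl _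

theorem CompactManifold.isLocalDiffeomorph_toProd {a b : ℕ} (M : CompactManifold a)
    (M' : CompactManifold b) :
    IsLocalDiffeomorph ((Q a).prod (Q b)) (Q (a + b)) ∞ (M.toProd M') := fun x =>
  isLocalDiffeomorphAt_patch (I := (Q a).prod (Q b)) {OpenPartialHomeomorph.refl (M × M')}
    patches_refl_cover (quadrantAppend a b) (appendL a b) (fun _ => rfl)
    (patches_refl_compat M M') rfl (x := x) trivial

/-! ### The unit interval -/

/-- The chart `r ↦ r/(1+r)` of the unit interval. -/
def intervalChart : OpenPartialHomeomorph Ray unitInterval where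
  toFun r := ⟨Ray.coord r / (1 + Ray.coord r), by
    have := Ray.coord_nonneg r
    refine ⟨by positivity, (div_le_one (by positivity)).2 (by linarith)⟩⟩
  invFun y := Ray.mk (y / (1 - y))
  source := Set.univ
  target := {y | (y : ℝ) < 1}
  map_source' r _ := by
    have := Ray.coord_nonneg r
    change Ray.coord r / (1 + Ray.coord r) < 1
    rw [div_lt_one (by positivity)]; linarith
  map_target' _ _ := trivial
  left_inv' r _ := by
    have := Ray.coord_nonneg r
    ext
    rw [Ray.coord_mk_of_nonneg]
    · field_simp; ring
    · field_simp; ring_nf; exact this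
  right_inv' y (hy : (y : ℝ) < 1) := by
    have := y.2.1
    have h1 : (0 : ℝ) < 1 - y := by linarith
    ext
    simp only []
    rw [Ray.coord_mk_of_nonneg (by positivity)]
    field_simp; ring
  open_source := isOpen_univ
  open_target := isOpen_lt continuous_subtype_val continuous_const
  continuousOn_toFun := by
    refine Continuous.continuousOn (Continuous.subtype_mk ?_ _)
    exact Ray.continuous_coord.div (by have := Ray.continuous_coord; fun_prop)
      fun r => by have := Ray.coord_nonneg r; positivity
  continuousOn_invFun := by
    refine Ray.continuous_mk.comp_continuousOn ?_
    refine ContinuousOn.div (by fun_prop) (by fun_prop) ?_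
    intro y (hy : (y : ℝ) < 1)
    linarith

theorem coe_intervalChart (r : Ray) :
    (intervalChart r : ℝ) = Ray.coord r / (1 + Ray.coord r) := rfl

theorem coord_intervalChart_symm {y : unitInterval} (hy : (y : ℝ) < 1) :
    Ray.coord (intervalChart.symm y) = y / (1 - y) := by
  have := y.2.1
  have h1 : (0 : ℝ) < 1 - y := by linarith
  exact Ray.coord_mk_of_nonneg (by positivity)

/-- The chart `r ↦ 1/(1+r)` of the unit interval. -/
def intervalChart' : OpenPartialHomeomorph Ray unitInterval :=
  intervalChart ≫ₕ unitInterval.symmHomeomorph.toOpenPartialHomeomorph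

theorem interval_cover (y : unitInterval) :
    ∃ e ∈ ({intervalChart, intervalChart'} : Set _), y ∈ e.target := by
  by_cases h : (y : ℝ) < 1
  · exact ⟨_, Or.inl rfl, h⟩
  · refine ⟨_, Or.inr rfl, ?_⟩
    have : y = 1 := Subtype.ext (le_antisymm y.2.2 (not_lt.1 h))
    simp [intervalChart', this, intervalChart]

/-- The two charts are exchanged by t ↦ 1 - t, so both mixed transitions are r ↦ 1/r, defined where
r > 0. -/
theorem interval_compat : ∀ e ∈ ({intervalChart, intervalChart'} : Set _),
    ∀ e' ∈ ({intervalChart, intervalChart'} : Set _),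
    ContMDiffOn (Q 1) (Q 1) ∞ (e ≫ₕ e'.symm) (e ≫ₕ e'.symm).source := by
  have key : ∀ f : Ray → Ray, ∀ s : Set Ray,
      (∀ r ∈ s, 0 < Ray.coord r ∧ Ray.coord (f r) = (Ray.coord r)⁻¹) →
      ContMDiffOn (Q 1) (Q 1) ∞ f s := by
    intro f s h
    refine Ray.contMDiffOn_of_coord ?_
    have h1 : ContMDiffOn (Q 1) 𝓘(ℝ, ℝ) ∞ (fun r => (Ray.coord r)⁻¹) s := by
      intro r hr
      exact ((contDiffAt_inv (n := ∞) ℝ (h r hr).1.ne').contMDiffAt.comp r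
        Ray.contMDiff_coord.contMDiffAt).contMDiffWithinAt
    exact h1.congr fun r hr => (h r hr).2
  have hid : ∀ e : OpenPartialHomeomorph Ray unitInterval,
      ContMDiffOn (Q 1) (Q 1) ∞ (e ≫ₕ e.symm) (e ≫ₕ e.symm).source := fun e =>
    contMDiffOn_id.congr fun r hr => by
      simp only [mfld_simps] at hr
      simp [e.left_inv hr.1]
  have aux : ∀ r : Ray, ((unitInterval.symm (intervalChart r) : unitInterval) : ℝ) < 1 →
      0 < Ray.coord r ∧ Ray.coord (intervalChart.symm (unitInterval.symm (intervalChart r)))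
        = (Ray.coord r)⁻¹ := by
    intro r h1
    have h0 := Ray.coord_nonneg r
    rw [coord_intervalChart_symm h1]
    rw [unitInterval.coe_symm_eq, coe_intervalChart] at h1 ⊢
    have h2 : 0 < Ray.coord r := by
      by_contra h
      have h3 : Ray.coord r = 0 := le_antisymm (not_lt.1 h) h0
      simp [h3] at h1
    refine ⟨h2, ?_⟩
    field_simp
    simp [h2.ne']
  rintro _ (rfl | rfl) _ (rfl | rfl)
  · exact hid _
  · refine key _ _ fun r hr => aux r ?_
    simp only [mfld_simps, intervalChart'] at hr
    exact hr.2
  · refine key _ _ fun r hr => aux r ?_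
    simp only [mfld_simps, intervalChart'] at hr
    exact hr.2
  · exact hid _

/-- The unit interval, as a compact manifold. -/
def interval : CompactManifold 1 :=
  letI : ChartedSpace (EuclideanQuadrant 1) unitInterval :=
    patchCharts {intervalChart, intervalChart'} interval_cover (Homeomorph.refl _)
  { carrier := unitInterval
    smooth := isManifold_patchCharts (I := Q 1) _ _ _ (ContinuousLinearEquiv.refl ℝ _)
      (fun _ => rfl) interval_compat }

/-- The chart `r ↦ r/(1+r)`, as a map to the interval. -/
def interval.chart (r : Ray) : interval := intervalChart r

/-- The chart `r ↦ 1/(1+r)`, as a map to the interval. -/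
def interval.chart' (r : Ray) : interval := intervalChart' r

theorem interval.isLocalDiffeomorph_chart : IsLocalDiffeomorph (Q 1) (Q 1) ∞ interval.chart :=
  fun r => isLocalDiffeomorphAt_patch (I := Q 1) (I' := Q 1) {intervalChart, intervalChart'}
    interval_cover (Homeomorph.refl _) (ContinuousLinearEquiv.refl ℝ _) (fun _ => rfl)
    interval_compat (Or.inl rfl) (x := r) trivial

theorem interval.isLocalDiffeomorph_chart' : IsLocalDiffeomorph (Q 1) (Q 1) ∞ interval.chart' :=
  fun r => isLocalDiffeomorphAt_patch (I := Q 1) (I' := Q 1) {intervalChart, intervalChart'}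
    interval_cover (Homeomorph.refl _) (ContinuousLinearEquiv.refl ℝ _) (fun _ => rfl)
    interval_compat (Or.inr rfl) (x := r) (by simp [intervalChart', intervalChart])

theorem interval.exists_chart (y : interval) :
    (∃ r, interval.chart r = y) ∨ ∃ r, interval.chart' r = y := by
  rcases interval_cover y with ⟨e, rfl | rfl, he⟩
  · exact Or.inl ⟨intervalChart.symm y, intervalChart.right_inv he⟩
  · exact Or.inr ⟨intervalChart'.symm y, intervalChart'.right_inv he⟩

/-- The contraction `r ↦ r/(1+r)` of the half-line. -/
def shrink (r : Ray) : Ray := Ray.mk (Ray.coord r / (1 + Ray.coord r))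

theorem coord_shrink (r : Ray) : Ray.coord (shrink r) = Ray.coord r / (1 + Ray.coord r) := by
  have := Ray.coord_nonneg r
  exact Ray.coord_mk_of_nonneg (by positivity)

theorem contMDiff_div_one_add :
    ContMDiff (Q 1) 𝓘(ℝ, ℝ) ∞ fun r => Ray.coord r / (1 + Ray.coord r) := fun r => by
  have := Ray.coord_nonneg r
  refine ContMDiffAt.comp (g := fun x : ℝ => x / (1 + x)) r (ContDiffAt.contMDiffAt ?_)
    Ray.contMDiff_coord.contMDiffAt
  exact contDiffAt_id.div (contDiffAt_const.add contDiffAt_id) (by simp; positivity)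

theorem isLocalDiffeomorph_shrink : IsLocalDiffeomorph (Q 1) (Q 1) ∞ shrink := by
  have hsm : ContMDiff (Q 1) (Q 1) ∞ shrink := by
    rw [← contMDiffOn_univ]
    refine Ray.contMDiffOn_of_coord ?_
    simp only [coord_shrink]
    exact contMDiff_div_one_add.contMDiffOn
  have hinv : ContMDiffOn (Q 1) (Q 1) ∞
      (fun r => Ray.mk (Ray.coord r / (1 - Ray.coord r))) {r | Ray.coord r < 1} := by
    refine Ray.contMDiffOn_of_coord (ContMDiffOn.congr
      (f := fun r => Ray.coord r / (1 - Ray.coord r)) (fun r (hr : Ray.coord r < 1) => ?_) ?_)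
    · refine ContMDiffAt.contMDiffWithinAt ?_
      refine ContMDiffAt.comp (g := fun x : ℝ => x / (1 - x)) r (ContDiffAt.contMDiffAt ?_)
        Ray.contMDiff_coord.contMDiffAt
      exact contDiffAt_id.div (contDiffAt_const.sub contDiffAt_id) (by simp; linarith)
    · intro r (hr : Ray.coord r < 1)
      have := Ray.coord_nonneg r
      have h1 : 0 < 1 - Ray.coord r := by linarith
      exact Ray.coord_mk_of_nonneg (by positivity)
  intro r
  refine isLocalDiffeomorphAt_of_eqOn
    { toFun := shrink
      invFun := fun r => Ray.mk (Ray.coord r / (1 - Ray.coord r))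
      source := Set.univ
      target := {r | Ray.coord r < 1}
      map_source' := ?_
      map_target' := fun _ _ => trivial
      left_inv' := ?_
      right_inv' := ?_
      open_source := isOpen_univ
      open_target := isOpen_lt Ray.continuous_coord continuous_const
      continuousOn_toFun := hsm.continuous.continuousOn
      continuousOn_invFun := hinv.continuousOn } hsm.contMDiffOn hinv trivial fun _ _ => rfl
  · intro r _
    have := Ray.coord_nonneg r
    change Ray.coord (shrink r) < 1
    rw [coord_shrink, div_lt_one (by positivity)]; linarith
  · intro r _
    have := Ray.coord_nonneg r
    ext
    rw [coord_shrink, Ray.coord_mk_of_nonneg]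
    · field_simp; ring
    · field_simp; ring_nf; exact this
  · intro r (hr : Ray.coord r < 1)
    have := Ray.coord_nonneg r
    have h1 : 0 < 1 - Ray.coord r := by linarith
    ext
    rw [coord_shrink, Ray.coord_mk_of_nonneg (by positivity)]
    field_simp; ring

namespace interval

/-- The collar of the endpoint `0`. -/
def lo (r : Ray) : interval := chart (shrink r)

/-- The collar of the endpoint `1`. -/
def hi (r : Ray) : interval := chart' (shrink r)

/-- The coordinate of a point of the interval. -/
def coord (y : interval) : ℝ := (y : unitInterval).1

theorem isLocalDiffeomorph_lo : IsLocalDiffeomorph (Q 1) (Q 1) ∞ lo := fun r =>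
  (isLocalDiffeomorph_shrink r).comp _ _ (isLocalDiffeomorph_chart _)

theorem isLocalDiffeomorph_hi : IsLocalDiffeomorph (Q 1) (Q 1) ∞ hi := fun r =>
  (isLocalDiffeomorph_shrink r).comp _ _ (isLocalDiffeomorph_chart' _)

theorem coord_lo (r : Ray) : coord (lo r) = Ray.coord r / (1 + 2 * Ray.coord r) := by
  have := Ray.coord_nonneg r
  change ((intervalChart (shrink r) : unitInterval) : ℝ) = _
  rw [coe_intervalChart, coord_shrink]
  field_simp
  ring

theorem coord_hi (r : Ray) : coord (hi r) = 1 - coord (lo r) := rfl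

/-- The reason for composing the charts with `shrink`: each collar stays in its own half of the
interval, so the two ends of a cylinder have disjoint collars. -/
theorem coord_lo_lt (r : Ray) : coord (lo r) < 1 / 2 := by
  have := Ray.coord_nonneg r
  rw [coord_lo, div_lt_div_iff₀ (by positivity) (by norm_num)]
  linarith

theorem coord_injective : Function.Injective coord := Subtype.val_injective

theorem lo_injective : Function.Injective lo := by
  intro r r' h
  have h1 := congrArg coord h
  have := Ray.coord_nonneg r
  have := Ray.coord_nonneg r'
  rw [coord_lo, coord_lo, div_eq_div_iff (by positivity) (by positivity)] at h1
  ext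
  linarith

theorem hi_injective : Function.Injective hi := by
  intro r r' h
  have h1 := congrArg coord h
  rw [coord_hi, coord_hi] at h1
  exact lo_injective (coord_injective (by linarith))

theorem lo_ne_hi (r r' : Ray) : lo r ≠ hi r' := by
  intro h
  have h1 := congrArg coord h
  rw [coord_hi] at h1
  linarith [coord_lo_lt r, coord_lo_lt r']

/-- Both charts are local diffeomorphisms and a nonzero point of the half-line is interior, so only
the chart origins are left. -/
theorem boundary_subset {y : interval} (hy : (Q 1).IsBoundaryPoint y) : y = lo 0 ∨ y = hi 0 := by
  have hz : shrink 0 = 0 := by ext; simp [coord_shrink]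
  rcases exists_chart y with ⟨r, rfl⟩ | ⟨r, rfl⟩
  · left
    have h3 : r = 0 := by
      by_contra h
      exact ((Q 1).isBoundaryPoint_iff_not_isInteriorPoint _).1
        (((isLocalDiffeomorph_chart r).isBoundaryPoint_iff (by simp)).2 hy)
        (Ray.isInteriorPoint_of_ne h)
    rw [lo, hz, h3]
  · right
    have h3 : r = 0 := by
      by_contra h
      exact ((Q 1).isBoundaryPoint_iff_not_isInteriorPoint _).1
        (((isLocalDiffeomorph_chart' r).isBoundaryPoint_iff (by simp)).2 hy)
        (Ray.isInteriorPoint_of_ne h)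
    rw [hi, hz, h3]

theorem contMDiff_coord : ContMDiff (Q 1) 𝓘(ℝ, ℝ) ∞ coord := by
  intro y
  rcases exists_chart y with ⟨r, rfl⟩ | ⟨r, rfl⟩
  · obtain ⟨g, g1, g2, g3, g4⟩ := (isLocalDiffeomorph_chart r).exists_inverse
    have := contMDiff_div_one_add.contMDiffAt.comp (chart r) g1.contMDiffAt
    refine this.congr_of_eventuallyEq ?_
    filter_upwards [g4] with z hz
    conv_lhs => rw [← hz]
    rfl
  · obtain ⟨g, g1, g2, g3, g4⟩ := (isLocalDiffeomorph_chart' r).exists_inverse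
    have := ((contDiff_const (c := (1 : ℝ))).sub (contDiff_id (𝕜 := ℝ))).contMDiff.contMDiffAt.comp
      (chart' r) (contMDiff_div_one_add.contMDiffAt.comp (chart' r) g1.contMDiffAt)
    refine this.congr_of_eventuallyEq ?_
    filter_upwards [g4] with z hz
    conv_lhs => rw [← hz]
    rfl

end interval

/-! ### Disjoint unions -/

/-- The disjoint union of two compact manifolds. -/
def CompactManifold.sum {n : ℕ} (M M' : CompactManifold n) : CompactManifold n where
  carrier := M ⊕ M'

section Sum

variable {E H M M' : Type*}
  [NormedAddCommGroup E] [NormedSpace ℝ E] [TopologicalSpace H] {I : ModelWithCorners ℝ E H}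
  [TopologicalSpace M] [ChartedSpace H M] [TopologicalSpace M'] [ChartedSpace H M']

theorem isLocalDiffeomorph_inl : IsLocalDiffeomorph I I ∞ (Sum.inl : M → M ⊕ M') := by
  intro x
  have : Nonempty M := ⟨x⟩
  refine isLocalDiffeomorphAt_of_eqOn
    (Topology.IsOpenEmbedding.toOpenPartialHomeomorph _ Topology.IsOpenEmbedding.inl)
    ContMDiff.inl.contMDiffOn ?_ trivial fun _ _ => rfl
  have h1 : ContMDiff I I ∞ (Sum.elim id (fun _ => x) : M ⊕ M' → M) :=
    contMDiff_id.sumElim contMDiff_const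
  refine h1.contMDiffOn.congr ?_
  rintro _ ⟨y, -, rfl⟩
  exact Topology.IsOpenEmbedding.toOpenPartialHomeomorph_left_inv _
    Topology.IsOpenEmbedding.inl

theorem isLocalDiffeomorph_inr : IsLocalDiffeomorph I I ∞ (Sum.inr : M' → M ⊕ M') := by
  intro x
  have : Nonempty M' := ⟨x⟩
  refine isLocalDiffeomorphAt_of_eqOn
    (Topology.IsOpenEmbedding.toOpenPartialHomeomorph _ Topology.IsOpenEmbedding.inr)
    ContMDiff.inr.contMDiffOn ?_ trivial fun _ _ => rfl
  have h1 : ContMDiff I I ∞ (Sum.elim (fun _ => x) id : M ⊕ M' → M') :=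
    contMDiff_const.sumElim contMDiff_id
  refine h1.contMDiffOn.congr ?_
  rintro _ ⟨y, -, rfl⟩
  exact Topology.IsOpenEmbedding.toOpenPartialHomeomorph_left_inv _
    Topology.IsOpenEmbedding.inr

end Sum

/-! ### Gluing along two collars -/

namespace Ray

theorem isLocalDiffeomorphAt_mk {t : ℝ} (ht : 0 < t) :
    IsLocalDiffeomorphAt 𝓘(ℝ, ℝ) (Q 1) ∞ mk t := by
  have h1 : ContMDiffOn 𝓘(ℝ, ℝ) (Q 1) ∞ mk (Set.Ioi 0) :=
    contMDiffOn_of_coord <| contMDiffOn_id.congr fun t ht => coord_mk_of_nonneg (le_of_lt ht)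
  refine isLocalDiffeomorphAt_of_eqOn
    { toFun := mk
      invFun := coord
      source := Set.Ioi 0
      target := {r | 0 < coord r}
      map_source' := fun t ht => by
        change 0 < coord (mk t)
        rwa [coord_mk_of_nonneg (le_of_lt ht)]
      map_target' := fun r hr => hr
      left_inv' := fun t ht => coord_mk_of_nonneg (le_of_lt ht)
      right_inv' := fun r _ => mk_coord r
      open_source := isOpen_Ioi
      open_target := isOpen_lt continuous_const continuous_coord
      continuousOn_toFun := h1.continuousOn
      continuousOn_invFun := continuous_coord.continuousOn } h1 contMDiff_coord.contMDiffOn ht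
      fun _ _ => rfl

theorem isLocalDiffeomorphAt_coord {r : Ray} (hr : 0 < coord r) :
    IsLocalDiffeomorphAt (Q 1) 𝓘(ℝ, ℝ) ∞ coord r := by
  have h1 := isLocalDiffeomorphAt_mk hr
  rw [← mk_coord r]
  refine IsLocalDiffeomorphAt.of_comp_right (f := mk) (g := coord) ?_ h1
  refine IsLocalDiffeomorphAt.congr' (f := id) ((Diffeomorph.refl 𝓘(ℝ, ℝ) ℝ ∞).isLocalDiffeomorph _)
    ?_
  filter_upwards [lt_mem_nhds hr] with t ht
  exact coord_mk_of_nonneg ht.le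

theorem isLocalDiffeomorph_exp : IsLocalDiffeomorph 𝓘(ℝ, ℝ) (Q 1) ∞ fun t => mk (Real.exp t) := by
  intro t
  refine IsLocalDiffeomorphAt.comp (f := Real.exp) (g := mk) _ _ ?_
    (isLocalDiffeomorphAt_mk (Real.exp_pos t))
  exact isLocalDiffeomorphAt_of_eqOn Real.expPartialHomeomorph
    Real.contDiff_exp.contMDiff.contMDiffOn
    (fun t ht => (Real.contDiffAt_log.2 (ne_of_gt ht)).contMDiffAt.contMDiffWithinAt) trivial
    fun _ _ => rfl

end Ray

/-- The two open embeddings `i`, `j` of `Z` give an open partial homeomorphism. -/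
theorem exists_patch {W Y Z : Type*} [TopologicalSpace W] [TopologicalSpace Y] [TopologicalSpace Z]
    [Nonempty Z] {i : Z → W} {j : Z → Y} (hi : Topology.IsOpenEmbedding i)
    (hj : Topology.IsOpenEmbedding j) : ∃ ψ : OpenPartialHomeomorph W Y,
      ψ.source = Set.range i ∧ ψ.target = Set.range j ∧ ∀ z, ψ (i z) = j z := by
  refine ⟨(hi.toOpenPartialHomeomorph i).symm ≫ₕ hj.toOpenPartialHomeomorph j, ?_, ?_, ?_⟩
  · simp
  · simp
  · intro z
    simp [Topology.IsOpenEmbedding.toOpenPartialHomeomorph_left_inv]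

namespace Collar

variable {n : ℕ} {F : CompactManifold n} {W : CompactManifold (n + 1)}

theorem isOpenEmbedding (c : Collar F W) : Topology.IsOpenEmbedding c.toFun :=
  .of_continuous_injective_isOpenMap c.isLocalDiffeomorph.contMDiff.continuous c.injective
    c.isLocalDiffeomorph.isOpenMap

theorem continuous_face (c : Collar F W) : Continuous c.face :=
  c.isOpenEmbedding.continuous.comp (Continuous.prodMk_left _)

theorem isClosed_range_face (c : Collar F W) : _root_.IsClosed (Set.range c.face) :=
  (isCompact_range c.continuous_face).isClosed

theorem face_eq_iff (c : Collar F W) {x y : F} {r : Ray} :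
    c.toFun (x, r) = c.face y ↔ x = y ∧ r = 0 := by
  rw [face, c.injective.eq_iff, Prod.mk.injEq]

theorem face_injective (c : Collar F W) : Function.Injective c.face := fun _ _ h =>
  (c.face_eq_iff.1 h).1

end Collar

/-- The result of gluing two faces of `W`, given by collars `c` and `c'`. -/
structure Gluing {n : ℕ} {F : CompactManifold n} {W : CompactManifold (n + 1)}
    (c c' : Collar F W) where
  Y : CompactManifold (n + 1)
  q : W → Y
  e : F × ℝ → Y
  surjective : Function.Surjective q
  q_face : ∀ x, q (c.face x) = q (c'.face x)
  eq_of_q_eq : ∀ u u', q u = q u' → u = u' ∨ (∃ x, u = c.face x ∧ u' = c'.face x) ∨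
    ∃ x, u = c'.face x ∧ u' = c.face x
  isQuotientMap : Topology.IsQuotientMap q
  isLocalDiffeomorphAt_q : ∀ u, u ∉ Set.range c.face → u ∉ Set.range c'.face →
    IsLocalDiffeomorphAt (Q (n + 1)) (Q (n + 1)) ∞ q u
  isLocalDiffeomorph_e : IsLocalDiffeomorph ((Q n).prod 𝓘(ℝ, ℝ)) (Q (n + 1)) ∞ e
  e_coord : ∀ x r, e (x, Ray.coord r) = q (c.toFun (x, r))
  e_neg_coord : ∀ x r, e (x, -Ray.coord r) = q (c'.toFun (x, r))

namespace Gluing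

variable {n : ℕ} {F : CompactManifold n} {W : CompactManifold (n + 1)} (c c' : Collar F W)
  (hd : ∀ z z', c.toFun z ≠ c'.toFun z')

/-- Two points are identified if they correspond to the same point of `F`. -/
def setoid : Setoid W where
  r u u' := u = u' ∨ (∃ x, u = c.face x ∧ u' = c'.face x) ∨ ∃ x, u = c'.face x ∧ u' = c.face x
  iseqv :=
    { refl := fun u => Or.inl rfl
      symm := by
        rintro u u' (h | ⟨x, h, h'⟩ | ⟨x, h, h'⟩)
        · exact Or.inl h.symm
        · exact Or.inr (Or.inr ⟨x, h', h⟩)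
        · exact Or.inr (Or.inl ⟨x, h', h⟩)
      trans := by
        -- A chain of two nontrivial identifications returns to its start, because the faces are
        -- embedded and disjoint.
        rintro u u' u'' (rfl | ⟨x, rfl, rfl⟩ | ⟨x, rfl, rfl⟩) (rfl | ⟨y, h, rfl⟩ | ⟨y, h, rfl⟩)
        · exact Or.inl rfl
        · exact Or.inr (Or.inl ⟨y, h, rfl⟩)
        · exact Or.inr (Or.inr ⟨y, h, rfl⟩)
        · exact Or.inr (Or.inl ⟨x, rfl, rfl⟩)
        · exact absurd h.symm (hd _ _)
        · rw [c'.face_injective h]; exact Or.inl rfl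
        · exact Or.inr (Or.inr ⟨x, rfl, rfl⟩)
        · rw [c.face_injective h]; exact Or.inl rfl
        · exact absurd h (hd _ _) }

/-- The glued space. -/
abbrev Space : Type := Quotient (setoid c c' hd)

/-- The quotient map. -/
def proj (u : W) : Space c c' hd := Quotient.mk _ u

theorem proj_eq_iff {u u' : W} : proj c c' hd u = proj c c' hd u' ↔
    u = u' ∨ (∃ x, u = c.face x ∧ u' = c'.face x) ∨ ∃ x, u = c'.face x ∧ u' = c.face x :=
  Quotient.eq (r := setoid c c' hd)

theorem continuous_proj : Continuous (proj c c' hd) := continuous_quot_mk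

/-- The complement of the two faces. -/
def off : Set W := {u | u ∉ Set.range c.face ∧ u ∉ Set.range c'.face}

theorem isOpen_off : IsOpen (off c c') :=
  c.isClosed_range_face.isOpen_compl.inter c'.isClosed_range_face.isOpen_compl

theorem eq_of_mem_off {u u' : W} (hu : u ∈ off c c')
    (h : proj c c' hd u = proj c c' hd u') : u = u' := by
  rcases (proj_eq_iff c c' hd).1 h with h | ⟨x, h, -⟩ | ⟨x, h, -⟩
  · exact h
  · exact absurd ⟨x, h.symm⟩ hu.1
  · exact absurd ⟨x, h.symm⟩ hu.2

/-- Off the two faces nothing is identified, so O is saturated and is the preimage of its image. -/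
theorem isOpen_image_off {O : Set W} (hO : IsOpen O) (h : O ⊆ off c c') :
    IsOpen (proj c c' hd '' O) := by
  refine isQuotientMap_quot_mk.isOpen_preimage.1 ?_
  change IsOpen (proj c c' hd ⁻¹' _)
  convert hO using 1
  refine Set.Subset.antisymm ?_ (Set.subset_preimage_image _ _)
  rintro u ⟨v, hv, huv⟩
  rwa [← eq_of_mem_off c c' hd (h hv) huv]

/-- The neighbourhood `F × ℝ` of the seam. -/
def seam (z : F × ℝ) : Space c c' hd :=
  if 0 ≤ z.2 then proj c c' hd (c.toFun (z.1, Ray.mk z.2))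
  else proj c c' hd (c'.toFun (z.1, Ray.mk (-z.2)))

theorem seam_coord (x : F) (r : Ray) :
    seam c c' hd (x, Ray.coord r) = proj c c' hd (c.toFun (x, r)) := by
  simp [seam, Ray.coord_nonneg]

theorem proj_face (x : F) : proj c c' hd (c.face x) = proj c c' hd (c'.face x) :=
  (proj_eq_iff c c' hd).2 (Or.inr (Or.inl ⟨x, rfl, rfl⟩))

theorem seam_neg_coord (x : F) (r : Ray) :
    seam c c' hd (x, -Ray.coord r) = proj c c' hd (c'.toFun (x, r)) := by
  -- At r = 0 the definition of `seam` goes through c and not through c', so the identification of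
  -- the faces is used here.
  by_cases h : r = 0
  · subst h
    have : Ray.mk 0 = 0 := by rw [← Ray.coord_zero, Ray.mk_coord]
    simpa [seam, this, Collar.face] using proj_face c c' hd x
  · have := Ray.coord_pos.2 h
    rw [seam, if_neg (by simpa using this)]
    simp

theorem exists_seam (s : ℝ) : (∃ r, s = Ray.coord r) ∨ ∃ r, r ≠ 0 ∧ s = -Ray.coord r := by
  rcases le_or_gt 0 s with h | h
  · exact Or.inl ⟨Ray.mk s, (Ray.coord_mk_of_nonneg h).symm⟩
  · have : Ray.coord (Ray.mk (-s)) = -s := Ray.coord_mk_of_nonneg (by linarith)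
    exact Or.inr ⟨Ray.mk (-s), by rw [← Ray.coord_pos, this]; linarith, by rw [this]; ring⟩

theorem continuous_seam : Continuous (seam c c' hd) := by
  refine Continuous.if_le ?_ ?_ continuous_const continuous_snd ?_
  · exact (continuous_proj c c' hd).comp (c.isOpenEmbedding.continuous.comp
      (continuous_fst.prodMk (Ray.continuous_mk.comp continuous_snd)))
  · exact (continuous_proj c c' hd).comp (c'.isOpenEmbedding.continuous.comp
      (continuous_fst.prodMk (Ray.continuous_mk.comp continuous_snd.neg)))
  · rintro ⟨x, s⟩ (h : 0 = s)
    subst h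
    have : Ray.mk 0 = 0 := by rw [← Ray.coord_zero, Ray.mk_coord]
    simpa [this, Collar.face] using proj_face c c' hd x

theorem seam_injective : Function.Injective (seam c c' hd) := by
  rintro ⟨x, s⟩ ⟨x', s'⟩ h
  rcases exists_seam s with ⟨r, rfl⟩ | ⟨r, hr, rfl⟩ <;>
  rcases exists_seam s' with ⟨r', rfl⟩ | ⟨r', hr', rfl⟩ <;>
  simp only [seam_coord, seam_neg_coord] at h <;>
  rcases (proj_eq_iff c c' hd).1 h with h | ⟨y, h, h'⟩ | ⟨y, h, h'⟩
  · obtain ⟨rfl, rfl⟩ := Prod.mk.injEq _ _ _ _ ▸ c.injective h; rfl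
  · exact absurd h' (hd _ _)
  · exact absurd h (hd _ _)
  · exact absurd h (hd _ _)
  · exact absurd (c'.face_eq_iff.1 h').2 hr'
  · exact absurd h (hd _ _)
  · exact absurd h.symm (hd _ _)
  · exact absurd h.symm (hd _ _)
  · exact absurd (c'.face_eq_iff.1 h).2 hr
  · obtain ⟨rfl, rfl⟩ := Prod.mk.injEq _ _ _ _ ▸ c'.injective h; rfl
  · exact absurd h.symm (hd _ _)
  · exact absurd (c'.face_eq_iff.1 h).2 hr

/-- The quotient topology is tested in W, where a piece of the seam becomes one piece in each
collar. Both the openness of `seam` and the closedness of the band in `t2Space` follow from this. -/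
theorem preimage_seam (O : Set (F × ℝ)) : proj c c' hd ⁻¹' (seam c c' hd '' O) =
    c.toFun '' {z | (z.1, Ray.coord z.2) ∈ O} ∪ c'.toFun '' {z | (z.1, -Ray.coord z.2) ∈ O} := by
  ext u
  constructor
  · rintro ⟨⟨x, s⟩, hz, h⟩
    rcases exists_seam s with ⟨r, rfl⟩ | ⟨r, hr, rfl⟩
    · rw [seam_coord] at h
      rcases (proj_eq_iff c c' hd).1 h with h | ⟨y, h, h'⟩ | ⟨y, h, h'⟩
      · exact Or.inl ⟨(x, r), hz, h⟩
      · obtain ⟨rfl, rfl⟩ := c.face_eq_iff.1 h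
        exact Or.inr ⟨(x, 0), by simpa using hz, h'.symm⟩
      · exact absurd h (hd _ _)
    · rw [seam_neg_coord] at h
      rcases (proj_eq_iff c c' hd).1 h with h | ⟨y, h, h'⟩ | ⟨y, h, h'⟩
      · exact Or.inr ⟨(x, r), hz, h⟩
      · exact absurd h.symm (hd _ _)
      · exact absurd (c'.face_eq_iff.1 h).2 hr
  · rintro (⟨⟨x, r⟩, hz, rfl⟩ | ⟨⟨x, r⟩, hz, rfl⟩)
    · exact ⟨_, hz, seam_coord c c' hd x r⟩
    · exact ⟨_, hz, seam_neg_coord c c' hd x r⟩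

theorem isOpenMap_seam : IsOpenMap (seam c c' hd) := by
  intro O hO
  have := Ray.continuous_coord
  refine isQuotientMap_quot_mk.isOpen_preimage.1 ?_
  change IsOpen (proj c c' hd ⁻¹' _)
  rw [preimage_seam]
  refine (c.isOpenEmbedding.isOpenMap _ ?_).union (c'.isOpenEmbedding.isOpenMap _ ?_)
  · exact hO.preimage (by fun_prop)
  · exact hO.preimage (by fun_prop)

theorem isOpenEmbedding_seam : Topology.IsOpenEmbedding (seam c c' hd) :=
  .of_continuous_injective_isOpenMap (continuous_seam c c' hd) (seam_injective c c' hd)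
    (isOpenMap_seam c c' hd)

theorem isOpenEmbedding_off :
    Topology.IsOpenEmbedding fun u : off c c' => proj c c' hd u.1 := by
  refine .of_continuous_injective_isOpenMap ((continuous_proj c c' hd).comp continuous_subtype_val)
    (fun u u' h => Subtype.ext (eq_of_mem_off c c' hd u.2 h)) fun O hO => ?_
  have := isOpen_image_off c c' hd ((isOpen_off c c').isOpenMap_subtype_val O hO)
    (by rintro _ ⟨u, -, rfl⟩; exact u.2)
  rwa [Set.image_image] at this

theorem mem_off_or_seam (y : Space c c' hd) :
    (∃ u ∈ off c c', proj c c' hd u = y) ∨ ∃ x, seam c c' hd (x, 0) = y := by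
  obtain ⟨u, rfl⟩ := Quotient.exists_rep y
  change (∃ u' ∈ off c c', proj c c' hd u' = proj c c' hd u) ∨ ∃ x, _ = proj c c' hd u
  by_cases h : u ∈ Set.range c.face
  · obtain ⟨x, rfl⟩ := h
    exact Or.inr ⟨x, by simpa [Collar.face] using seam_coord c c' hd x 0⟩
  · by_cases h' : u ∈ Set.range c'.face
    · obtain ⟨x, rfl⟩ := h'
      exact Or.inr ⟨x, by simpa [Collar.face] using seam_neg_coord c c' hd x 0⟩
    · exact Or.inl ⟨u, ⟨h, h'⟩, rfl⟩

theorem isCompact_setOf_coord_le : IsCompact {r : Ray | Ray.coord r ≤ 1} := by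
  have : {r : Ray | Ray.coord r ≤ 1} = Ray.mk '' Set.Icc 0 1 := by
    ext r
    constructor
    · exact fun h => ⟨Ray.coord r, ⟨Ray.coord_nonneg r, h⟩, Ray.mk_coord r⟩
    · rintro ⟨t, ht, rfl⟩
      change Ray.coord (Ray.mk t) ≤ 1
      rw [Ray.coord_mk_of_nonneg ht.1]; exact ht.2
  rw [this]
  exact isCompact_Icc.image Ray.continuous_mk

/-- Two points off the faces are separated in W. A point of the seam is separated inside F × ℝ from
any other point of F × ℝ, and from a point outside F × ℝ by the band |s| ≤ 1, which is closed
because F is compact. -/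
theorem t2Space : T2Space (Space c c' hd) := by
  have key : ∀ (u : W) (x : F), proj c c' hd u ≠ seam c c' hd (x, 0) →
      ∃ O O' : Set (Space c c' hd), IsOpen O ∧ IsOpen O' ∧ proj c c' hd u ∈ O ∧
        seam c c' hd (x, 0) ∈ O' ∧ Disjoint O O' := by
    intro u x hne
    by_cases hu : proj c c' hd u ∈ Set.range (seam c c' hd)
    · obtain ⟨z, hz⟩ := hu
      rw [← hz] at hne ⊢
      obtain ⟨O, O', h1, h2, h3, h4, h5⟩ := t2_separation (fun h => hne (congrArg _ h))
      exact ⟨_, _, isOpenMap_seam c c' hd O h1, isOpenMap_seam c c' hd O' h2,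
        Set.mem_image_of_mem _ h3, Set.mem_image_of_mem _ h4,
        (Set.disjoint_image_iff (seam_injective c c' hd)).2 h5⟩
    · refine ⟨(seam c c' hd '' {z | |z.2| ≤ 1})ᶜ, seam c c' hd '' {z | |z.2| < 1}, ?_, ?_, ?_, ?_,
        ?_⟩
      · rw [isOpen_compl_iff]
        refine isQuotientMap_quot_mk.isClosed_preimage.1 ?_
        change _root_.IsClosed (proj c c' hd ⁻¹' _)
        rw [preimage_seam]
        have hK : IsCompact (Set.univ ×ˢ {r : Ray | Ray.coord r ≤ 1} : Set (F × Ray)) :=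
          isCompact_univ.prod isCompact_setOf_coord_le
        have hK1 : {z : F × Ray | (z.1, Ray.coord z.2) ∈ {z : F × ℝ | |z.2| ≤ 1}}
            = Set.univ ×ˢ {r : Ray | Ray.coord r ≤ 1} := by
          ext z; simp [abs_of_nonneg (Ray.coord_nonneg _)]
        have hK2 : {z : F × Ray | (z.1, -Ray.coord z.2) ∈ {z : F × ℝ | |z.2| ≤ 1}}
            = Set.univ ×ˢ {r : Ray | Ray.coord r ≤ 1} := by
          ext z; simp [abs_of_nonneg (Ray.coord_nonneg _)]
        rw [hK1, hK2]
        exact ((hK.image c.isOpenEmbedding.continuous).union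
          (hK.image c'.isOpenEmbedding.continuous)).isClosed
      · exact isOpenMap_seam c c' hd _ (isOpen_lt (by fun_prop) continuous_const)
      · rintro ⟨z, -, hz⟩
        exact hu ⟨z, hz⟩
      · exact ⟨(x, 0), by simp, rfl⟩
      · rw [Set.disjoint_compl_left_iff_subset]
        exact Set.image_mono fun z (hz : |z.2| < 1) => le_of_lt hz
  refine ⟨fun y y' hne => ?_⟩
  rcases mem_off_or_seam c c' hd y with ⟨u, hu, rfl⟩ | ⟨x, rfl⟩
  · rcases mem_off_or_seam c c' hd y' with ⟨u', hu', rfl⟩ | ⟨x', rfl⟩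
    · obtain ⟨O, O', h1, h2, h3, h4, h5⟩ := t2_separation (fun h : u = u' => hne (congrArg _ h))
      refine ⟨_, _, isOpen_image_off c c' hd (h1.inter (isOpen_off c c')) Set.inter_subset_right,
        isOpen_image_off c c' hd (h2.inter (isOpen_off c c')) Set.inter_subset_right,
        Set.mem_image_of_mem _ ⟨h3, hu⟩, Set.mem_image_of_mem _ ⟨h4, hu'⟩, ?_⟩
      rw [Set.disjoint_left]
      rintro _ ⟨a, ha, rfl⟩ ⟨b, hb, hab⟩
      have := eq_of_mem_off c c' hd hb.2 hab
      subst this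
      exact Set.disjoint_left.1 h5 ha.1 hb.1
    · exact key u x' hne
  · obtain ⟨u', rfl⟩ := Quotient.exists_rep y'
    obtain ⟨O, O', h1, h2, h3, h4, h5⟩ := key u' x hne.symm
    exact ⟨O', O, h2, h1, h4, h3, h5.symm⟩

/-- The map `F × ℝ → W`, `(x, s) ↦ c (x, exp s)`. -/
def expCollar (z : F × ℝ) : W := c.toFun (z.1, Ray.mk (Real.exp z.2))

/-- A patch has to start in W, whereas the neighbourhood F × ℝ of the seam does not lie in W. The
exponential identifies ℝ with the open half-line and so realises F × ℝ as an open part of the collar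
c. -/
theorem isLocalDiffeomorph_expCollar :
    IsLocalDiffeomorph ((Q n).prod 𝓘(ℝ, ℝ)) (Q (n + 1)) ∞ (expCollar c) := by
  rintro ⟨x, s⟩
  exact IsLocalDiffeomorphAt.comp (f := Prod.map id fun t => Ray.mk (Real.exp t)) (g := c.toFun)
    _ _ (((Diffeomorph.refl (Q n) F ∞).isLocalDiffeomorph x).prodMap
      (Ray.isLocalDiffeomorph_exp s)) (c.isLocalDiffeomorph _)

theorem expCollar_injective : Function.Injective (expCollar c) := by
  rintro ⟨x, s⟩ ⟨x', s'⟩ h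
  have h1 := c.injective h
  simp only [Prod.mk.injEq] at h1
  have h2 := congrArg Ray.coord h1.2
  rw [Ray.coord_mk_of_nonneg (Real.exp_pos _).le, Ray.coord_mk_of_nonneg (Real.exp_pos _).le] at h2
  rw [h1.1, Real.exp_injective h2]

theorem isOpenEmbedding_expCollar : Topology.IsOpenEmbedding (expCollar c) :=
  .of_continuous_injective_isOpenMap (isLocalDiffeomorph_expCollar c).contMDiff.continuous
    (expCollar_injective c) (isLocalDiffeomorph_expCollar c).isOpenMap

/-- The patches of the glued manifold: the quotient map off the two faces, and `F × ℝ` embedded in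
`W` by `expCollar` and in the glued manifold by `seam`. -/
def patches : Set (OpenPartialHomeomorph W (Space c c' hd)) :=
  {ψ | ψ.source ⊆ off c c' ∧ ∀ u ∈ ψ.source, ψ u = proj c c' hd u} ∪
  {ψ | ψ.source ⊆ Set.range (expCollar c) ∧
    ∀ z, expCollar c z ∈ ψ.source → ψ (expCollar c z) = seam c c' hd z}

theorem exists_patch_off {u : W} (hu : u ∈ off c c') :
    ∃ ψ ∈ patches c c' hd, u ∈ ψ.source ∧ ∀ v ∈ off c c', ψ v = proj c c' hd v := by
  have : Nonempty (off c c') := ⟨⟨u, hu⟩⟩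
  obtain ⟨ψ, h1, h2, h3⟩ := exists_patch (isOpen_off c c').isOpenEmbedding_subtypeVal
    (isOpenEmbedding_off c c' hd)
  rw [Subtype.range_coe] at h1
  refine ⟨ψ, Or.inl ⟨h1.le, fun v hv => h3 ⟨v, h1 ▸ hv⟩⟩, h1 ▸ hu, fun v hv => h3 ⟨v, hv⟩⟩

theorem exists_patch_seam (z : F × ℝ) :
    ∃ ψ ∈ patches c c' hd, expCollar c z ∈ ψ.source ∧
      ∀ z, ψ (expCollar c z) = seam c c' hd z := by
  have : Nonempty (F × ℝ) := ⟨z⟩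
  obtain ⟨ψ, h1, h2, h3⟩ := exists_patch (isOpenEmbedding_expCollar c)
    (isOpenEmbedding_seam c c' hd)
  exact ⟨ψ, Or.inr ⟨h1.le, fun z _ => h3 z⟩, h1 ▸ ⟨z, rfl⟩, h3⟩

theorem patches_cover (y : Space c c' hd) : ∃ ψ ∈ patches c c' hd, y ∈ ψ.target := by
  rcases mem_off_or_seam c c' hd y with ⟨u, hu, rfl⟩ | ⟨x, rfl⟩
  · obtain ⟨ψ, h1, h2, h3⟩ := exists_patch_off c c' hd hu
    exact ⟨ψ, h1, h3 u hu ▸ ψ.map_source h2⟩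
  · obtain ⟨ψ, h1, h2, h3⟩ := exists_patch_seam c c' hd (x, 0)
    exact ⟨ψ, h1, h3 (x, 0) ▸ ψ.map_source h2⟩

/-- The transition from a patch off the faces to one at the seam. -/
theorem isLocalDiffeomorphAt_transition {ψ ψ' : OpenPartialHomeomorph W (Space c c' hd)}
    (h1 : ψ.source ⊆ off c c') (h2 : ∀ u ∈ ψ.source, ψ u = proj c c' hd u)
    (h1' : ψ'.source ⊆ Set.range (expCollar c))
    (h2' : ∀ z, expCollar c z ∈ ψ'.source → ψ' (expCollar c z) = seam c c' hd z)
    {u : W} (hu : u ∈ (ψ ≫ₕ ψ'.symm).source) :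
    IsLocalDiffeomorphAt (Q (n + 1)) (Q (n + 1)) ∞ (ψ ≫ₕ ψ'.symm) u := by
  have hS : (ψ ≫ₕ ψ'.symm).source ∈ nhds u := (ψ ≫ₕ ψ'.symm).open_source.mem_nhds hu
  -- On the overlap the transition is determined by the seam coordinates z of a point, so after
  -- precomposition with the collar c or c' it becomes `expCollar c` at (x, r) or at (x, -r).
  have main : ∀ v ∈ (ψ ≫ₕ ψ'.symm).source, ∀ z, proj c c' hd v = seam c c' hd z →
      (ψ ≫ₕ ψ'.symm) v = expCollar c z := by
    intro v hv z hz
    simp only [mfld_simps] at hv ⊢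
    obtain ⟨z', hz'⟩ := h1' (ψ'.map_target hv.2)
    have h3 : ψ' (expCollar c z') = ψ v := by rw [hz', ψ'.right_inv hv.2]
    rw [h2' z' (hz' ▸ ψ'.map_target hv.2), h2 v hv.1, hz] at h3
    rw [← hz', seam_injective c c' hd h3]
  obtain ⟨⟨x, s⟩, hz⟩ : proj c c' hd u ∈ Set.range (seam c c' hd) := by
    simp only [mfld_simps] at hu
    obtain ⟨z', hz'⟩ := h1' (ψ'.map_target hu.2)
    refine ⟨z', ?_⟩
    rw [← h2' z' (hz' ▸ ψ'.map_target hu.2), hz', ψ'.right_inv hu.2, h2 u hu.1]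
  have huo : u ∈ off c c' := h1 hu.1
  rcases exists_seam s with ⟨r, rfl⟩ | ⟨r, hr, rfl⟩
  · rw [seam_coord] at hz
    obtain rfl := eq_of_mem_off c c' hd huo hz.symm
    have hr : 0 < Ray.coord r := by
      rw [Ray.coord_pos]
      rintro rfl
      exact huo.1 ⟨x, rfl⟩
    refine IsLocalDiffeomorphAt.of_comp_right (f := c.toFun) ?_ (c.isLocalDiffeomorph _)
    have h4 : IsLocalDiffeomorphAt ((Q n).prod (Q 1)) (Q (n + 1)) ∞
        (expCollar c ∘ Prod.map id Ray.coord) (x, r) :=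
      (((Diffeomorph.refl (Q n) F ∞).isLocalDiffeomorph x).prodMap
        (Ray.isLocalDiffeomorphAt_coord hr)).comp _ _ (isLocalDiffeomorph_expCollar c _)
    refine h4.congr' ?_
    filter_upwards [c.isOpenEmbedding.continuous.continuousAt.eventually hS] with z hz
    exact main _ hz (z.1, Ray.coord z.2) (seam_coord c c' hd _ _).symm
  · rw [seam_neg_coord] at hz
    obtain rfl := eq_of_mem_off c c' hd huo hz.symm
    refine IsLocalDiffeomorphAt.of_comp_right (f := c'.toFun) ?_ (c'.isLocalDiffeomorph _)
    have h5 : IsLocalDiffeomorphAt (Q 1) 𝓘(ℝ, ℝ) ∞ (fun r => -Ray.coord r) r :=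
      IsLocalDiffeomorphAt.comp (g := fun t : ℝ => -t) _ _
        (Ray.isLocalDiffeomorphAt_coord (Ray.coord_pos.2 hr))
        ((ContinuousLinearEquiv.neg ℝ (M := ℝ)).toDiffeomorph.isLocalDiffeomorph _)
    have h4 : IsLocalDiffeomorphAt ((Q n).prod (Q 1)) (Q (n + 1)) ∞
        (expCollar c ∘ Prod.map id fun r => -Ray.coord r) (x, r) :=
      (((Diffeomorph.refl (Q n) F ∞).isLocalDiffeomorph x).prodMap h5).comp _ _
        (isLocalDiffeomorph_expCollar c _)
    refine h4.congr' ?_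
    filter_upwards [c'.isOpenEmbedding.continuous.continuousAt.eventually hS] with z hz
    exact main _ hz (z.1, -Ray.coord z.2) (seam_neg_coord c c' hd _ _).symm

/-- Two patches of the same kind have the identity as transition. The mixed transitions are inverse
to each other, so one direction needs a computation and the other follows by two out of three. -/
theorem patches_compat : ∀ ψ ∈ patches c c' hd, ∀ ψ' ∈ patches c c' hd,
    ContMDiffOn (Q (n + 1)) (Q (n + 1)) ∞ (ψ ≫ₕ ψ'.symm) (ψ ≫ₕ ψ'.symm).source := by
  rintro ψ (⟨h1, h2⟩ | ⟨h1, h2⟩) ψ' (⟨h1', h2'⟩ | ⟨h1', h2'⟩)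
  · refine contMDiffOn_id.congr fun u hu => ?_
    simp only [mfld_simps] at hu ⊢
    have h3 := ψ'.right_inv hu.2
    rw [h2' _ (ψ'.map_target hu.2)] at h3
    exact eq_of_mem_off c c' hd (h1' (ψ'.map_target hu.2)) (h3.trans (h2 _ hu.1))
  · exact fun u hu => (isLocalDiffeomorphAt_transition c c' hd h1 h2 h1' h2' hu).contMDiffAt
      |>.contMDiffWithinAt
  · intro u hu
    have hu' : (ψ ≫ₕ ψ'.symm) u ∈ (ψ' ≫ₕ ψ.symm).source := by
      have := (ψ ≫ₕ ψ'.symm).map_source hu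
      rwa [← OpenPartialHomeomorph.symm_source, OpenPartialHomeomorph.trans_symm_eq_symm_trans_symm,
        OpenPartialHomeomorph.symm_symm] at this
    have h3 := isLocalDiffeomorphAt_transition c c' hd h1' h2' h1 h2 hu'
    have h4 : ∀ v ∈ (ψ ≫ₕ ψ'.symm).source, (ψ' ≫ₕ ψ.symm) ((ψ ≫ₕ ψ'.symm) v) = v := by
      intro v hv
      simp only [mfld_simps] at hv ⊢
      rw [ψ'.right_inv hv.2, ψ.left_inv hv.1]
    refine (IsLocalDiffeomorphAt.of_comp_left (I := Q (n + 1)) (I' := Q (n + 1))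
      (I'' := Q (n + 1)) (f := ψ ≫ₕ ψ'.symm) (g := ψ' ≫ₕ ψ.symm) ?_ h3
      ((ψ ≫ₕ ψ'.symm).continuousAt hu)).contMDiffAt.contMDiffWithinAt
    refine IsLocalDiffeomorphAt.congr' (f := id)
      ((Diffeomorph.refl (Q (n + 1)) W ∞).isLocalDiffeomorph _) ?_
    filter_upwards [(ψ ≫ₕ ψ'.symm).open_source.mem_nhds hu] with v hv
    exact h4 v hv
  · refine contMDiffOn_id.congr fun u hu => ?_
    simp only [mfld_simps] at hu ⊢
    obtain ⟨z, rfl⟩ := h1 hu.1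
    obtain ⟨z', hz'⟩ := h1' (ψ'.map_target hu.2)
    have h3 := ψ'.right_inv hu.2
    rw [← hz', h2' _ (hz' ▸ ψ'.map_target hu.2), h2 _ hu.1] at h3
    rw [← hz', seam_injective c c' hd h3]

end Gluing

/-- Two disjoint collars of the same manifold can be glued. -/
theorem exists_gluing {n : ℕ} {F : CompactManifold n} {W : CompactManifold (n + 1)}
    (c c' : Collar F W) (hd : ∀ z z', c.toFun z ≠ c'.toFun z') : Nonempty (Gluing c c') := by
  let _ : ChartedSpace (EuclideanQuadrant (n + 1)) (Gluing.Space c c' hd) :=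
    patchCharts (Gluing.patches c c' hd) (Gluing.patches_cover c c' hd) (Homeomorph.refl _)
  have hm : IsManifold (Q (n + 1)) ∞ (Gluing.Space c c' hd) :=
    isManifold_patchCharts (I := Q (n + 1)) _ _ _ (ContinuousLinearEquiv.refl ℝ _)
      (fun _ => rfl) (Gluing.patches_compat c c' hd)
  have : T2Space (Gluing.Space c c' hd) := Gluing.t2Space c c' hd
  have : SecondCountableTopology (EuclideanQuadrant (n + 1)) :=
    inferInstanceAs (SecondCountableTopology
      {x : EuclideanSpace ℝ (Fin (n + 1)) // ∀ i, 0 ≤ x i})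
  -- A quotient need not inherit second countability; it comes from compactness and from charts in a
  -- second countable model.
  have : SecondCountableTopology (Gluing.Space c c' hd) :=
    ChartedSpace.secondCountable_of_sigmaCompact (EuclideanQuadrant (n + 1)) _
  have hp : ∀ ψ ∈ Gluing.patches c c' hd, ∀ u ∈ ψ.source,
      IsLocalDiffeomorphAt (Q (n + 1)) (Q (n + 1)) ∞ ψ u := fun ψ hψ u hu =>
    isLocalDiffeomorphAt_patch (I := Q (n + 1)) (I' := Q (n + 1)) _ _ (Homeomorph.refl _)
      (ContinuousLinearEquiv.refl ℝ _) (fun _ => rfl) (Gluing.patches_compat c c' hd) hψ hu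
  refine ⟨{
    Y := { carrier := Gluing.Space c c' hd }
    q := Gluing.proj c c' hd
    e := Gluing.seam c c' hd
    surjective := Quotient.exists_rep
    q_face := Gluing.proj_face c c' hd
    eq_of_q_eq := fun u u' => (Gluing.proj_eq_iff c c' hd).1
    isQuotientMap := isQuotientMap_quot_mk
    isLocalDiffeomorphAt_q := fun u hu hu' => ?_
    isLocalDiffeomorph_e := fun z => ?_
    e_coord := Gluing.seam_coord c c' hd
    e_neg_coord := Gluing.seam_neg_coord c c' hd }⟩
  · obtain ⟨ψ, h1, h2, h3⟩ := Gluing.exists_patch_off c c' hd ⟨hu, hu'⟩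
    refine (hp ψ h1 u h2).congr' ?_
    filter_upwards [(Gluing.isOpen_off c c').mem_nhds ⟨hu, hu'⟩] with v hv
    exact (h3 v hv).symm
  · obtain ⟨ψ, h1, h2, h3⟩ := Gluing.exists_patch_seam c c' hd z
    have h4 := (Gluing.isLocalDiffeomorph_expCollar c z).comp _ _ (hp ψ h1 _ h2)
    exact h4.congr' (.of_forall fun z => (h3 z).symm)

/-! ### Derivatives -/

theorem Ray.hasMFDerivAt_coord (r : Ray) :
    HasMFDerivAt (Q 1) 𝓘(ℝ, ℝ) Ray.coord r (EuclideanSpace.proj (𝕜 := ℝ) (0 : Fin 1)) :=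
  ((EuclideanSpace.proj (𝕜 := ℝ) (0 : Fin 1)).hasMFDerivAt (x := (Q 1) r)).comp r
    ((Q 1).hasMFDerivAt (x := r))

theorem Ray.mfderiv_coord (r : Ray) (w : EuclideanSpace ℝ (Fin 1)) :
    mfderiv (Q 1) 𝓘(ℝ, ℝ) Ray.coord r w = w 0 := by
  rw [(Ray.hasMFDerivAt_coord r).mfderiv]; rfl

/-- A vector in `ℝ¹` is determined by its coordinate. -/
theorem euclideanSpace_one_eq (w : EuclideanSpace ℝ (Fin 1)) : w = EuclideanSpace.single 0 (w 0) := by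
  ext i
  rw [Subsingleton.elim i 0]
  simp

theorem _root_.IsLocalDiffeomorphAt.mfderiv_bijective {E H M E' H' M' : Type*}
    [NormedAddCommGroup E] [NormedSpace ℝ E] [TopologicalSpace H] {I : ModelWithCorners ℝ E H}
    [TopologicalSpace M] [ChartedSpace H M] [NormedAddCommGroup E'] [NormedSpace ℝ E']
    [TopologicalSpace H'] {I' : ModelWithCorners ℝ E' H'} [TopologicalSpace M']
    [ChartedSpace H' M'] {f : M → M'} {x : M} (hf : IsLocalDiffeomorphAt I I' ∞ f x) :
    Function.Bijective (mfderiv I I' f x) := by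
  rw [← hf.mfderivToContinuousLinearEquiv_coe (by simp)]
  exact (hf.mfderivToContinuousLinearEquiv (by simp)).bijective

namespace Gluing

variable {n : ℕ} {F : CompactManifold n} {W : CompactManifold (n + 1)} {c c' : Collar F W}
  (G : Gluing c c')

theorem q_comp (G : Gluing c c') : G.q ∘ c.toFun = G.e ∘ Prod.map id Ray.coord :=
  funext fun z => (G.e_coord z.1 z.2).symm

theorem q_comp' (G : Gluing c c') :
    G.q ∘ c'.toFun = G.e ∘ Prod.map id fun r => -Ray.coord r :=
  funext fun z => (G.e_neg_coord z.1 z.2).symm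

/-- In a collar, q becomes the smooth map e restricted to one half of F × ℝ; off the faces it is a
local diffeomorphism. -/
theorem contMDiff_q : ContMDiff (Q (n + 1)) (Q (n + 1)) ∞ G.q := by
  have key : ∀ (d : Collar F W) (f : F × Ray → G.Y), G.q ∘ d.toFun = f →
      ContMDiff ((Q n).prod (Q 1)) (Q (n + 1)) ∞ f → ∀ x,
      ContMDiffAt (Q (n + 1)) (Q (n + 1)) ∞ G.q (d.face x) := by
    intro d f h hf x
    obtain ⟨g, g1, g2, g3, g4⟩ := (d.isLocalDiffeomorph (x, 0)).exists_inverse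
    refine (hf.contMDiffAt.comp (d.face x) g1.contMDiffAt).congr_of_eventuallyEq ?_
    filter_upwards [g4] with u hu
    conv_lhs => rw [← hu]
    exact congrFun h (g u)
  intro u
  by_cases hu : u ∈ Set.range c.face
  · obtain ⟨x, rfl⟩ := hu
    exact key c _ G.q_comp (G.isLocalDiffeomorph_e.contMDiff.comp
      (contMDiff_id.prodMap Ray.contMDiff_coord)) x
  by_cases hu' : u ∈ Set.range c'.face
  · obtain ⟨x, rfl⟩ := hu'
    exact key c' _ G.q_comp' (G.isLocalDiffeomorph_e.contMDiff.comp
      (contMDiff_id.prodMap Ray.contMDiff_coord.neg)) x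
  exact (G.isLocalDiffeomorphAt_q u hu hu').contMDiffAt

theorem mdifferentiable_q : MDifferentiable (Q (n + 1)) (Q (n + 1)) G.q :=
  G.contMDiff_q.mdifferentiable (by simp)

theorem mfderiv_q_c (x : F) (r : Ray) (v : EuclideanSpace ℝ (Fin n))
    (w : EuclideanSpace ℝ (Fin 1)) :
    mfderiv (Q (n + 1)) (Q (n + 1)) G.q (c.toFun (x, r))
      (mfderiv ((Q n).prod (Q 1)) (Q (n + 1)) c.toFun (x, r) (v, w)) =
    mfderiv ((Q n).prod 𝓘(ℝ, ℝ)) (Q (n + 1)) G.e (x, Ray.coord r) (v, w 0) := by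
  have h1 := mfderiv_comp (x, r) (G.mdifferentiable_q (c.toFun (x, r)))
    (c.isLocalDiffeomorph.mdifferentiable (by simp) (x, r))
  have hm : MDifferentiableAt ((Q n).prod (Q 1)) ((Q n).prod 𝓘(ℝ, ℝ))
      (Prod.map (id : F → F) Ray.coord) (x, r) :=
    ((mdifferentiableAt_id).prodMap (Ray.hasMFDerivAt_coord r).mdifferentiableAt)
  have h2 := mfderiv_comp (x, r) (f := Prod.map (id : F → F) Ray.coord) (g := G.e)
    (G.isLocalDiffeomorph_e.mdifferentiable (by simp) _) hm
  rw [G.q_comp, h2, mfderiv_prodMap mdifferentiableAt_id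
    (Ray.hasMFDerivAt_coord r).mdifferentiableAt] at h1
  have h3 := DFunLike.congr_fun h1 ((v, w) : EuclideanSpace ℝ (Fin n) × EuclideanSpace ℝ (Fin 1))
  refine h3.symm.trans ?_
  change mfderiv ((Q n).prod 𝓘(ℝ, ℝ)) (Q (n + 1)) G.e (x, Ray.coord r)
    (mfderiv (Q n) (Q n) (id : F → F) x v, mfderiv (Q 1) 𝓘(ℝ, ℝ) Ray.coord r w) = _
  rw [mfderiv_id, Ray.mfderiv_coord]
  rfl

/-- The sign records that the inward normals of the two glued faces point in opposite directions
across the seam. -/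
theorem mfderiv_q_c' (x : F) (r : Ray) (v : EuclideanSpace ℝ (Fin n))
    (w : EuclideanSpace ℝ (Fin 1)) :
    mfderiv (Q (n + 1)) (Q (n + 1)) G.q (c'.toFun (x, r))
      (mfderiv ((Q n).prod (Q 1)) (Q (n + 1)) c'.toFun (x, r) (v, w)) =
    mfderiv ((Q n).prod 𝓘(ℝ, ℝ)) (Q (n + 1)) G.e (x, -Ray.coord r) (v, -w 0) := by
  have h1 := mfderiv_comp (x, r) (G.mdifferentiable_q (c'.toFun (x, r)))
    (c'.isLocalDiffeomorph.mdifferentiable (by simp) (x, r))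
  have hn := (Ray.hasMFDerivAt_coord r).neg
  have hm : MDifferentiableAt ((Q n).prod (Q 1)) ((Q n).prod 𝓘(ℝ, ℝ))
      (Prod.map (id : F → F) fun r => -Ray.coord r) (x, r) :=
    ((mdifferentiableAt_id).prodMap hn.mdifferentiableAt)
  have h2 := mfderiv_comp (x, r) (f := Prod.map (id : F → F) fun r => -Ray.coord r) (g := G.e)
    (G.isLocalDiffeomorph_e.mdifferentiable (by simp) _) hm
  rw [G.q_comp', h2, mfderiv_prodMap mdifferentiableAt_id hn.mdifferentiableAt] at h1
  have h3 := DFunLike.congr_fun h1 ((v, w) : EuclideanSpace ℝ (Fin n) × EuclideanSpace ℝ (Fin 1))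
  refine h3.symm.trans ?_
  change mfderiv ((Q n).prod 𝓘(ℝ, ℝ)) (Q (n + 1)) G.e (x, -Ray.coord r)
    (mfderiv (Q n) (Q n) (id : F → F) x v, mfderiv (Q 1) 𝓘(ℝ, ℝ) (fun r => -Ray.coord r) r w) = _
  have h4 : mfderiv (Q 1) 𝓘(ℝ, ℝ) (fun r => -Ray.coord r) r
      = -(EuclideanSpace.proj (𝕜 := ℝ) (0 : Fin 1)) := hn.mfderiv
  rw [mfderiv_id, h4]
  rfl

/-- At a face q is only the inclusion of a half-space and not a local diffeomorphism. Its derivative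
is still bijective, because the chain rule expresses it by the derivative of e. -/
theorem mfderiv_q_bijective (u : W) :
    Function.Bijective (mfderiv (Q (n + 1)) (Q (n + 1)) G.q u) := by
  by_cases hu : u ∈ Set.range c.face
  · obtain ⟨x, rfl⟩ := hu
    have h1 := (c.isLocalDiffeomorph (x, 0)).mfderiv_bijective
    refine (Function.Bijective.of_comp_iff _ h1).1 ?_
    have h2 := (G.isLocalDiffeomorph_e (x, Ray.coord 0)).mfderiv_bijective
    have h3 : Function.Bijective fun p : EuclideanSpace ℝ (Fin n) × EuclideanSpace ℝ (Fin 1) =>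
        (p.1, p.2 0) := by
      refine ⟨fun p p' h => ?_, fun p => ⟨(p.1, EuclideanSpace.single 0 p.2), by simp⟩⟩
      simp only [Prod.mk.injEq] at h
      refine Prod.ext h.1 ?_
      rw [euclideanSpace_one_eq p.2, h.2, ← euclideanSpace_one_eq]
    have h4 := h2.comp h3
    have h5 := funext fun p : EuclideanSpace ℝ (Fin n) × EuclideanSpace ℝ (Fin 1) =>
      G.mfderiv_q_c x 0 p.1 p.2
    exact (congrArg Function.Bijective h5).mpr h4
  by_cases hu' : u ∈ Set.range c'.face
  · obtain ⟨x, rfl⟩ := hu'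
    have h1 := (c'.isLocalDiffeomorph (x, 0)).mfderiv_bijective
    refine (Function.Bijective.of_comp_iff _ h1).1 ?_
    have h2 := (G.isLocalDiffeomorph_e (x, -Ray.coord 0)).mfderiv_bijective
    have h3 : Function.Bijective fun p : EuclideanSpace ℝ (Fin n) × EuclideanSpace ℝ (Fin 1) =>
        (p.1, -p.2 0) := by
      refine ⟨fun p p' h => ?_, fun p => ⟨(p.1, EuclideanSpace.single 0 (-p.2)), by simp⟩⟩
      simp only [Prod.mk.injEq, neg_inj] at h
      refine Prod.ext h.1 ?_
      rw [euclideanSpace_one_eq p.2, h.2, ← euclideanSpace_one_eq]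
    have h4 := h2.comp h3
    have h5 := funext fun p : EuclideanSpace ℝ (Fin n) × EuclideanSpace ℝ (Fin 1) =>
      G.mfderiv_q_c' x 0 p.1 p.2
    exact (congrArg Function.Bijective h5).mpr h4
  exact (G.isLocalDiffeomorphAt_q u hu hu').mfderiv_bijective

end Gluing

namespace interval

/-- This derivative supplies the extra coordinate of the framing of a cylinder, so it must not
vanish. In the two charts it is ±1/(1 + r)². -/
theorem mfderiv_coord_injective (y : interval) :
    Function.Injective (mfderiv (Q 1) 𝓘(ℝ, ℝ) coord y) := by
  have key : ∀ (f : Ray → interval) (g : ℝ → ℝ) (r : Ray) (a : ℝ), a ≠ 0 →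
      IsLocalDiffeomorph (Q 1) (Q 1) ∞ f → (∀ r, coord (f r) = g (Ray.coord r)) →
      HasDerivAt g a (Ray.coord r) →
      Function.Injective (mfderiv (Q 1) 𝓘(ℝ, ℝ) coord (f r)) := by
    intro f g r a ha hf hfg hd
    have h1 := mfderiv_comp r (contMDiff_coord.mdifferentiable (by simp) (f r))
      (hf.mdifferentiable (by simp) r)
    have h2 : HasMFDerivAt (Q 1) 𝓘(ℝ, ℝ) (coord ∘ f) r _ :=
      (hd.hasFDerivAt.hasMFDerivAt.comp r (Ray.hasMFDerivAt_coord r)).congr_of_eventuallyEq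
        (.of_forall hfg)
    rw [h2.mfderiv] at h1
    refine (Function.Injective.of_comp_iff' _ (hf r).mfderiv_bijective).1 ?_
    intro (w : EuclideanSpace ℝ (Fin 1)) (w' : EuclideanSpace ℝ (Fin 1)) hw
    have h3 := (DFunLike.congr_fun h1 w).trans (hw.trans (DFunLike.congr_fun h1 w').symm)
    change ContinuousLinearMap.toSpanSingleton ℝ a (w 0)
      = ContinuousLinearMap.toSpanSingleton ℝ a (w' 0) at h3
    simp only [ContinuousLinearMap.toSpanSingleton_apply, smul_eq_mul, mul_eq_mul_right_iff, ha,
      or_false] at h3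
    refine (euclideanSpace_one_eq w).trans ?_
    rw [h3]
    exact (euclideanSpace_one_eq w').symm
  rcases exists_chart y with ⟨r, rfl⟩ | ⟨r, rfl⟩
  · have h0 := Ray.coord_nonneg r
    have h1 : (1 + Ray.coord r) ≠ 0 := by positivity
    refine key chart (fun x => x / (1 + x)) r (1 / (1 + Ray.coord r) ^ 2) (by positivity)
      isLocalDiffeomorph_chart (fun r => rfl) ?_
    exact ((hasDerivAt_id' (Ray.coord r)).fun_div ((hasDerivAt_id' (Ray.coord r)).const_add 1)
      h1).congr_deriv (by ring)
  · have h0 := Ray.coord_nonneg r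
    have h1 : (1 + Ray.coord r) ≠ 0 := by positivity
    refine key chart' (fun x => 1 - x / (1 + x)) r (-(1 / (1 + Ray.coord r) ^ 2))
      (by simp; positivity) isLocalDiffeomorph_chart' (fun r => rfl) ?_
    exact (((hasDerivAt_id' (Ray.coord r)).fun_div ((hasDerivAt_id' (Ray.coord r)).const_add 1)
      h1).const_sub 1).congr_deriv (by ring)

/-- The collar r/(1 + 2r) has derivative exactly 1 at 0, so the framing of a cylinder restricts to
its ends without a scalar factor. -/
theorem mfderiv_coord_lo (w : EuclideanSpace ℝ (Fin 1)) :
    mfderiv (Q 1) 𝓘(ℝ, ℝ) coord (lo 0) (mfderiv (Q 1) (Q 1) lo 0 w) = w 0 := by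
  have h1 := mfderiv_comp (0 : Ray) (contMDiff_coord.mdifferentiable (by simp) (lo 0))
    (isLocalDiffeomorph_lo.mdifferentiable (by simp) 0)
  have hd : HasDerivAt (fun x : ℝ => x / (1 + 2 * x)) 1 (Ray.coord 0) := by
    have := (hasDerivAt_id' (Ray.coord 0)).fun_div
      (((hasDerivAt_id' (Ray.coord 0)).const_mul 2).const_add 1) (by simp)
    simpa using this
  have h2 : HasMFDerivAt (Q 1) 𝓘(ℝ, ℝ) (coord ∘ lo) (0 : Ray) _ :=
    (hd.hasFDerivAt.hasMFDerivAt.comp (0 : Ray) (Ray.hasMFDerivAt_coord 0)).congr_of_eventuallyEq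
      (.of_forall fun r => coord_lo r)
  rw [h2.mfderiv] at h1
  have h3 := DFunLike.congr_fun h1 w
  refine h3.symm.trans ?_
  change ContinuousLinearMap.toSpanSingleton ℝ (1:ℝ) (w 0) = _
  simp

theorem mfderiv_coord_hi (w : EuclideanSpace ℝ (Fin 1)) :
    mfderiv (Q 1) 𝓘(ℝ, ℝ) coord (hi 0) (mfderiv (Q 1) (Q 1) hi 0 w) = -w 0 := by
  have h1 := mfderiv_comp (0 : Ray) (contMDiff_coord.mdifferentiable (by simp) (hi 0))
    (isLocalDiffeomorph_hi.mdifferentiable (by simp) 0)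
  have hd : HasDerivAt (fun x : ℝ => 1 - x / (1 + 2 * x)) (-1) (Ray.coord 0) := by
    have := ((hasDerivAt_id' (Ray.coord 0)).fun_div
      (((hasDerivAt_id' (Ray.coord 0)).const_mul 2).const_add 1) (by simp)).const_sub 1
    simpa using this
  have h2 : HasMFDerivAt (Q 1) 𝓘(ℝ, ℝ) (coord ∘ hi) (0 : Ray) _ :=
    (hd.hasFDerivAt.hasMFDerivAt.comp (0 : Ray) (Ray.hasMFDerivAt_coord 0)).congr_of_eventuallyEq
      (.of_forall fun r => (coord_hi r).trans (by rw [coord_lo]; rfl))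
  rw [h2.mfderiv] at h1
  have h3 := DFunLike.congr_fun h1 w
  refine h3.symm.trans ?_
  change ContinuousLinearMap.toSpanSingleton ℝ (-1:ℝ) (w 0) = _
  simp

end interval

/-! ### Tangent bundles -/

section Tangent

variable {E H M E' H' M' : Type*}
  [NormedAddCommGroup E] [NormedSpace ℝ E] [TopologicalSpace H] {I : ModelWithCorners ℝ E H}
  [TopologicalSpace M] [ChartedSpace H M] [IsManifold I ∞ M]
  [NormedAddCommGroup E'] [NormedSpace ℝ E'] [TopologicalSpace H'] {I' : ModelWithCorners ℝ E' H'}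
  [TopologicalSpace M'] [ChartedSpace H' M'] [IsManifold I' ∞ M']

instance : IsManifold I 1 M := IsManifold.of_le (n := ∞) (by simp)

/-- Continuity of a function on a tangent bundle can be checked after a local diffeomorphism. -/
theorem continuousAt_tangentBundle_of_comp {K Z : Type*} [TopologicalSpace K] [TopologicalSpace Z]
    {f : M' → M} {x : M'} (hf : IsLocalDiffeomorphAt I' I ∞ f x) (Ψ : M → E × K → Z) (v : E')
    (k : K)
    (h : ContinuousAt (fun z : TangentBundle I' M' × K =>
      Ψ (f z.1.proj) (mfderiv I' I f z.1.proj z.1.snd, z.2)) (⟨x, v⟩, k)) :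
    ContinuousAt (fun z : TangentBundle I M × K => Ψ z.1.proj (z.1.snd, z.2))
      (⟨f x, mfderiv I' I f x v⟩, k) := by
  obtain ⟨e, hx, hfe, h1, h2⟩ := hf.exists_openPartialHomeomorph
  have hfx : f x ∈ e.target := hfe hx ▸ e.map_source hx
  -- The tangent map of the local inverse is continuous; precomposition with it carries the
  -- hypothesis over M' to the claim over M.
  have hcont : ContinuousOn (tangentMapWithin I I' e.symm e.target)
      (Bundle.TotalSpace.proj ⁻¹' e.target) :=
    h2.continuousOn_tangentMapWithin (by simp) e.open_target.uniqueMDiffOn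
  have hopen : IsOpen (Bundle.TotalSpace.proj ⁻¹' e.target : Set (TangentBundle I M)) :=
    e.open_target.preimage (FiberBundle.continuous_proj E (TangentSpace I))
  have hd : ∀ y ∈ e.target, ∀ w : E, mfderiv I' I f (e.symm y)
      (mfderivWithin I I' e.symm e.target y w) = w := by
    intro y hy w
    rw [mfderivWithin_of_isOpen e.open_target hy]
    have hm : MDifferentiableAt I I' e.symm y :=
      (h2.mdifferentiableOn (by simp) y hy).mdifferentiableAt (e.open_target.mem_nhds hy)
    have hfm : MDifferentiableAt I' I f (e.symm y) := by
      refine ((h1.mdifferentiableOn (by simp) _ (e.map_target hy)).mdifferentiableAt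
        (e.open_source.mem_nhds (e.map_target hy))).congr_of_eventuallyEq ?_
      filter_upwards [e.open_source.mem_nhds (e.map_target hy)] with z hz
      exact hfe hz
    have h3 := mfderiv_comp y hfm hm
    have h4 : f ∘ e.symm =ᶠ[nhds y] id := by
      filter_upwards [e.open_target.mem_nhds hy] with z hz
      change f (e.symm z) = z
      rw [hfe (e.map_target hz), e.right_inv hz]
    rw [h4.mfderiv_eq, mfderiv_id] at h3
    exact (DFunLike.congr_fun h3 w).symm
  have hfe' : ∀ y ∈ e.target, f (e.symm y) = y := fun y hy => by
    rw [hfe (e.map_target hy), e.right_inv hy]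
  have key : (fun z : TangentBundle I M × K => Ψ z.1.proj (z.1.snd, z.2)) =ᶠ[nhds
      (⟨f x, mfderiv I' I f x v⟩, k)] (fun z : TangentBundle I' M' × K =>
      Ψ (f z.1.proj) (mfderiv I' I f z.1.proj z.1.snd, z.2)) ∘
      fun z => (tangentMapWithin I I' e.symm e.target z.1, z.2) := by
    have : Prod.fst ⁻¹' (Bundle.TotalSpace.proj ⁻¹' e.target : Set (TangentBundle I M)) ∈
        nhds ((⟨f x, mfderiv I' I f x v⟩, k) : TangentBundle I M × K) :=
      (hopen.preimage continuous_fst).mem_nhds hfx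
    filter_upwards [this] with z hz
    change _ = Ψ (f (e.symm z.1.proj)) (mfderiv I' I f (e.symm z.1.proj)
      (mfderivWithin I I' e.symm e.target z.1.proj z.1.snd), z.2)
    exact (congr_arg₂ (fun a b => Ψ a (b, z.2)) (hfe' _ hz) (hd _ hz z.1.snd)).symm
  refine ContinuousAt.congr ?_ key.symm
  have hpt : tangentMapWithin I I' e.symm e.target ⟨f x, mfderiv I' I f x v⟩ = ⟨x, v⟩ := by
    have h3 : e.symm (f x) = x := by rw [hfe hx, e.left_inv hx]
    have h4 := hd (f x) hfx (mfderiv I' I f x v)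
    rw [h3] at h4
    have h5 := hf.mfderiv_bijective.1 h4
    change (⟨e.symm (f x), mfderivWithin I I' e.symm e.target (f x) (mfderiv I' I f x v)⟩ :
      TangentBundle I' M') = _
    rw [h3, h5]
  refine ContinuousAt.comp (g := fun z : TangentBundle I' M' × K =>
      Ψ (f z.1.proj) (mfderiv I' I f z.1.proj z.1.snd, z.2)) ?_ ?_
  · dsimp only
    rw [hpt]
    exact h
  · refine ContinuousAt.prodMk ?_ continuousAt_snd
    exact (hcont.continuousAt (hopen.mem_nhds hfx)).comp (f := Prod.fst) continuousAt_fst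

theorem continuous_tangentBundle_prod_mk {Z : Type*} [TopologicalSpace Z]
    {a : Z → TangentBundle I M} {b : Z → TangentBundle I' M'} (ha : Continuous a)
    (hb : Continuous b) : Continuous fun z => (⟨((a z).1, (b z).1), ((a z).2, (b z).2)⟩ :
      TangentBundle (I.prod I') (M × M')) :=
  (contMDiff_equivTangentBundleProd_symm (n := 0) (I := I) (M := M) (I' := I')
    (M' := M')).continuous.comp (ha.prodMk hb)

theorem continuous_tangentBundle_prod_fst :
    Continuous fun z : TangentBundle (I.prod I') (M × M') =>
      (⟨z.1.1, z.2.1⟩ : TangentBundle I M) :=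
  continuous_fst.comp (contMDiff_equivTangentBundleProd (n := 0) (I := I) (M := M) (I' := I')
    (M' := M')).continuous

theorem continuous_tangentBundle_prod_snd :
    Continuous fun z : TangentBundle (I.prod I') (M × M') =>
      (⟨z.1.2, z.2.2⟩ : TangentBundle I' M') :=
  continuous_snd.comp (contMDiff_equivTangentBundleProd (n := 0) (I := I) (M := M) (I' := I')
    (M' := M')).continuous

theorem continuous_tangentBundle_model_mk {Z : Type*} [TopologicalSpace Z] {a : Z → H} {b : Z → E}
    (ha : Continuous a) (hb : Continuous b) :
    Continuous fun z => (⟨a z, b z⟩ : TangentBundle I H) :=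
  (tangentBundleModelSpaceHomeomorph I).symm.continuous.comp (ha.prodMk hb)

theorem continuous_tangentBundle_model_snd :
    Continuous fun z : TangentBundle I H => (z.2 : E) :=
  continuous_snd.comp (tangentBundleModelSpaceHomeomorph I).continuous

theorem continuous_tangentBundle_proj :
    Continuous fun z : TangentBundle I M => z.proj :=
  FiberBundle.continuous_proj E (TangentSpace I)

end Tangent

/-! ### Framings as families of linear maps -/

/-- The Euclidean space `ℝⁿ`. -/
abbrev Eucl (n : ℕ) : Type := EuclideanSpace ℝ (Fin n)

/-- An injective linear map `V ⊕ ℝ^ℕ → V' ⊕ ℝ^ℕ` that is the identity on the coordinates `≥ R`. -/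
structure IsStable {V V' : Type*} [AddCommGroup V] [Module ℝ V] [AddCommGroup V'] [Module ℝ V']
    (R : ℕ) (L : V × (ℕ → ℝ) →ₗ[ℝ] V' × (ℕ → ℝ)) : Prop where
  injective : Function.Injective L
  apply_tail : ∀ s, (∀ i < R, s i = 0) → L (0, s) = (0, s)
  snd_apply : ∀ z, ∀ i, R ≤ i → (L z).2 i = z.2 i

/-- A stable framing of `M`, as a family of linear maps `T_xM ⊕ ℝ^ℕ → ℝⁿ ⊕ ℝ^ℕ` that are the
identity on the coordinates `≥ R`. -/
structure IsFraming {n : ℕ} (M : CompactManifold n) (R : ℕ)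
    (Φ : M → Eucl n × (ℕ → ℝ) →ₗ[ℝ] Eucl n × (ℕ → ℝ)) : Prop where
  stable : ∀ x, IsStable R (Φ x)
  continuous : Continuous fun z : TangentBundle (Q n) M × (ℕ → ℝ) => Φ z.1.proj (z.1.snd, z.2)

theorem IsStable.mono {V V' : Type*} [AddCommGroup V] [Module ℝ V] [AddCommGroup V'] [Module ℝ V']
    {R R' : ℕ} (hR : R ≤ R') {L : V × (ℕ → ℝ) →ₗ[ℝ] V' × (ℕ → ℝ)} (h : IsStable R L) :
    IsStable R' L :=
  ⟨h.injective, fun s hs => h.apply_tail s fun i hi => hs i (hi.trans_le hR),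
    fun z i hi => h.snd_apply z i (hR.trans hi)⟩

section Framing

variable {n : ℕ} {M : CompactManifold n}

theorem IsFraming.mono {R R' : ℕ} (hR : R ≤ R')
    {Φ : M → Eucl n × (ℕ → ℝ) →ₗ[ℝ] Eucl n × (ℕ → ℝ)}
    (h : IsFraming M R Φ) : IsFraming M R' Φ :=
  ⟨fun x => (h.stable x).mono hR, h.continuous⟩

theorem StableFraming.extend_snd_of_lt (φ : StableFraming M) (x : M) (v : M.Tangent x)
    (s : ℕ → ℝ) {i : ℕ} (h : i < φ.rank) : (φ.extend x v s).2 i =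
      (φ.iso x (v, WithLp.toLp 2 fun i : Fin φ.rank => s i)).2 ⟨i, h⟩ := dif_pos h

theorem StableFraming.extend_snd_of_le (φ : StableFraming M) (x : M) (v : M.Tangent x)
    (s : ℕ → ℝ) {i : ℕ} (h : φ.rank ≤ i) : (φ.extend x v s).2 i = s i := dif_neg (not_lt.2 h)

/-- The stable framing, extended by the identity, as a family of linear maps. -/
def StableFraming.toLin (φ : StableFraming M) (x : M) :
    EuclideanSpace ℝ (Fin n) × (ℕ → ℝ) →ₗ[ℝ] EuclideanSpace ℝ (Fin n) × (ℕ → ℝ) where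
  toFun z := φ.extend x z.1 z.2
  map_add' z z' := by
    have h := (φ.iso x).map_add (z.1, WithLp.toLp 2 fun i : Fin φ.rank => z.2 i)
      (z'.1, WithLp.toLp 2 fun i : Fin φ.rank => z'.2 i)
    refine Prod.ext (congrArg Prod.fst h :) (funext fun i => ?_)
    by_cases hi : i < φ.rank
    · exact (φ.extend_snd_of_lt x _ _ hi).trans
        ((congrFun (congrArg WithLp.ofLp (congrArg Prod.snd h)) ⟨i, hi⟩).trans
        (congr_arg₂ (· + ·) (φ.extend_snd_of_lt x _ _ hi) (φ.extend_snd_of_lt x _ _ hi)).symm)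
    · exact (φ.extend_snd_of_le x _ _ (not_lt.1 hi)).trans
        (congr_arg₂ (· + ·) (φ.extend_snd_of_le x _ _ (not_lt.1 hi))
        (φ.extend_snd_of_le x _ _ (not_lt.1 hi))).symm
  map_smul' a z := by
    have h := (φ.iso x).map_smul a (z.1, WithLp.toLp 2 fun i : Fin φ.rank => z.2 i)
    refine Prod.ext (congrArg Prod.fst h :) (funext fun i => ?_)
    by_cases hi : i < φ.rank
    · exact (φ.extend_snd_of_lt x _ _ hi).trans
        ((congrFun (congrArg WithLp.ofLp (congrArg Prod.snd h)) ⟨i, hi⟩).trans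
        (congrArg (a * ·) (φ.extend_snd_of_lt x _ _ hi)).symm)
    · exact (φ.extend_snd_of_le x _ _ (not_lt.1 hi)).trans
        (congrArg (a * ·) (φ.extend_snd_of_le x _ _ (not_lt.1 hi))).symm

theorem StableFraming.isStable (φ : StableFraming M) (x : M) :
    IsStable φ.rank (φ.toLin x) where
  injective := by
    rw [injective_iff_map_eq_zero]
    rintro ⟨v, s⟩ h
    have h1 : (φ.iso x (v, WithLp.toLp 2 fun i : Fin φ.rank => s i)).1 = 0 := congrArg Prod.fst h
    have h2 : ∀ i, (if h : i < φ.rank then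
        (φ.iso x (v, WithLp.toLp 2 fun i : Fin φ.rank => s i)).2 ⟨i, h⟩ else s i) = 0 :=
      fun i => congrFun (congrArg Prod.snd h) i
    have h3 : φ.iso x (v, WithLp.toLp 2 fun i : Fin φ.rank => s i) = 0 := by
      refine Prod.ext h1 ?_
      ext i
      have := h2 i
      rwa [dif_pos i.2] at this
    rw [map_eq_zero_iff _ (φ.iso x).injective] at h3
    refine Prod.ext (congrArg Prod.fst h3 :) (funext fun i => ?_)
    by_cases hi : i < φ.rank
    · exact congrFun (congrArg WithLp.ofLp (congrArg Prod.snd h3)) ⟨i, hi⟩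
    · have := h2 i
      rwa [dif_neg hi] at this
  apply_tail s hs := by
    have h1 : (((0 : EuclideanSpace ℝ (Fin n)), WithLp.toLp 2 fun i : Fin φ.rank => s i) :
        M.Tangent x × EuclideanSpace ℝ (Fin φ.rank)) = 0 := by
      refine Prod.ext rfl ?_
      ext i
      exact hs i i.2
    have h2 := (congrArg (φ.iso x) h1).trans (map_zero _)
    refine Prod.ext (congrArg Prod.fst h2 :) (funext fun i => ?_)
    change (if h : i < φ.rank then _ else s i) = s i
    split_ifs with h
    · exact (congrFun (congrArg WithLp.ofLp (congrArg Prod.snd h2)) ⟨i, h⟩).trans (hs i h).symm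
    · rfl
  snd_apply z i hi := by
    change (if h : i < φ.rank then _ else z.2 i) = _
    rw [dif_neg (not_lt.2 hi)]

/-- Together with `IsFraming.exists_stableFraming` this makes `IsFraming` an equivalent form of a
stable framing, in which composition, descent and definition by cases no longer involve changes of
rank. -/
theorem StableFraming.isFraming (φ : StableFraming M) : IsFraming M φ.rank φ.toLin where
  stable := φ.isStable
  continuous := by
    have h1 : Continuous fun z : TangentBundle (Q n) M × (ℕ → ℝ) =>
        φ.iso z.1.proj (z.1.snd, WithLp.toLp 2 fun i : Fin φ.rank => z.2 i) := by
      refine φ.continuous_iso.comp (continuous_fst.prodMk ?_)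
      exact (PiLp.continuous_toLp 2 _).comp (by fun_prop)
    refine Continuous.prodMk (continuous_fst.comp h1) (continuous_pi fun i => ?_)
    by_cases hi : i < φ.rank
    · simp only [hi, dif_pos]
      exact (PiLp.continuous_apply 2 _ _).comp (continuous_snd.comp h1)
    · simp only [hi, dif_neg, not_false_iff]
      fun_prop

/-- The extension of a finite sequence by zero. -/
def extendZero (R : ℕ) : EuclideanSpace ℝ (Fin R) →ₗ[ℝ] (ℕ → ℝ) where
  toFun a i := if h : i < R then a ⟨i, h⟩ else 0
  map_add' a b := by ext i; simp only [Pi.add_apply]; split_ifs <;> simp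
  map_smul' c a := by ext i; simp only [Pi.smul_apply]; split_ifs <;> simp

theorem extendZero_of_lt {R : ℕ} (a : EuclideanSpace ℝ (Fin R)) {i : ℕ} (h : i < R) :
    extendZero R a i = a ⟨i, h⟩ := dif_pos h

theorem extendZero_of_le {R : ℕ} (a : EuclideanSpace ℝ (Fin R)) {i : ℕ} (h : R ≤ i) :
    extendZero R a i = 0 := dif_neg (not_lt.2 h)

/-- On the first R stable coordinates Φ x is an injective endomorphism of a finite-dimensional
space, hence an isomorphism. The conditions on the other coordinates make Φ x the extension of this
restriction by the identity. -/
theorem IsFraming.exists_stableFraming {R : ℕ}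
    {Φ : M → Eucl n × (ℕ → ℝ) →ₗ[ℝ] Eucl n × (ℕ → ℝ)}
    (h : IsFraming M R Φ) : ∃ φ : StableFraming M, φ.toLin = Φ := by
  let L : M → EuclideanSpace ℝ (Fin n) × EuclideanSpace ℝ (Fin R) →ₗ[ℝ]
      EuclideanSpace ℝ (Fin n) × EuclideanSpace ℝ (Fin R) := fun x =>
    { toFun := fun z => ((Φ x (z.1, extendZero R z.2)).1,
        WithLp.toLp 2 fun i => (Φ x (z.1, extendZero R z.2)).2 i)
      map_add' := fun z z' => by
        have h1 : (z.1 + z'.1, extendZero R (z.2 + z'.2))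
          = (z.1, extendZero R z.2) + (z'.1, extendZero R z'.2) := by rw [map_add]; rfl
        have h2 := (congrArg (Φ x) h1).trans (map_add _ _ _)
        refine Prod.ext (congrArg Prod.fst h2 :) ?_
        ext i
        exact congrFun (congrArg Prod.snd h2) i
      map_smul' := fun c z => by
        have h1 : (c • z.1, extendZero R (c • z.2)) = c • (z.1, extendZero R z.2) := by
          rw [map_smul]; rfl
        have h2 := (congrArg (Φ x) h1).trans (map_smul _ _ _)
        refine Prod.ext (congrArg Prod.fst h2 :) ?_
        ext i
        exact congrFun (congrArg Prod.snd h2) i }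
  have hL : ∀ x, Function.Injective (L x) := by
    intro x
    rw [injective_iff_map_eq_zero]
    rintro ⟨v, a⟩ hz
    have h1 : Φ x (v, extendZero R a) = 0 := by
      refine Prod.ext (congrArg Prod.fst hz :) (funext fun i => ?_)
      by_cases hi : i < R
      · exact congrFun (congrArg WithLp.ofLp (congrArg Prod.snd hz)) ⟨i, hi⟩
      · rw [(h.stable x).snd_apply _ i (not_lt.1 hi)]
        exact extendZero_of_le a (not_lt.1 hi)
    rw [map_eq_zero_iff _ (h.stable x).injective] at h1
    refine Prod.ext (congrArg Prod.fst h1 :) ?_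
    ext i
    have := congrFun (congrArg Prod.snd h1) i
    exact (extendZero_of_lt a i.2).symm.trans this
  refine ⟨{
    rank := R
    iso := fun x => (LinearEquiv.ofInjectiveEndo (L x) (hL x)).toContinuousLinearEquiv
    continuous_iso := ?_ }, ?_⟩
  · change Continuous fun z : TangentBundle (Q n) M × EuclideanSpace ℝ (Fin R) =>
      L z.1.proj (z.1.snd, z.2)
    have h1 : Continuous fun z : TangentBundle (Q n) M × EuclideanSpace ℝ (Fin R) =>
        Φ z.1.proj (z.1.snd, extendZero R z.2) := by
      refine h.continuous.comp (continuous_fst.prodMk ?_)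
      exact (extendZero R).continuous_of_finiteDimensional.comp continuous_snd
    refine Continuous.prodMk (continuous_fst.comp h1) ?_
    refine (PiLp.continuous_toLp 2 _).comp (continuous_pi fun i => ?_)
    exact (continuous_apply _).comp (continuous_snd.comp h1)
  · funext x
    refine LinearMap.ext ?_
    rintro ⟨v, s⟩
    have h1 : Φ x (v, s) = Φ x (v, extendZero R (WithLp.toLp 2 fun i : Fin R => s i)) +
        (0, s - extendZero R (WithLp.toLp 2 fun i : Fin R => s i)) := by
      rw [← (h.stable x).apply_tail (s - extendZero R (WithLp.toLp 2 fun i : Fin R => s i)), ← map_add]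
      · simp
      · intro i hi
        simp [extendZero_of_lt _ hi]
    refine Prod.ext ?_ (funext fun i => ?_)
    · change (Φ x (v, extendZero R (WithLp.toLp 2 fun i : Fin R => s i))).1 = _
      rw [h1]; simp
    · change (if hi : i < R then (Φ x (v, extendZero R (WithLp.toLp 2 fun i : Fin R => s i))).2 i
        else s i) = _
      split_ifs with hi
      · rw [h1]; simp [extendZero_of_lt _ hi]
      · exact ((h.stable x).snd_apply (v, s) i (not_lt.1 hi)).symm

end Framing

/-! ### Stable linear maps -/

section Stable

variable {V V' V'' : Type*} [AddCommGroup V] [Module ℝ V] [AddCommGroup V'] [Module ℝ V']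
  [AddCommGroup V''] [Module ℝ V''] {R : ℕ}

theorem IsStable.comp {L' : V' × (ℕ → ℝ) →ₗ[ℝ] V'' × (ℕ → ℝ)} {L : V × (ℕ → ℝ) →ₗ[ℝ] V' × (ℕ → ℝ)}
    (h' : IsStable R L') (h : IsStable R L) : IsStable R (L' ∘ₗ L) :=
  ⟨h'.injective.comp h.injective, fun s hs => by
    rw [LinearMap.comp_apply, h.apply_tail s hs, h'.apply_tail s hs], fun z i hi => by
    rw [LinearMap.comp_apply, h'.snd_apply _ i hi, h.snd_apply _ i hi]⟩

theorem isStable_prodMap {A : V →ₗ[ℝ] V'} (hA : Function.Injective A) :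
    IsStable R (A.prodMap (LinearMap.id : (ℕ → ℝ) →ₗ[ℝ] (ℕ → ℝ))) :=
  ⟨hA.prodMap Function.injective_id, fun s _ => by simp, fun z i _ => by simp⟩

/-- A family of stable maps descends along a surjection of the base and isomorphisms of the
fibres. -/
theorem exists_descent {U M : Type*} {y : U → M} (hy : Function.Surjective y)
    {A : U → V →ₗ[ℝ] V'} (hA : ∀ u, Function.Bijective (A u))
    {Ψ : U → V × (ℕ → ℝ) →ₗ[ℝ] V'' × (ℕ → ℝ)} (hΨ : ∀ u, IsStable R (Ψ u))
    (hc : ∀ u u' v v' s, y u = y u' → A u v = A u' v' → Ψ u (v, s) = Ψ u' (v', s)) :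
    ∃ Φ : M → V' × (ℕ → ℝ) →ₗ[ℝ] V'' × (ℕ → ℝ), (∀ x, IsStable R (Φ x)) ∧
      ∀ u v s, Φ (y u) (A u v, s) = Ψ u (v, s) := by
  let B : U → V ≃ₗ[ℝ] V' := fun u => LinearEquiv.ofBijective (A u) (hA u)
  let σ : M → U := Function.surjInv hy
  refine ⟨fun x => Ψ (σ x) ∘ₗ ((B (σ x)).symm : V' →ₗ[ℝ] V).prodMap LinearMap.id,
    fun x => (hΨ _).comp (isStable_prodMap (B (σ x)).symm.injective), fun u v s => ?_⟩
  refine hc _ _ _ _ _ (Function.surjInv_eq hy _) ?_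
  exact (B (σ (y u))).apply_symm_apply (A u v)

end Stable

/-! ### Derivatives of maps and collars -/

section Derivatives

variable {n m : ℕ}

/-- The derivative, as a linear map between Euclidean spaces. -/
def tderiv {M : CompactManifold n} {M' : CompactManifold m} (f : M → M') (x : M) :
    Eucl n →ₗ[ℝ] Eucl m where
  toFun v := mfderiv (Q n) (Q m) f x v
  map_add' := (mfderiv (Q n) (Q m) f x).map_add
  map_smul' := (mfderiv (Q n) (Q m) f x).map_smul

theorem tderiv_bijective {M M' : CompactManifold n} {f : M → M'} {x : M}
    (hf : IsLocalDiffeomorphAt (Q n) (Q n) ∞ f x) : Function.Bijective (tderiv f x) :=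
  hf.mfderiv_bijective

theorem IsFraming.comp_continuous {M : CompactManifold n} {R : ℕ}
    {Φ : M → Eucl n × (ℕ → ℝ) →ₗ[ℝ] Eucl n × (ℕ → ℝ)} (h : IsFraming M R Φ) {Z : Type*}
    [TopologicalSpace Z] {x : Z → M} {v : Z → Eucl n} {s : Z → ℕ → ℝ}
    (hx : Continuous fun z => (⟨x z, v z⟩ : TangentBundle (Q n) M)) (hs : Continuous s) :
    Continuous fun z => Φ (x z) (v z, s z) :=
  h.continuous.comp (hx.prodMk hs)

namespace Collar

variable {F : CompactManifold n} {W : CompactManifold (n + 1)} (c : Collar F W)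

/-- The isomorphism `TF ⊕ ℝ → TW` at a point of the collar. -/
def derivAt (x : F) (r : Ray) : Eucl n × ℝ →ₗ[ℝ] Eucl (n + 1) :=
  ({ toFun := fun v => mfderiv ((Q n).prod (Q 1)) (Q (n + 1)) c.toFun (x, r) v
     map_add' := (mfderiv ((Q n).prod (Q 1)) (Q (n + 1)) c.toFun (x, r)).map_add
     map_smul' := (mfderiv ((Q n).prod (Q 1)) (Q (n + 1)) c.toFun (x, r)).map_smul } :
    Eucl n × Eucl 1 →ₗ[ℝ] Eucl (n + 1)) ∘ₗ
    LinearMap.prodMap LinearMap.id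
      (LinearMap.toSpanSingleton ℝ (Eucl 1) (EuclideanSpace.single (0 : Fin 1) (1 : ℝ)))

theorem derivAt_apply (x : F) (r : Ray) (v : Eucl n) (t : ℝ) :
    c.derivAt x r (v, t) = mfderiv ((Q n).prod (Q 1)) (Q (n + 1)) c.toFun (x, r)
      ((v, EuclideanSpace.single 0 t) : Eucl n × Eucl 1) := by
  have : (t • EuclideanSpace.single (0 : Fin 1) (1 : ℝ)) =
      EuclideanSpace.single (0 : Fin 1) t := by
    ext i; simp
  exact congrArg (fun w : Eucl 1 => mfderiv ((Q n).prod (Q 1)) (Q (n + 1)) c.toFun (x, r)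
    ((v, w) : Eucl n × Eucl 1)) this

theorem derivAt_zero (x : F) (v : Eucl n) (t : ℝ) : c.derivAt x 0 (v, t) = c.deriv x v t :=
  c.derivAt_apply x 0 v t

theorem derivAt_bijective (x : F) (r : Ray) : Function.Bijective (c.derivAt x r) := by
  refine (c.isLocalDiffeomorph (x, r)).mfderiv_bijective.comp ?_
  have h : Function.Bijective (LinearMap.toSpanSingleton ℝ (Eucl 1)
      (EuclideanSpace.single (0 : Fin 1) (1 : ℝ))) := by
    refine ⟨fun a b h => ?_, fun w => ⟨w 0, ?_⟩⟩
    · simpa using congrFun (congrArg WithLp.ofLp h) 0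
    · rw [euclideanSpace_one_eq w]
      ext i; simp
  exact Function.bijective_id.prodMap h

theorem contMDiff : ContMDiff ((Q n).prod (Q 1)) (Q (n + 1)) ∞ c.toFun :=
  c.isLocalDiffeomorph.contMDiff

theorem continuous_derivAt {Z : Type*} [TopologicalSpace Z] {x : Z → TangentBundle (Q n) F}
    {r : Z → Ray} {t : Z → ℝ} (hx : Continuous x) (hr : Continuous r) (ht : Continuous t) :
    Continuous fun z => (⟨c.toFun ((x z).proj, r z), c.derivAt (x z).proj (r z) ((x z).snd, t z)⟩ :
      TangentBundle (Q (n + 1)) W) := by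
  have h1 : Continuous fun z => (⟨r z, t z • EuclideanSpace.single (0 : Fin 1) (1 : ℝ)⟩ :
      TangentBundle (Q 1) Ray) := continuous_tangentBundle_model_mk hr (by fun_prop)
  exact (c.contMDiff.continuous_tangentMap (by simp)).comp (continuous_tangentBundle_prod_mk hx h1)

end Collar

end Derivatives

/-! ### Gluing framings -/

/-- The hypothesis `hcc` says that the framings along the two faces agree once the normal coordinate
is reversed, which is what opposite inward normals require. The linear maps then descend because the
derivative of q is bijective. -/
theorem Gluing.exists_framing {n : ℕ} {F : CompactManifold n} {W : CompactManifold (n + 1)}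
    {c c' : Collar F W} (G : Gluing c c') {R : ℕ}
    {Φ : W → Eucl (n + 1) × (ℕ → ℝ) →ₗ[ℝ] Eucl (n + 1) × (ℕ → ℝ)} (hΦ : IsFraming W R Φ)
    (hcc : ∀ x v t s, Φ (c.face x) (c.derivAt x 0 (v, t), s) =
      Φ (c'.face x) (c'.derivAt x 0 (v, -t), s)) :
    ∃ Φ' : G.Y → Eucl (n + 1) × (ℕ → ℝ) →ₗ[ℝ] Eucl (n + 1) × (ℕ → ℝ), IsFraming G.Y R Φ' ∧
      ∀ u v s, Φ' (G.q u) (tderiv G.q u v, s) = Φ u (v, s) := by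
  have e1 : ∀ x r v t, tderiv G.q (c.toFun (x, r)) (c.derivAt x r (v, t)) =
      mfderiv ((Q n).prod 𝓘(ℝ, ℝ)) (Q (n + 1)) G.e (x, Ray.coord r) ((v, t) : Eucl n × ℝ) := by
    intro x r v t
    rw [c.derivAt_apply]
    refine (G.mfderiv_q_c x r v (EuclideanSpace.single 0 t)).trans ?_
    exact congrArg (fun b : ℝ => mfderiv ((Q n).prod 𝓘(ℝ, ℝ)) (Q (n + 1)) G.e
      (x, Ray.coord r) ((v, b) : Eucl n × ℝ)) (by simp)
  have e2 : ∀ x r v t, tderiv G.q (c'.toFun (x, r)) (c'.derivAt x r (v, -t)) =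
      mfderiv ((Q n).prod 𝓘(ℝ, ℝ)) (Q (n + 1)) G.e (x, -Ray.coord r) ((v, t) : Eucl n × ℝ) := by
    intro x r v t
    rw [c'.derivAt_apply]
    refine (G.mfderiv_q_c' x r v (EuclideanSpace.single 0 (-t))).trans ?_
    exact congrArg (fun b : ℝ => mfderiv ((Q n).prod 𝓘(ℝ, ℝ)) (Q (n + 1)) G.e
      (x, -Ray.coord r) ((v, b) : Eucl n × ℝ)) (by simp)
  have key : ∀ x v v' s, tderiv G.q (c.face x) v = tderiv G.q (c'.face x) v' →
      Φ (c.face x) (v, s) = Φ (c'.face x) (v', s) := by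
    intro x v v' s h
    obtain ⟨⟨a, t⟩, rfl⟩ := (c.derivAt_bijective x 0).2 v
    obtain ⟨⟨a', t'⟩, rfl⟩ := (c'.derivAt_bijective x 0).2 v'
    have h1 := e1 x 0 a t
    have h2 := e2 x 0 a' (-t')
    rw [neg_neg] at h2
    have h0 : -Ray.coord 0 = Ray.coord 0 := by simp
    rw [h0] at h2
    have h3 := (G.isLocalDiffeomorph_e (x, Ray.coord 0)).mfderiv_bijective.1
      (h1.symm.trans (h.trans h2))
    obtain ⟨rfl, rfl⟩ : a = a' ∧ t = -t' := Prod.ext_iff.1 h3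
    simpa using hcc x a (-t') s
  obtain ⟨Φ', h1, h2⟩ := exists_descent (y := G.q) G.surjective (A := fun u => tderiv G.q u)
    (fun u => G.mfderiv_q_bijective u) (fun u => hΦ.stable u) (by
      intro u u' v v' s hu hv
      rcases G.eq_of_q_eq u u' hu with rfl | ⟨x, rfl, rfl⟩ | ⟨x, rfl, rfl⟩
      · rw [(G.mfderiv_q_bijective u).1 hv]
      · exact key x v v' s hv
      · exact (key x v' v s hv.symm).symm)
  refine ⟨Φ', ⟨h1, continuous_iff_continuousAt.2 ?_⟩, h2⟩
  -- Since q is not a local diffeomorphism at the seam, continuity is tested through e, where the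
  -- framing is given by two formulas that agree at 0.
  have seam : ∀ x w s, ContinuousAt (fun z : TangentBundle (Q (n + 1)) G.Y × (ℕ → ℝ) =>
      Φ' z.1.proj (z.1.snd, z.2)) (⟨G.q (c.face x), w⟩, s) := by
    intro x w s
    have hx : G.e (x, 0) = G.q (c.face x) := by
      rw [← Ray.coord_zero, G.e_coord]; rfl
    rw [← hx]
    obtain ⟨v, rfl⟩ := (G.isLocalDiffeomorph_e (x, 0)).mfderiv_bijective.2 w
    refine continuousAt_tangentBundle_of_comp (G.isLocalDiffeomorph_e (x, 0))
      (fun y z => Φ' y z) v s (Continuous.continuousAt ?_)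
    have hform : (fun z : TangentBundle ((Q n).prod 𝓘(ℝ, ℝ)) (F × ℝ) × (ℕ → ℝ) =>
        Φ' (G.e z.1.proj) (mfderiv ((Q n).prod 𝓘(ℝ, ℝ)) (Q (n + 1)) G.e z.1.proj z.1.snd, z.2)) =
        fun z => if 0 ≤ z.1.proj.2 then
          Φ (c.toFun (z.1.proj.1, Ray.mk z.1.proj.2))
            (c.derivAt z.1.proj.1 (Ray.mk z.1.proj.2) z.1.snd, z.2)
        else Φ (c'.toFun (z.1.proj.1, Ray.mk (-z.1.proj.2)))
            (c'.derivAt z.1.proj.1 (Ray.mk (-z.1.proj.2)) (z.1.snd.1, -z.1.snd.2), z.2) := by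
      funext ⟨⟨⟨a, b⟩, ⟨v, t⟩⟩, s⟩
      dsimp only
      split_ifs with hb
      · refine Eq.trans ?_ (h2 _ _ _)
        have h3 := e1 a (Ray.mk b) v t
        rw [Ray.coord_mk_of_nonneg hb] at h3
        have h4 := G.e_coord a (Ray.mk b)
        rw [Ray.coord_mk_of_nonneg hb] at h4
        exact congr_arg₂ (fun y z => Φ' y (z, s)) h4 h3.symm
      · refine Eq.trans ?_ (h2 _ _ _)
        have hb' : 0 ≤ -b := by linarith
        have h3 := e2 a (Ray.mk (-b)) v t
        rw [Ray.coord_mk_of_nonneg hb', neg_neg] at h3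
        have h4 := G.e_neg_coord a (Ray.mk (-b))
        rw [Ray.coord_mk_of_nonneg hb', neg_neg] at h4
        exact congr_arg₂ (fun y z => Φ' y (z, s)) h4 h3.symm
    rw [hform]
    have p1 : Continuous fun z : TangentBundle ((Q n).prod 𝓘(ℝ, ℝ)) (F × ℝ) × (ℕ → ℝ) =>
        (⟨z.1.proj.1, z.1.snd.1⟩ : TangentBundle (Q n) F) :=
      continuous_tangentBundle_prod_fst.comp continuous_fst
    have p2 : Continuous fun z : TangentBundle ((Q n).prod 𝓘(ℝ, ℝ)) (F × ℝ) × (ℕ → ℝ) =>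
        (z.1.snd.2 : ℝ) :=
      continuous_tangentBundle_model_snd.comp (continuous_tangentBundle_prod_snd.comp continuous_fst)
    have p3 : Continuous fun z : TangentBundle ((Q n).prod 𝓘(ℝ, ℝ)) (F × ℝ) × (ℕ → ℝ) =>
        z.1.proj.2 :=
      continuous_snd.comp (continuous_tangentBundle_proj.comp continuous_fst)
    refine Continuous.if_le ?_ ?_ continuous_const p3 ?_
    · exact hΦ.comp_continuous (c.continuous_derivAt p1 (Ray.continuous_mk.comp p3) p2)
        continuous_snd
    · exact hΦ.comp_continuous (c'.continuous_derivAt p1 (Ray.continuous_mk.comp p3.neg) p2.neg)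
        continuous_snd
    · rintro ⟨⟨⟨a, b⟩, ⟨v, t⟩⟩, s⟩ hb
      obtain rfl : 0 = b := hb
      have h0 : Ray.mk (0 : ℝ) = 0 := by rw [← Ray.coord_zero, Ray.mk_coord]
      have h0' : Ray.mk (-0 : ℝ) = 0 := by rw [neg_zero, h0]
      dsimp only
      rw [h0, h0']
      exact hcc a v t s
  rintro ⟨⟨y, w⟩, s⟩
  obtain ⟨u, rfl⟩ := G.surjective y
  by_cases hu : u ∈ Set.range c.face
  · obtain ⟨x, rfl⟩ := hu
    exact seam x w s
  by_cases hu' : u ∈ Set.range c'.face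
  · obtain ⟨x, rfl⟩ := hu'
    have := seam x
    rw [G.q_face] at this
    exact this w s
  obtain ⟨v, rfl⟩ := (G.mfderiv_q_bijective u).2 w
  refine continuousAt_tangentBundle_of_comp (G.isLocalDiffeomorphAt_q u hu hu')
      (fun y z => Φ' y z) v s (Continuous.continuousAt ?_)
  refine hΦ.continuous.congr fun z => ?_
  exact (h2 _ _ _).symm

/-! ### Rotations -/

section Rotation

variable {Y : Type*} [AddCommGroup Y] [Module ℝ Y]

/-- The rotation by the angle `θ` generated by `J`, for `J³ = -J`. -/
def rotation (J : Y →ₗ[ℝ] Y) (θ : ℝ) : Y →ₗ[ℝ] Y :=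
  LinearMap.id + Real.sin θ • J + (1 - Real.cos θ) • (J ∘ₗ J)

theorem rotation_apply (J : Y →ₗ[ℝ] Y) (θ : ℝ) (y : Y) :
    rotation J θ y = y + Real.sin θ • J y + (1 - Real.cos θ) • J (J y) := rfl

@[simp] theorem rotation_zero (J : Y →ₗ[ℝ] Y) : rotation J 0 = LinearMap.id := by
  simp [rotation]

theorem rotation_half_pi (J : Y →ₗ[ℝ] Y) (y : Y) :
    rotation J (Real.pi / 2) y = y + J y + J (J y) := by
  simp [rotation_apply]

/-- From J³ = -J it follows that -J² is a projection, on the image of which J is a complex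
structure; the rest is sin² + cos² = 1. -/
theorem rotation_neg_rotation {J : Y →ₗ[ℝ] Y} (hJ : ∀ y, J (J (J y)) = -J y) (θ : ℝ) (y : Y) :
    rotation J (-θ) (rotation J θ y) = y := by
  have h1 := Real.sin_sq_add_cos_sq θ
  have h2 : (2 * (1 - Real.cos θ) - Real.sin θ ^ 2 - (1 - Real.cos θ) ^ 2) = 0 := by
    linear_combination -h1
  have h3 := congrArg (fun a : ℝ => a • J (J y)) h2
  simp only [rotation_apply, map_add, map_smul, hJ, map_neg, Real.sin_neg, Real.cos_neg, zero_smul]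
    at h3 ⊢
  rw [← sub_eq_zero, ← h3]
  module

theorem continuous_rotation [TopologicalSpace Y] [ContinuousAdd Y] [ContinuousSMul ℝ Y]
    {J : Y →ₗ[ℝ] Y} (hJ : Continuous J) {Z : Type*} [TopologicalSpace Z] {θ : Z → ℝ} {y : Z → Y}
    (hθ : Continuous θ) (hy : Continuous y) : Continuous fun z => rotation J (θ z) (y z) := by
  simp only [rotation_apply]
  fun_prop

/-- A function on `[0,∞)` that decreases from `π / 2` to `0`. -/
def angle (r : ℝ) : ℝ := Real.pi / 2 * max 0 (1 - r)

@[simp] theorem angle_zero : angle 0 = Real.pi / 2 := by simp [angle]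

theorem angle_of_one_le {r : ℝ} (h : 1 ≤ r) : angle r = 0 := by
  simp [angle, h]

theorem continuous_angle : Continuous angle := by
  unfold angle; fun_prop

section Stabilising

variable {V : Type*} [AddCommGroup V] [Module ℝ V]

/-- The generator of the rotations in the plane spanned by `e`, where `ℓ e = 1`, and the stable
coordinate `R`. -/
def stabilisingGenerator (ℓ : V →ₗ[ℝ] ℝ) (e : V) (R : ℕ) :
    V × (ℕ → ℝ) →ₗ[ℝ] V × (ℕ → ℝ) where
  toFun z := (-(z.2 R) • e, Pi.single R (ℓ z.1))
  map_add' z z' := by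
    refine Prod.ext ?_ ?_
    · simp only [Prod.snd_add, Pi.add_apply, Prod.fst_add]; module
    · simp [Pi.single_add]
  map_smul' a z := by
    refine Prod.ext ?_ ?_
    · simp only [Prod.smul_snd, Pi.smul_apply, Prod.smul_fst, smul_eq_mul, RingHom.id_apply]; module
    · simp [← Pi.single_smul]

theorem stabilisingGenerator_apply (ℓ : V →ₗ[ℝ] ℝ) (e : V) (R : ℕ) (z : V × (ℕ → ℝ)) :
    stabilisingGenerator ℓ e R z = (-(z.2 R) • e, Pi.single R (ℓ z.1)) := rfl

theorem stabilisingGenerator_cube {ℓ : V →ₗ[ℝ] ℝ} {e : V} (he : ℓ e = 1) (R : ℕ)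
    (z : V × (ℕ → ℝ)) : stabilisingGenerator ℓ e R (stabilisingGenerator ℓ e R
      (stabilisingGenerator ℓ e R z)) = -stabilisingGenerator ℓ e R z := by
  refine Prod.ext ?_ ?_ <;> simp [stabilisingGenerator_apply, he, Pi.single_neg]

theorem isStable_rotation_stabilisingGenerator {ℓ : V →ₗ[ℝ] ℝ} {e : V} (he : ℓ e = 1) {R R' : ℕ}
    (hR : R < R') (θ : ℝ) : IsStable R' (rotation (stabilisingGenerator ℓ e R) θ) where
  injective := Function.LeftInverse.injective
    (rotation_neg_rotation (stabilisingGenerator_cube he R) θ)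
  apply_tail s hs := by
    have : stabilisingGenerator ℓ e R (0, s) = 0 := by
      simp [stabilisingGenerator_apply, hs R hR]
    simp [rotation_apply, this]
  snd_apply z i hi := by
    simp [rotation_apply, stabilisingGenerator_apply, (hR.trans_le hi).ne']

/-- The quarter turn stores ℓ v in the stable coordinate R and puts minus the old coordinate R in
the direction e. This sign makes the face outgoing in `Collar.exists_outgoing`. -/
theorem rotation_stabilisingGenerator_half_pi (ℓ : V →ₗ[ℝ] ℝ) {e : V} (he : ℓ e = 1) (R : ℕ)
    (v : V) (s : ℕ → ℝ) : rotation (stabilisingGenerator ℓ e R) (Real.pi / 2) (v, s) =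
      (v - (ℓ v + s R) • e, Function.update s R (ℓ v)) := by
  rw [rotation_half_pi]
  refine Prod.ext ?_ (funext fun i => ?_)
  · simp only [stabilisingGenerator_apply, Prod.fst_add, Pi.single_eq_same]
    module
  · by_cases hi : i = R
    · subst hi; simp [stabilisingGenerator_apply, he]
    · simp [stabilisingGenerator_apply, hi]

theorem continuous_stabilisingGenerator [TopologicalSpace V] [ContinuousSMul ℝ V]
    {ℓ : V →ₗ[ℝ] ℝ} (hℓ : Continuous ℓ) (e : V) (R : ℕ) :
    Continuous (stabilisingGenerator ℓ e R) := by
  refine Continuous.prodMk (by fun_prop) ?_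
  exact (continuous_single R).comp (hℓ.comp continuous_fst)

end Stabilising

/-- The generator of the simultaneous rotations in the planes of the stable coordinates `a + j` and
`b + j`, for `j < m`. -/
def blockGenerator (a b m : ℕ) : (ℕ → ℝ) →ₗ[ℝ] (ℕ → ℝ) where
  toFun s i := if a ≤ i ∧ i < a + m then -s (i - a + b)
    else if b ≤ i ∧ i < b + m then s (i - b + a) else 0
  map_add' s s' := by ext i; simp only [Pi.add_apply]; split_ifs <;> ring
  map_smul' c s := by
    ext i; simp only [Pi.smul_apply, smul_eq_mul, RingHom.id_apply]; split_ifs <;> ring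

theorem blockGenerator_apply (a b m : ℕ) (s : ℕ → ℝ) (i : ℕ) :
    blockGenerator a b m s i = if a ≤ i ∧ i < a + m then -s (i - a + b)
      else if b ≤ i ∧ i < b + m then s (i - b + a) else 0 := rfl

/-- As the blocks are disjoint, the generator is a complex structure on their span, and it vanishes
on the other coordinates. -/
theorem blockGenerator_sq {a b m : ℕ} (h : a + m ≤ b) (s : ℕ → ℝ) (i : ℕ) :
    blockGenerator a b m (blockGenerator a b m s) i =
      if a ≤ i ∧ i < a + m ∨ b ≤ i ∧ i < b + m then -s i else 0 := by
  rw [blockGenerator_apply]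
  split_ifs with h1 h2 h3 h4 h5
  · rw [blockGenerator_apply, if_neg (by omega), if_pos (by omega)]
    congr 2; omega
  · exact absurd (Or.inl h1) h2
  · rw [blockGenerator_apply, if_pos (by omega)]
    congr 2; omega
  · exact absurd (Or.inr h3) h4
  · omega
  · rfl

theorem blockGenerator_cube {a b m : ℕ} (h : a + m ≤ b) (s : ℕ → ℝ) :
    blockGenerator a b m (blockGenerator a b m (blockGenerator a b m s)) =
      -blockGenerator a b m s := by
  ext i
  rw [blockGenerator_sq h, Pi.neg_apply]
  split_ifs with h1
  · rfl
  · rw [blockGenerator_apply, if_neg (by tauto), if_neg (by tauto), neg_zero]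

theorem continuous_blockGenerator (a b m : ℕ) : Continuous (blockGenerator a b m) := by
  refine continuous_pi fun i => ?_
  simp only [blockGenerator_apply]
  split_ifs <;> fun_prop

theorem isStable_rotation_blockGenerator {V : Type*} [AddCommGroup V] [Module ℝ V] {a b m R : ℕ}
    (h : a + m ≤ b) (hR : b + m ≤ R) (θ : ℝ) : IsStable R
      (LinearMap.prodMap (LinearMap.id : V →ₗ[ℝ] V) (rotation (blockGenerator a b m) θ)) := by
  have h1 : ∀ (s : ℕ → ℝ) (i : ℕ), R ≤ i → rotation (blockGenerator a b m) θ s i = s i := by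
    intro s i hi
    simp only [rotation_apply, Pi.add_apply, Pi.smul_apply, blockGenerator_sq h]
    rw [blockGenerator_apply, if_neg (by omega), if_neg (by omega), if_neg (by omega)]
    simp
  have h2 : ∀ (s : ℕ → ℝ), (∀ i < R, s i = 0) → rotation (blockGenerator a b m) θ s = s := by
    intro s hs
    have : blockGenerator a b m s = 0 := by
      ext i
      rw [blockGenerator_apply]
      split_ifs
      · rw [hs _ (by omega)]; simp
      · rw [hs _ (by omega)]; rfl
      · rfl
    simp [rotation_apply, this]
  refine ⟨Function.injective_id.prodMap (Function.LeftInverse.injective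
    (rotation_neg_rotation (blockGenerator_cube h) θ)), fun s hs => ?_, fun z i hi => h1 _ i hi⟩
  exact Prod.ext rfl (h2 s hs)

end Rotation

/-! ### Suspensions of stable maps -/

/-- `ℝⁿ ⊕ ℝ = ℝ^{n+1}`, as a linear isomorphism. -/
def snocL (n : ℕ) : (Eucl n × ℝ) ≃ₗ[ℝ] Eucl (n + 1) where
  toFun p := snoc p.1 p.2
  invFun x := (WithLp.toLp 2 fun i => x i.castSucc, x (Fin.last n))
  map_add' p p' := by
    ext i
    refine Fin.lastCases ?_ (fun i => ?_) i <;> simp [snoc]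
  map_smul' a p := by
    ext i
    refine Fin.lastCases ?_ (fun i => ?_) i <;> simp [snoc]
  left_inv p := by
    refine Prod.ext ?_ ?_
    · ext i; simp [snoc]
    · simp [snoc]
  right_inv x := by
    ext i
    refine Fin.lastCases ?_ (fun i => ?_) i <;> simp [snoc]

theorem snocL_apply {n : ℕ} (a : Eucl n) (t : ℝ) : snocL n (a, t) = snoc a t := rfl

theorem snoc_injective {n : ℕ} {a a' : Eucl n} {t t' : ℝ} (h : snoc a t = snoc a' t') :
    a = a' ∧ t = t' :=
  Prod.ext_iff.1 ((snocL n).injective (a₁ := (a, t)) (a₂ := (a', t')) h)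

theorem continuous_snoc {n : ℕ} {Z : Type*} [TopologicalSpace Z] {a : Z → Eucl n} {t : Z → ℝ}
    (ha : Continuous a) (ht : Continuous t) : Continuous fun z => snoc (a z) (t z) :=
  (snocL n).toContinuousLinearEquiv.continuous.comp (ha.prodMk ht)

section Suspension

variable {V V₁ : Type*} [AddCommGroup V] [Module ℝ V] [AddCommGroup V₁] [Module ℝ V₁] {n : ℕ}

/-- The direct sum of `L : V ⊕ ℝ^ℕ → ℝⁿ ⊕ ℝ^ℕ` and `ℓ : V₁ → ℝ`. -/
def suspend (L : V × (ℕ → ℝ) →ₗ[ℝ] Eucl n × (ℕ → ℝ)) (ℓ : V₁ →ₗ[ℝ] ℝ) :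
    (V × V₁) × (ℕ → ℝ) →ₗ[ℝ] Eucl (n + 1) × (ℕ → ℝ) where
  toFun z := (snoc (L (z.1.1, z.2)).1 (ℓ z.1.2), (L (z.1.1, z.2)).2)
  map_add' z z' := by
    have h : L ((z + z').1.1, (z + z').2) = L (z.1.1, z.2) + L (z'.1.1, z'.2) := by
      rw [← map_add]; rfl
    refine Prod.ext ?_ ?_
    · have h1 := (snocL n).map_add ((L (z.1.1, z.2)).1, ℓ z.1.2) ((L (z'.1.1, z'.2)).1, ℓ z'.1.2)
      refine Eq.trans ?_ h1
      rw [h]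
      simp [snocL_apply]
    · rw [h]; rfl
  map_smul' a z := by
    have h : L ((a • z).1.1, (a • z).2) = a • L (z.1.1, z.2) := by
      rw [← map_smul]; rfl
    refine Prod.ext ?_ ?_
    · have h1 := (snocL n).map_smul a ((L (z.1.1, z.2)).1, ℓ z.1.2)
      refine Eq.trans ?_ h1
      rw [h]
      simp [snocL_apply]
    · rw [h]; rfl

theorem suspend_apply (L : V × (ℕ → ℝ) →ₗ[ℝ] Eucl n × (ℕ → ℝ)) (ℓ : V₁ →ₗ[ℝ] ℝ) (v : V) (w : V₁)
    (s : ℕ → ℝ) : suspend L ℓ ((v, w), s) = (snoc (L (v, s)).1 (ℓ w), (L (v, s)).2) := rfl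

theorem IsStable.suspend {L : V × (ℕ → ℝ) →ₗ[ℝ] Eucl n × (ℕ → ℝ)} {R : ℕ} (hL : IsStable R L)
    {ℓ : V₁ →ₗ[ℝ] ℝ} (hℓ : Function.Injective ℓ) : IsStable R (suspend L ℓ) where
  injective := by
    rintro ⟨⟨v, w⟩, s⟩ ⟨⟨v', w'⟩, s'⟩ h
    rw [suspend_apply, suspend_apply, Prod.mk.injEq] at h
    obtain ⟨h1, h2⟩ := snoc_injective h.1
    have h3 := hL.injective (Prod.ext h1 h.2)
    rw [Prod.mk.injEq] at h3
    rw [h3.1, h3.2, hℓ h2]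
  apply_tail s hs := by
    have h := hL.apply_tail s hs
    refine Prod.ext ?_ ?_
    · change snoc (L (0, s)).1 (ℓ 0) = 0
      rw [h, map_zero]
      exact (snocL n).map_zero
    · change (L (0, s)).2 = s
      rw [h]
  snd_apply z i hi := hL.snd_apply _ i hi

end Suspension

/-! ### Constructions of framings -/

section Constructions

variable {n m : ℕ} {R : ℕ}

/-- The two inclusions are jointly bijective with bijective derivatives, so the framings descend;
continuity is local and each inclusion is a local diffeomorphism. -/
theorem DisjointUnion.exists_framing {A B C : CompactManifold n} (u : DisjointUnion A B C)
    {ΦA : A → Eucl n × (ℕ → ℝ) →ₗ[ℝ] Eucl n × (ℕ → ℝ)} (hA : IsFraming A R ΦA)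
    {ΦB : B → Eucl n × (ℕ → ℝ) →ₗ[ℝ] Eucl n × (ℕ → ℝ)} (hB : IsFraming B R ΦB) :
    ∃ Φ : C → Eucl n × (ℕ → ℝ) →ₗ[ℝ] Eucl n × (ℕ → ℝ), IsFraming C R Φ ∧
      (∀ x v s, Φ (u.a x) (tderiv u.a x v, s) = ΦA x (v, s)) ∧
      ∀ x v s, Φ (u.b x) (tderiv u.b x v, s) = ΦB x (v, s) := by
  let D : A ⊕ B → Eucl n →ₗ[ℝ] Eucl n := Sum.elim (fun x => tderiv u.a x) fun x => tderiv u.b x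
  have hb : ∀ z, Function.Bijective (D z) := by
    rintro (x | x)
    · exact tderiv_bijective (u.isLocalDiffeomorph_a x)
    · exact tderiv_bijective (u.isLocalDiffeomorph_b x)
  obtain ⟨Φ, h1, h2⟩ := exists_descent u.bijective.2 (A := D) hb (Ψ := Sum.elim ΦA ΦB)
    (by rintro (x | x); exacts [hA.stable x, hB.stable x]) (by
      intro z z' v v' s h hv
      obtain rfl := u.bijective.1 h
      exact congrArg (fun v => Sum.elim ΦA ΦB z (v, s)) ((hb z).1 hv))
  refine ⟨Φ, ⟨h1, continuous_iff_continuousAt.2 ?_⟩, fun x => h2 (Sum.inl x),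
    fun x => h2 (Sum.inr x)⟩
  rintro ⟨⟨y, w⟩, s⟩
  obtain ⟨x | x, rfl⟩ := u.bijective.2 y
  · obtain ⟨v, rfl⟩ := (hb (Sum.inl x)).2 w
    refine continuousAt_tangentBundle_of_comp (u.isLocalDiffeomorph_a x)
      (fun y z => Φ y z) v s (Continuous.continuousAt ?_)
    exact hA.continuous.congr fun z => (h2 (Sum.inl z.1.proj) z.1.snd z.2).symm
  · obtain ⟨v, rfl⟩ := (hb (Sum.inr x)).2 w
    refine continuousAt_tangentBundle_of_comp (u.isLocalDiffeomorph_b x)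
      (fun y z => Φ y z) v s (Continuous.continuousAt ?_)
    exact hB.continuous.congr fun z => (h2 (Sum.inr z.1.proj) z.1.snd z.2).symm

/-- The modification of a framing in the collar of a face by paths of stable automorphisms of the
normal direction and of the target. -/
theorem Collar.exists_modification {F : CompactManifold n} {W : CompactManifold (n + 1)}
    (c : Collar F W) {Φ : W → Eucl (n + 1) × (ℕ → ℝ) →ₗ[ℝ] Eucl (n + 1) × (ℕ → ℝ)}
    (hΦ : IsFraming W R Φ) {g : ℝ → ℝ × (ℕ → ℝ) →ₗ[ℝ] ℝ × (ℕ → ℝ)}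
    {g' : ℝ → Eucl (n + 1) × (ℕ → ℝ) →ₗ[ℝ] Eucl (n + 1) × (ℕ → ℝ)}
    (hg : ∀ r, IsStable R (g r)) (hg' : ∀ r, IsStable R (g' r))
    (cg : Continuous fun z : ℝ × ℝ × (ℕ → ℝ) => g z.1 z.2)
    (cg' : Continuous fun z : ℝ × Eucl (n + 1) × (ℕ → ℝ) => g' z.1 z.2)
    (g1 : ∀ r, 1 ≤ r → g r = LinearMap.id) (g1' : ∀ r, 1 ≤ r → g' r = LinearMap.id) :
    ∃ Φ' : W → Eucl (n + 1) × (ℕ → ℝ) →ₗ[ℝ] Eucl (n + 1) × (ℕ → ℝ), IsFraming W R Φ' ∧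
      (∀ u, u ∉ Set.range c.toFun → Φ' u = Φ u) ∧
      ∀ x r v t s, Φ' (c.toFun (x, r)) (c.derivAt x r (v, t), s) =
        g' (Ray.coord r) (Φ (c.toFun (x, r))
          (c.derivAt x r (v, (g (Ray.coord r) (t, s)).1), (g (Ray.coord r) (t, s)).2)) := by
  classical
  let B : F × Ray → (Eucl n × ℝ) ≃ₗ[ℝ] Eucl (n + 1) := fun z =>
    LinearEquiv.ofBijective (c.derivAt z.1 z.2) (c.derivAt_bijective z.1 z.2)
  let σ : ℝ → (Eucl n × ℝ) × (ℕ → ℝ) →ₗ[ℝ] (Eucl n × ℝ) × (ℕ → ℝ) := fun r =>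
    (LinearEquiv.prodAssoc ℝ (Eucl n) ℝ (ℕ → ℝ)).symm.toLinearMap ∘ₗ
      (LinearMap.prodMap LinearMap.id (g r)) ∘ₗ
      (LinearEquiv.prodAssoc ℝ (Eucl n) ℝ (ℕ → ℝ)).toLinearMap
  have σ_apply : ∀ r v t s, σ r ((v, t), s) = ((v, (g r (t, s)).1), (g r (t, s)).2) :=
    fun _ _ _ _ => rfl
  have hσ : ∀ r, IsStable R (σ r) := by
    intro r
    refine ⟨?_, fun s hs => ?_, fun z i hi => (hg r).snd_apply _ i hi⟩
    · exact (LinearEquiv.prodAssoc ℝ (Eucl n) ℝ (ℕ → ℝ)).symm.injective.comp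
        ((Function.injective_id.prodMap (hg r).injective).comp
        (LinearEquiv.prodAssoc ℝ (Eucl n) ℝ (ℕ → ℝ)).injective)
    · change ((0, (g r (0, s)).1), (g r (0, s)).2) = _
      rw [(hg r).apply_tail s hs]; rfl
  -- In the splitting TF ⊕ ℝσ ⊕ ℝ^ℕ given by the collar, g mixes only σ with the stable coordinates
  -- and leaves TF alone.
  let Ψ : F × Ray → Eucl (n + 1) × (ℕ → ℝ) →ₗ[ℝ] Eucl (n + 1) × (ℕ → ℝ) := fun z =>
    g' (Ray.coord z.2) ∘ₗ Φ (c.toFun z) ∘ₗ (c.derivAt z.1 z.2).prodMap LinearMap.id ∘ₗ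
      σ (Ray.coord z.2) ∘ₗ ((B z).symm : Eucl (n + 1) →ₗ[ℝ] Eucl n × ℝ).prodMap LinearMap.id
  have hΨ : ∀ z, IsStable R (Ψ z) := fun z => (hg' _).comp ((hΦ.stable _).comp
    ((isStable_prodMap (c.derivAt_bijective z.1 z.2).1).comp ((hσ _).comp
    (isStable_prodMap (B z).symm.injective))))
  have Ψ_apply : ∀ x r v t s, Ψ (x, r) (c.derivAt x r (v, t), s) =
      g' (Ray.coord r) (Φ (c.toFun (x, r))
        (c.derivAt x r (v, (g (Ray.coord r) (t, s)).1), (g (Ray.coord r) (t, s)).2)) := by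
    intro x r v t s
    have h1 : (B (x, r)).symm (c.derivAt x r (v, t)) = (v, t) :=
      (B (x, r)).symm_apply_apply (v, t)
    change g' (Ray.coord r) (Φ (c.toFun (x, r)) ((c.derivAt x r).prodMap LinearMap.id
      (σ (Ray.coord r) ((B (x, r)).symm (c.derivAt x r (v, t)), s)))) = _
    rw [h1, σ_apply]
    rfl
  let Φ' : W → Eucl (n + 1) × (ℕ → ℝ) →ₗ[ℝ] Eucl (n + 1) × (ℕ → ℝ) := fun u =>
    if h : ∃ z, c.toFun z = u then Ψ h.choose else Φ u
  have hin : ∀ z, Φ' (c.toFun z) = Ψ z := by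
    intro z
    have h : ∃ z', c.toFun z' = c.toFun z := ⟨z, rfl⟩
    have h2 : h.choose = z := c.injective h.choose_spec
    change (if h : ∃ z', c.toFun z' = c.toFun z then Ψ h.choose else Φ (c.toFun z)) = _
    rw [dif_pos h, h2]
  have hout : ∀ u, u ∉ Set.range c.toFun → Φ' u = Φ u := fun u hu => dif_neg hu
  have hfar : ∀ x r, 1 ≤ Ray.coord r → Φ' (c.toFun (x, r)) = Φ (c.toFun (x, r)) := by
    intro x r hr
    rw [hin]
    refine LinearMap.ext ?_
    rintro ⟨w, s⟩
    obtain ⟨⟨v, t⟩, rfl⟩ := (c.derivAt_bijective x r).2 w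
    rw [Ψ_apply, g1 _ hr, g1' _ hr]
    rfl
  -- As F is compact, the part r ≤ 1 of the collar is closed in W. Nothing has changed outside it,
  -- so continuity at points off the collar is that of Φ.
  have hK : _root_.IsClosed (c.toFun '' {z | Ray.coord z.2 ≤ 1}) := by
    have : IsCompact {z : F × Ray | Ray.coord z.2 ≤ 1} := by
      have h := isCompact_univ (X := F) |>.prod Gluing.isCompact_setOf_coord_le
      convert h using 1
      ext z; simp
    exact (this.image c.contMDiff.continuous).isClosed
  refine ⟨Φ', ⟨fun u => ?_, continuous_iff_continuousAt.2 ?_⟩, hout, fun x r v t s => ?_⟩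
  · by_cases hu : u ∈ Set.range c.toFun
    · obtain ⟨z, rfl⟩ := hu
      rw [hin]; exact hΨ z
    · rw [hout u hu]; exact hΦ.stable u
  · rintro ⟨⟨u, w⟩, s⟩
    by_cases hu : u ∈ Set.range c.toFun
    · obtain ⟨⟨x, r⟩, rfl⟩ := hu
      obtain ⟨v, rfl⟩ := (c.isLocalDiffeomorph (x, r)).mfderiv_bijective.2 w
      refine continuousAt_tangentBundle_of_comp (c.isLocalDiffeomorph (x, r))
        (fun y z => Φ' y z) v s (Continuous.continuousAt ?_)
      have p1 : Continuous fun z : TangentBundle ((Q n).prod (Q 1)) (F × Ray) × (ℕ → ℝ) =>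
          (⟨z.1.proj.1, z.1.snd.1⟩ : TangentBundle (Q n) F) :=
        continuous_tangentBundle_prod_fst.comp continuous_fst
      have p2 : Continuous fun z : TangentBundle ((Q n).prod (Q 1)) (F × Ray) × (ℕ → ℝ) =>
          (z.1.snd.2 : Eucl 1) 0 :=
        (PiLp.continuous_apply 2 _ 0).comp (continuous_tangentBundle_model_snd.comp
          (continuous_tangentBundle_prod_snd.comp continuous_fst))
      have p3 : Continuous fun z : TangentBundle ((Q n).prod (Q 1)) (F × Ray) × (ℕ → ℝ) =>
          z.1.proj.2 :=
        continuous_snd.comp (continuous_tangentBundle_proj.comp continuous_fst)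
      have p4 : Continuous fun z : TangentBundle ((Q n).prod (Q 1)) (F × Ray) × (ℕ → ℝ) =>
          g (Ray.coord z.1.proj.2) ((z.1.snd.2 : Eucl 1) 0, z.2) :=
        cg.comp ((Ray.continuous_coord.comp p3).prodMk (p2.prodMk continuous_snd))
      refine (cg'.comp ((Ray.continuous_coord.comp p3).prodMk (hΦ.comp_continuous
        (c.continuous_derivAt p1 p3 (continuous_fst.comp p4)) (continuous_snd.comp p4)))).congr ?_
      rintro ⟨⟨⟨x, r⟩, ⟨v, w⟩⟩, s⟩
      refine (Ψ_apply x r v ((w : Eucl 1) 0) s).symm.trans ?_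
      rw [c.derivAt_apply, ← euclideanSpace_one_eq w, ← hin]
    · have h1 : ∀ u, u ∉ c.toFun '' {z | Ray.coord z.2 ≤ 1} → Φ' u = Φ u := by
        intro u hu
        by_cases hu' : u ∈ Set.range c.toFun
        · obtain ⟨⟨x, r⟩, rfl⟩ := hu'
          exact hfar x r (not_le.1 fun h => hu ⟨(x, r), h, rfl⟩).le
        · exact hout u hu'
      refine hΦ.continuous.continuousAt.congr ?_
      have hu2 : u ∉ c.toFun '' {z | Ray.coord z.2 ≤ 1} := fun h => hu (Set.image_subset_range _ _ h)
      have h2 : ∀ᶠ z : TangentBundle (Q (n + 1)) W × (ℕ → ℝ) in nhds (⟨u, w⟩, s),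
          z.1.proj ∉ c.toFun '' {z | Ray.coord z.2 ≤ 1} :=
        (hK.isOpen_compl.preimage (continuous_tangentBundle_proj.comp continuous_fst)).mem_nhds hu2
      filter_upwards [h2] with z hz
      rw [h1 _ hz]
  · rw [hin]; exact Ψ_apply x r v t s

end Constructions

/-! ### Boundaries -/

section Boundary

variable {n : ℕ}

theorem isBoundaryPoint_prod {E H M E' H' M' : Type*}
    [NormedAddCommGroup E] [NormedSpace ℝ E] [TopologicalSpace H] {I : ModelWithCorners ℝ E H}
    [TopologicalSpace M] [ChartedSpace H M] [NormedAddCommGroup E'] [NormedSpace ℝ E']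
    [TopologicalSpace H'] {I' : ModelWithCorners ℝ E' H'} [TopologicalSpace M']
    [ChartedSpace H' M'] {x : M} {y : M'} :
    (I.prod I').IsBoundaryPoint (x, y) ↔ I.IsBoundaryPoint x ∨ I'.IsBoundaryPoint y := by
  refine (Set.ext_iff.1 (ModelWithCorners.boundary_prod (I := I) (J := I') (M := M) (N := M'))
    (x, y)).trans ⟨?_, ?_⟩
  · rintro (⟨-, h⟩ | ⟨h, -⟩)
    exacts [Or.inr h, Or.inl h]
  · rintro (h | h)
    exacts [Or.inr ⟨h, trivial⟩, Or.inl ⟨trivial, h⟩]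

theorem Ray.isBoundaryPoint_iff {r : Ray} : (Q 1).IsBoundaryPoint r ↔ r = 0 := by
  refine ⟨fun h => ?_, fun h => h ▸ Ray.isBoundaryPoint_zero⟩
  by_contra h'
  exact ((Q 1).isBoundaryPoint_iff_not_isInteriorPoint _).1 h (Ray.isInteriorPoint_of_ne h')

theorem Collar.toFun_mem_boundary_iff {F : CompactManifold n} {W : CompactManifold (n + 1)}
    (c : Collar F W) {x : F} {r : Ray} :
    c.toFun (x, r) ∈ W.boundary ↔ x ∈ F.boundary ∨ r = 0 :=
  ((c.isLocalDiffeomorph (x, r)).isBoundaryPoint_iff (by simp)).symm.trans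
    (isBoundaryPoint_prod.trans (or_congr Iff.rfl Ray.isBoundaryPoint_iff))

theorem Collar.face_mem_boundary {F : CompactManifold n} {W : CompactManifold (n + 1)}
    (c : Collar F W) (x : F) : c.face x ∈ W.boundary :=
  c.toFun_mem_boundary_iff.2 (Or.inr rfl)

theorem CompactManifold.toProd_mem_boundary_iff {a b : ℕ} (M : CompactManifold a)
    (M' : CompactManifold b) {x : M} {y : M'} :
    M.toProd M' (x, y) ∈ (M.prod M').boundary ↔ x ∈ M.boundary ∨ y ∈ M'.boundary :=
  ((M.isLocalDiffeomorph_toProd M' (x, y)).isBoundaryPoint_iff (by simp)).symm.trans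
    isBoundaryPoint_prod

theorem DisjointUnion.boundary_eq {A B C : CompactManifold n} (u : DisjointUnion A B C)
    (hA : A.boundary = ∅) (hB : B.boundary = ∅) : C.boundary = ∅ := by
  refine Set.eq_empty_of_forall_notMem fun y hy => ?_
  obtain ⟨x | x, rfl⟩ := u.bijective.2 y
  · have := ((u.isLocalDiffeomorph_a x).isBoundaryPoint_iff (by simp)).2 hy
    exact (Set.ext_iff.1 hA x).1 this
  · have := ((u.isLocalDiffeomorph_b x).isBoundaryPoint_iff (by simp)).2 hy
    exact (Set.ext_iff.1 hB x).1 this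

/-- `A ⊔ B` is the disjoint union of `A` and `B`. -/
def CompactManifold.sumDisjointUnion (A B : CompactManifold n) : DisjointUnion A B (A.sum B) where
  a := Sum.inl
  b := Sum.inr
  isLocalDiffeomorph_a := isLocalDiffeomorph_inl
  isLocalDiffeomorph_b := isLocalDiffeomorph_inr
  bijective := by
    have : (Sum.elim (Sum.inl : A → A ⊕ B) Sum.inr) = id := Sum.elim_inl_inr
    exact this ▸ Function.bijective_id

end Boundary

/-! ### Cylinders -/

section Cylinder

variable {n : ℕ} (C : CompactManifold n)

/-- The cylinder `C × [0,1]`. -/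
abbrev CompactManifold.cylinder : CompactManifold (n + 1) := C.prod interval

/-- The collar of the face `C × {0}` of the cylinder. -/
def CompactManifold.cylinderLo : Collar C C.cylinder where
  toFun z := C.toProd interval (z.1, interval.lo z.2)
  isLocalDiffeomorph z :=
    (((Diffeomorph.refl (Q n) C ∞).isLocalDiffeomorph z.1).prodMap (interval.isLocalDiffeomorph_lo z.2)).comp _ _
      (C.isLocalDiffeomorph_toProd interval _)
  injective := (C.toProd interval).injective.comp
    (Function.injective_id.prodMap interval.lo_injective)

/-- The collar of the face `C × {1}` of the cylinder. -/
def CompactManifold.cylinderHi : Collar C C.cylinder where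
  toFun z := C.toProd interval (z.1, interval.hi z.2)
  isLocalDiffeomorph z :=
    (((Diffeomorph.refl (Q n) C ∞).isLocalDiffeomorph z.1).prodMap (interval.isLocalDiffeomorph_hi z.2)).comp _ _
      (C.isLocalDiffeomorph_toProd interval _)
  injective := (C.toProd interval).injective.comp
    (Function.injective_id.prodMap interval.hi_injective)

theorem CompactManifold.cylinder_disjoint (z z' : C × Ray) :
    C.cylinderLo.toFun z ≠ C.cylinderHi.toFun z' := fun h =>
  interval.lo_ne_hi _ _ (congrArg Prod.snd ((C.toProd interval).injective h))

theorem CompactManifold.cylinder_boundary (hC : C.boundary = ∅) : C.cylinder.boundary =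
    Set.range C.cylinderLo.face ∪ Set.range C.cylinderHi.face := by
  refine Set.Subset.antisymm (fun y hy => ?_) ?_
  · obtain ⟨⟨x, t⟩, rfl⟩ := (C.toProd interval).surjective y
    rcases (C.toProd_mem_boundary_iff interval).1 hy with h | h
    · exact absurd h (by rw [hC]; exact id)
    · rcases interval.boundary_subset h with rfl | rfl
      · exact Or.inl ⟨x, rfl⟩
      · exact Or.inr ⟨x, rfl⟩
  · rintro _ (⟨x, rfl⟩ | ⟨x, rfl⟩)
    · exact C.cylinderLo.face_mem_boundary x
    · exact C.cylinderHi.face_mem_boundary x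

/-- Φ is suspended by the derivative of the coordinate of [0,1]. That coordinate increases along the
inward normal at the lower end and decreases along it at the upper end, hence the opposite signs. -/
theorem IsFraming.exists_cylinder {R : ℕ} {Φ : C → Eucl n × (ℕ → ℝ) →ₗ[ℝ] Eucl n × (ℕ → ℝ)}
    (hΦ : IsFraming C R Φ) : ∃ Φ' : C.cylinder → Eucl (n + 1) × (ℕ → ℝ) →ₗ[ℝ]
      Eucl (n + 1) × (ℕ → ℝ), IsFraming C.cylinder R Φ' ∧
      (∀ x y (v : Eucl n) (w : Eucl 1) s, Φ' (C.toProd interval (x, y))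
        (mfderiv ((Q n).prod (Q 1)) (Q (n + 1)) (C.toProd interval) (x, y)
          ((v, w) : Eucl n × Eucl 1), s) =
        (snoc (Φ x (v, s)).1 (mfderiv (Q 1) 𝓘(ℝ, ℝ) interval.coord y w), (Φ x (v, s)).2)) ∧
      (∀ x v t s, Φ' (C.cylinderLo.face x) (C.cylinderLo.derivAt x 0 (v, t), s) =
        (snoc (Φ x (v, s)).1 t, (Φ x (v, s)).2)) ∧
      ∀ x v t s, Φ' (C.cylinderHi.face x) (C.cylinderHi.derivAt x 0 (v, t), s) =
        (snoc (Φ x (v, s)).1 (-t), (Φ x (v, s)).2) := by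
  let f : C × interval → C.cylinder := C.toProd interval
  have hf : IsLocalDiffeomorph ((Q n).prod (Q 1)) (Q (n + 1)) ∞ f :=
    C.isLocalDiffeomorph_toProd interval
  let A : C × interval → Eucl n × Eucl 1 →ₗ[ℝ] Eucl (n + 1) := fun z =>
    { toFun := fun v => mfderiv ((Q n).prod (Q 1)) (Q (n + 1)) f z v
      map_add' := (mfderiv ((Q n).prod (Q 1)) (Q (n + 1)) f z).map_add
      map_smul' := (mfderiv ((Q n).prod (Q 1)) (Q (n + 1)) f z).map_smul }
  have hA : ∀ z, Function.Bijective (A z) := fun z => (hf z).mfderiv_bijective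
  let τ : interval → Eucl 1 →ₗ[ℝ] ℝ := fun y =>
    { toFun := fun v => mfderiv (Q 1) 𝓘(ℝ, ℝ) interval.coord y v
      map_add' := (mfderiv (Q 1) 𝓘(ℝ, ℝ) interval.coord y).map_add
      map_smul' := (mfderiv (Q 1) 𝓘(ℝ, ℝ) interval.coord y).map_smul }
  have hτ : ∀ y, Function.Injective (τ y) := interval.mfderiv_coord_injective
  obtain ⟨Φ', h1, h2⟩ := exists_descent (y := f) (C.toProd interval).surjective hA
    (Ψ := fun z => suspend (Φ z.1) (τ z.2)) (fun z => (hΦ.stable z.1).suspend (hτ z.2)) (by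
      intro z z' v v' s h hv
      obtain rfl := (C.toProd interval).injective h
      rw [(hA z).1 hv])
  have key : ∀ (c : Collar C C.cylinder) (γ : Ray → interval),
      IsLocalDiffeomorph (Q 1) (Q 1) ∞ γ → c.toFun = f ∘ Prod.map id γ → ∀ x v t s,
      Φ' (c.face x) (c.derivAt x 0 (v, t), s) = (snoc (Φ x (v, s)).1
        (τ (γ 0) (mfderiv (Q 1) (Q 1) γ 0 (EuclideanSpace.single (0 : Fin 1) t))),
        (Φ x (v, s)).2) := by
    intro c γ hγ hc x v t s
    have hm := hγ.mdifferentiable (by simp) 0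
    have h3 := mfderiv_comp (x, (0 : Ray)) (hf.mdifferentiable (by simp) (x, γ 0))
      (mdifferentiableAt_id.prodMap hm)
    rw [mfderiv_prodMap mdifferentiableAt_id hm, mfderiv_id] at h3
    have e : c.derivAt x 0 (v, t) = A (x, γ 0)
        (v, mfderiv (Q 1) (Q 1) γ 0 (EuclideanSpace.single (0 : Fin 1) t)) := by
      rw [Collar.derivAt_apply, hc]
      exact DFunLike.congr_fun h3 (v, EuclideanSpace.single (0 : Fin 1) t)
    have e' : c.face x = f (x, γ 0) := congrFun hc (x, 0)
    rw [e, e']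
    exact h2 (x, γ 0) _ s
  have hs : ∀ t : ℝ, (EuclideanSpace.single (0 : Fin 1) t : Eucl 1) 0 = t := fun t => by simp
  refine ⟨Φ', ⟨h1, continuous_iff_continuousAt.2 ?_⟩, fun x y v w s => h2 (x, y) (v, w) s,
    fun x v t s => ?_, fun x v t s => ?_⟩
  · rintro ⟨⟨y, w⟩, s⟩
    obtain ⟨z, rfl⟩ := (C.toProd interval).surjective y
    obtain ⟨v, rfl⟩ := (hA z).2 w
    refine continuousAt_tangentBundle_of_comp (hf z) (fun y z => Φ' y z) v s
      (Continuous.continuousAt ?_)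
    have p1 : Continuous fun z : TangentBundle ((Q n).prod (Q 1)) (C × interval) × (ℕ → ℝ) =>
        Φ z.1.proj.1 (z.1.snd.1, z.2) :=
      hΦ.comp_continuous (continuous_tangentBundle_prod_fst.comp continuous_fst) continuous_snd
    have p2 : Continuous fun z : TangentBundle ((Q n).prod (Q 1)) (C × interval) × (ℕ → ℝ) =>
        τ z.1.proj.2 z.1.snd.2 :=
      (continuous_tangentBundle_model_snd (I := 𝓘(ℝ, ℝ))).comp
        ((interval.contMDiff_coord.continuous_tangentMap (by simp)).comp
        (continuous_tangentBundle_prod_snd.comp continuous_fst))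
    refine ((continuous_snoc (continuous_fst.comp p1) p2).prodMk (continuous_snd.comp p1)).congr ?_
    rintro ⟨⟨z, v⟩, s⟩
    exact (h2 z v s).symm
  · have h4 : τ (interval.lo 0) (mfderiv (Q 1) (Q 1) interval.lo 0
        (EuclideanSpace.single (0 : Fin 1) t)) = t :=
      (interval.mfderiv_coord_lo _).trans (hs t)
    exact (key C.cylinderLo interval.lo interval.isLocalDiffeomorph_lo rfl x v t s).trans
      (congrArg (fun a => (snoc (Φ x (v, s)).1 a, (Φ x (v, s)).2)) h4)
  · have h4 : τ (interval.hi 0) (mfderiv (Q 1) (Q 1) interval.hi 0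
        (EuclideanSpace.single (0 : Fin 1) t)) = -t :=
      (interval.mfderiv_coord_hi _).trans (congrArg Neg.neg (hs t))
    exact (key C.cylinderHi interval.hi interval.isLocalDiffeomorph_hi rfl x v t s).trans
      (congrArg (fun a => (snoc (Φ x (v, s)).1 a, (Φ x (v, s)).2)) h4)

end Cylinder

/-! ### Exchange of factors in products -/

section LocalDiffeo

variable {E H M E' H' M' E'' H'' M'' : Type*}
  [NormedAddCommGroup E] [NormedSpace ℝ E] [TopologicalSpace H] {I : ModelWithCorners ℝ E H}
  [TopologicalSpace M] [ChartedSpace H M] [NormedAddCommGroup E'] [NormedSpace ℝ E']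
  [TopologicalSpace H'] {I' : ModelWithCorners ℝ E' H'} [TopologicalSpace M'] [ChartedSpace H' M']
  [NormedAddCommGroup E''] [NormedSpace ℝ E''] [TopologicalSpace H'']
  {I'' : ModelWithCorners ℝ E'' H''} [TopologicalSpace M''] [ChartedSpace H'' M'']

theorem isLocalDiffeomorphAt_id (x : M) : IsLocalDiffeomorphAt I I ∞ id x :=
  (Diffeomorph.refl I M ∞).isLocalDiffeomorph x

theorem isLocalDiffeomorph_prodRightComm : IsLocalDiffeomorph ((I.prod I').prod I'')
    ((I.prod I'').prod I') ∞ fun z : (M × M') × M'' => ((z.1.1, z.2), z.1.2) :=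
  isLocalDiffeomorph_of_homeomorph
    { toFun := fun z : (M × M') × M'' => ((z.1.1, z.2), z.1.2)
      invFun := fun z : (M × M'') × M' => ((z.1.1, z.2), z.1.2)
      left_inv := fun _ => rfl
      right_inv := fun _ => rfl
      continuous_toFun := by fun_prop
      continuous_invFun := by fun_prop }
    (((contMDiff_fst.comp contMDiff_fst).prodMk contMDiff_snd).prodMk
      (contMDiff_snd.comp contMDiff_fst))
    (((contMDiff_fst.comp contMDiff_fst).prodMk contMDiff_snd).prodMk
      (contMDiff_snd.comp contMDiff_fst))

end LocalDiffeo

/-! ### Manifolds with singularities and several boundary components -/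

section Cob

variable {k d : ℕ} {J : Type*} {P : J → CompactManifold k}

namespace BSManifold

theorem ι_mem_boundary_iff (A : BSManifold P d) {i : J} {x : A.N i} {p : P i} {r : Ray} :
    A.ι i (x, p, r) ∈ A.M.boundary ↔ x ∈ (A.N i).boundary ∨ p ∈ (P i).boundary ∨ r = 0 :=
  ((A.isLocalDiffeomorph i (x, p, r)).isBoundaryPoint_iff (by simp)).symm.trans
    (isBoundaryPoint_prod.trans (or_congr Iff.rfl (isBoundaryPoint_prod.trans
      (or_congr Iff.rfl Ray.isBoundaryPoint_iff))))

theorem ι_eq (A : BSManifold P d) {i : J} {x x' : A.N i} {p p' : P i} {r r' : Ray}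
    (h : A.ι i (x, p, r) = A.ι i (x', p', r')) : x = x' ∧ p = p' ∧ r = r' := by
  have := A.injective (a₁ := ⟨i, x, p, r⟩) (a₂ := ⟨i, x', p', r'⟩) h
  simpa using this

theorem ι_mem_singularFace (A : BSManifold P d) {i : J} {x : A.N i} {p : P i} {r : Ray}
    (h : A.ι i (x, p, r) ∈ A.singularFace) : r = 0 := by
  obtain ⟨i', x', p', h⟩ := h
  have h1 := A.injective (a₁ := ⟨i', x', p', 0⟩) (a₂ := ⟨i, x, p, r⟩) h
  obtain rfl := congrArg Sigma.fst h1
  exact (A.ι_eq h).2.2.symm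

theorem face_mem_singularFace (A : BSManifold P d) (i : J) (x : A.N i) (p : P i) :
    A.face i x p ∈ A.singularFace := ⟨i, x, p, rfl⟩

/-- If x were a boundary point of N i, the whole collar line over (x, p) would lie in the boundary,
but the singular face meets that line only at r = 0. The point p matters: when P i is empty, nothing
constrains N i. -/
theorem IsClosed.boundary_N {A : BSManifold P d} (h : A.IsClosed) (i : J) (p : P i) :
    (A.N i).boundary = ∅ := by
  refine Set.eq_empty_of_forall_notMem fun x hx => ?_
  have h1 : A.ι i (x, p, Ray.mk 1) ∈ A.singularFace := h ▸ A.ι_mem_boundary_iff.2 (Or.inl hx)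
  have h2 := congrArg Ray.coord (A.ι_mem_singularFace h1)
  rw [Ray.coord_mk_of_nonneg zero_le_one, Ray.coord_zero] at h2
  exact one_ne_zero h2

section Bordism

variable {A B : BSManifold P d} (b : A.Bordism B)

theorem Bordism.mem_range_A {i : J} {n : b.W.N i} {p : P i} (a : A.M)
    (h : b.cA.face a = b.W.ι i (n, p, 0)) : n ∈ Set.range (b.cNA i).face := by
  obtain ⟨i', x, p', rfl⟩ := (b.essential_A a).1 (h ▸ b.W.face_mem_singularFace i n p)
  have h1 := (b.corner_A i' x p' 0 0).symm.trans h
  obtain rfl := congrArg Sigma.fst (b.W.injective (a₁ := ⟨i', (b.cNA i').toFun (x, 0), p', 0⟩)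
    (a₂ := ⟨i, n, p, 0⟩) h1)
  exact ⟨x, (b.W.ι_eq h1).1⟩

theorem Bordism.mem_range_B {i : J} {n : b.W.N i} {p : P i} (a : B.M)
    (h : b.cB.face a = b.W.ι i (n, p, 0)) : n ∈ Set.range (b.cNB i).face := by
  obtain ⟨i', x, p', rfl⟩ := (b.essential_B a).1 (h ▸ b.W.face_mem_singularFace i n p)
  have h1 := (b.corner_B i' x p' 0 0).symm.trans h
  obtain rfl := congrArg Sigma.fst (b.W.injective (a₁ := ⟨i', (b.cNB i').toFun (x, 0), p', 0⟩)
    (a₂ := ⟨i, n, p, 0⟩) h1)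
  exact ⟨x, (b.W.ι_eq h1).1⟩

/-- For t > 0 the point with coordinates (n, p, t) is a boundary point off the singular face, hence
lies on an essential face. These faces are closed, so t → 0 gives a point common to an essential
face and the singular face, and such points come from the singular faces of A and B. -/
theorem Bordism.boundary_N_subset (i : J) (p : P i) (n : b.W.N i) (hn : n ∈ (b.W.N i).boundary) :
    n ∈ Set.range (b.cNA i).face ∨ n ∈ Set.range (b.cNB i).face := by
  have hcl : _root_.IsClosed (Set.range b.cA.face ∪ Set.range b.cB.face) :=
    b.cA.isClosed_range_face.union b.cB.isClosed_range_face
  have hcont : Continuous fun t : ℝ => b.W.ι i (n, p, Ray.mk t) :=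
    (b.W.isLocalDiffeomorph i).contMDiff.continuous.comp
      (continuous_const.prodMk (continuous_const.prodMk Ray.continuous_mk))
  have h0 : b.W.ι i (n, p, 0) ∈ Set.range b.cA.face ∪ Set.range b.cB.face := by
    have h1 : Ray.mk (0 : ℝ) = 0 := by rw [← Ray.coord_zero, Ray.mk_coord]
    rw [← h1]
    refine (hcl.preimage hcont).closure_subset_iff.2 (fun t ht => ?_)
      (by rw [closure_Ioi]; exact Set.self_mem_Ici : (0 : ℝ) ∈ closure (Set.Ioi 0))
    have h2 : b.W.ι i (n, p, Ray.mk t) ∈ b.W.M.boundary :=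
      b.W.ι_mem_boundary_iff.2 (Or.inl hn)
    rw [b.boundary_eq] at h2
    refine h2.resolve_right fun h3 => ?_
    have h4 := congrArg Ray.coord (b.W.ι_mem_singularFace h3)
    rw [Ray.coord_mk_of_nonneg (le_of_lt ht), Ray.coord_zero] at h4
    exact ht.ne' h4
  rcases h0 with ⟨a, h⟩ | ⟨a, h⟩
  exacts [Or.inl (b.mem_range_A a h), Or.inr (b.mem_range_B a h)]

end Bordism

end BSManifold

variable {X : Type*} [TopologicalSpace X]

/-- The framing `Φ` is compatible with the singularities of `W` over the point `n` of `N i`. -/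
def BSManifold.CompatibleAt (W : BSManifold P d) (φP : ∀ i, StableFraming (P i))
    (Φ : W.M → Eucl (k + (d + 1)) × (ℕ → ℝ) →ₗ[ℝ] Eucl (k + (d + 1)) × (ℕ → ℝ)) (i : J)
    (n : W.N i) : Prop :=
  ∃ ν : Eucl d → ℝ → (ℕ → ℝ) → Eucl (d + 1) × (ℕ → ℝ),
    ∀ (p : P i) (v : Eucl d) (w : Eucl k) (t : ℝ) (s : ℕ → ℝ),
      Φ (W.face i n p) (W.deriv i n p v w t, s) =
        directSum (φP i).rank ((φP i).extend p w s) (ν v t (tail (φP i).rank s))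

/-- A compact manifold with singularities over `X` whose essential boundary is the disjoint union of
the closed manifolds `obj j`. -/
structure Cob {ι : Type} (obj : ι → BSSingular P d X) where
  W : BSManifold P (d + 1)
  c : ∀ j, Collar (obj j).M W.M
  cN : ∀ j i, Collar ((obj j).N i) (W.N i)
  disjoint : ∀ j j', j ≠ j' → ∀ z z', (c j).toFun z ≠ (c j').toFun z'
  disjoint_N : ∀ j j', j ≠ j' → ∀ i z z', (cN j i).toFun z ≠ (cN j' i).toFun z'
  corner : ∀ j i x (p : P i) (s t : Ray),
    (c j).toFun ((obj j).ι i (x, p, s), t) = W.ι i ((cN j i).toFun (x, t), p, s)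
  mem_range : ∀ j i n p r a, W.ι i (n, p, r) = (c j).face a → n ∈ Set.range (cN j i).face
  boundary_N : ∀ i, P i → ∀ n ∈ (W.N i).boundary, ∃ j, n ∈ Set.range (cN j i).face
  boundary : ∀ w ∈ W.M.boundary, (∃ j, w ∈ Set.range (c j).face) ∨ w ∈ W.singularFace
  map : C(W.M, X)
  map_compatible : W.MapCompatible map
  map_face : ∀ j x, map ((c j).face x) = (obj j).map x

namespace Cob

variable {ι ι' : Type} {obj : ι → BSSingular P d X} {obj' : ι' → BSSingular P d X}

/-- `W` has a stable framing that is compatible with the singularities and that restricts to the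
framings `ψ j` of the boundary components, where `σ` is `ε j` times the inward normal. -/
def IsFramed (B : Cob obj) (φP : ∀ i, StableFraming (P i))
    (ψ : ∀ j, StableFraming (obj j).M) (ε : ι → ℝ) : Prop :=
  ∃ R Φ, IsFraming B.W.M R Φ ∧ (∀ i n, B.W.CompatibleAt φP Φ i n) ∧
    ∀ j x v t s, Φ ((B.c j).face x) ((B.c j).derivAt x 0 (v, t), s) =
      (snoc ((ψ j).toLin x (v, s)).1 (ε j * t), ((ψ j).toLin x (v, s)).2)

/-- Reindexing the boundary components. -/
def reindex (B : Cob obj) (e : ι' ≃ ι) : Cob (obj ∘ e) where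
  W := B.W
  c j := B.c (e j)
  cN j := B.cN (e j)
  disjoint j j' h := B.disjoint _ _ (e.injective.ne h)
  disjoint_N j j' h := B.disjoint_N _ _ (e.injective.ne h)
  corner j := B.corner (e j)
  mem_range j := B.mem_range (e j)
  boundary_N i p n hn := by
    obtain ⟨j, hj⟩ := B.boundary_N i p n hn
    obtain ⟨j, rfl⟩ := e.surjective j
    exact ⟨j, hj⟩
  boundary w hw := by
    rcases B.boundary w hw with ⟨j, hj⟩ | h
    · obtain ⟨j, rfl⟩ := e.surjective j
      exact Or.inl ⟨j, hj⟩
    · exact Or.inr h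
  map := B.map
  map_compatible := B.map_compatible
  map_face j := B.map_face (e j)

theorem IsFramed.reindex {B : Cob obj} {φP : ∀ i, StableFraming (P i)}
    {ψ : ∀ j, StableFraming (obj j).M} {ε : ι → ℝ} (h : B.IsFramed φP ψ ε) (e : ι' ≃ ι) :
    (B.reindex e).IsFramed φP (fun j => ψ (e j)) (ε ∘ e) := by
  obtain ⟨R, Φ, h1, h2, h3⟩ := h
  exact ⟨R, Φ, h1, h2, fun j => h3 (e j)⟩

end Cob

/-- A bordism of closed manifolds with singularities, as a manifold with two boundary components. -/
def BSManifold.Bordism.toCob {A B : BSSingular P d X} (hP : ∀ i, (P i).boundary = ∅)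
    (b : A.toBSManifold.Bordism B.toBSManifold) (F : C(b.W.M, X)) (hF : b.W.MapCompatible F)
    (hA : ∀ x, F (b.cA.face x) = A.map x) (hB : ∀ x, F (b.cB.face x) = B.map x) :
    Cob (fun j : Bool => cond j A B) where
  W := b.W
  c j := match j with
    | true => b.cA
    | false => b.cB
  cN j := match j with
    | true => b.cNA
    | false => b.cNB
  disjoint j j' h := match j, j', h with
    | true, false, _ => b.disjoint
    | false, true, _ => fun z z' h => b.disjoint z' z h.symm
  disjoint_N j j' h := match j, j', h with
    | true, false, _ => b.disjoint_N
    | false, true, _ => fun i z z' h => b.disjoint_N i z' z h.symm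
  corner j := match j with
    | true => b.corner_A
    | false => b.corner_B
  mem_range := by
    have key := b.boundary_N_subset
    -- For r ≠ 0 a boundary point in the singular collar comes from the boundary of N i, since P i
    -- is closed. It is then in the face of A or of B, and disjointness of the two collars excludes
    -- the wrong one.
    have h0 : ∀ i n p r, b.W.ι i (n, p, r) ∈ b.W.M.boundary → r ≠ 0 → n ∈ (b.W.N i).boundary := by
      intro i n p r h hr
      rcases b.W.ι_mem_boundary_iff.1 h with h | h | h
      · exact h
      · exact absurd h (by rw [hP]; exact id)
      · exact absurd h hr
    rintro (_ | _) i n p r a h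
    · by_cases hr : r = 0
      · subst hr
        exact b.mem_range_B a h.symm
      · rcases key i p n (h0 i n p r (h ▸ b.cB.face_mem_boundary a) hr) with ⟨x, rfl⟩ | h'
        · refine absurd ?_ (b.disjoint (A.ι i (x, p, r), 0) (a, 0))
          rw [b.corner_A]; exact h
        · exact h'
    · by_cases hr : r = 0
      · subst hr
        exact b.mem_range_A a h.symm
      · rcases key i p n (h0 i n p r (h ▸ b.cA.face_mem_boundary a) hr) with h' | ⟨x, rfl⟩
        · exact h'
        · refine absurd ?_ (b.disjoint (a, 0) (B.ι i (x, p, r), 0))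
          rw [b.corner_B]; exact h.symm
  boundary_N i p n hn := by
    rcases b.boundary_N_subset i p n hn with h | h
    exacts [⟨true, h⟩, ⟨false, h⟩]
  boundary w hw := by
    rw [b.boundary_eq] at hw
    rcases hw with (h | h) | h
    exacts [Or.inl ⟨true, h⟩, Or.inl ⟨false, h⟩, Or.inr h]
  map := F
  map_compatible := hF
  map_face j := match j with
    | true => hA
    | false => hB

end Cob

section Cob

variable {k d : ℕ} {J : Type*} {P : J → CompactManifold k} {X : Type*} [TopologicalSpace X]

theorem Collar.Compatible.toLin {n : ℕ} {F : CompactManifold n} {W : CompactManifold (n + 1)}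
    {c : Collar F W} {ε : ℝ} {φF : StableFraming F} {φW : StableFraming W}
    (h : c.Compatible ε φF φW) (x : F) (v : Eucl n) (t : ℝ) (s : ℕ → ℝ) :
    φW.toLin (c.face x) (c.derivAt x 0 (v, t), s) =
      (snoc (φF.toLin x (v, s)).1 (ε * t), (φF.toLin x (v, s)).2) := by
  rw [c.derivAt_zero]
  exact h x v t s

theorem BSManifold.Framing.compatibleAt {W : BSManifold P d} {φP : ∀ i, StableFraming (P i)}
    (φ : W.Framing φP) (i : J) (n : W.N i) : W.CompatibleAt φP φ.total.toLin i n :=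
  ⟨fun v t s => (φ.normal i).extend n v t s, fun p v w t s => φ.compatible i n p v w t s⟩

theorem BSManifold.Bordism.isFramed_toCob {A B : BSSingular P d X}
    {φP : ∀ i, StableFraming (P i)} (hP : ∀ i, (P i).boundary = ∅)
    (b : A.toBSManifold.Bordism B.toBSManifold) (F : C(b.W.M, X)) (hF : b.W.MapCompatible F)
    (hA : ∀ x, F (b.cA.face x) = A.map x) (hB : ∀ x, F (b.cB.face x) = B.map x)
    (φ : b.W.Framing φP) (ψ : ∀ j : Bool, StableFraming (cond j A B).M)
    (hcA : b.cA.Compatible 1 (ψ true) φ.total) (hcB : b.cB.Compatible (-1) (ψ false) φ.total) :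
    (b.toCob hP F hF hA hB).IsFramed φP ψ fun j => cond j 1 (-1) :=
  ⟨φ.total.rank, φ.total.toLin, φ.total.isFraming, φ.compatibleAt, fun j =>
    match j with
    | true => hcA.toLin
    | false => hcB.toLin⟩

namespace Cob

/-- Families produced by the formal reduction agree with those of the geometric constructions only
pointwise. The framings are compared by `HEq` because their types depend on the family. -/
theorem exists_isFramed_congr {ι : Type} {obj obj' : ι → BSSingular P d X}
    {φP : ∀ i, StableFraming (P i)} {ψ : ∀ j, StableFraming (obj j).M}
    {ψ' : ∀ j, StableFraming (obj' j).M} {ε ε' : ι → ℝ} (h : ∀ j, obj j = obj' j)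
    (hψ : ∀ j, HEq (ψ j) (ψ' j)) (hε : ∀ j, ε j = ε' j)
    (hB : ∃ B : Cob obj, B.IsFramed φP ψ ε) : ∃ B : Cob obj', B.IsFramed φP ψ' ε' := by
  obtain rfl : obj = obj' := funext h
  obtain rfl : ψ = ψ' := funext fun j => eq_of_heq (hψ j)
  obtain rfl : ε = ε' := funext hε
  exact hB

/-! #### The empty manifold -/

theorem _root_.BaasSullivan.isEmpty_tangentBundle_empty (n : ℕ) :
    IsEmpty (TangentBundle (Q n) (CompactManifold.empty n)) :=
  ⟨fun z => isEmptyElim z.proj⟩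

/-- The empty manifold, with no boundary components. -/
def empty (obj : Empty → BSSingular P d X) : Cob obj where
  W := nonsingular P (CompactManifold.empty _)
  c j := j.elim
  cN j := j.elim
  disjoint j := j.elim
  disjoint_N j := j.elim
  corner j := j.elim
  mem_range j := j.elim
  boundary_N _ _ n := isEmptyElim (α := CompactManifold.empty (d + 1)) n
  boundary w := isEmptyElim (α := CompactManifold.empty _) w
  map := ⟨fun w => isEmptyElim (α := CompactManifold.empty _) w,
    continuous_iff_continuousAt.2 fun w => isEmptyElim (α := CompactManifold.empty _) w⟩
  map_compatible _ n := isEmptyElim (α := CompactManifold.empty (d + 1)) n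
  map_face j := j.elim

theorem isFramed_empty (obj : Empty → BSSingular P d X) (φP : ∀ i, StableFraming (P i))
    (ψ : ∀ j, StableFraming (obj j).M) (ε : Empty → ℝ) : (empty obj).IsFramed φP ψ ε := by
  refine ⟨0, fun w => isEmptyElim (α := CompactManifold.empty _) w,
    ⟨fun w => isEmptyElim (α := CompactManifold.empty _) w, ?_⟩,
    fun i n => isEmptyElim (α := CompactManifold.empty (d + 1)) n, fun j => j.elim⟩
  have := isEmpty_tangentBundle_empty (k + (d + 1 + 1))
  exact continuous_iff_continuousAt.2 fun z => isEmptyElim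
    (α := TangentBundle (Q (k + (d + 1 + 1))) (CompactManifold.empty (k + (d + 1 + 1)))) z.1

/-! #### Reversing the signs -/

/-- The reflection of the last coordinate of `ℝ^{n+1}`. -/
def _root_.BaasSullivan.reflectLast (n : ℕ) : Eucl (n + 1) ≃ₗ[ℝ] Eucl (n + 1) :=
  (snocL n).symm ≪≫ₗ (LinearEquiv.prodCongr (LinearEquiv.refl ℝ _) (LinearEquiv.neg ℝ)) ≪≫ₗ snocL n

theorem _root_.BaasSullivan.reflectLast_snoc {n : ℕ} (a : Eucl n) (t : ℝ) :
    reflectLast n (snoc a t) = snoc a (-t) := by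
  have h : (snocL n).symm (snoc a t) = (a, t) := (snocL n).symm_apply_apply (a, t)
  simp [reflectLast, h, snocL_apply]

theorem _root_.BaasSullivan.continuous_reflectLast (n : ℕ) : Continuous (reflectLast n) :=
  (reflectLast n).toContinuousLinearEquiv.continuous

/-- The coordinate split off by `snoc` belongs to the second summand. That suspension, reflection
and desuspension respect direct sums all rests on this. -/
theorem _root_.BaasSullivan.append_snoc {k m : ℕ} (a : Eucl k) (b : Eucl m) (t : ℝ) :
    append (k := k) (m := m + 1) a (snoc b t) = snoc (append a b : Eucl (k + m)) t := by
  ext i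
  exact congrFun (Fin.append_snoc (α := ℝ) (a : Fin k → ℝ) (b : Fin m → ℝ) t) i

theorem _root_.BaasSullivan.exists_snoc {n : ℕ} (a : Eucl (n + 1)) : ∃ b t, a = snoc b t :=
  ⟨_, _, ((snocL n).apply_symm_apply a).symm⟩

theorem _root_.BaasSullivan.reflectLast_append {k m : ℕ} (a : Eucl k) (b : Eucl (m + 1)) :
    reflectLast (k + m) (append (k := k) (m := m + 1) a b) =
      append (k := k) (m := m + 1) a (reflectLast m b) := by
  obtain ⟨b, t, rfl⟩ := exists_snoc b
  rw [append_snoc, reflectLast_snoc, reflectLast_snoc, append_snoc]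

/-- Reflecting the last target coordinate changes all signs ε at once. This coordinate belongs to
the normal summand and not to the ℝᵏ of P i, so compatibility with the singularities persists. -/
theorem IsFramed.neg {ι : Type} {obj : ι → BSSingular P d X} {B : Cob obj}
    {φP : ∀ i, StableFraming (P i)} {ψ : ∀ j, StableFraming (obj j).M} {ε : ι → ℝ}
    (h : B.IsFramed φP ψ ε) : B.IsFramed φP ψ fun j => -ε j := by
  obtain ⟨R, Φ, h1, h2, h3⟩ := h
  refine ⟨R, fun w => (reflectLast (k + (d + 1))).toLinearMap.prodMap LinearMap.id ∘ₗ Φ w,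
    ⟨fun w => (isStable_prodMap (reflectLast _).injective).comp (h1.stable w), ?_⟩,
    fun i n => ?_, fun j x v t s => ?_⟩
  · exact ((continuous_reflectLast (k + (d + 1))).comp
      (continuous_fst.comp h1.continuous)).prodMk (continuous_snd.comp h1.continuous)
  · obtain ⟨ν, hν⟩ := h2 i n
    refine ⟨fun v t s => (reflectLast (d + 1) (ν v t s).1, (ν v t s).2), fun p v w t s => ?_⟩
    refine (congrArg (Prod.map (reflectLast (k + (d + 1))) id) (hν p v w t s)).trans ?_
    exact Prod.ext (reflectLast_append _ _) rfl
  · refine (congrArg (Prod.map (reflectLast (k + (d + 1))) id) (h3 j x v t s)).trans ?_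
    refine Prod.ext ((reflectLast_snoc _ _).trans ?_) rfl
    rw [neg_mul]

end Cob

/-! #### Disjoint unions -/

namespace BSManifold

/-- The disjoint union of manifolds with singularities. -/
def sum (A B : BSManifold P d) : BSManifold P d where
  M := A.M.sum B.M
  N i := (A.N i).sum (B.N i)
  finite := by
    refine (A.finite.union B.finite).subset ?_
    rintro i ⟨x | x⟩
    exacts [Or.inl ⟨x⟩, Or.inr ⟨x⟩]
  ι i z := match z with
    | (Sum.inl x, z) => Sum.inl (A.ι i (x, z))
    | (Sum.inr x, z) => Sum.inr (B.ι i (x, z))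
  isLocalDiffeomorph i := by
    rintro ⟨x | x, z⟩
    · exact IsLocalDiffeomorphAt.of_comp_right
        (f := Prod.map (Sum.inl : A.N i → A.N i ⊕ B.N i) (id : P i × Ray → P i × Ray))
        (((A.isLocalDiffeomorph i (x, z)).comp _ _ (isLocalDiffeomorph_inl _)))
        ((isLocalDiffeomorph_inl x).prodMap (isLocalDiffeomorphAt_id z))
    · exact IsLocalDiffeomorphAt.of_comp_right
        (f := Prod.map (Sum.inr : B.N i → A.N i ⊕ B.N i) (id : P i × Ray → P i × Ray))
        (((B.isLocalDiffeomorph i (x, z)).comp _ _ (isLocalDiffeomorph_inr _)))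
        ((isLocalDiffeomorph_inr x).prodMap (isLocalDiffeomorphAt_id z))
  injective := by
    rintro ⟨i, x | x, z⟩ ⟨i', x' | x', z'⟩ h
    · have := A.injective (a₁ := ⟨i, x, z⟩) (a₂ := ⟨i', x', z'⟩) (Sum.inl_injective h)
      cases this; rfl
    · exact (Sum.inl_ne_inr h).elim
    · exact (Sum.inr_ne_inl h).elim
    · have := B.injective (a₁ := ⟨i, x, z⟩) (a₂ := ⟨i', x', z'⟩) (Sum.inr_injective h)
      cases this; rfl

end BSManifold

/-- A collar in one summand. -/
def Collar.inl {n : ℕ} {F : CompactManifold n} {W : CompactManifold (n + 1)} (c : Collar F W)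
    (W' : CompactManifold (n + 1)) : Collar F (W.sum W') where
  toFun z := Sum.inl (c.toFun z)
  isLocalDiffeomorph z := (c.isLocalDiffeomorph z).comp _ _ (isLocalDiffeomorph_inl _)
  injective := Sum.inl_injective.comp c.injective

/-- A collar in one summand. -/
def Collar.inr {n : ℕ} {F : CompactManifold n} {W : CompactManifold (n + 1)} (c : Collar F W)
    (W' : CompactManifold (n + 1)) : Collar F (W'.sum W) where
  toFun z := Sum.inr (c.toFun z)
  isLocalDiffeomorph z := (c.isLocalDiffeomorph z).comp _ _ (isLocalDiffeomorph_inr _)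
  injective := Sum.inr_injective.comp c.injective

theorem tderiv_derivAt {n : ℕ} {F : CompactManifold n} {W W' : CompactManifold (n + 1)}
    {c : Collar F W} {c' : Collar F W'} {f : W → W'} (hc : c'.toFun = f ∘ c.toFun) {x : F} {r : Ray}
    (hf : MDifferentiableAt (Q (n + 1)) (Q (n + 1)) f (c.toFun (x, r)))  (v : Eucl n) (t : ℝ) :
    c'.derivAt x r (v, t) = tderiv f (c.toFun (x, r)) (c.derivAt x r (v, t)) := by
  rw [c'.derivAt_apply, c.derivAt_apply, hc]
  have h := mfderiv_comp (x, r) hf (c.isLocalDiffeomorph.mdifferentiable (by simp) (x, r))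
  exact DFunLike.congr_fun h ((v, EuclideanSpace.single (0 : Fin 1) t) : Eucl n × Eucl 1)

/-- The derivative of the inclusion of a singular face is compatible with maps of manifolds with
singularities. -/
theorem BSManifold.tderiv_deriv {W W' : BSManifold P d} {i : J} {f : W.M → W'.M}
    {g : W.N i → W'.N i} (h : ∀ n p s, W'.ι i (g n, p, s) = f (W.ι i (n, p, s))) {n : W.N i}
    {p : P i} (hf : MDifferentiableAt (Q (k + (d + 1))) (Q (k + (d + 1))) f (W.face i n p))
    (hg : MDifferentiableAt (Q d) (Q d) g n) (v : Eucl d) (w : Eucl k) (t : ℝ) :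
    W'.deriv i (g n) p (tderiv g n v) w t =
      tderiv f (W.face i n p) (W.deriv i n p v w t) := by
  have h1 : W'.ι i ∘ Prod.map g (id : P i × Ray → P i × Ray) = f ∘ W.ι i :=
    funext fun z => h z.1 z.2.1 z.2.2
  have h2 := mfderiv_comp (n, p, (0 : Ray)) (f := Prod.map g (id : P i × Ray → P i × Ray))
    ((W'.isLocalDiffeomorph i).mdifferentiable (by simp) (g n, p, 0))
    (hg.prodMap (mdifferentiableAt_id (I := (Q k).prod (Q 1))))
  have h3 := mfderiv_comp (n, p, (0 : Ray)) hf
    ((W.isLocalDiffeomorph i).mdifferentiable (by simp) (n, p, 0))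
  rw [h1, h3, mfderiv_prodMap hg mdifferentiableAt_id, mfderiv_id] at h2
  exact (DFunLike.congr_fun h2 ((v, w, EuclideanSpace.single (0 : Fin 1) t) :
    Eucl d × Eucl k × Eucl 1)).symm

/-- In `CompatibleAt` the normal datum ν is an arbitrary function at a single point of N i, with no
linearity or continuity demanded. So it can be transported with any right inverse of the derivative
of g. -/
theorem BSManifold.CompatibleAt.map {W W' : BSManifold P d} {φP : ∀ i, StableFraming (P i)}
    {Φ : W.M → Eucl (k + (d + 1)) × (ℕ → ℝ) →ₗ[ℝ] Eucl (k + (d + 1)) × (ℕ → ℝ)}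
    {Φ' : W'.M → Eucl (k + (d + 1)) × (ℕ → ℝ) →ₗ[ℝ] Eucl (k + (d + 1)) × (ℕ → ℝ)}
    {i : J} {n : W.N i} (hΦ : W.CompatibleAt φP Φ i n) {f : W.M → W'.M} {g : W.N i → W'.N i}
    (h : ∀ n p s, W'.ι i (g n, p, s) = f (W.ι i (n, p, s)))
    (hf : MDifferentiable (Q (k + (d + 1))) (Q (k + (d + 1))) f)
    (hg : MDifferentiable (Q d) (Q d) g) (hg' : Function.Surjective (tderiv g n))
    (hΦ' : ∀ u v s, Φ' (f u) (tderiv f u v, s) = Φ u (v, s)) : W'.CompatibleAt φP Φ' i (g n) := by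
  obtain ⟨ν, hν⟩ := hΦ
  refine ⟨fun v t s => ν (Function.surjInv hg' v) t s, fun p v w t s => ?_⟩
  refine Eq.trans ?_ (hν p (Function.surjInv hg' v) w t s)
  have h1 := W.tderiv_deriv h (p := p) (hf _) (hg n) (Function.surjInv hg' v) w t
  rw [Function.surjInv_eq hg'] at h1
  have h2 : W'.face i (g n) p = f (W.face i n p) := h n p 0
  have h3 := hΦ' (W.face i n p) (W.deriv i n p (Function.surjInv hg' v) w t) s
  exact (congr_arg₂ (fun u (w : Eucl (k + (d + 1))) => Φ' u (w, s)) h2 h1).trans h3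

namespace Cob

variable {ι ι' : Type} {obj : ι → BSSingular P d X} {obj' : ι' → BSSingular P d X}

/-- The disjoint union. -/
def sum (B : Cob obj) (B' : Cob obj') : Cob (Sum.elim obj obj') where
  W := B.W.sum B'.W
  c j := match j with
    | Sum.inl j => (B.c j).inl B'.W.M
    | Sum.inr j => (B'.c j).inr B.W.M
  cN j i := match j with
    | Sum.inl j => (B.cN j i).inl (B'.W.N i)
    | Sum.inr j => (B'.cN j i).inr (B.W.N i)
  disjoint := by
    rintro (j | j) (j' | j') h z z' hz
    · exact B.disjoint j j' (fun e => h (congrArg _ e)) z z' (Sum.inl_injective hz)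
    · exact Sum.inl_ne_inr hz
    · exact Sum.inr_ne_inl hz
    · exact B'.disjoint j j' (fun e => h (congrArg _ e)) z z' (Sum.inr_injective hz)
  disjoint_N := by
    rintro (j | j) (j' | j') h i z z' hz
    · exact B.disjoint_N j j' (fun e => h (congrArg _ e)) i z z' (Sum.inl_injective hz)
    · exact Sum.inl_ne_inr hz
    · exact Sum.inr_ne_inl hz
    · exact B'.disjoint_N j j' (fun e => h (congrArg _ e)) i z z' (Sum.inr_injective hz)
  corner := by
    rintro (j | j) i x p s t
    · exact congrArg Sum.inl (B.corner j i x p s t)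
    · exact congrArg Sum.inr (B'.corner j i x p s t)
  mem_range := by
    rintro (j | j) i (n | n) p r a h
    · obtain ⟨x, rfl⟩ := B.mem_range j i n p r a (Sum.inl_injective h)
      exact ⟨x, rfl⟩
    · exact (Sum.inr_ne_inl h).elim
    · exact (Sum.inl_ne_inr h).elim
    · obtain ⟨x, rfl⟩ := B'.mem_range j i n p r a (Sum.inr_injective h)
      exact ⟨x, rfl⟩
  boundary_N := by
    rintro i p (n | n) h
    · obtain ⟨j, x, rfl⟩ := B.boundary_N i p n
        (((isLocalDiffeomorph_inl n).isBoundaryPoint_iff (by simp)).2 h)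
      exact ⟨Sum.inl j, x, rfl⟩
    · obtain ⟨j, x, rfl⟩ := B'.boundary_N i p n
        (((isLocalDiffeomorph_inr n).isBoundaryPoint_iff (by simp)).2 h)
      exact ⟨Sum.inr j, x, rfl⟩
  boundary := by
    rintro (w | w) h
    · rcases B.boundary w (((isLocalDiffeomorph_inl w).isBoundaryPoint_iff (by simp)).2 h) with
        ⟨j, x, rfl⟩ | ⟨i, n, p, rfl⟩
      · exact Or.inl ⟨Sum.inl j, x, rfl⟩
      · exact Or.inr ⟨i, Sum.inl n, p, rfl⟩
    · rcases B'.boundary w (((isLocalDiffeomorph_inr w).isBoundaryPoint_iff (by simp)).2 h) with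
        ⟨j, x, rfl⟩ | ⟨i, n, p, rfl⟩
      · exact Or.inl ⟨Sum.inr j, x, rfl⟩
      · exact Or.inr ⟨i, Sum.inr n, p, rfl⟩
  map := ⟨Sum.elim B.map B'.map, B.map.continuous.sumElim B'.map.continuous⟩
  map_compatible := by
    rintro i (n | n) p p'
    · exact B.map_compatible i n p p'
    · exact B'.map_compatible i n p p'
  map_face := by
    rintro (j | j) x
    · exact B.map_face j x
    · exact B'.map_face j x

theorem IsFramed.sum {B : Cob obj} {B' : Cob obj'} {φP : ∀ i, StableFraming (P i)}
    (ψ : ∀ j, StableFraming (Sum.elim obj obj' j).M) {ε : ι → ℝ} {ε' : ι' → ℝ}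
    (h : B.IsFramed φP (fun j => ψ (Sum.inl j)) ε)
    (h' : B'.IsFramed φP (fun j => ψ (Sum.inr j)) ε') :
    (B.sum B').IsFramed φP ψ (Sum.elim ε ε') := by
  obtain ⟨R, Φ, h1, h2, h3⟩ := h
  obtain ⟨R', Φ', h1', h2', h3'⟩ := h'
  obtain ⟨Θ, k1, k2, k3⟩ := (B.W.M.sumDisjointUnion B'.W.M).exists_framing
    (h1.mono (le_max_left R R')) (h1'.mono (le_max_right R R'))
  refine ⟨_, Θ, k1, ?_, ?_⟩
  · rintro i (n | n)
    · exact (h2 i n).map (W' := B.W.sum B'.W) (fun _ _ _ => rfl)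
        (isLocalDiffeomorph_inl.mdifferentiable (by simp))
        (isLocalDiffeomorph_inl.mdifferentiable (by simp))
        (tderiv_bijective (isLocalDiffeomorph_inl n)).2 k2
    · exact (h2' i n).map (W' := B.W.sum B'.W) (fun _ _ _ => rfl)
        (isLocalDiffeomorph_inr.mdifferentiable (by simp))
        (isLocalDiffeomorph_inr.mdifferentiable (by simp))
        (tderiv_bijective (isLocalDiffeomorph_inr n)).2 k3
  · rintro (j | j) x v t s
    · have := tderiv_derivAt (c := B.c j) (c' := (B.c j).inl B'.W.M) (f := Sum.inl) rfl
        (r := 0) (isLocalDiffeomorph_inl.mdifferentiable (by simp) _) (x := x) v t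
      exact (congrArg (fun u => Θ _ (u, s)) this).trans ((k2 _ _ _).trans (h3 j x v t s))
    · have := tderiv_derivAt (c := B'.c j) (c' := (B'.c j).inr B.W.M) (f := Sum.inr) rfl
        (r := 0) (isLocalDiffeomorph_inr.mdifferentiable (by simp) _) (x := x) v t
      exact (congrArg (fun u => Θ _ (u, s)) this).trans ((k3 _ _ _).trans (h3' j x v t s))

end Cob

end Cob

/-! ### Gluing manifolds with singularities -/

namespace Gluing

variable {n : ℕ} {F F' : CompactManifold n} {W : CompactManifold (n + 1)} {c c' : Collar F W}

theorem not_mem_range_face {b : F' × Ray → W} (hb : ∀ z z', b z ≠ c.toFun z') (z : F' × Ray) :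
    b z ∉ Set.range c.face := fun ⟨x, hx⟩ => hb z (x, 0) hx.symm

/-- A collar that is disjoint from the glued ones gives a collar in the glued manifold. -/
def collar (G : Gluing c c') (b : Collar F' W) (hb : ∀ z z', b.toFun z ≠ c.toFun z')
    (hb' : ∀ z z', b.toFun z ≠ c'.toFun z') : Collar F' G.Y where
  toFun := G.q ∘ b.toFun
  isLocalDiffeomorph z := (b.isLocalDiffeomorph z).comp _ _ (G.isLocalDiffeomorphAt_q _
    (not_mem_range_face hb z) (not_mem_range_face hb' z))
  injective z z' h := by
    rcases G.eq_of_q_eq _ _ h with h | ⟨x, h, -⟩ | ⟨x, h, -⟩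
    · exact b.injective h
    · exact absurd h (hb z (x, 0))
    · exact absurd h (hb' z (x, 0))

/-- A boundary point of the glued manifold comes from a boundary point off the glued faces or from a
boundary point of the face. -/
theorem exists_of_mem_boundary (G : Gluing c c') {y : G.Y} (hy : y ∈ G.Y.boundary) :
    (∃ w ∈ W.boundary, w ∉ Set.range c.face ∧ w ∉ Set.range c'.face ∧ G.q w = y) ∨
      ∃ x ∈ F.boundary, G.q (c.face x) = y := by
  have key : ∀ x, G.q (c.face x) = y → x ∈ F.boundary := by
    rintro x rfl
    have h := G.e_coord x 0
    have h1 : (Q (n + 1)).IsBoundaryPoint (G.e (x, Ray.coord 0)) := h ▸ hy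
    rcases isBoundaryPoint_prod.1 (((G.isLocalDiffeomorph_e _).isBoundaryPoint_iff
      (by simp)).2 h1) with h2 | h2
    · exact h2
    · exact absurd (show Ray.coord 0 ∈ ModelWithCorners.boundary (I := 𝓘(ℝ, ℝ)) ℝ from h2)
        (by rw [ModelWithCorners.Boundaryless.boundary_eq_empty]; exact id)
  obtain ⟨w, rfl⟩ := G.surjective y
  by_cases h : w ∈ Set.range c.face
  · obtain ⟨x, rfl⟩ := h
    exact Or.inr ⟨x, key x rfl, rfl⟩
  by_cases h' : w ∈ Set.range c'.face
  · obtain ⟨x, rfl⟩ := h'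
    exact Or.inr ⟨x, key x (G.q_face x), G.q_face x⟩
  exact Or.inl ⟨w, ((G.isLocalDiffeomorphAt_q w h h').isBoundaryPoint_iff (by simp)).2 hy, h, h',
    rfl⟩

end Gluing

section Glue

variable {k d : ℕ} {J : Type*} {P : J → CompactManifold k}

namespace BSManifold

variable {W : BSManifold P (d + 1)} {A : BSManifold P d} {c c' : Collar A.M W.M}
  {cN cN' : ∀ i, Collar (A.N i) (W.N i)}

section

variable (hc : ∀ i x (p : P i) s t, c.toFun (A.ι i (x, p, s), t) = W.ι i ((cN i).toFun (x, t), p, s))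
  (hc' : ∀ i x (p : P i) s t, c'.toFun (A.ι i (x, p, s), t) = W.ι i ((cN' i).toFun (x, t), p, s))
  (hm : ∀ i n p r a, W.ι i (n, p, r) = c.face a → n ∈ Set.range (cN i).face)
  (hm' : ∀ i n p r a, W.ι i (n, p, r) = c'.face a → n ∈ Set.range (cN' i).face)
  (G : Gluing c c') (GN : ∀ i, Gluing (cN i) (cN' i))

/-- The collar of the singular face after gluing. -/
def glueι (i : J) (z : (GN i).Y × P i × Ray) : G.Y :=
  G.q (W.ι i (Function.surjInv (GN i).surjective z.1, z.2))

-- The preimage chosen in `glueι` does not matter: the corner conditions send the two preimages of a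
-- seam point of N i to the two preimages of one seam point of M.
include hc hc' in
theorem glueι_q (i : J) (n : W.N i) (z : P i × Ray) :
    glueι G GN i ((GN i).q n, z) = G.q (W.ι i (n, z)) := by
  obtain ⟨p, s⟩ := z
  have key : ∀ x, G.q (W.ι i ((cN i).face x, p, s)) = G.q (W.ι i ((cN' i).face x, p, s)) :=
    fun x => by
      have h1 := hc i x p s 0
      have h2 := hc' i x p s 0
      have h3 := G.q_face (A.ι i (x, p, s))
      exact (congrArg G.q h1.symm).trans (h3.trans (congrArg G.q h2))
  rcases (GN i).eq_of_q_eq _ _ (Function.surjInv_eq (GN i).surjective ((GN i).q n)) with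
    h | ⟨x, h, rfl⟩ | ⟨x, h, rfl⟩
  · change G.q (W.ι i (Function.surjInv (GN i).surjective ((GN i).q n), p, s)) = _
    rw [h]
  · change G.q (W.ι i (Function.surjInv (GN i).surjective _, p, s)) = _
    rw [h]
    exact key x
  · change G.q (W.ι i (Function.surjInv (GN i).surjective _, p, s)) = _
    rw [h]
    exact (key x).symm

include hc hc' in
theorem glueι_e (i : J) (x : A.N i) (t : ℝ) (p : P i) (s : Ray) :
    glueι G GN i ((GN i).e (x, t), p, s) = G.e (A.ι i (x, p, s), t) := by
  rcases Gluing.exists_seam t with ⟨r, rfl⟩ | ⟨r, -, rfl⟩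
  · rw [(GN i).e_coord, glueι_q hc hc', G.e_coord, hc]
  · rw [(GN i).e_neg_coord, glueι_q hc hc', G.e_neg_coord, hc']

-- At the seam of N i, `glueι_e` expresses the map by G.e and the singular collar of A. Away from it
-- `glueι_q` expresses it by G.q, which is a local diffeomorphism there because `hm` and `hm'` keep
-- these points off the glued faces of W.
include hc hc' hm hm' in
theorem isLocalDiffeomorph_glueι (i : J) :
    IsLocalDiffeomorph ((Q (d + 1)).prod ((Q k).prod (Q 1))) (Q (k + (d + 1) + 1)) ∞
      (glueι G GN i) := by
  have seam : ∀ x z, IsLocalDiffeomorphAt ((Q (d + 1)).prod ((Q k).prod (Q 1)))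
      (Q (k + (d + 1) + 1)) ∞ (glueι G GN i) ((GN i).q ((cN i).face x), z) := by
    intro x z
    have h1 : (glueι G GN i) ∘ (Prod.map (GN i).e (id : P i × Ray → P i × Ray)) =
        G.e ∘ Prod.map (A.ι i) id ∘ fun z : (A.N i × ℝ) × P i × Ray => ((z.1.1, z.2), z.1.2) :=
      funext fun z => glueι_e hc hc' G GN i z.1.1 z.1.2 z.2.1 z.2.2
    have h2 : IsLocalDiffeomorphAt (((Q d).prod 𝓘(ℝ, ℝ)).prod ((Q k).prod (Q 1)))
        (Q (k + (d + 1) + 1)) ∞ (glueι G GN i ∘ Prod.map (GN i).e (id : P i × Ray → P i × Ray))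
        ((x, Ray.coord 0), z) := by
      rw [h1]
      exact ((isLocalDiffeomorph_prodRightComm _).comp _ _
        ((A.isLocalDiffeomorph i (x, z)).prodMap (isLocalDiffeomorphAt_id _))).comp _ _
        (G.isLocalDiffeomorph_e _)
    have h3 := h2.of_comp_right
      (((GN i).isLocalDiffeomorph_e (x, Ray.coord 0)).prodMap (isLocalDiffeomorphAt_id z))
    have h4 : Prod.map (GN i).e (id : P i × Ray → P i × Ray) ((x, Ray.coord 0), z) =
        ((GN i).q ((cN i).face x), z) := Prod.ext ((GN i).e_coord x 0) rfl
    rwa [h4] at h3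
  rintro ⟨y, z⟩
  obtain ⟨n, rfl⟩ := (GN i).surjective y
  by_cases h : n ∈ Set.range (cN i).face
  · obtain ⟨x, rfl⟩ := h
    exact seam x z
  by_cases h' : n ∈ Set.range (cN' i).face
  · obtain ⟨x, rfl⟩ := h'
    have := seam x z
    rwa [(GN i).q_face] at this
  refine IsLocalDiffeomorphAt.of_comp_right
    (f := Prod.map (GN i).q (id : P i × Ray → P i × Ray)) (x := (n, z)) ?_
    (((GN i).isLocalDiffeomorphAt_q n h h').prodMap (isLocalDiffeomorphAt_id z))
  have h1 : glueι G GN i ∘ Prod.map (GN i).q (id : P i × Ray → P i × Ray) = G.q ∘ W.ι i :=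
    funext fun z => glueι_q hc hc' G GN i z.1 z.2
  rw [h1]
  refine (W.isLocalDiffeomorph i (n, z)).comp _ _ (G.isLocalDiffeomorphAt_q _ ?_ ?_)
  · rintro ⟨a, ha⟩
    exact h (hm i n z.1 z.2 a ha.symm)
  · rintro ⟨a, ha⟩
    exact h' (hm' i n z.1 z.2 a ha.symm)

-- Two distinct points can collide only if they lie on opposite glued faces. The corner conditions
-- then lift both to the singular collar of A, which is injective.
include hc hc' hm hm' in
theorem glueι_injective :
    Function.Injective fun z : Σ i, (GN i).Y × P i × Ray => glueι G GN z.1 z.2 := by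
  have key : ∀ i i' n n' p p' s s' a, W.ι i (n, p, s) = c.face a → W.ι i' (n', p', s') = c'.face a →
      (⟨i, (GN i).q n, p, s⟩ : Σ i, (GN i).Y × P i × Ray) = ⟨i', (GN i').q n', p', s'⟩ := by
    intro i i' n n' p p' s s' a h h'
    obtain ⟨x, rfl⟩ := hm i n p s a h
    obtain ⟨x', rfl⟩ := hm' i' n' p' s' a h'
    have h1 : A.ι i (x, p, s) = a := c.face_injective ((hc i x p s 0).trans h)
    have h2 : A.ι i' (x', p', s') = a := c'.face_injective ((hc' i' x' p' s' 0).trans h')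
    have h3 := A.injective (a₁ := ⟨i, x, p, s⟩) (a₂ := ⟨i', x', p', s'⟩) (h1.trans h2.symm)
    cases h3
    rw [(GN i).q_face]
  rintro ⟨i, y, p, s⟩ ⟨i', y', p', s'⟩ h
  obtain ⟨n, rfl⟩ := (GN i).surjective y
  obtain ⟨n', rfl⟩ := (GN i').surjective y'
  have h1 : G.q (W.ι i (n, p, s)) = G.q (W.ι i' (n', p', s')) :=
    (glueι_q hc hc' G GN i n (p, s)).symm.trans (h.trans (glueι_q hc hc' G GN i' n' (p', s')))
  rcases G.eq_of_q_eq _ _ h1 with h | ⟨a, h, h'⟩ | ⟨a, h, h'⟩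
  · have h3 := W.injective (a₁ := ⟨i, n, p, s⟩) (a₂ := ⟨i', n', p', s'⟩) h
    cases h3
    rfl
  · exact key _ _ _ _ _ _ _ _ a h h'
  · exact (key _ _ _ _ _ _ _ _ a h' h).symm

/-- The result of gluing two boundary components of a manifold with singularities. -/
def glue : BSManifold P (d + 1) where
  M := G.Y
  N i := (GN i).Y
  finite := by
    refine W.finite.subset ?_
    rintro i ⟨y⟩
    obtain ⟨n, -⟩ := (GN i).surjective y
    exact ⟨n⟩
  ι := glueι G GN
  isLocalDiffeomorph := isLocalDiffeomorph_glueι hc hc' hm hm' G GN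
  injective := glueι_injective hc hc' hm hm' G GN

end

end BSManifold

namespace Cob

variable {X : Type*} [TopologicalSpace X] {ι : Type} {obj : ι → BSSingular P d X}
  {o : BSSingular P d X}

section

variable (B : Cob (Sum.elim obj fun _ : Bool => o)) (G : Gluing (B.c (Sum.inr true))
  (B.c (Sum.inr false))) (GN : ∀ i, Gluing (B.cN (Sum.inr true) i) (B.cN (Sum.inr false) i))

theorem map_eq_of_q_eq {w w' : B.W.M} (h : G.q w = G.q w') : B.map w = B.map w' := by
  have h1 : ∀ a, B.map ((B.c (Sum.inr true)).face a) = B.map ((B.c (Sum.inr false)).face a) :=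
    fun a => (B.map_face (Sum.inr true) a).trans (B.map_face (Sum.inr false) a).symm
  rcases G.eq_of_q_eq _ _ h with rfl | ⟨a, rfl, rfl⟩ | ⟨a, rfl, rfl⟩
  exacts [rfl, h1 a, (h1 a).symm]

/-- Gluing two isomorphic boundary components. -/
def glue : Cob obj where
  W := BSManifold.glue (A := o.toBSManifold) (B.corner (Sum.inr true)) (B.corner (Sum.inr false))
    (B.mem_range (Sum.inr true)) (B.mem_range (Sum.inr false)) G GN
  c j := G.collar (B.c (Sum.inl j)) (B.disjoint (Sum.inl j) (Sum.inr true) Sum.inl_ne_inr)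
    (B.disjoint (Sum.inl j) (Sum.inr false) Sum.inl_ne_inr)
  cN j i := (GN i).collar (B.cN (Sum.inl j) i) (B.disjoint_N (Sum.inl j) (Sum.inr true) Sum.inl_ne_inr i)
    (B.disjoint_N (Sum.inl j) (Sum.inr false) Sum.inl_ne_inr i)
  disjoint j j' h z z' hz := by
    rcases G.eq_of_q_eq _ _ hz with hz | ⟨a, hz, -⟩ | ⟨a, hz, -⟩
    · exact B.disjoint (Sum.inl j) (Sum.inl j') (Sum.inl_injective.ne h) z z' hz
    · exact B.disjoint (Sum.inl j) (Sum.inr true) Sum.inl_ne_inr z (a, 0) hz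
    · exact B.disjoint (Sum.inl j) (Sum.inr false) Sum.inl_ne_inr z (a, 0) hz
  disjoint_N j j' h i z z' hz := by
    rcases (GN i).eq_of_q_eq _ _ hz with hz | ⟨a, hz, -⟩ | ⟨a, hz, -⟩
    · exact B.disjoint_N (Sum.inl j) (Sum.inl j') (Sum.inl_injective.ne h) i z z' hz
    · exact B.disjoint_N (Sum.inl j) (Sum.inr true) Sum.inl_ne_inr i z (a, 0) hz
    · exact B.disjoint_N (Sum.inl j) (Sum.inr false) Sum.inl_ne_inr i z (a, 0) hz
  corner j i x p s t := by
    refine Eq.trans ?_ (BSManifold.glueι_q (A := o.toBSManifold) (B.corner (Sum.inr true))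
      (B.corner (Sum.inr false)) G GN i ((B.cN (Sum.inl j) i).toFun (x, t)) (p, s)).symm
    exact congrArg G.q (B.corner (Sum.inl j) i x p s t)
  mem_range j i y p r a h := by
    obtain ⟨n, rfl⟩ := (GN i).surjective y
    have h1 := (BSManifold.glueι_q (A := o.toBSManifold) (B.corner (Sum.inr true))
      (B.corner (Sum.inr false)) G GN i n (p, r)).symm.trans h
    rcases G.eq_of_q_eq _ _ h1 with h | ⟨b, -, h⟩ | ⟨b, -, h⟩
    · obtain ⟨x, rfl⟩ := B.mem_range (Sum.inl j) i n p r a h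
      exact ⟨x, rfl⟩
    · exact absurd h (B.disjoint (Sum.inl j) (Sum.inr false) Sum.inl_ne_inr (a, 0) (b, 0))
    · exact absurd h (B.disjoint (Sum.inl j) (Sum.inr true) Sum.inl_ne_inr (a, 0) (b, 0))
  boundary_N i p y hy := by
    rcases (GN i).exists_of_mem_boundary hy with ⟨n, hn, h1, h2, rfl⟩ | ⟨x, hx, -⟩
    · obtain ⟨j | j | j, x, rfl⟩ := B.boundary_N i p n hn
      · exact ⟨j, x, rfl⟩
      · exact absurd ⟨x, rfl⟩ h2
      · exact absurd ⟨x, rfl⟩ h1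
    -- The seam of N i adds no boundary, because the glued component o is closed.
    · have : (o.N i).boundary = ∅ := o.closed.boundary_N i p
      exact absurd hx (by
        change x ∉ (o.N i).boundary
        rw [this]; exact id)
  boundary y hy := by
    have hq : ∀ i n p, G.q (B.W.face i n p) ∈ (BSManifold.glue (A := o.toBSManifold)
        (B.corner (Sum.inr true)) (B.corner (Sum.inr false)) (B.mem_range (Sum.inr true))
        (B.mem_range (Sum.inr false)) G GN).singularFace := fun i n p =>
      ⟨i, (GN i).q n, p, BSManifold.glueι_q (A := o.toBSManifold) (B.corner (Sum.inr true))
        (B.corner (Sum.inr false)) G GN i n (p, 0)⟩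
    rcases G.exists_of_mem_boundary hy with ⟨w, hw, h1, h2, rfl⟩ | ⟨a, ha, rfl⟩
    · rcases B.boundary w hw with ⟨j | j | j, x, rfl⟩ | ⟨i, n, p, rfl⟩
      · exact Or.inl ⟨j, x, rfl⟩
      · exact absurd ⟨x, rfl⟩ h2
      · exact absurd ⟨x, rfl⟩ h1
      · exact Or.inr (hq i n p)
    -- The only boundary of the closed o is its singular face, which the corner condition carries
    -- into the singular face of the glued manifold.
    · have ha' : a ∈ o.singularFace := by
        have := o.closed
        rw [BSManifold.IsClosed] at this
        rw [← this]; exact ha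
      obtain ⟨i, x, p, rfl⟩ := ha'
      have h1 := B.corner (Sum.inr true) i x p 0 0
      have h2 := hq i ((B.cN (Sum.inr true) i).toFun (x, 0)) p
      refine Or.inr ?_
      rw [BSManifold.face, ← h1] at h2
      exact h2
  map := ⟨fun y => B.map (Function.surjInv G.surjective y),
    G.isQuotientMap.continuous_iff.2 (B.map.continuous.congr fun _ =>
      B.map_eq_of_q_eq G (Function.surjInv_eq G.surjective _).symm)⟩
  map_compatible i y p p' := by
    obtain ⟨n, rfl⟩ := (GN i).surjective y
    have h : ∀ p, B.map (Function.surjInv G.surjective (BSManifold.glueι (A := o.toBSManifold)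
        G GN i ((GN i).q n, p, 0))) = B.map (B.W.face i n p) := fun p =>
      B.map_eq_of_q_eq G ((Function.surjInv_eq G.surjective _).trans
        (BSManifold.glueι_q (A := o.toBSManifold) (B.corner (Sum.inr true))
          (B.corner (Sum.inr false)) G GN i n (p, 0)))
    exact (h p).trans ((B.map_compatible i n p p').trans (h p').symm)
  map_face j x := (B.map_eq_of_q_eq G (Function.surjInv_eq G.surjective _)).trans
    (B.map_face (Sum.inl j) x)

/-- Opposite signs ε at the two copies of o mean that their restrictions agree after the normal
coordinate is reversed, as `Gluing.exists_framing` demands. -/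
theorem IsFramed.glue {B : Cob (Sum.elim obj fun _ : Bool => o)} {φP : ∀ i, StableFraming (P i)}
    {ψ : ∀ j, StableFraming (Sum.elim obj (fun _ : Bool => o) j).M} {ε : ι ⊕ Bool → ℝ}
    (h : B.IsFramed φP ψ ε) (hψ : ψ (Sum.inr true) = ψ (Sum.inr false))
    (hε : ε (Sum.inr false) = -ε (Sum.inr true))
    (G : Gluing (B.c (Sum.inr true)) (B.c (Sum.inr false)))
    (GN : ∀ i, Gluing (B.cN (Sum.inr true) i) (B.cN (Sum.inr false) i)) :
    (B.glue G GN).IsFramed φP (fun j => ψ (Sum.inl j)) fun j => ε (Sum.inl j) := by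
  obtain ⟨R, Φ, h1, h2, h3⟩ := h
  obtain ⟨Φ', k1, k2⟩ := G.exists_framing h1 (by
    intro x v t s
    refine (h3 (Sum.inr true) x v t s).trans (Eq.trans ?_ (h3 (Sum.inr false) x v (-t) s).symm)
    have h4 : ∀ a : ℝ, ε (Sum.inr true) * a = ε (Sum.inr false) * -a := fun a => by rw [hε]; ring
    rw [h4, hψ]
    rfl)
  refine ⟨R, Φ', k1, fun i y => ?_, fun j x v t s => ?_⟩
  · obtain ⟨n, rfl⟩ := (GN i).surjective y
    exact (h2 i n).map (W' := (B.glue G GN).W)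
      (fun n p s => BSManifold.glueι_q (A := o.toBSManifold) (B.corner (Sum.inr true))
          (B.corner (Sum.inr false)) G GN i n (p, s))
      G.mdifferentiable_q (GN i).mdifferentiable_q ((GN i).mfderiv_q_bijective n).2 k2
  · have := tderiv_derivAt (c := B.c (Sum.inl j)) (c' := (B.glue G GN).c j) (f := G.q) rfl
      (r := 0) (G.mdifferentiable_q _) (x := x) v t
    exact (congrArg (fun u => Φ' _ (u, s)) this).trans ((k2 _ _ _).trans (h3 (Sum.inl j) x v t s))

end

end Cob

end Glue

/-- Precomposition of a collar with an open embedding. -/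
def Collar.precomp {n : ℕ} {F F' : CompactManifold n} {W : CompactManifold (n + 1)}
    (c : Collar F W) {f : F' → F} (hf : IsLocalDiffeomorph (Q n) (Q n) ∞ f)
    (hf' : Function.Injective f) : Collar F' W where
  toFun z := c.toFun (f z.1, z.2)
  isLocalDiffeomorph z :=
    ((hf z.1).prodMap (isLocalDiffeomorphAt_id z.2)).comp _ _ (c.isLocalDiffeomorph (f z.1, z.2))
  injective := c.injective.comp (hf'.prodMap Function.injective_id)

theorem Collar.precomp_derivAt {n : ℕ} {F F' : CompactManifold n} {W : CompactManifold (n + 1)}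
    (c : Collar F W) {f : F' → F} (hf : IsLocalDiffeomorph (Q n) (Q n) ∞ f)
    (hf' : Function.Injective f) (x : F') (r : Ray) (v : Eucl n) (t : ℝ) :
    (c.precomp hf hf').derivAt x r (v, t) = c.derivAt (f x) r (tderiv f x v, t) := by
  rw [Collar.derivAt_apply, Collar.derivAt_apply]
  have hm := hf.mdifferentiable (by simp) x
  have h := mfderiv_comp (x, r) (f := Prod.map f (id : Ray → Ray))
    (c.isLocalDiffeomorph.mdifferentiable (by simp) (f x, r))
    (hm.prodMap (mdifferentiableAt_id (I := Q 1)))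
  rw [mfderiv_prodMap hm mdifferentiableAt_id, mfderiv_id] at h
  exact DFunLike.congr_fun h ((v, EuclideanSpace.single (0 : Fin 1) t) : Eucl n × Eucl 1)

/-! ### Cylinders on manifolds with singularities -/

section Cylinder

variable {k d : ℕ} {J : Type*} {P : J → CompactManifold k}

namespace BSManifold

variable (C : BSManifold P d)

/-- The singular collar of the cylinder. -/
def cylinderι (i : J) (z : (C.N i).cylinder × P i × Ray) : C.M.cylinder :=
  C.M.toProd interval (C.ι i ((((C.N i).toProd interval).symm z.1).1, z.2),
    (((C.N i).toProd interval).symm z.1).2)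

theorem cylinderι_comp (i : J) : C.cylinderι i ∘
    Prod.map ((C.N i).toProd interval) (id : P i × Ray → P i × Ray) =
      C.M.toProd interval ∘ Prod.map (C.ι i) (id : interval → interval) ∘
        fun z : (C.N i × interval) × P i × Ray => ((z.1.1, z.2), z.1.2) := rfl

theorem isLocalDiffeomorph_cylinderι (i : J) :
    IsLocalDiffeomorph ((Q (d + 1)).prod ((Q k).prod (Q 1))) (Q (k + (d + 1) + 1)) ∞
      (C.cylinderι i) := by
  rintro ⟨y, z⟩
  obtain ⟨⟨x, t⟩, rfl⟩ := ((C.N i).toProd interval).surjective y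
  refine IsLocalDiffeomorphAt.of_comp_right
    (f := Prod.map ((C.N i).toProd interval) (id : P i × Ray → P i × Ray)) (x := ((x, t), z)) ?_
    (((C.N i).isLocalDiffeomorph_toProd interval _).prodMap (isLocalDiffeomorphAt_id z))
  rw [cylinderι_comp]
  exact ((isLocalDiffeomorph_prodRightComm _).comp _ _
    ((C.isLocalDiffeomorph i (x, z)).prodMap (isLocalDiffeomorphAt_id t))).comp _ _
    (C.M.isLocalDiffeomorph_toProd interval _)

/-- The cylinder `C × [0,1]`. -/
def cylinder : BSManifold P (d + 1) where
  M := C.M.cylinder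
  N i := (C.N i).cylinder
  finite := by
    refine C.finite.subset ?_
    rintro i ⟨y⟩
    exact ⟨(((C.N i).toProd interval).symm y).1⟩
  ι := C.cylinderι
  isLocalDiffeomorph := C.isLocalDiffeomorph_cylinderι
  injective := by
    rintro ⟨i, y, z⟩ ⟨i', y', z'⟩ h
    obtain ⟨⟨x, t⟩, rfl⟩ := ((C.N i).toProd interval).surjective y
    obtain ⟨⟨x', t'⟩, rfl⟩ := ((C.N i').toProd interval).surjective y'
    have h1 := (C.M.toProd interval).injective h
    have h2 := C.injective (a₁ := ⟨i, x, z⟩) (a₂ := ⟨i', x', z'⟩) (congrArg Prod.fst h1)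
    have h3 : t = t' := congrArg Prod.snd h1
    cases h2
    rw [h3]

theorem cylinder_deriv (i : J) (x : C.N i) (y : interval) (p : P i) (v : Eucl d) (a : Eucl 1)
    (w : Eucl k) (t : ℝ) : C.cylinder.deriv i ((C.N i).toProd interval (x, y)) p
      (mfderiv ((Q d).prod (Q 1)) (Q (d + 1)) ((C.N i).toProd interval) (x, y)
        ((v, a) : Eucl d × Eucl 1)) w t =
      mfderiv ((Q (k + (d + 1))).prod (Q 1)) (Q (k + (d + 1) + 1)) (C.M.toProd interval)
        (C.face i x p, y) ((C.deriv i x p v w t, a) : Eucl (k + (d + 1)) × Eucl 1) := by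
  have m1 : MDifferentiableAt ((Q d).prod (Q 1)) (Q (d + 1)) ((C.N i).toProd interval) (x, y) :=
    ((C.N i).isLocalDiffeomorph_toProd interval).mdifferentiable (by simp) _
  have h1 := mfderiv_comp ((x, y), p, (0 : Ray))
    (f := Prod.map ((C.N i).toProd interval) (id : P i × Ray → P i × Ray))
    ((C.isLocalDiffeomorph_cylinderι i).mdifferentiable (by simp)
      ((C.N i).toProd interval (x, y), p, 0))
    (m1.prodMap (mdifferentiableAt_id (I := (Q k).prod (Q 1))))
  rw [mfderiv_prodMap m1 mdifferentiableAt_id, mfderiv_id, cylinderι_comp] at h1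
  have h2 : HasMFDerivAt (((Q d).prod (Q 1)).prod ((Q k).prod (Q 1))) ((Q d).prod ((Q k).prod (Q 1)))
      (fun z : (C.N i × interval) × P i × Ray => (z.1.1, z.2)) ((x, y), p, 0) _ :=
    ((hasMFDerivAt_fst ((x, y) : C.N i × interval)).comp ((x, y), p, (0 : Ray))
      (hasMFDerivAt_fst _)).prodMk (hasMFDerivAt_snd _)
  have h3 : HasMFDerivAt ((Q d).prod ((Q k).prod (Q 1))) (Q (k + (d + 1))) (C.ι i) (x, p, 0) _ :=
    ((C.isLocalDiffeomorph i).mdifferentiable (by simp) _).hasMFDerivAt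
  have h4 : HasMFDerivAt ((Q (k + (d + 1))).prod (Q 1)) (Q (k + (d + 1) + 1))
      (C.M.toProd interval) (C.ι i (x, p, 0), y) _ :=
    ((C.M.isLocalDiffeomorph_toProd interval).mdifferentiable (by simp) _).hasMFDerivAt
  have h5 := (h4.comp ((x, y), p, (0 : Ray)) ((h3.comp ((x, y), p, (0 : Ray)) h2).prodMk
    ((hasMFDerivAt_snd ((x, y) : C.N i × interval)).comp ((x, y), p, (0 : Ray))
      (hasMFDerivAt_fst _)))).mfderiv
  have h6 := h1.symm.trans h5
  exact DFunLike.congr_fun h6 (((v, a), w, EuclideanSpace.single (0 : Fin 1) t) :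
    (Eucl d × Eucl 1) × Eucl k × Eucl 1)

end BSManifold

end Cylinder

/-! ### Disjoint unions as boundaries of cylinders -/

section Union

variable {k d : ℕ} {J : Type*} {P : J → CompactManifold k}

theorem DisjointUnion.injective_a {n : ℕ} {A B C : CompactManifold n} (u : DisjointUnion A B C) :
    Function.Injective u.a := fun _ _ h =>
  Sum.inl_injective (u.bijective.1 (a₁ := Sum.inl _) (a₂ := Sum.inl _) h)

theorem DisjointUnion.injective_b {n : ℕ} {A B C : CompactManifold n} (u : DisjointUnion A B C) :
    Function.Injective u.b := fun _ _ h =>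
  Sum.inr_injective (u.bijective.1 (a₁ := Sum.inr _) (a₂ := Sum.inr _) h)

theorem DisjointUnion.a_ne_b {n : ℕ} {A B C : CompactManifold n} (u : DisjointUnion A B C) (x : A)
    (y : B) : u.a x ≠ u.b y := fun h =>
  Sum.inl_ne_inr (u.bijective.1 (a₁ := Sum.inl x) (a₂ := Sum.inr y) h)

theorem DisjointUnion.mem_range {n : ℕ} {A B C : CompactManifold n} (u : DisjointUnion A B C)
    (z : C) : z ∈ Set.range u.a ∨ z ∈ Set.range u.b := by
  obtain ⟨x | x, rfl⟩ := u.bijective.2 z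
  exacts [Or.inl ⟨x, rfl⟩, Or.inr ⟨x, rfl⟩]

/-- The coordinate of [0,1] comes last, so by `append_snoc` it joins the normal datum ν, and the
factor φP i is untouched. -/
theorem BSManifold.CompatibleAt.cylinder {C : BSManifold P d} {φP : ∀ i, StableFraming (P i)}
    {Φ : C.M → Eucl (k + (d + 1)) × (ℕ → ℝ) →ₗ[ℝ] Eucl (k + (d + 1)) × (ℕ → ℝ)}
    {Φ' : C.M.cylinder → Eucl (k + (d + 1) + 1) × (ℕ → ℝ) →ₗ[ℝ] Eucl (k + (d + 1) + 1) × (ℕ → ℝ)}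
    (hΦ' : ∀ x y (v : Eucl (k + (d + 1))) (w : Eucl 1) s, Φ' (C.M.toProd interval (x, y))
        (mfderiv ((Q (k + (d + 1))).prod (Q 1)) (Q (k + (d + 1) + 1)) (C.M.toProd interval) (x, y)
          ((v, w) : Eucl (k + (d + 1)) × Eucl 1), s) =
        (snoc (Φ x (v, s)).1 (mfderiv (Q 1) 𝓘(ℝ, ℝ) interval.coord y w), (Φ x (v, s)).2))
    {i : J} {x : C.N i} (hΦ : C.CompatibleAt φP Φ i x) (y : interval) :
    C.cylinder.CompatibleAt φP Φ' i ((C.N i).toProd interval (x, y)) := by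
  obtain ⟨ν, hν⟩ := hΦ
  have hD := ((C.N i).isLocalDiffeomorph_toProd interval (x, y)).mfderiv_bijective.2
  let D : Eucl (d + 1) → Eucl d × Eucl 1 := Function.surjInv hD
  refine ⟨fun v t s => (snoc (ν (D v).1 t s).1
    (mfderiv (Q 1) 𝓘(ℝ, ℝ) interval.coord y (D v).2), (ν (D v).1 t s).2), fun p v w t s => ?_⟩
  have h1 := C.cylinder_deriv i x y p (D v).1 (D v).2 w t
  have h2 : mfderiv ((Q d).prod (Q 1)) (Q (d + 1)) ((C.N i).toProd interval) (x, y)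
      (((D v).1, (D v).2) : Eucl d × Eucl 1) = v := Function.surjInv_eq hD v
  rw [h2] at h1
  refine (congrArg (fun u : Eucl (k + (d + 1) + 1) => Φ' (C.M.toProd interval (C.face i x p, y))
    (u, s)) h1).trans ((hΦ' _ y _ _ s).trans ?_)
  have h3 := hν p (D v).1 w t s
  refine (congrArg (fun u : Eucl (k + (d + 1)) × (ℕ → ℝ) => (snoc u.1
    (mfderiv (Q 1) 𝓘(ℝ, ℝ) interval.coord y (D v).2), u.2)) h3).trans ?_
  exact Prod.ext (append_snoc _ _ _).symm rfl

variable {X : Type*} [TopologicalSpace X] {A B C : BSSingular P d X}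

/-- For a disjoint union `C = A ⊔ B`, the cylinder `C × [0,1]`, with boundary components
`C`, `A` and `B`. -/
def BSManifold.DisjointUnion.toCob
    (u : BSManifold.DisjointUnion A.toBSManifold B.toBSManifold C.toBSManifold)
    (hA : ∀ x, C.map (u.total.a x) = A.map x) (hB : ∀ x, C.map (u.total.b x) = B.map x) :
    Cob (fun j : Option Bool => j.elim C fun b => cond b A B) where
  W := C.cylinder
  c j := match j with
    | none => C.M.cylinderLo
    | some true => C.M.cylinderHi.precomp u.total.isLocalDiffeomorph_a u.total.injective_a
    | some false => C.M.cylinderHi.precomp u.total.isLocalDiffeomorph_b u.total.injective_b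
  cN j i := match j with
    | none => (C.N i).cylinderLo
    | some true =>
      (C.N i).cylinderHi.precomp (u.sing i).isLocalDiffeomorph_a (u.sing i).injective_a
    | some false =>
      (C.N i).cylinderHi.precomp (u.sing i).isLocalDiffeomorph_b (u.sing i).injective_b
  disjoint := by
    rintro (_ | _ | _) (_ | _ | _) h z z' hz
    · exact h rfl
    · exact C.M.cylinder_disjoint _ _ hz
    · exact C.M.cylinder_disjoint _ _ hz
    · exact C.M.cylinder_disjoint _ _ hz.symm
    · exact h rfl
    · exact u.total.a_ne_b _ _ (congrArg Prod.fst (C.M.cylinderHi.injective hz)).symm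
    · exact C.M.cylinder_disjoint _ _ hz.symm
    · exact u.total.a_ne_b _ _ (congrArg Prod.fst (C.M.cylinderHi.injective hz))
    · exact h rfl
  disjoint_N := by
    rintro (_ | _ | _) (_ | _ | _) h i z z' hz
    · exact h rfl
    · exact (C.N i).cylinder_disjoint _ _ hz
    · exact (C.N i).cylinder_disjoint _ _ hz
    · exact (C.N i).cylinder_disjoint _ _ hz.symm
    · exact h rfl
    · exact (u.sing i).a_ne_b _ _ (congrArg Prod.fst ((C.N i).cylinderHi.injective hz)).symm
    · exact (C.N i).cylinder_disjoint _ _ hz.symm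
    · exact (u.sing i).a_ne_b _ _ (congrArg Prod.fst ((C.N i).cylinderHi.injective hz))
    · exact h rfl
  corner := by
    rintro (_ | _ | _) i x p s t
    · rfl
    · exact congrArg (fun y => C.M.cylinderHi.toFun (y, t)) (u.compatible_b i x p s)
    · exact congrArg (fun y => C.M.cylinderHi.toFun (y, t)) (u.compatible_a i x p s)
  mem_range := by
    rintro (_ | _ | _) i n p r a h
    all_goals
      obtain ⟨⟨x, y⟩, rfl⟩ := ((C.N i).toProd interval).surjective n
      have h1 := (C.M.toProd interval).injective h
      have h2 := congrArg Prod.fst h1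
      obtain rfl := congrArg Prod.snd h1
    · exact ⟨x, rfl⟩
    · rcases (u.sing i).mem_range x with ⟨x', rfl⟩ | ⟨x', rfl⟩
      · exact absurd ((u.compatible_a i x' p r).trans h2) (u.total.a_ne_b _ _)
      · exact ⟨x', rfl⟩
    · rcases (u.sing i).mem_range x with ⟨x', rfl⟩ | ⟨x', rfl⟩
      · exact ⟨x', rfl⟩
      · exact absurd ((u.compatible_b i x' p r).trans h2).symm (u.total.a_ne_b _ _)
  boundary_N i p n hn := by
    rw [show (C.cylinder.N i).boundary = _ from
      (C.N i).cylinder_boundary (C.closed.boundary_N i p)] at hn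
    rcases hn with ⟨x, rfl⟩ | ⟨x, rfl⟩
    · exact ⟨none, x, rfl⟩
    · rcases (u.sing i).mem_range x with ⟨x', rfl⟩ | ⟨x', rfl⟩
      · exact ⟨some true, x', rfl⟩
      · exact ⟨some false, x', rfl⟩
  boundary w hw := by
    obtain ⟨⟨m, y⟩, rfl⟩ := (C.M.toProd interval).surjective w
    rcases (C.M.toProd_mem_boundary_iff interval).1 hw with h | h
    · have hm : m ∈ C.singularFace := by
        have := C.closed
        rw [BSManifold.IsClosed] at this
        rw [← this]; exact h
      obtain ⟨i, x, p, rfl⟩ := hm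
      exact Or.inr ⟨i, (C.N i).toProd interval (x, y), p, rfl⟩
    · rcases interval.boundary_subset h with rfl | rfl
      · exact Or.inl ⟨none, m, rfl⟩
      · rcases u.total.mem_range m with ⟨x', rfl⟩ | ⟨x', rfl⟩
        · exact Or.inl ⟨some true, x', rfl⟩
        · exact Or.inl ⟨some false, x', rfl⟩
  map := C.map.comp ⟨fun w => ((C.M.toProd interval).symm w).1,
    continuous_fst.comp (C.M.toProd interval).symm.continuous⟩
  map_compatible := by
    intro i n p p'
    obtain ⟨⟨x, y⟩, rfl⟩ := ((C.N i).toProd interval).surjective n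
    exact C.map_compatible i x p p'
  map_face := by
    rintro (_ | _ | _) x
    · rfl
    · exact hB x
    · exact hA x

/-- The lower end C is incoming, and the two pieces A and B of the upper end are outgoing. So the
relation [C] - [A] - [B] = 0 is represented by a signed family that bounds. -/
theorem BSManifold.DisjointUnion.isFramed_toCob
    (u : BSManifold.DisjointUnion A.toBSManifold B.toBSManifold C.toBSManifold)
    (hA : ∀ x, C.map (u.total.a x) = A.map x) (hB : ∀ x, C.map (u.total.b x) = B.map x)
    {φP : ∀ i, StableFraming (P i)} (φ : C.Framing φP)
    (ψ : ∀ j : Option Bool, StableFraming (j.elim C fun b => cond b A B).M)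
    (hψ : ψ none = φ.total)
    (hu : u.total.Compatible (ψ (some true)) (ψ (some false)) φ.total) :
    (u.toCob hA hB).IsFramed φP ψ fun j => j.elim 1 fun _ => -1 := by
  obtain ⟨Φ', h1, h2, h3, h4⟩ := φ.total.isFraming.exists_cylinder
  refine ⟨_, Φ', h1, fun i n => ?_, ?_⟩
  · obtain ⟨⟨x, y⟩, rfl⟩ := ((C.N i).toProd interval).surjective n
    exact (φ.compatibleAt i x).cylinder h2 y
  · rintro (_ | _ | _) x v t s
    · refine (h3 x v t s).trans ?_
      rw [hψ]
      exact Prod.ext (congrArg (snoc (φ.total.toLin x (v, s)).1) (one_mul t).symm :) rfl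
    · have h5 := C.M.cylinderHi.precomp_derivAt u.total.isLocalDiffeomorph_b u.total.injective_b
        x 0 v t
      refine (congrArg (fun w => Φ' (C.M.cylinderHi.face (u.total.b x)) (w, s)) h5).trans
        ((h4 _ _ t s).trans ?_)
      have h6 : φ.total.toLin (u.total.b x) (tderiv u.total.b x v, s) =
        (ψ (some false)).toLin x (v, s) := hu.2 x v s
      rw [h6]
      exact Prod.ext (congrArg (snoc ((ψ (some false)).toLin x (v, s)).1) (neg_one_mul t).symm :) rfl
    · have h5 := C.M.cylinderHi.precomp_derivAt u.total.isLocalDiffeomorph_a u.total.injective_a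
        x 0 v t
      refine (congrArg (fun w => Φ' (C.M.cylinderHi.face (u.total.a x)) (w, s)) h5).trans
        ((h4 _ _ t s).trans ?_)
      have h6 : φ.total.toLin (u.total.a x) (tderiv u.total.a x v, s) =
        (ψ (some true)).toLin x (v, s) := hu.1 x v s
      rw [h6]
      exact Prod.ext (congrArg (snoc ((ψ (some true)).toLin x (v, s)).1) (neg_one_mul t).symm :) rfl

end Union

/-! ### Formal sums -/

section FormalSums

variable {S : Type*}

/-- The element of the free abelian group represented by a multiset of signed generators. -/
def formalSum (m : Multiset (S × Bool)) : FreeAbelianGroup S :=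
  (m.map fun t => cond t.2 (FreeAbelianGroup.of t.1) (-FreeAbelianGroup.of t.1)).sum

theorem formalSum_add (m m' : Multiset (S × Bool)) :
    formalSum (m + m') = formalSum m + formalSum m' := by
  simp [formalSum]

theorem formalSum_cons (t : S × Bool) (m : Multiset (S × Bool)) :
    formalSum (t ::ₘ m)
      = cond t.2 (FreeAbelianGroup.of t.1) (-FreeAbelianGroup.of t.1) + formalSum m := by
  simp [formalSum]

theorem formalSum_neg (m : Multiset (S × Bool)) :
    formalSum (m.map fun t => (t.1, !t.2)) = -formalSum m := by
  induction m using Multiset.induction with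
  | empty => simp [formalSum]
  | cons t m ih =>
    rw [Multiset.map_cons, formalSum_cons, formalSum_cons, ih, neg_add]
    obtain ⟨t, b⟩ := t
    cases b <;> simp

-- The homomorphism on the right reads off the coefficient of s. Hence a multiset without cancelling
-- pairs is determined by its formal sum.
open Classical in
theorem count_sub_count_eq_lift (m : Multiset (S × Bool)) (s : S) :
    (m.count (s, true) : ℤ) - m.count (s, false)
      = FreeAbelianGroup.lift (fun x => if s = x then (1 : ℤ) else 0) (formalSum m) := by
  induction m using Multiset.induction with
  | empty => simp [formalSum]
  | cons t m ih =>
    rw [formalSum_cons, map_add, ← ih]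
    obtain ⟨t, b⟩ := t
    cases b <;> by_cases h : s = t <;> simp [h] <;> ring

theorem exists_formalSum_eq_of_mem_closure {rel : Set (FreeAbelianGroup S)}
    {Null : Multiset (S × Bool) → Prop} (zero : Null 0)
    (add : ∀ m m', Null m → Null m' → Null (m + m'))
    (neg : ∀ m, Null m → Null (m.map fun t => (t.1, !t.2)))
    (relation : ∀ z ∈ rel, ∃ m, Null m ∧ formalSum m = z) {z : FreeAbelianGroup S}
    (hz : z ∈ AddSubgroup.closure rel) : ∃ m, Null m ∧ formalSum m = z := by
  induction hz using AddSubgroup.closure_induction with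
  | mem z hz => exact relation z hz
  | zero => exact ⟨0, zero, by simp [formalSum]⟩
  | add a b _ _ ha hb =>
    obtain ⟨m, hm, rfl⟩ := ha
    obtain ⟨m', hm', rfl⟩ := hb
    exact ⟨m + m', add _ _ hm hm', formalSum_add _ _⟩
  | neg a _ ha =>
    obtain ⟨m, hm, rfl⟩ := ha
    exact ⟨_, neg _ hm, formalSum_neg _⟩

open Classical in
/-- If a class of multisets of signed generators is closed under sums, negation and cancellation and
represents the relations, then it contains the reduced representatives of the consequences of the
relations. -/
theorem null_pair_of_sub_mem_closure {rel : Set (FreeAbelianGroup S)}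
    {Null : Multiset (S × Bool) → Prop} (zero : Null 0)
    (add : ∀ m m', Null m → Null m' → Null (m + m'))
    (neg : ∀ m, Null m → Null (m.map fun t => (t.1, !t.2)))
    (cancel : ∀ s m, Null ((s, true) ::ₘ (s, false) ::ₘ m) → Null m)
    (relation : ∀ z ∈ rel, ∃ m, Null m ∧ formalSum m = z) {s s' : S} (hs : s ≠ s')
    (h : FreeAbelianGroup.of s - FreeAbelianGroup.of s' ∈ AddSubgroup.closure rel) :
    Null {(s, true), (s', false)} := by
  obtain ⟨m, hm, hz⟩ := exists_formalSum_eq_of_mem_closure zero add neg relation h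
  -- Cancelling pairs are removed one at a time, which leaves the formal sum unchanged. A multiset
  -- without such pairs is the reduced word of its sum, and for s ≠ s' the reduced word of s - s' is
  -- the required pair; for s = s' it would be empty.
  induction hn : m.card using Nat.strong_induction_on generalizing m with
  | _ n ih =>
    by_cases hc : ∃ t, (t, true) ∈ m ∧ (t, false) ∈ m
    · obtain ⟨t, h1, h2⟩ := hc
      obtain ⟨m', rfl⟩ := Multiset.exists_cons_of_mem h1
      obtain ⟨m'', rfl⟩ := Multiset.exists_cons_of_mem
        ((Multiset.mem_cons.1 h2).resolve_left (by simp))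
      refine ih m''.card ?_ m'' (cancel t _ hm) ?_ rfl
      · rw [← hn, Multiset.card_cons, Multiset.card_cons]; omega
      · rw [← hz, formalSum_cons, formalSum_cons]; simp
    · convert hm
      ext ⟨t, b⟩
      have key := count_sub_count_eq_lift m t
      rw [hz] at key
      simp only [map_sub, FreeAbelianGroup.lift_apply_of] at key
      have hor : m.count (t, true) = 0 ∨ m.count (t, false) = 0 := by
        by_contra! h'
        exact hc ⟨t, Multiset.count_ne_zero.1 h'.1, Multiset.count_ne_zero.1 h'.2⟩
      have e : ((s, true) ::ₘ {(s', false)} : Multiset (S × Bool)).count (t, b)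
          = cond b (if t = s then 1 else 0) (if t = s' then 1 else 0) := by
        cases b <;> simp [Multiset.count_cons, Multiset.count_singleton]
      rw [Multiset.insert_eq_cons, e]
      by_cases h1 : t = s <;> by_cases h2 : t = s' <;> cases b <;>
        simp only [h1, h2, if_true, if_false, cond_true, cond_false] at key hor ⊢ <;>
        first | (exact absurd (h1.symm.trans h2) hs) | (simp only [hs, hs.symm, if_false] at key ⊢; omega) | omega

/-- For every value the fibres of p and q have the same number of elements, so bijections between
the fibres assemble to the reindexing. -/
theorem exists_equiv_of_map_univ_eq {ι κ T : Type*} [Fintype ι] [Fintype κ] {p : ι → T}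
    {q : κ → T} (h : Finset.univ.val.map p = Finset.univ.val.map q) :
    ∃ e : κ ≃ ι, ∀ j, p (e j) = q j := by
  classical
  have hc : ∀ t, Nonempty ({j // q j = t} ≃ {j // p j = t}) := fun t => by
    have h1 := congrArg (Multiset.count t) h
    rw [Multiset.count_map, Multiset.count_map] at h1
    refine ⟨Fintype.equivOfCardEq ?_⟩
    rw [Fintype.card_subtype, Fintype.card_subtype]
    simpa only [Finset.card, Finset.filter_val, eq_comm] using h1.symm
  let e := fun t => (hc t).some
  refine ⟨(Equiv.sigmaFiberEquiv q).symm.trans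
    ((Equiv.sigmaCongrRight e).trans (Equiv.sigmaFiberEquiv p)), fun j => ?_⟩
  exact (e (q j) ⟨j, rfl⟩).2

/-- If a class of families of signed generators is closed under the operations below and represents
the relations, then it contains the reduced representatives of the consequences of the relations. -/
theorem family_pair_of_sub_mem_closure {bordant : S → S → Prop} {union : S → S → S → Prop}
    {K : ∀ {ι : Type}, (ι → S × Bool) → Prop} (empty : ∀ p : Empty → S × Bool, K p)
    (sum : ∀ {ι ι' : Type} (p : ι → S × Bool) (p' : ι' → S × Bool), K p → K p' → K (Sum.elim p p'))
    (neg : ∀ {ι : Type} (p : ι → S × Bool), K p → K fun j => ((p j).1, !(p j).2))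
    (reindex : ∀ {ι ι' : Type} (p : ι → S × Bool) (e : ι' ≃ ι), K p → K (p ∘ e))
    (cancel : ∀ {ι : Type} (p : ι → S × Bool) (s : S),
      K (Sum.elim p fun b : Bool => (s, b)) → K p)
    (bordism : ∀ s s', bordant s s' → K fun b : Bool => (cond b s s', b))
    (disjointUnion : ∀ s s' t, union s s' t →
      K fun j : Option Bool => (j.elim t fun b => cond b s s', j.elim true fun _ => false))
    {s s' : S} (hs : s ≠ s')
    (h : (BordismGroup.cls s : BordismGroup bordant union) = BordismGroup.cls s') :
    K fun b : Bool => (cond b s s', b) := by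
  have transfer : ∀ {ι κ : Type} [Fintype ι] [Fintype κ] (p : ι → S × Bool) (q : κ → S × Bool),
      Finset.univ.val.map p = Finset.univ.val.map q → K p → K q := fun p q hpq hp => by
    obtain ⟨e, he⟩ := exists_equiv_of_map_univ_eq hpq
    obtain rfl : p ∘ e = q := funext he
    exact reindex p e hp
  have map_sum : ∀ {ι κ : Type} [Fintype ι] [Fintype κ] (p : ι → S × Bool) (q : κ → S × Bool),
      Finset.univ.val.map (Sum.elim p q) = Finset.univ.val.map p + Finset.univ.val.map q :=
    fun p q => by
      rw [← Finset.univ_disjSum_univ, Finset.val_disjSum, Multiset.disjSum, Multiset.map_add,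
        Multiset.map_map, Multiset.map_map]
      rfl
  have map_bool : ∀ q : Bool → S × Bool, Finset.univ.val.map q = {q true, q false} := fun q => rfl
  obtain ⟨ι, _, p, hp, hK⟩ := null_pair_of_sub_mem_closure (rel := relations bordant union)
    (Null := fun m => ∃ (ι : Type) (_ : Fintype ι) (p : ι → S × Bool),
      Finset.univ.val.map p = m ∧ K p) (s := s) (s' := s')
    ⟨Empty, inferInstance, Empty.elim, rfl, empty _⟩
    (by
      rintro _ _ ⟨ι, _, p, rfl, hp⟩ ⟨κ, _, q, rfl, hq⟩
      exact ⟨ι ⊕ κ, inferInstance, _, map_sum p q, sum p q hp hq⟩)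
    (by
      rintro _ ⟨ι, _, p, rfl, hp⟩
      exact ⟨ι, inferInstance, _, (Multiset.map_map _ _ _).symm, neg p hp⟩)
    (by
      rintro t m ⟨ι, _, p, hm, hp⟩
      -- The remaining multiset has no index type of its own; a list enumerating it provides one.
      obtain ⟨l, rfl⟩ : ∃ l : List (S × Bool), (l : Multiset (S × Bool)) = m := Quot.exists_rep m
      have hl : Finset.univ.val.map l.get = (l : Multiset (S × Bool)) := by
        simp
      refine ⟨Fin l.length, inferInstance, l.get, hl, cancel _ t (transfer p _ ?_ hp)⟩
      rw [map_sum, hl, map_bool, hm, Multiset.insert_eq_cons, ← Multiset.singleton_add,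
        ← Multiset.singleton_add, ← Multiset.singleton_add]
      exact (add_assoc _ _ _).symm.trans (add_comm _ _))
    (by
      rintro _ (⟨A, B, hAB, rfl⟩ | ⟨A, B, C, hABC, rfl⟩)
      · refine ⟨_, ⟨Bool, inferInstance, _, rfl, bordism A B hAB⟩, ?_⟩
        rw [map_bool]
        simp [formalSum, sub_eq_add_neg]
      · refine ⟨_, ⟨Option Bool, inferInstance, _, rfl, disjointUnion A B C hABC⟩, ?_⟩
        rw [show (Finset.univ : Finset (Option Bool)) = {none, some true, some false} from rfl]
        simp [formalSum, sub_eq_add_neg, add_comm]) hs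
    (by
      have h1 := QuotientAddGroup.eq.1 h.symm
      rwa [neg_add_eq_sub] at h1)
  exact transfer p _ (hp.trans (map_bool fun b => (cond b s s', b)).symm) hK

end FormalSums

/-! ### From equality of classes to a bordism -/

section NullBordism

variable {k d : ℕ} {J : Type*} {P : J → CompactManifold k} {X : Type*} [TopologicalSpace X]

theorem Cob.congr {ι : Type} {obj obj' : ι → BSSingular P d X} (h : ∀ j, obj j = obj' j)
    (hB : Nonempty (Cob obj)) : Nonempty (Cob obj') := by
  obtain rfl : obj = obj' := funext h
  exact hB

theorem Cob.exists_gluings {ι : Type} {obj : ι → BSSingular P d X} {o : BSSingular P d X}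
    (B : Cob (Sum.elim obj fun _ : Bool => o)) :
    Nonempty (Gluing (B.c (Sum.inr true)) (B.c (Sum.inr false)) ×
      ∀ i, Gluing (B.cN (Sum.inr true) i) (B.cN (Sum.inr false) i)) := by
  obtain ⟨G⟩ := exists_gluing (B.c (Sum.inr true)) (B.c (Sum.inr false))
    (B.disjoint (Sum.inr true) (Sum.inr false) (by simp))
  have GN := fun i => exists_gluing (B.cN (Sum.inr true) i) (B.cN (Sum.inr false) i)
    (B.disjoint_N (Sum.inr true) (Sum.inr false) (by simp) i)
  exact ⟨G, fun i => (GN i).some⟩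

/-- Two distinct objects with the same bordism class are bordant. -/
theorem BSSingular.exists_cob (hP : ∀ i, (P i).boundary = ∅) {A B : BSSingular P d X} (hAB : A ≠ B)
    (h : (BordismGroup.cls A : BSOmega P d X) = BordismGroup.cls B) :
    Nonempty (Cob fun b : Bool => cond b A B) :=
  family_pair_of_sub_mem_closure (K := fun p => Nonempty (Cob fun j => (p j).1))
    (fun _ => ⟨Cob.empty _⟩)
    (fun p p' ⟨B⟩ ⟨B'⟩ => Cob.congr (by rintro (j | j) <;> rfl) ⟨B.sum B'⟩)
    -- Without framings the signs play no role, so reversing them changes nothing.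
    (fun _ h => h)
    (fun _ e ⟨B⟩ => ⟨B.reindex e⟩)
    (fun {ι} p s hB => by
      obtain ⟨B⟩ := Cob.congr (obj' := Sum.elim (fun j => (p j).1) fun _ : Bool => s)
        (by rintro (j | j) <;> rfl) hB
      obtain ⟨G, GN⟩ := B.exists_gluings
      exact ⟨B.glue G GN⟩)
    (fun A B ⟨b, F, hF, hA, hB⟩ => ⟨b.toCob hP F hF hA hB⟩)
    (fun A B C ⟨u, hA, hB⟩ => ⟨u.toCob hA hB⟩) hAB h

/-- Two distinct objects with the same framed bordism class are framed bordant. -/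
theorem FramedBSSingular.exists_cob {φP : ∀ i, StableFraming (P i)} (hP : ∀ i, (P i).boundary = ∅)
    {A B : FramedBSSingular φP d X} (hAB : A ≠ B)
    (h : (BordismGroup.cls A : FramedBSOmega φP d X) = BordismGroup.cls B) :
    ∃ W : Cob fun b : Bool => (cond b A B).toBSSingular,
      W.IsFramed φP (fun b => (cond b A B).framing.total) fun b => cond b 1 (-1) := by
  refine family_pair_of_sub_mem_closure
    (K := fun {ι} (p : ι → FramedBSSingular φP d X × Bool) =>
      ∃ W : Cob fun j => (p j).1.toBSSingular,
        W.IsFramed φP (fun j => (p j).1.framing.total) fun j => cond (p j).2 1 (-1))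
    ?_ ?_ ?_ ?_ ?_ ?_ ?_ hAB h
  · exact fun _ => ⟨Cob.empty _, Cob.isFramed_empty _ _ _ _⟩
  · rintro ι ι' p p' ⟨B, hB⟩ ⟨B', hB'⟩
    exact Cob.exists_isFramed_congr (by rintro (j | j) <;> rfl) (by rintro (j | j) <;> rfl)
      (by rintro (j | j) <;> rfl) ⟨_, hB.sum (B' := B')
        (fun j => match j with
          | Sum.inl j => (p j).1.framing.total
          | Sum.inr j => (p' j).1.framing.total) hB'⟩
  · rintro ι p ⟨B, hB⟩
    exact Cob.exists_isFramed_congr (fun j => rfl) (fun j => HEq.rfl)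
      (fun j => by cases h : (p j).2 <;> simp [h]) ⟨B, hB.neg⟩
  · rintro ι ι' p e ⟨B, hB⟩
    exact ⟨B.reindex e, hB.reindex e⟩
  · intro ι p s hB
    obtain ⟨B, hB⟩ := Cob.exists_isFramed_congr
      (obj' := Sum.elim (fun j => (p j).1.toBSSingular) fun _ : Bool => s.toBSSingular)
      (ψ' := fun j => match j with
        | Sum.inl j => (p j).1.framing.total
        | Sum.inr j => s.framing.total)
      (ε' := Sum.elim (fun j => cond (p j).2 1 (-1)) fun b => cond b 1 (-1))
      (by rintro (j | j) <;> rfl) (by rintro (j | j) <;> rfl) (by rintro (j | j) <;> rfl) hB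
    obtain ⟨G, GN⟩ := B.exists_gluings
    exact ⟨B.glue G GN, hB.glue rfl (by simp) G GN⟩
  · rintro A B ⟨b, F, φ, hF, hA, hB, hcA, hcB⟩
    exact Cob.exists_isFramed_congr (by rintro (_ | _) <;> rfl) (by rintro (_ | _) <;> rfl)
      (fun _ => rfl) ⟨_, b.isFramed_toCob hP F hF hA hB φ
        (fun j => match j with
          | true => A.framing.total
          | false => B.framing.total) hcA hcB⟩
  · rintro A B C ⟨u, hA, hB, hu⟩
    exact Cob.exists_isFramed_congr (by rintro (_ | _ | _) <;> rfl)
      (by rintro (_ | _ | _) <;> rfl) (by rintro (_ | _ | _) <;> rfl)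
      ⟨_, u.isFramed_toCob hA hB C.framing
        (fun j => match j with
          | none => C.framing.total
          | some true => A.framing.total
          | some false => B.framing.total) rfl hu⟩

end NullBordism

/-! ### Shrinking and combining collars -/

namespace Ray

/-- Multiplication by a positive number. -/
def scale (a : ℝ) (r : Ray) : Ray := mk (a * coord r)

theorem coord_scale {a : ℝ} (ha : 0 < a) (r : Ray) : coord (scale a r) = a * coord r :=
  coord_mk_of_nonneg (mul_nonneg ha.le (coord_nonneg r))

theorem contMDiff_scale {a : ℝ} (ha : 0 < a) : ContMDiff (Q 1) (Q 1) ∞ (scale a) := by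
  rw [← contMDiffOn_univ]
  refine contMDiffOn_of_coord ?_
  simp only [coord_scale ha]
  exact (((contDiff_const (c := a)).mul contDiff_id).contMDiff.comp contMDiff_coord).contMDiffOn

theorem isLocalDiffeomorph_scale {a : ℝ} (ha : 0 < a) :
    IsLocalDiffeomorph (Q 1) (Q 1) ∞ (scale a) :=
  isLocalDiffeomorph_of_homeomorph
    { toFun := scale a
      invFun := scale a⁻¹
      left_inv := fun r => by
        ext; rw [coord_scale (inv_pos.2 ha), coord_scale ha]; field_simp
      right_inv := fun r => by
        ext; rw [coord_scale ha, coord_scale (inv_pos.2 ha)]; field_simp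
      continuous_toFun := (contMDiff_scale ha).continuous
      continuous_invFun := (contMDiff_scale (inv_pos.2 ha)).continuous }
    (contMDiff_scale ha) (contMDiff_scale (inv_pos.2 ha))

/-- The contraction `r ↦ δr/(δ+r)` of the half-line. -/
def contract (δ : ℝ) (r : Ray) : Ray := scale δ (shrink (scale δ⁻¹ r))

variable {δ : ℝ}

theorem coord_contract (hδ : 0 < δ) (r : Ray) :
    coord (contract δ r) = δ * coord r / (δ + coord r) := by
  have := coord_nonneg r
  rw [contract, coord_scale hδ, coord_shrink, coord_scale (inv_pos.2 hδ)]
  field_simp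

theorem coord_contract_lt (hδ : 0 < δ) (r : Ray) : coord (contract δ r) < δ := by
  have := coord_nonneg r
  rw [coord_contract hδ, div_lt_iff₀ (by positivity)]
  nlinarith

theorem contract_zero (hδ : 0 < δ) : contract δ 0 = 0 := by
  ext; simp [coord_contract hδ]

theorem isLocalDiffeomorph_contract (hδ : 0 < δ) :
    IsLocalDiffeomorph (Q 1) (Q 1) ∞ (contract δ) := fun r =>
  ((isLocalDiffeomorph_scale (inv_pos.2 hδ) r).comp _ _ (isLocalDiffeomorph_shrink _)).comp
    _ _ (isLocalDiffeomorph_scale hδ _)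

theorem contract_injective (hδ : 0 < δ) : Function.Injective (contract δ) := fun r r' h => by
  have h1 := congrArg coord h
  have := coord_nonneg r
  have := coord_nonneg r'
  rw [coord_contract hδ, coord_contract hδ, div_eq_div_iff (by positivity) (by positivity)] at h1
  ext
  have h2 : δ ^ 2 * (coord r - coord r') = 0 := by linear_combination h1
  rcases mul_eq_zero.1 h2 with h | h
  · exact absurd h (by positivity)
  · linarith

/-- The derivative of δr/(δ + r) at 0 is 1 for every δ, so shrinking a collar keeps its inward
normal, and with it every condition on framings along the face. -/
theorem mfderiv_contract_zero (hδ : 0 < δ) (w : Eucl 1) :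
    mfderiv (Q 1) (Q 1) (contract δ) 0 w = w := by
  have h1 := mfderiv_comp (0 : Ray) (contMDiff_coord.mdifferentiable (by simp) (contract δ 0))
    ((isLocalDiffeomorph_contract hδ).mdifferentiable (by simp) 0)
  have hd : HasDerivAt (fun x : ℝ => δ * x / (δ + x)) 1 (coord 0) := by
    have := ((hasDerivAt_id' (coord 0)).const_mul δ).fun_div
      ((hasDerivAt_id' (coord 0)).const_add δ) (by simpa using hδ.ne')
    have e : (δ * 1 * (δ + coord 0) - δ * coord 0 * 1) / (δ + coord 0) ^ 2 = 1 := by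
      rw [coord_zero]; field_simp; ring
    rwa [e] at this
  have h2 : HasMFDerivAt (Q 1) 𝓘(ℝ, ℝ) (coord ∘ contract δ) (0 : Ray) _ :=
    (hd.hasFDerivAt.hasMFDerivAt.comp (0 : Ray) (hasMFDerivAt_coord 0)).congr_of_eventuallyEq
      (Filter.Eventually.of_forall fun r => coord_contract hδ r)
  have h3 : EuclideanSpace.proj (𝕜 := ℝ) (0 : Fin 1) (mfderiv (Q 1) (Q 1) (contract δ) 0 w) = w 0 := by
    refine (mfderiv_coord (contract δ 0) _).symm.trans ?_
    refine (DFunLike.congr_fun h1 w).symm.trans ?_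
    rw [h2.mfderiv]
    change (1 : ℝ →L[ℝ] ℝ).smulRight (1 : ℝ) (w 0) = w 0
    simp
  refine (euclideanSpace_one_eq _).trans ?_
  exact (congrArg (EuclideanSpace.single (0 : Fin 1)) h3).trans (euclideanSpace_one_eq w).symm

end Ray

namespace Collar

variable {n : ℕ} {F F' : CompactManifold n} {W : CompactManifold (n + 1)}

/-- A collar, shrunk to a given size. -/
def contract (c : Collar F W) {δ : ℝ} (hδ : 0 < δ) : Collar F W where
  toFun z := c.toFun (z.1, Ray.contract δ z.2)
  isLocalDiffeomorph z := ((isLocalDiffeomorphAt_id z.1).prodMap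
    (Ray.isLocalDiffeomorph_contract hδ z.2)).comp _ _ (c.isLocalDiffeomorph _)
  injective := c.injective.comp (Function.injective_id.prodMap (Ray.contract_injective hδ))

theorem contract_face (c : Collar F W) {δ : ℝ} (hδ : 0 < δ) : (c.contract hδ).face = c.face :=
  funext fun x => congrArg (fun r => c.toFun (x, r)) (Ray.contract_zero hδ)

theorem contract_derivAt (c : Collar F W) {δ : ℝ} (hδ : 0 < δ) (x : F) (v : Eucl n) (t : ℝ) :
    (c.contract hδ).derivAt x 0 (v, t) = c.derivAt x 0 (v, t) := by
  rw [derivAt_apply, derivAt_apply]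
  have hm := (Ray.isLocalDiffeomorph_contract hδ).mdifferentiable (by simp) 0
  have h := mfderiv_comp (x, (0 : Ray)) (f := Prod.map (id : F → F) (Ray.contract δ))
    (c.isLocalDiffeomorph.mdifferentiable (by simp) (x, Ray.contract δ 0))
    (mdifferentiableAt_id.prodMap hm)
  refine (DFunLike.congr_fun h ((v, EuclideanSpace.single (0 : Fin 1) t) : Eucl n × Eucl 1)).trans ?_
  have h2 : mfderiv ((Q n).prod (Q 1)) ((Q n).prod (Q 1)) (Prod.map (id : F → F) (Ray.contract δ))
      (x, 0) ((v, EuclideanSpace.single (0 : Fin 1) t) : Eucl n × Eucl 1) =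
        ((v, EuclideanSpace.single (0 : Fin 1) t) : Eucl n × Eucl 1) := by
    rw [mfderiv_prodMap mdifferentiableAt_id hm]
    exact Prod.ext (by simp [mfderiv_id]; rfl) (Ray.mfderiv_contract_zero hδ _)
  refine (congrArg (mfderiv ((Q n).prod (Q 1)) (Q (n + 1)) c.toFun (x, Ray.contract δ 0)) h2).trans ?_
  have h3 : ∀ r : Ray, r = 0 → ∀ u : Eucl n × Eucl 1,
      (mfderiv ((Q n).prod (Q 1)) (Q (n + 1)) c.toFun (x, r) u : Eucl (n + 1)) =
        mfderiv ((Q n).prod (Q 1)) (Q (n + 1)) c.toFun (x, 0) u := by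
    rintro r rfl u; rfl
  exact h3 _ (Ray.contract_zero hδ) _

/-- Small collars of disjoint faces are disjoint. -/
theorem exists_contract_disjoint (c : Collar F W) (c' : Collar F' W)
    (hd : ∀ x x', c.face x ≠ c'.face x') : ∃ (δ : ℝ) (hδ : 0 < δ),
      ∀ z z', (c.contract hδ).toFun z ≠ (c'.contract hδ).toFun z' := by
  have key : ∀ {F : CompactManifold n} (c : Collar F W) (U : Set W), IsOpen U →
      Set.range c.face ⊆ U → ∃ ε > 0, ∀ x r, Ray.coord r < ε → c.toFun (x, r) ∈ U := by
    intro F c U hU hc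
    -- As F is compact, the tube lemma gives one size of the collar that works over all of F.
    obtain ⟨u, v, -, hv, hu, h0, huv⟩ := generalized_tube_lemma
      (isCompact_univ (X := F)) (isCompact_singleton (x := (0 : Ray)))
      (hU.preimage c.isOpenEmbedding.continuous) (by
        rintro ⟨x, r⟩ ⟨-, hr⟩
        obtain rfl : r = 0 := hr
        exact hc ⟨x, rfl⟩)
    have hv' := hv.preimage Ray.continuous_mk
    obtain ⟨ε, hε, h⟩ := Metric.isOpen_iff.1 hv' 0 (by
      have : Ray.mk 0 = 0 := Ray.mk_coord 0
      rw [Set.mem_preimage, this]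
      exact h0 rfl)
    refine ⟨ε, hε, fun x r hr => huv (Set.mk_mem_prod (hu trivial) ?_)⟩
    have h1 := h (a := Ray.coord r) (by
      rw [Metric.mem_ball, Real.dist_eq, sub_zero, abs_of_nonneg (Ray.coord_nonneg r)]; exact hr)
    rwa [Set.mem_preimage, Ray.mk_coord] at h1
  obtain ⟨U, U', hU, hU', hcU, hcU', hUU'⟩ := normal_separation
    c.isClosed_range_face c'.isClosed_range_face (Set.disjoint_left.2 (by
      rintro _ ⟨x, rfl⟩ ⟨x', h⟩
      exact hd x x' h.symm))
  obtain ⟨ε, hε, h⟩ := key c U hU hcU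
  obtain ⟨ε', hε', h'⟩ := key c' U' hU' hcU'
  refine ⟨min ε ε', lt_min hε hε', fun z z' hz => ?_⟩
  refine Set.disjoint_left.1 hUU' (h z.1 (Ray.contract (min ε ε') z.2) ?_)
    (hz ▸ h' z'.1 (Ray.contract (min ε ε') z'.2) ?_)
  · exact (Ray.coord_contract_lt (lt_min hε hε') _).trans_le (min_le_left _ _)
  · exact (Ray.coord_contract_lt (lt_min hε hε') _).trans_le (min_le_right _ _)

/-- The union of two disjoint collars. -/
def union (c : Collar F W) (c' : Collar F' W) (hd : ∀ z z', c.toFun z ≠ c'.toFun z') :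
    Collar (F.sum F') W where
  toFun z := match z with
    | (Sum.inl x, r) => c.toFun (x, r)
    | (Sum.inr x, r) => c'.toFun (x, r)
  isLocalDiffeomorph := by
    rintro ⟨x | x, r⟩
    · exact IsLocalDiffeomorphAt.of_comp_right (f := Prod.map (Sum.inl : F → F ⊕ F') (id : Ray → Ray))
        (x := (x, r)) (c.isLocalDiffeomorph (x, r))
        ((isLocalDiffeomorph_inl x).prodMap (isLocalDiffeomorphAt_id r))
    · exact IsLocalDiffeomorphAt.of_comp_right (f := Prod.map (Sum.inr : F' → F ⊕ F') (id : Ray → Ray))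
        (x := (x, r)) (c'.isLocalDiffeomorph (x, r))
        ((isLocalDiffeomorph_inr x).prodMap (isLocalDiffeomorphAt_id r))
  injective := by
    rintro ⟨x | x, r⟩ ⟨x' | x', r'⟩ h
    · obtain ⟨rfl, rfl⟩ := Prod.ext_iff.1 (c.injective h); rfl
    · exact absurd h (hd _ _)
    · exact absurd h.symm (hd _ _)
    · obtain ⟨rfl, rfl⟩ := Prod.ext_iff.1 (c'.injective h); rfl

theorem union_face (c : Collar F W) (c' : Collar F' W) (hd : ∀ z z', c.toFun z ≠ c'.toFun z') :
    (c.union c' hd).face = Sum.elim c.face c'.face := by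
  funext x
  rcases x with x | x <;> rfl

theorem range_union_face (c : Collar F W) (c' : Collar F' W)
    (hd : ∀ z z', c.toFun z ≠ c'.toFun z') :
    Set.range (c.union c' hd).face = Set.range c.face ∪ Set.range c'.face := by
  rw [union_face]
  exact Set.Sum.elim_range _ _

theorem union_derivAt_inl (c : Collar F W) (c' : Collar F' W)
    (hd : ∀ z z', c.toFun z ≠ c'.toFun z') (x : F) (r : Ray) (v : Eucl n) (t : ℝ) :
    (c.union c' hd).derivAt (Sum.inl x) r (tderiv (M' := F.sum F') Sum.inl x v, t) =
      c.derivAt x r (v, t) :=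
  ((c.union c' hd).precomp_derivAt (F' := F) isLocalDiffeomorph_inl Sum.inl_injective
    x r v t).symm

theorem union_derivAt_inr (c : Collar F W) (c' : Collar F' W)
    (hd : ∀ z z', c.toFun z ≠ c'.toFun z') (x : F') (r : Ray) (v : Eucl n) (t : ℝ) :
    (c.union c' hd).derivAt (Sum.inr x) r (tderiv (M' := F.sum F') Sum.inr x v, t) =
      c'.derivAt x r (v, t) :=
  ((c.union c' hd).precomp_derivAt (F' := F') isLocalDiffeomorph_inr Sum.inr_injective
    x r v t).symm

end Collar

/-! ### Making a boundary framing outgoing -/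

section Desuspension

/-- The coordinates of a vector in `ℝⁿ⁺¹ ⊕ ℝ^ℕ`, with the last one moved to the stable
coordinate `R`. -/
def desuspend {n : ℕ} (R : ℕ) (y : Eucl (n + 1) × (ℕ → ℝ)) : Eucl n × (ℕ → ℝ) :=
  (((snocL n).symm y.1).1, Function.update y.2 R ((snocL n).symm y.1).2)

theorem desuspend_snoc {n : ℕ} (R : ℕ) (a : Eucl n) (t : ℝ) (s : ℕ → ℝ) :
    desuspend R (snoc a t, s) = (a, Function.update s R t) := by
  have h : (snocL n).symm (snoc a t) = (a, t) := (snocL n).symm_apply_apply (a, t)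
  simp [desuspend, h]

/-- The last coordinate belongs to the second summand, and R lies beyond the r stable coordinates of
the first. So only the second summand is affected, where the stable coordinate R has index R - r. -/
theorem desuspend_directSum {k m r R : ℕ} (h : r ≤ R) (u : Eucl k × (ℕ → ℝ))
    (u' : Eucl (m + 1) × (ℕ → ℝ)) :
    desuspend (n := k + m) R (directSum (k := k) (m := m + 1) r u u') =
      directSum r u (desuspend (R - r) u') := by
  obtain ⟨b, s⟩ := u'
  obtain ⟨b, t, rfl⟩ := exists_snoc b
  rw [desuspend_snoc, directSum, append_snoc, desuspend_snoc]
  refine Prod.ext rfl (funext fun i => ?_)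
  simp only [directSum, Function.update_apply]
  by_cases h1 : i = R
  · subst h1
    rw [if_pos rfl, if_neg (by omega), if_pos rfl]
  · rw [if_neg h1]
    split_ifs with h2 h3
    · rfl
    · omega
    · rfl

theorem directSum_congr {k m r : ℕ} {u v : Eucl k × (ℕ → ℝ)} (h : u.1 = v.1)
    (h' : ∀ i < r, u.2 i = v.2 i) (u' : Eucl m × (ℕ → ℝ)) :
    directSum r u u' = directSum r v u' := by
  refine Prod.ext (by simp [directSum, h]) (funext fun i => ?_)
  simp only [directSum]
  split_ifs with hi
  exacts [h' i hi, rfl]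

/-- In a direct sum the first summand is read only below its rank, where it depends on no further
stable coordinate. So the coordinate used for a desuspension can be reset without effect on it. -/
theorem StableFraming.directSum_extend_congr {k m : ℕ} {P : CompactManifold k}
    (φ : StableFraming P) (p : P) (w : Eucl k) {s s' : ℕ → ℝ} (h : ∀ i < φ.rank, s i = s' i)
    (u : Eucl m × (ℕ → ℝ)) :
    directSum φ.rank (φ.extend p w s) u = directSum φ.rank (φ.extend p w s') u := by
  have e : (WithLp.toLp 2 fun i : Fin φ.rank => s i) = WithLp.toLp 2 fun i : Fin φ.rank => s' i :=
    congrArg _ (funext fun i => h i i.2)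
  refine directSum_congr ?_ (fun i hi => ?_) u
  · exact congrArg (fun a => (φ.iso p (w, a)).1) e
  · rw [φ.extend_snd_of_lt p w s hi, φ.extend_snd_of_lt p w s' hi, e]

variable {n R : ℕ} {F : CompactManifold n} {W : CompactManifold (n + 1)}

/-- A framing can be modified in the collar of a face so that the face becomes outgoing. -/
theorem Collar.exists_outgoing (c : Collar F W)
    {Φ : W → Eucl (n + 1) × (ℕ → ℝ) →ₗ[ℝ] Eucl (n + 1) × (ℕ → ℝ)} (hΦ : IsFraming W R Φ) :
    ∃ (Φ' : W → Eucl (n + 1) × (ℕ → ℝ) →ₗ[ℝ] Eucl (n + 1) × (ℕ → ℝ))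
      (Ψ : F → Eucl n × (ℕ → ℝ) →ₗ[ℝ] Eucl n × (ℕ → ℝ)),
      IsFraming W (R + 1) Φ' ∧ IsFraming F (R + 1) Ψ ∧
      (∀ u, u ∉ Set.range c.toFun → Φ' u = Φ u) ∧
      (∀ x v t s, Φ' (c.face x) (c.derivAt x 0 (v, t), s) =
        (snoc (Ψ x (v, s)).1 (-t), (Ψ x (v, s)).2)) ∧
      ∀ x v s, Ψ x (v, s) =
        desuspend R (Φ (c.face x) (c.derivAt x 0 (v, -s R), Function.update s R 0)) := by
  let ℓ : Eucl (n + 1) →ₗ[ℝ] ℝ := LinearMap.snd ℝ (Eucl n) ℝ ∘ₗ (snocL n).symm.toLinearMap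
  let e : Eucl (n + 1) := snoc 0 1
  have ℓ_snoc : ∀ (a : Eucl n) (t : ℝ), ℓ (snoc a t) = t := fun a t =>
    congrArg Prod.snd ((snocL n).symm_apply_apply (a, t))
  have he : ℓ e = 1 := ℓ_snoc 0 1
  have hℓ : Continuous ℓ := ℓ.continuous_of_finiteDimensional
  have hid : (LinearMap.id : ℝ →ₗ[ℝ] ℝ) 1 = 1 := rfl
  have cont : ∀ {V : Type} [NormedAddCommGroup V] [NormedSpace ℝ V]
      (J : V × (ℕ → ℝ) →ₗ[ℝ] V × (ℕ → ℝ)), Continuous J →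
      Continuous fun z : ℝ × V × (ℕ → ℝ) => rotation J (angle z.1) z.2 := fun J hJ =>
    continuous_rotation hJ (continuous_angle.comp continuous_fst) continuous_snd
  have one_le : ∀ {V : Type} [AddCommGroup V] [Module ℝ V]
      (J : V × (ℕ → ℝ) →ₗ[ℝ] V × (ℕ → ℝ)) (r : ℝ), 1 ≤ r →
      rotation J (angle r) = LinearMap.id := fun J r hr => by
    rw [angle_of_one_le hr, rotation_zero]
  -- Coordinate R is fresh, since Φ is the identity from R on. Two quarter turns are made along the
  -- collar: in the source between σ and coordinate R, in the target between the last coordinate and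
  -- coordinate R. Thus t passes from σ to coordinate R, through Φ unchanged, and with a minus sign
  -- to the last coordinate, while the previous last coordinate is stored in R.
  obtain ⟨Φ', h1, h2, h3⟩ := c.exists_modification (hΦ.mono (Nat.le_succ R))
    (g := fun r => rotation (stabilisingGenerator LinearMap.id (1 : ℝ) R) (angle r))
    (g' := fun r => rotation (stabilisingGenerator ℓ e R) (angle r))
    (fun r => isStable_rotation_stabilisingGenerator hid (Nat.lt_succ_self R) _)
    (fun r => isStable_rotation_stabilisingGenerator he (Nat.lt_succ_self R) _)
    (cont _ (continuous_stabilisingGenerator continuous_id _ R))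
    (cont _ (continuous_stabilisingGenerator hℓ e R)) (one_le _) (one_le _)
  have key : ∀ x v t s, Φ' (c.face x) (c.derivAt x 0 (v, t), s) =
      (snoc (desuspend R (Φ (c.face x) (c.derivAt x 0 (v, -s R), Function.update s R 0))).1 (-t),
        (desuspend R (Φ (c.face x) (c.derivAt x 0 (v, -s R), Function.update s R 0))).2) := by
    intro x v t s
    refine (h3 x 0 v t s).trans ?_
    simp only [Ray.coord_zero, angle_zero, rotation_stabilisingGenerator_half_pi _ hid,
      rotation_stabilisingGenerator_half_pi _ he]
    have e1 : t - ((LinearMap.id : ℝ →ₗ[ℝ] ℝ) t + s R) • (1 : ℝ) = -s R := by simp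
    rw [e1]
    have e2 : Φ (c.toFun (x, 0)) (c.derivAt x 0 (v, -s R), Function.update s R t) =
        Φ (c.face x) (c.derivAt x 0 (v, -s R), Function.update s R 0) + (0, Pi.single R t) := by
      rw [← (hΦ.stable (c.face x)).apply_tail (Pi.single R t) fun i hi => by simp [hi.ne],
        ← map_add]
      refine congrArg (Φ (c.face x)) (Prod.ext (add_zero _).symm (funext fun i => ?_))
      by_cases hi : i = R
      · subst hi; simp
      · simp [hi]
    have e3 : (Φ (c.face x) (c.derivAt x 0 (v, -s R), Function.update s R 0)).2 R = 0 := by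
      rw [(hΦ.stable (c.face x)).snd_apply _ R le_rfl]; simp
    refine (congrArg (fun y : Eucl (n + 1) × (ℕ → ℝ) =>
      (y.1 - (ℓ y.1 + y.2 R) • e, Function.update y.2 R (ℓ y.1))) e2).trans ?_
    generalize Φ (c.face x) (c.derivAt x 0 (v, -s R), Function.update s R 0) = y at e3
    obtain ⟨y, z⟩ := y
    obtain ⟨a, b, rfl⟩ := exists_snoc y
    have e3' : z R = 0 := e3
    rw [desuspend_snoc]
    refine Prod.ext ?_ (funext fun i => ?_)
    · have h4 := _root_.map_sub (snocL n) (a, b) ((b + t) • ((0 : Eucl n), (1 : ℝ)))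
      rw [_root_.map_smul, snocL_apply, snocL_apply] at h4
      simp only [Prod.mk_add_mk, add_zero, Pi.add_apply, Pi.single_eq_same, e3', zero_add, ℓ_snoc]
      refine h4.symm.trans (congrArg (snocL n) (?_ : _ = (a, -t)))
      ext <;> simp
    · by_cases hi : i = R
      · subst hi; simp [ℓ_snoc]
      · simp [hi]
  -- Ψ is taken from Φ' at t = 0, so that its linearity, stability and continuity come from Φ'; the
  -- formula by `desuspend` follows afterwards.
  let Ψ : F → Eucl n × (ℕ → ℝ) →ₗ[ℝ] Eucl n × (ℕ → ℝ) := fun x =>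
    (LinearMap.fst ℝ (Eucl n) ℝ ∘ₗ (snocL n).symm.toLinearMap).prodMap LinearMap.id ∘ₗ
      Φ' (c.face x) ∘ₗ (c.derivAt x 0 ∘ₗ LinearMap.inl ℝ (Eucl n) ℝ).prodMap LinearMap.id
  have hΨ : ∀ x v s, Ψ x (v, s) = (((snocL n).symm (Φ' (c.face x) (c.derivAt x 0 (v, 0), s)).1).1,
      (Φ' (c.face x) (c.derivAt x 0 (v, 0), s)).2) := fun _ _ _ => rfl
  have hΨ' : ∀ x v s, Ψ x (v, s) =
      desuspend R (Φ (c.face x) (c.derivAt x 0 (v, -s R), Function.update s R 0)) := by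
    intro x v s
    rw [hΨ, key, ← snocL_apply, LinearEquiv.symm_apply_apply]
  refine ⟨Φ', Ψ, h1, ⟨fun x => ⟨?_, fun s hs => ?_, fun z i hi => ?_⟩, ?_⟩, h2, fun x v t s => ?_,
    hΨ'⟩
  · rintro ⟨v, s⟩ ⟨v', s'⟩ h
    have h4 : Φ' (c.face x) (c.derivAt x 0 (v, 0), s) =
        Φ' (c.face x) (c.derivAt x 0 (v', 0), s') := by
      rw [key, key, ← hΨ', ← hΨ', h]
    have h5 := (h1.stable _).injective h4
    rw [Prod.mk.injEq] at h5
    exact Prod.ext (congrArg (Prod.fst : Eucl n × ℝ → Eucl n) ((c.derivAt_bijective x 0).1 h5.1)) h5.2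
  · rw [hΨ]
    have h0 : c.derivAt x 0 ((0 : Eucl n), (0 : ℝ)) = 0 := map_zero _
    rw [h0, (h1.stable _).apply_tail s hs]
    simp
  · exact (h1.stable (c.face x)).snd_apply _ i hi
  · have h4 := h1.comp_continuous (Z := TangentBundle (Q n) F × (ℕ → ℝ))
      (c.continuous_derivAt (r := fun _ => 0) (t := fun _ => 0) continuous_fst
      continuous_const continuous_const) continuous_snd
    exact ((LinearMap.fst ℝ (Eucl n) ℝ ∘ₗ
      (snocL n).symm.toLinearMap).continuous_of_finiteDimensional.comp h4.fst).prodMk h4.snd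
  · rw [hΨ', key]

end Desuspension

/-! ### Factors of product framings -/

/-- With p fixed, inserting zeros into the stable coordinates of φ (`shift`) restricts Ψ to its
second summand. So μ, about which nothing is assumed, inherits linearity, stability and continuity
from Ψ. -/
theorem exists_factor_framing {k m R : ℕ} {P : CompactManifold k} {N : CompactManifold m}
    (hP : Nonempty P) (φ : StableFraming P)
    {Ψ : P.prod N → Eucl (k + m) × (ℕ → ℝ) →ₗ[ℝ] Eucl (k + m) × (ℕ → ℝ)}
    (hΨ : IsFraming (P.prod N) R Ψ) (μ : N → Eucl m → (ℕ → ℝ) → Eucl m × (ℕ → ℝ))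
    (h : ∀ p n (w : Eucl k) (v : Eucl m) s, Ψ (P.toProd N (p, n))
      (mfderiv ((Q k).prod (Q m)) (Q (k + m)) (P.toProd N) (p, n) ((w, v) : Eucl k × Eucl m), s) =
        directSum φ.rank (φ.extend p w s) (μ n v (tail φ.rank s))) :
    ∃ φN : StableFraming N, ∀ n v s, φN.extend n v s = μ n v s := by
  obtain ⟨p⟩ := hP
  let shift : (ℕ → ℝ) →ₗ[ℝ] (ℕ → ℝ) :=
    { toFun := fun s i => if i < φ.rank then 0 else s (i - φ.rank)
      map_add' := fun s s' => by ext i; simp only [Pi.add_apply]; split_ifs <;> simp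
      map_smul' := fun a s => by ext i; simp }
  have shift_lt : ∀ s i, i < φ.rank → shift s i = 0 := fun s i hi => if_pos hi
  have tail_shift : ∀ s, tail φ.rank (shift s) = s := fun s => funext fun i => by
    change (if i + φ.rank < φ.rank then 0 else s (i + φ.rank - φ.rank)) = s i
    rw [if_neg (by omega), Nat.add_sub_cancel]
  let D : N → Eucl k × Eucl m →ₗ[ℝ] Eucl (k + m) := fun n =>
    { toFun := fun v => mfderiv ((Q k).prod (Q m)) (Q (k + m)) (P.toProd N) (p, n) v
      map_add' := (mfderiv ((Q k).prod (Q m)) (Q (k + m)) (P.toProd N) (p, n)).map_add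
      map_smul' := (mfderiv ((Q k).prod (Q m)) (Q (k + m)) (P.toProd N) (p, n)).map_smul }
  have hD : ∀ n, Function.Injective (D n) := fun n =>
    (P.isLocalDiffeomorph_toProd N (p, n)).mfderiv_bijective.1
  let T : (ℕ → ℝ) →ₗ[ℝ] (ℕ → ℝ) := LinearMap.funLeft ℝ ℝ fun i => i + φ.rank
  let A : Eucl (k + m) →ₗ[ℝ] Eucl m :=
    LinearMap.snd ℝ (Eucl k) (Eucl m) ∘ₗ (appendL k m).symm.toLinearEquiv.toLinearMap
  have hA : ∀ a b, A (append a b) = b := fun a b =>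
    congrArg Prod.snd ((appendL k m).symm_apply_apply (a, b))
  let L : N → Eucl m × (ℕ → ℝ) →ₗ[ℝ] Eucl m × (ℕ → ℝ) := fun n =>
    A.prodMap T ∘ₗ Ψ (P.toProd N (p, n)) ∘ₗ (D n ∘ₗ LinearMap.inr ℝ (Eucl k) (Eucl m)).prodMap shift
  have hΨ' : ∀ n v s, Ψ (P.toProd N (p, n)) (D n (0, v), shift s) =
      directSum φ.rank (φ.extend p (0 : Eucl k) (shift s)) (μ n v s) := fun n v s => by
    have := h p n 0 v (shift s)
    rwa [tail_shift] at this
  have hL : ∀ n v s, L n (v, s) = μ n v s := fun n v s => by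
    refine (congrArg (A.prodMap T) (hΨ' n v s)).trans (Prod.ext (hA _ _) (funext fun i => ?_))
    change (if i + φ.rank < φ.rank then _ else (μ n v s).2 (i + φ.rank - φ.rank)) = _
    rw [if_neg (by omega), Nat.add_sub_cancel]
  have hF : IsFraming N R L := by
    refine ⟨fun n => ⟨?_, fun s hs => ?_, fun z i hi => ?_⟩, ?_⟩
    · rw [injective_iff_map_eq_zero]
      rintro ⟨v, s⟩ h0
      have h1 := hΨ' n v s
      have h2 : φ.extend p (0 : Eucl k) (shift s) = (0, shift s) :=
        (φ.isStable p).apply_tail (shift s) (shift_lt s)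
      rw [← hL, h0, h2] at h1
      have h3 : directSum φ.rank ((0 : Eucl k), shift s) (0 : Eucl m × (ℕ → ℝ)) = 0 := by
        refine Prod.ext ((appendL k m).map_zero) (funext fun i => ?_)
        change (if i < φ.rank then shift s i else 0) = 0
        split_ifs with hi
        exacts [shift_lt s i hi, rfl]
      rw [h3] at h1
      have h4 := (hΨ.stable _).injective (h1.trans (map_zero _).symm)
      have h5 := hD n ((congrArg Prod.fst h4).trans (map_zero (D n)).symm)
      have h6 : s = 0 := by
        rw [← tail_shift s, show shift s = 0 from congrArg Prod.snd h4]; rfl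
      exact Prod.ext (congrArg Prod.snd h5) h6
    · have h0 : D n ((0 : Eucl k), (0 : Eucl m)) = 0 := map_zero _
      change A.prodMap T (Ψ _ (D n (0, 0), shift s)) = _
      rw [h0, (hΨ.stable _).apply_tail (shift s) fun i hi => ?_]
      · exact Prod.ext (map_zero A) (tail_shift s)
      · change (if i < φ.rank then 0 else s (i - φ.rank)) = 0
        split_ifs
        exacts [rfl, hs _ (by omega)]
    · change (Ψ _ _).2 (i + φ.rank) = _
      rw [(hΨ.stable _).snd_apply _ _ (by omega)]
      exact congrFun (tail_shift z.2) i
    · have h1 : Continuous fun z : TangentBundle (Q m) N × (ℕ → ℝ) =>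
          (⟨P.toProd N (p, z.1.proj), D z.1.proj (0, z.1.snd)⟩ : TangentBundle (Q (k + m)) (P.prod N)) :=
        ((P.isLocalDiffeomorph_toProd N).contMDiff.continuous_tangentMap (by simp)).comp
          (continuous_tangentBundle_prod_mk (a := fun _ => (⟨p, 0⟩ : TangentBundle (Q k) P))
            continuous_const continuous_fst)
      have hsh : Continuous shift := continuous_pi fun i => by
        by_cases hi : i < φ.rank
        · simp only [shift_lt _ i hi]; exact continuous_const
        · have : ∀ s, shift s i = s (i - φ.rank) := fun s => if_neg hi
          simp only [this]; fun_prop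
      have h2 := hΨ.comp_continuous h1 (hsh.comp continuous_snd)
      refine (A.continuous_of_finiteDimensional.comp h2.fst).prodMk ?_
      exact continuous_pi fun i => (continuous_apply (i + φ.rank)).comp h2.snd
  obtain ⟨φN, hφN⟩ := hF.exists_stableFraming
  refine ⟨φN, fun n v s => ?_⟩
  exact (congrArg (fun L : N → Eucl m × (ℕ → ℝ) →ₗ[ℝ] Eucl m × (ℕ → ℝ) => L n (v, s)) hφN).trans
    (hL n v s)

/-! ### Elements of bordism groups -/

theorem BordismGroup.cls_eq_of_bordant {S : Type*} {bordant : S → S → Prop}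
    {union : S → S → S → Prop} {A B : S} (h : bordant A B) :
    (cls A : BordismGroup bordant union) = cls B := by
  refine Eq.symm (QuotientAddGroup.eq.2 ?_)
  rw [neg_add_eq_sub]
  exact AddSubgroup.subset_closure (Or.inl ⟨A, B, h, rfl⟩)

theorem BordismGroup.cls_eq_add {S : Type*} {bordant : S → S → Prop}
    {union : S → S → S → Prop} {A B C : S} (h : union A B C) :
    (cls C : BordismGroup bordant union) = cls A + cls B := by
  refine Eq.symm (QuotientAddGroup.eq.2 ?_)
  change -(FreeAbelianGroup.of A + FreeAbelianGroup.of B) + FreeAbelianGroup.of C ∈ _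
  rw [neg_add_eq_sub]
  exact AddSubgroup.subset_closure (Or.inr ⟨A, B, C, h, rfl⟩)

/-- Every bordism class is a difference of classes of objects, if there are disjoint unions. -/
theorem BordismGroup.exists_eq_sub {S : Type*} {bordant : S → S → Prop}
    {union : S → S → S → Prop} (hu : ∀ A B, ∃ C, union A B C) (A₀ : S)
    (z : BordismGroup bordant union) : ∃ A B, z = cls A - cls B := by
  obtain ⟨z, rfl⟩ := QuotientAddGroup.mk_surjective z
  induction z using FreeAbelianGroup.induction_on' with
  | zero => exact ⟨A₀, A₀, (sub_self _).symm⟩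
  | pure A =>
    obtain ⟨C, hC⟩ := hu A A
    refine ⟨C, A, ?_⟩
    rw [cls_eq_add hC, add_sub_cancel_right]
    rfl
  | neg A h =>
    obtain ⟨B, C, h⟩ := h
    exact ⟨C, B, by rw [QuotientAddGroup.mk_neg, h, neg_sub]⟩
  | add a b ha hb =>
    obtain ⟨A, B, ha⟩ := ha
    obtain ⟨A', B', hb⟩ := hb
    obtain ⟨C, hC⟩ := hu A A'
    obtain ⟨C', hC'⟩ := hu B B'
    refine ⟨C, C', ?_⟩
    rw [QuotientAddGroup.mk_add, ha, hb, cls_eq_add hC, cls_eq_add hC']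
    abel

/-! ### Sums and products of closed manifolds over a space -/

section Sums

variable {n : ℕ} {X : Type*} [TopologicalSpace X]

/-- The disjoint union of two closed manifolds over `X`. -/
def Singular.sum (A B : Singular n X) : Singular n X where
  toCompactManifold := A.toCompactManifold.sum B.toCompactManifold
  boundary_eq := (CompactManifold.sumDisjointUnion _ _).boundary_eq A.boundary_eq B.boundary_eq
  map := ⟨Sum.elim A.map B.map, A.map.continuous.sumElim B.map.continuous⟩

theorem Singular.union_sum (A B : Singular n X) : Singular.Union A B (A.sum B) :=
  ⟨CompactManifold.sumDisjointUnion _ _, fun _ => rfl, fun _ => rfl⟩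

/-- The disjoint union of two closed framed manifolds over `X`, with a given framing. -/
def FramedSingular.sum (A B : FramedSingular n X)
    (φ : StableFraming (A.toCompactManifold.sum B.toCompactManifold)) : FramedSingular n X where
  toClosedManifold := (A.toSingular.sum B.toSingular).toClosedManifold
  framing := φ
  map := (A.toSingular.sum B.toSingular).map

theorem FramedSingular.exists_union_sum (A B : FramedSingular n X) :
    ∃ φ, (A.toCompactManifold.sumDisjointUnion B.toCompactManifold).Compatible
      A.framing B.framing φ ∧ FramedSingular.Union A B (A.sum B φ) := by
  obtain ⟨Φ, h1, h2, h3⟩ :=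
    (A.toCompactManifold.sumDisjointUnion B.toCompactManifold).exists_framing
      (A.framing.isFraming.mono (le_max_left _ B.framing.rank))
      (B.framing.isFraming.mono (le_max_right A.framing.rank _))
  obtain ⟨φ, rfl⟩ := h1.exists_stableFraming
  exact ⟨φ, ⟨h2, h3⟩, CompactManifold.sumDisjointUnion _ _, fun _ => rfl, fun _ => rfl, h2, h3⟩

end Sums

section Products

variable {k m : ℕ}

/-- The identification of the product manifold with the product. -/
def CompactManifold.prodDiffeomorph (P : CompactManifold k) (N : CompactManifold m) :
    Diffeomorph ((Q k).prod (Q m)) (Q (k + m)) (P × N) (P.prod N) ∞ where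
  toEquiv := (P.toProd N).toEquiv
  contMDiff_toFun := (P.isLocalDiffeomorph_toProd N).contMDiff
  contMDiff_invFun y := by
    obtain ⟨x, rfl⟩ := (P.toProd N).surjective y
    obtain ⟨g, h1, -, -, h4⟩ := (P.isLocalDiffeomorph_toProd N x).exists_inverse
    refine h1.contMDiffAt.congr_of_eventuallyEq ?_
    filter_upwards [h4] with z hz
    conv_lhs => rw [← hz]
    exact (P.toProd N).symm_apply_apply _

theorem CompactManifold.boundary_prod {P : CompactManifold k} {N : CompactManifold m}
    (hP : P.boundary = ∅) (hN : N.boundary = ∅) : (P.prod N).boundary = ∅ := by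
  refine Set.eq_empty_of_forall_notMem fun y hy => ?_
  obtain ⟨⟨p, n⟩, rfl⟩ := (P.toProd N).surjective y
  have := (P.toProd_mem_boundary_iff N).1 hy
  simp [hP, hN] at this

variable {J : Type*} {P : J → CompactManifold k} (W : BSManifold P m)

namespace BSManifold

/-- The collar of one component of the singular face. -/
def productCollar (i : J) : Collar ((P i).prod (W.N i)) W.M where
  toFun z := W.ι i ((((P i).toProd (W.N i)).symm z.1).2, (((P i).toProd (W.N i)).symm z.1).1, z.2)
  isLocalDiffeomorph := by
    rintro ⟨y, r⟩
    obtain ⟨⟨p, n⟩, rfl⟩ := ((P i).toProd (W.N i)).surjective y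
    refine IsLocalDiffeomorphAt.of_comp_right
      (f := Prod.map ((P i).toProd (W.N i)) (id : Ray → Ray)) (x := ((p, n), r)) ?_
      (((P i).isLocalDiffeomorph_toProd (W.N i) _).prodMap (isLocalDiffeomorphAt_id r))
    have h : IsLocalDiffeomorph (((Q k).prod (Q m)).prod (Q 1)) ((Q m).prod ((Q k).prod (Q 1))) ∞
        fun z : (P i × W.N i) × Ray => (z.1.2, z.1.1, z.2) :=
      isLocalDiffeomorph_of_homeomorph
        { toFun := fun z : (P i × W.N i) × Ray => (z.1.2, z.1.1, z.2)
          invFun := fun z : W.N i × P i × Ray => ((z.2.1, z.1), z.2.2)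
          left_inv := fun _ => rfl
          right_inv := fun _ => rfl
          continuous_toFun := by fun_prop
          continuous_invFun := by fun_prop }
        (contMDiff_fst.snd.prodMk (contMDiff_fst.fst.prodMk contMDiff_snd))
        ((contMDiff_snd.fst.prodMk contMDiff_fst).prodMk contMDiff_snd.snd)
    exact (h ((p, n), r)).comp _ _ (W.isLocalDiffeomorph i _)
  injective := by
    rintro ⟨y, r⟩ ⟨y', r'⟩ h
    obtain ⟨h1, h2, rfl⟩ := W.ι_eq h
    obtain rfl := ((P i).toProd (W.N i)).symm.injective (Prod.ext h2 h1)
    rfl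

theorem productCollar_derivAt (i : J) (p : P i) (n : W.N i) (w : Eucl k) (v : Eucl m) (t : ℝ) :
    (W.productCollar i).derivAt ((P i).toProd (W.N i) (p, n)) 0
      (mfderiv ((Q k).prod (Q m)) (Q (k + m)) ((P i).toProd (W.N i)) (p, n)
        ((w, v) : Eucl k × Eucl m), t) = W.deriv i n p v w t := by
  refine (Collar.derivAt_apply _ _ _ _ _).trans ?_
  let f : (P i × W.N i) × Ray → (P i).prod (W.N i) × Ray :=
    Prod.map ((P i).toProd (W.N i)) id
  let g : (P i × W.N i) × Ray → W.N i × P i × Ray := fun z => (z.1.2, z.1.1, z.2)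
  have ht := (P i).isLocalDiffeomorph_toProd (W.N i)
  have hf1 := ht.mdifferentiable (by simp) (p, n)
  have h1 := mfderiv_comp ((p, n), (0 : Ray)) (f := f)
    ((W.productCollar i).isLocalDiffeomorph.mdifferentiable (by simp)
      ((P i).toProd (W.N i) (p, n), 0)) (hf1.prodMap mdifferentiableAt_id)
  have hg : HasMFDerivAt (((Q k).prod (Q m)).prod (Q 1)) ((Q m).prod ((Q k).prod (Q 1))) g
      ((p, n), 0) _ :=
    ((hasMFDerivAt_snd (p, n)).comp ((p, n), (0 : Ray)) (hasMFDerivAt_fst _)).prodMk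
      (((hasMFDerivAt_fst (p, n)).comp ((p, n), (0 : Ray)) (hasMFDerivAt_fst _)).prodMk
        (hasMFDerivAt_snd ((p, n), (0 : Ray))))
  have h2 := mfderiv_comp ((p, n), (0 : Ray)) (f := g)
    ((W.isLocalDiffeomorph i).mdifferentiable (by simp) (n, p, 0)) hg.mdifferentiableAt
  have h3 := DFunLike.congr_fun (h1.symm.trans h2)
    (((w, v), EuclideanSpace.single (0 : Fin 1) t) : (Eucl k × Eucl m) × Eucl 1)
  have h4 : mfderiv (((Q k).prod (Q m)).prod (Q 1)) ((Q (k + m)).prod (Q 1)) f ((p, n), 0)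
      (((w, v), EuclideanSpace.single (0 : Fin 1) t) : (Eucl k × Eucl m) × Eucl 1) =
      ((mfderiv ((Q k).prod (Q m)) (Q (k + m)) ((P i).toProd (W.N i)) (p, n)
        ((w, v) : Eucl k × Eucl m), EuclideanSpace.single (0 : Fin 1) t) :
          Eucl (k + m) × Eucl 1) := by
    rw [mfderiv_prodMap hf1 mdifferentiableAt_id]
    exact Prod.ext rfl (by simp [mfderiv_id]; rfl)
  refine (congrArg (mfderiv ((Q (k + m)).prod (Q 1)) (Q (k + m + 1)) (W.productCollar i).toFun
    ((P i).toProd (W.N i) (p, n), 0)) h4.symm).trans (h3.trans ?_)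
  rw [hg.mfderiv]
  rfl

variable {X : Type*} [TopologicalSpace X]

/-- One component of the singular face, as a closed manifold over `X`. -/
def faceSingular (F : C(W.M, X)) (i : J) (hP : (P i).boundary = ∅) (hN : (W.N i).boundary = ∅) :
    Singular (k + m) X where
  toCompactManifold := (P i).prod (W.N i)
  boundary_eq := CompactManifold.boundary_prod hP hN
  map := ⟨fun y => F ((W.productCollar i).face y),
    F.continuous.comp (W.productCollar i).continuous_face⟩

/-- The normal factor of one component of the singular face, as a closed manifold over `X`. -/
def normalSingular (F : C(W.M, X)) (i : J) (p : P i) (hN : (W.N i).boundary = ∅) :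
    Singular m X where
  toCompactManifold := W.N i
  boundary_eq := hN
  map := ⟨fun n => F (W.face i n p), F.continuous.comp
    ((W.isLocalDiffeomorph i).contMDiff.continuous.comp (by fun_prop))⟩

theorem isProduct_faceSingular {F : C(W.M, X)} (hF : W.MapCompatible F) (i : J)
    (hP : (P i).boundary = ∅) (hN : (W.N i).boundary = ∅) (p : P i) :
    IsProduct ⟨P i, hP⟩ (W.normalSingular F i p hN) (W.faceSingular F i hP hN) :=
  ⟨(P i).prodDiffeomorph (W.N i), fun p' x => hF i x p' p⟩

end BSManifold

end Products

/-! ### Turning one singular face into an outgoing face -/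

section Outgoing

variable {k m : ℕ} {J : Type*} {P : J → CompactManifold k} {X : Type*} [TopologicalSpace X]
  (W : BSManifold P m)

/-- As N i and P i are closed, the singular collar meets the boundary only at r = 0. So a face that
avoids the singular face avoids its whole collar, where framings will be modified. -/
theorem Collar.face_ne_ι {D : CompactManifold (k + m)} (c : Collar D W.M) {i : J}
    (hP : (P i).boundary = ∅) (hN : (W.N i).boundary = ∅) (hd : ∀ x n p, c.face x ≠ W.face i n p)
    (x : D) (z : W.N i × P i × Ray) : c.face x ≠ W.ι i z := by
  obtain ⟨n, p, r⟩ := z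
  intro h
  rcases W.ι_mem_boundary_iff.1 (h ▸ c.face_mem_boundary x) with h1 | h1 | rfl
  · rw [hN] at h1; exact h1
  · rw [hP] at h1; exact h1
  · exact hd x n p h

theorem BSManifold.range_productCollar (i : J) : Set.range (W.productCollar i).face =
    {y | ∃ n p, W.face i n p = y} := by
  refine Set.Subset.antisymm ?_ ?_
  · rintro _ ⟨y, rfl⟩
    obtain ⟨⟨p, n⟩, rfl⟩ := ((P i).toProd (W.N i)).surjective y
    exact ⟨n, p, rfl⟩
  · rintro _ ⟨n, p, rfl⟩
    exact ⟨(P i).toProd (W.N i) (p, n), rfl⟩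

theorem BSManifold.exists_contract_productCollar {D : CompactManifold (k + m)} (c : Collar D W.M)
    {i : J} (hd : ∀ x n p, c.face x ≠ W.face i n p) : ∃ (δ : ℝ) (hδ : 0 < δ),
      ∀ z z', (c.contract hδ).toFun z ≠ ((W.productCollar i).contract hδ).toFun z' :=
  c.exists_contract_disjoint (W.productCollar i) fun x y => by
    obtain ⟨⟨p, n⟩, rfl⟩ := ((P i).toProd (W.N i)).surjective y
    exact hd x n p

variable {W}

/-- A component of the singular face can be added to an outgoing face. -/
theorem Singular.exists_add_face {F : C(W.M, X)} (hF : W.MapCompatible F) (D : Singular (k + m) X)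
    (c : Collar D.toCompactManifold W.M) (hc : ∀ x, F (c.face x) = D.map x) {i : J}
    (hP : (P i).boundary = ∅) (hN : P i → (W.N i).boundary = ∅)
    (hd : ∀ x n p, c.face x ≠ W.face i n p) :
    ∃ (D' : Singular (k + m) X) (c' : Collar D'.toCompactManifold W.M),
      (∀ x, F (c'.face x) = D'.map x) ∧
      Set.range c'.face = Set.range c.face ∪ {y | ∃ n p, W.face i n p = y} ∧
      (BordismGroup.cls D' - BordismGroup.cls D : Omega (k + m) X) ∈ products k m X := by
  -- For empty P i there is nothing to add, and N i need not be closed.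
  rcases isEmpty_or_nonempty (P i) with h0 | ⟨⟨p⟩⟩
  · refine ⟨D, c, hc, ?_, by rw [sub_self]; exact zero_mem _⟩
    rw [Set.eq_empty_of_forall_notMem (s := {y | ∃ n p, W.face i n p = y})
      fun y ⟨_, p, _⟩ => h0.elim p, Set.union_empty]
  obtain ⟨δ, hδ, hdis⟩ := W.exists_contract_productCollar c hd
  let E := W.faceSingular F i hP (hN p)
  let c' := (c.contract hδ).union ((W.productCollar i).contract hδ) hdis
  have hface : c'.face = Sum.elim c.face (W.productCollar i).face := by
    rw [Collar.union_face, Collar.contract_face, Collar.contract_face]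
  refine ⟨D.sum E, c', fun x => ?_, ?_, ?_⟩
  · refine (congrArg F (congrFun hface x)).trans ?_
    rcases x with x | y
    exacts [hc x, rfl]
  · refine (Collar.range_union_face _ _ hdis).trans ?_
    rw [Collar.contract_face, Collar.contract_face, W.range_productCollar]
  · rw [BordismGroup.cls_eq_add (D.union_sum E), add_sub_cancel_left]
    exact AddSubgroup.subset_closure ⟨_, _, _, W.isProduct_faceSingular hF i hP (hN p) p, rfl⟩

/-- A component of the singular face can be added to an outgoing framed face. -/
theorem FramedSingular.exists_add_face {φP : ∀ i, StableFraming (P i)} {F : C(W.M, X)}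
    (hF : W.MapCompatible F) (D : FramedSingular (k + m) X)
    (c : Collar D.toCompactManifold W.M) (hc : ∀ x, F (c.face x) = D.map x) {i : J}
    (hP : (P i).boundary = ∅) (hN : P i → (W.N i).boundary = ∅)
    (hd : ∀ x n p, c.face x ≠ W.face i n p) {R : ℕ}
    {Φ : W.M → Eucl (k + m + 1) × (ℕ → ℝ) →ₗ[ℝ] Eucl (k + m + 1) × (ℕ → ℝ)}
    (hΦ : IsFraming W.M R Φ) (hi : ∀ n, W.CompatibleAt φP Φ i n)
    (hcΦ : ∀ x v t s, Φ (c.face x) (c.derivAt x 0 (v, t), s) =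
      (snoc (D.framing.toLin x (v, s)).1 (-t), (D.framing.toLin x (v, s)).2)) :
    ∃ (D' : FramedSingular (k + m) X) (c' : Collar D'.toCompactManifold W.M) (R' : ℕ)
      (Φ' : W.M → Eucl (k + m + 1) × (ℕ → ℝ) →ₗ[ℝ] Eucl (k + m + 1) × (ℕ → ℝ)),
      IsFraming W.M R' Φ' ∧ (∀ u, u ∉ Set.range (W.ι i) → Φ' u = Φ u) ∧
      (∀ x v t s, Φ' (c'.face x) (c'.derivAt x 0 (v, t), s) =
        (snoc (D'.framing.toLin x (v, s)).1 (-t), (D'.framing.toLin x (v, s)).2)) ∧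
      (∀ x, F (c'.face x) = D'.map x) ∧
      Set.range c'.face = Set.range c.face ∪ {y | ∃ n p, W.face i n p = y} ∧
      (BordismGroup.cls D' - BordismGroup.cls D : FramedOmega (k + m) X)
        ∈ framedProducts k m X := by
  rcases isEmpty_or_nonempty (P i) with h0 | ⟨⟨p⟩⟩
  · refine ⟨D, c, R, Φ, hΦ, fun _ _ => rfl, hcΦ, hc, ?_, by rw [sub_self]; exact zero_mem _⟩
    rw [Set.eq_empty_of_forall_notMem (s := {y | ∃ n p, W.face i n p = y})
      fun y ⟨_, p, _⟩ => h0.elim p, Set.union_empty]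
  obtain ⟨δ, hδ, hdis⟩ := W.exists_contract_productCollar c hd
  let b := W.productCollar i
  -- The rank is raised so that the coordinate used for the desuspension lies beyond those that
  -- stabilise φP i.
  let R₀ := max R (φP i).rank
  have hR₀ : (φP i).rank ≤ R₀ := le_max_right _ _
  obtain ⟨Φ', Ψ, h1, h2, h3, h4, h5⟩ := b.exists_outgoing (hΦ.mono (le_max_left R (φP i).rank))
  choose ν hν using hi
  -- This is the desuspension of the normal datum ν. Since ν was chosen pointwise, μ is only a
  -- function at first; `exists_factor_framing` shows that it is a framing of N i.
  let μ : W.N i → Eucl m → (ℕ → ℝ) → Eucl m × (ℕ → ℝ) := fun n v s =>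
    desuspend (R₀ - (φP i).rank) (ν n v (-s (R₀ - (φP i).rank))
      (Function.update s (R₀ - (φP i).rank) 0))
  have hμ : ∀ p n (w : Eucl k) (v : Eucl m) s, Ψ ((P i).toProd (W.N i) (p, n))
      (mfderiv ((Q k).prod (Q m)) (Q (k + m)) ((P i).toProd (W.N i)) (p, n)
        ((w, v) : Eucl k × Eucl m), s) =
        directSum (φP i).rank ((φP i).extend p w s) (μ n v (tail (φP i).rank s)) := by
    intro p n w v s
    refine (h5 _ _ _).trans ?_
    have e1 := W.productCollar_derivAt i p n w v (-s R₀)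
    have e2 := hν n p v w (-s R₀) (Function.update s R₀ 0)
    refine (congrArg (desuspend R₀) ((congrArg (fun u : Eucl (k + m + 1) => Φ (W.face i n p)
      (u, Function.update s R₀ 0)) e1).trans e2)).trans ?_
    refine (desuspend_directSum hR₀ _ _).trans ?_
    have e3 : tail (φP i).rank (Function.update s R₀ 0) =
        Function.update (tail (φP i).rank s) (R₀ - (φP i).rank) 0 := funext fun j => by
      simp only [tail, Function.update_apply]
      refine if_congr ?_ rfl rfl
      omega
    have e4 : tail (φP i).rank s (R₀ - (φP i).rank) = s R₀ := by
      rw [tail, Nat.sub_add_cancel hR₀]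
    rw [e3]
    refine ((φP i).directSum_extend_congr p w (s' := s) (fun j hj => ?_) _).trans ?_
    · rw [Function.update_of_ne (by omega)]
    · simp only [μ, e4]
  obtain ⟨φN, hφN⟩ := exists_factor_framing ⟨p⟩ (φP i) h2 μ hμ
  obtain ⟨ψ, rfl⟩ := h2.exists_stableFraming
  let E : FramedSingular (k + m) X :=
    { toClosedManifold := (W.faceSingular F i hP (hN p)).toClosedManifold
      framing := ψ
      map := (W.faceSingular F i hP (hN p)).map }
  let N : FramedSingular m X :=
    { toClosedManifold := (W.normalSingular F i p (hN p)).toClosedManifold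
      framing := φN
      map := (W.normalSingular F i p (hN p)).map }
  have hE : IsFramedProduct ⟨⟨P i, hP⟩, φP i⟩ N E := by
    refine ⟨(P i).prodDiffeomorph (W.N i), fun p' x => hF i x p' p, fun p' n w v s => ?_⟩
    exact (hμ p' n w v s).trans (congrArg (directSum (φP i).rank ((φP i).extend p' w s))
      (hφN n v _).symm)
  obtain ⟨φ, ⟨hu1, hu2⟩, hu⟩ := D.exists_union_sum E
  let c' := (c.contract hδ).union (b.contract hδ) hdis
  have hface : c'.face = Sum.elim c.face b.face := by
    rw [Collar.union_face, Collar.contract_face, Collar.contract_face]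
  have hl : ∀ x (v : Eucl (k + m)) t s, Φ' (c'.face (Sum.inl x)) (c'.derivAt (Sum.inl x) 0
      (tderiv (M' := D.toCompactManifold.sum ((P i).prod (W.N i))) Sum.inl x v, t), s) =
      (snoc (D.framing.toLin x (v, s)).1 (-t), (D.framing.toLin x (v, s)).2) := by
    intro x v t s
    -- The framing has changed only in the singular collar, which the old outgoing face avoids.
    have h6 : c.face x ∉ Set.range b.toFun := by
      rintro ⟨⟨y, r⟩, hy⟩
      obtain ⟨⟨p, n⟩, rfl⟩ := ((P i).toProd (W.N i)).surjective y
      exact c.face_ne_ι W hP (hN p) hd x (n, p, r) hy.symm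
    have e1 : Φ' (c'.face (Sum.inl x)) = Φ (c.face x) :=
      (congrArg Φ' (congrFun hface (Sum.inl x))).trans (h3 _ h6)
    have e2 := (Collar.union_derivAt_inl _ _ hdis x 0 v t).trans (c.contract_derivAt hδ x v t)
    exact (congrArg (fun L : Eucl (k + m + 1) × (ℕ → ℝ) →ₗ[ℝ] Eucl (k + m + 1) × (ℕ → ℝ) =>
      L (c'.derivAt (Sum.inl x) 0 (tderiv (M' := D.toCompactManifold.sum ((P i).prod (W.N i)))
        Sum.inl x v, t), s)) e1).trans ((congrArg (fun u : Eucl (k + m + 1) =>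
          Φ (c.face x) (u, s)) e2).trans (hcΦ x v t s))
  have hr : ∀ x (v : Eucl (k + m)) t s, Φ' (c'.face (Sum.inr x)) (c'.derivAt (Sum.inr x) 0
      (tderiv (M' := D.toCompactManifold.sum ((P i).prod (W.N i))) Sum.inr x v, t), s) =
      (snoc (ψ.toLin x (v, s)).1 (-t), (ψ.toLin x (v, s)).2) := by
    intro x v t s
    have e1 : Φ' (c'.face (Sum.inr x)) = Φ' (b.face x) :=
      congrArg Φ' (congrFun hface (Sum.inr x))
    have e2 := (Collar.union_derivAt_inr _ _ hdis x 0 v t).trans (b.contract_derivAt hδ x v t)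
    exact (congrArg (fun L : Eucl (k + m + 1) × (ℕ → ℝ) →ₗ[ℝ] Eucl (k + m + 1) × (ℕ → ℝ) =>
      L (c'.derivAt (Sum.inr x) 0 (tderiv (M' := D.toCompactManifold.sum ((P i).prod (W.N i)))
        Sum.inr x v, t), s)) e1).trans ((congrArg (fun u : Eucl (k + m + 1) =>
          Φ' (b.face x) (u, s)) e2).trans (h4 x v t s))
  refine ⟨D.sum E φ, c', R₀ + 1, Φ', h1, fun u hu' => ?_, fun x v t s => ?_, fun x => ?_, ?_, ?_⟩
  · refine h3 u fun ⟨⟨y, r⟩, hy⟩ => hu' ?_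
    obtain ⟨⟨p, n⟩, rfl⟩ := ((P i).toProd (W.N i)).surjective y
    exact ⟨(n, p, r), hy⟩
  · rcases x with x | x
    · obtain ⟨v, rfl⟩ := (tderiv_bijective (M' := D.toCompactManifold.sum ((P i).prod (W.N i)))
        (isLocalDiffeomorph_inl x)).2 v
      exact (hl x v t s).trans (congrArg (fun y : Eucl (k + m) × (ℕ → ℝ) => (snoc y.1 (-t), y.2))
        (hu1 x v s).symm)
    · obtain ⟨v, rfl⟩ := (tderiv_bijective (M' := D.toCompactManifold.sum ((P i).prod (W.N i)))
        (isLocalDiffeomorph_inr x)).2 v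
      exact (hr x v t s).trans (congrArg (fun y : Eucl (k + m) × (ℕ → ℝ) => (snoc y.1 (-t), y.2))
        (hu2 x v s).symm)
  · refine (congrArg F (congrFun hface x)).trans ?_
    rcases x with x | y
    exacts [hc x, rfl]
  · refine (Collar.range_union_face _ _ hdis).trans ?_
    rw [Collar.contract_face, Collar.contract_face, W.range_productCollar]
  · rw [BordismGroup.cls_eq_add hu, add_sub_cancel_left]
    exact AddSubgroup.subset_closure ⟨_, _, _, hE, rfl⟩

end Outgoing

/-! ### The empty manifold over a space -/

section Empty

variable (n : ℕ) (X : Type*) [TopologicalSpace X]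

/-- The empty closed manifold over `X`. -/
def Singular.empty : Singular n X where
  toCompactManifold := CompactManifold.empty n
  boundary_eq := Set.eq_empty_of_isEmpty _
  map := ⟨fun x => isEmptyElim (α := CompactManifold.empty n) x,
    continuous_of_const fun x => isEmptyElim (α := CompactManifold.empty n) x⟩

theorem isFraming_empty : IsFraming (CompactManifold.empty n) 0
    fun x => isEmptyElim (α := CompactManifold.empty n) x := by
  refine ⟨fun x => isEmptyElim (α := CompactManifold.empty n) x, ?_⟩
  have := isEmpty_tangentBundle_empty n
  exact continuous_iff_continuousAt.2 fun z => isEmptyElim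
    (α := TangentBundle (Q n) (CompactManifold.empty n)) z.1

/-- The empty closed framed manifold over `X`. -/
def FramedSingular.empty : FramedSingular n X where
  toClosedManifold := (Singular.empty n X).toClosedManifold
  framing := (isFraming_empty n).exists_stableFraming.choose
  map := (Singular.empty n X).map

end Empty

/-! ### Turning all singular faces into outgoing faces -/

section Kernel

variable {k m : ℕ} {J : Type*} {P : J → CompactManifold k} {X : Type*} [TopologicalSpace X]
  {W : BSManifold P m}

theorem BSManifold.face_eq {i i' : J} {n : W.N i} {n' : W.N i'} {p : P i} {p' : P i'} {r r' : Ray}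
    (h : W.ι i (n, p, r) = W.ι i' (n', p', r')) : i = i' :=
  congrArg Sigma.fst (W.injective (a₁ := ⟨i, n, p, r⟩) (a₂ := ⟨i', n', p', r'⟩) h)

/-- Components of the singular face can be added to an outgoing face. -/
theorem Singular.exists_add_faces {F : C(W.M, X)} (hF : W.MapCompatible F) (B : Singular (k + m) X)
    (c : Collar B.toCompactManifold W.M) (hc : ∀ x, F (c.face x) = B.map x)
    (hP : ∀ i, (P i).boundary = ∅) (hN : ∀ i, P i → (W.N i).boundary = ∅)
    (hd : ∀ x i n p, c.face x ≠ W.face i n p) (S : Finset J) :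
    ∃ (D : Singular (k + m) X) (c' : Collar D.toCompactManifold W.M),
      (∀ x, F (c'.face x) = D.map x) ∧
      Set.range c'.face = Set.range c.face ∪ {y | ∃ i ∈ S, ∃ n p, W.face i n p = y} ∧
      (BordismGroup.cls D - BordismGroup.cls B : Omega (k + m) X) ∈ products k m X := by
  classical
  induction S using Finset.induction_on with
  | empty => exact ⟨B, c, hc, by simp, by rw [sub_self]; exact zero_mem _⟩
  | insert i S hi ih =>
    obtain ⟨D, c', h1, h2, h3⟩ := ih
    obtain ⟨D', c'', h4, h5, h6⟩ := D.exists_add_face hF c' h1 (hP i) (hN i) (by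
      intro x n p hx
      rcases h2 ▸ Set.mem_range_self x with ⟨y, hy⟩ | ⟨i', hi', n', p', hy⟩
      · exact hd y i n p (hy.trans hx)
      · exact hi (BSManifold.face_eq (hy.trans hx) ▸ hi'))
    refine ⟨D', c'', h4, ?_, ?_⟩
    · rw [h5, h2, Set.union_assoc]
      congr 1
      ext y
      simp only [Set.mem_union, Set.mem_ofPred_eq, Finset.mem_insert, exists_eq_or_imp]
      exact or_comm
    · have := add_mem h6 h3
      rwa [sub_add_sub_cancel] at this

/-- Components of the singular face can be added to an outgoing framed face. -/
theorem FramedSingular.exists_add_faces {φP : ∀ i, StableFraming (P i)} {F : C(W.M, X)}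
    (hF : W.MapCompatible F) (B : FramedSingular (k + m) X)
    (c : Collar B.toCompactManifold W.M) (hc : ∀ x, F (c.face x) = B.map x)
    (hP : ∀ i, (P i).boundary = ∅) (hN : ∀ i, P i → (W.N i).boundary = ∅)
    (hd : ∀ x i n p, c.face x ≠ W.face i n p) {R : ℕ}
    {Φ : W.M → Eucl (k + m + 1) × (ℕ → ℝ) →ₗ[ℝ] Eucl (k + m + 1) × (ℕ → ℝ)}
    (hΦ : IsFraming W.M R Φ) (hi : ∀ i n, W.CompatibleAt φP Φ i n)
    (hcΦ : ∀ x v t s, Φ (c.face x) (c.derivAt x 0 (v, t), s) =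
      (snoc (B.framing.toLin x (v, s)).1 (-t), (B.framing.toLin x (v, s)).2)) (S : Finset J) :
    ∃ (D : FramedSingular (k + m) X) (c' : Collar D.toCompactManifold W.M) (R' : ℕ)
      (Φ' : W.M → Eucl (k + m + 1) × (ℕ → ℝ) →ₗ[ℝ] Eucl (k + m + 1) × (ℕ → ℝ)),
      IsFraming W.M R' Φ' ∧ (∀ u, (∀ i ∈ S, u ∉ Set.range (W.ι i)) → Φ' u = Φ u) ∧
      (∀ x v t s, Φ' (c'.face x) (c'.derivAt x 0 (v, t), s) =
        (snoc (D.framing.toLin x (v, s)).1 (-t), (D.framing.toLin x (v, s)).2)) ∧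
      (∀ x, F (c'.face x) = D.map x) ∧
      Set.range c'.face = Set.range c.face ∪ {y | ∃ i ∈ S, ∃ n p, W.face i n p = y} ∧
      (BordismGroup.cls D - BordismGroup.cls B : FramedOmega (k + m) X)
        ∈ framedProducts k m X := by
  classical
  induction S using Finset.induction_on with
  | empty =>
    exact ⟨B, c, R, Φ, hΦ, fun _ _ => rfl, hcΦ, hc, by simp, by rw [sub_self]; exact zero_mem _⟩
  | insert i S hiS ih =>
    obtain ⟨D, c', R', Φ', h7, h8, h9, h1, h2, h3⟩ := ih
    obtain ⟨D', c'', R'', Φ'', h10, h11, h12, h4, h5, h6⟩ :=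
      D.exists_add_face hF c' h1 (hP i) (hN i) (by
        intro x n p hx
        rcases h2 ▸ Set.mem_range_self x with ⟨y, hy⟩ | ⟨i', hi', n', p', hy⟩
        · exact hd y i n p (hy.trans hx)
        · exact hiS (BSManifold.face_eq (hy.trans hx) ▸ hi')) h7 (fun n => by
        obtain ⟨ν, hν⟩ := hi i n
        refine ⟨ν, fun p v w t s => ?_⟩
        -- The earlier modifications took place in the collars of other components, so the framing
        -- is still compatible over N i.
        rw [h8 (W.face i n p) fun i' hi' ⟨z, hz⟩ => hiS (BSManifold.face_eq hz ▸ hi')]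
        exact hν p v w t s) h9
    refine ⟨D', c'', R'', Φ'', h10, fun u hu => ?_, h12, h4, ?_, ?_⟩
    · rw [h11 u (hu i (Finset.mem_insert_self i S)),
        h8 u fun i' hi' => hu i' (Finset.mem_insert_of_mem hi')]
    · rw [h5, h2, Set.union_assoc]
      congr 1
      ext y
      simp only [Set.mem_union, Set.mem_ofPred_eq, Finset.mem_insert, exists_eq_or_imp]
      exact or_comm
    · have := add_mem h6 h3
      rwa [sub_add_sub_cancel] at this

end Kernel

/-! ### The kernel consists of products -/

section Kernel

variable {k d : ℕ} {J : Type*} {P : J → CompactManifold k} {X : Type*} [TopologicalSpace X]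

/-- The reduction of formal sums yields a bordism only between distinct objects, so distinct A and B
must remain distinct as singular manifolds. -/
theorem Singular.toBS_injective : Function.Injective
    (Singular.toBS P : Singular (k + (d + 1)) X → BSSingular P d X) := by
  intro A A' h
  have hf : HEq (A.toBS P : BSSingular P d X).map (A'.toBS P : BSSingular P d X).map := by rw [h]
  have hM : (A.toBS P : BSSingular P d X).M = (A'.toBS P : BSSingular P d X).M := by rw [h]
  obtain ⟨⟨M, _⟩, f⟩ := A
  obtain ⟨⟨M', _⟩, f'⟩ := A'
  obtain rfl : M = M' := hM
  obtain rfl : f = f' := eq_of_heq hf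
  rfl

theorem FramedSingular.toBS_injective {φP : ∀ i, StableFraming (P i)} : Function.Injective
    (FramedSingular.toBS φP : FramedSingular (k + (d + 1)) X → FramedBSSingular φP d X) := by
  intro A A' h
  have hf : HEq (A.toBS φP : FramedBSSingular φP d X).map
    (A'.toBS φP : FramedBSSingular φP d X).map := by rw [h]
  have hM : (A.toBS φP : FramedBSSingular φP d X).M = (A'.toBS φP : FramedBSSingular φP d X).M := by
    rw [h]
  have hφ : HEq (A.toBS φP : FramedBSSingular φP d X).framing.total
    (A'.toBS φP : FramedBSSingular φP d X).framing.total := by rw [h]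
  obtain ⟨⟨⟨M, _⟩, φ⟩, f⟩ := A
  obtain ⟨⟨⟨M', _⟩, φ'⟩, f'⟩ := A'
  obtain rfl : M = M' := hM
  obtain rfl : f = f' := eq_of_heq hf
  obtain rfl : φ = φ' := eq_of_heq hφ
  rfl

/-- Boundary of N i can only come from the normal manifolds of the ends, and these are empty when
the ends are nonsingular. This makes every component of the singular face a product of closed
manifolds. -/
theorem Cob.boundary_N_eq_empty {ι : Type} {obj : ι → BSSingular P d X} (V : Cob obj)
    (h : ∀ j i, IsEmpty ((obj j).N i)) (i : J) (p : P i) : (V.W.N i).boundary = ∅ := by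
  refine Set.eq_empty_of_forall_notMem fun n hn => ?_
  obtain ⟨j, x, -⟩ := V.boundary_N i p n hn
  exact (h j i).elim x

theorem Cob.face_ne {ι : Type} {obj : ι → BSSingular P d X} (V : Cob obj)
    (h : ∀ j i, IsEmpty ((obj j).N i)) (j : ι) (a : (obj j).M) (i : J) (n : V.W.N i) (p : P i) :
    (V.c j).face a ≠ V.W.face i n p := fun e => by
  obtain ⟨x, -⟩ := V.mem_range j i n p 0 a e.symm
  exact (h j i).elim x

/-- The faces `A` and `D` make up the boundary of `V`, if `D` contains the outgoing face and the
singular face. -/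
theorem Cob.boundary_eq {obj : Bool → BSSingular P d X} (V : Cob obj)
    {D : Set V.W.M} (hD : D = Set.range (V.c false).face ∪
      {y | ∃ i ∈ V.W.finite.toFinset, ∃ n p, V.W.face i n p = y}) (hD' : D ⊆ V.W.M.boundary) :
    V.W.M.boundary = Set.range (V.c true).face ∪ D := by
  refine Set.Subset.antisymm (fun w hw => ?_) ?_
  · rw [hD]
    rcases V.boundary w hw with ⟨_ | _, h⟩ | ⟨i, n, p, h⟩
    · exact Or.inr (Or.inl h)
    · exact Or.inl h
    · exact Or.inr (Or.inr ⟨i, V.W.finite.mem_toFinset.2 ⟨n⟩, n, p, h⟩)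
  · rintro _ (⟨x, rfl⟩ | h)
    exacts [(V.c true).face_mem_boundary x, hD' h]

/-- Once its singular face counts as outgoing, V is an ordinary bordism from A to some D, and [D] -
[B] is a sum of products. The collars of A and D are shrunk to become disjoint. -/
theorem ker_naturalMap_le (hP : ∀ i, (P i).boundary = ∅) :
    (naturalMap P d X).ker ≤ products k (d + 1) X := by
  intro z hz
  obtain ⟨A, B, rfl⟩ := BordismGroup.exists_eq_sub
    (fun A B => ⟨_, Singular.union_sum A B⟩) (Singular.empty (k + (d + 1)) X) z
  have h : (BordismGroup.cls (A.toBS P) : BSOmega P d X) = BordismGroup.cls (B.toBS P) := by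
    have := (naturalMap P d X).mem_ker.1 hz
    rwa [map_sub, sub_eq_zero, naturalMap, BordismGroup.map_cls, BordismGroup.map_cls] at this
  by_cases hAB : A = B
  · rw [hAB, sub_self]; exact zero_mem _
  obtain ⟨V⟩ := BSSingular.exists_cob hP (Singular.toBS_injective.ne hAB) h
  have he : ∀ j i, IsEmpty ((cond j (A.toBS P) (B.toBS P)).N i) := by
    rintro (_ | _) i <;> exact inferInstanceAs (IsEmpty (CompactManifold.empty d))
  let cA : Collar A.toCompactManifold V.W.M := V.c true
  let cB : Collar B.toCompactManifold V.W.M := V.c false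
  obtain ⟨D, c, h1, h2, h3⟩ := B.exists_add_faces V.map_compatible cB (V.map_face false) hP
    (V.boundary_N_eq_empty he) (V.face_ne he false) V.W.finite.toFinset
  obtain ⟨δ, hδ, hdis⟩ := cA.exists_contract_disjoint c (by
    intro x y hxy
    rcases h2 ▸ Set.mem_range_self y with ⟨b, hb⟩ | ⟨i, -, n, p, hb⟩
    · exact V.disjoint true false (by simp) (x, 0) (b, 0) (hxy.trans hb.symm)
    · exact V.face_ne he true x i n p (hxy.trans hb.symm))
  have hb := V.boundary_eq h2 (by rintro _ ⟨x, rfl⟩; exact c.face_mem_boundary x)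
  have hAD : Singular.Bordant A D :=
    ⟨{  W := V.W.M
        cA := cA.contract hδ
        cB := c.contract hδ
        disjoint := hdis
        boundary_eq := by rw [Collar.contract_face, Collar.contract_face]; exact hb }, V.map,
      fun x => (congrArg V.map (congrFun (cA.contract_face hδ) x)).trans (V.map_face true x),
      fun x => (congrArg V.map (congrFun (c.contract_face hδ) x)).trans (h1 x)⟩
  rw [BordismGroup.cls_eq_of_bordant hAD]
  exact h3

/-- The argument is that of `ker_naturalMap_le`. The framing of V is modified only in the singular
collars, so A stays an incoming face, while B and the former singular faces are outgoing. -/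
theorem ker_framedNaturalMap_le {φP : ∀ i, StableFraming (P i)} (hP : ∀ i, (P i).boundary = ∅) :
    (framedNaturalMap φP d X).ker ≤ framedProducts k (d + 1) X := by
  intro z hz
  obtain ⟨A, B, rfl⟩ := BordismGroup.exists_eq_sub
    (fun A B => (FramedSingular.exists_union_sum A B).imp' (A.sum B) fun _ => And.right)
    (FramedSingular.empty (k + (d + 1)) X) z
  have h : (BordismGroup.cls (A.toBS φP) : FramedBSOmega φP d X) =
      BordismGroup.cls (B.toBS φP) := by
    have := (framedNaturalMap φP d X).mem_ker.1 hz
    rwa [map_sub, sub_eq_zero, framedNaturalMap, BordismGroup.map_cls,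
      BordismGroup.map_cls] at this
  by_cases hAB : A = B
  · rw [hAB, sub_self]; exact zero_mem _
  obtain ⟨V, hV⟩ := FramedBSSingular.exists_cob hP (FramedSingular.toBS_injective.ne hAB) h
  have he : ∀ j i, IsEmpty ((cond j (A.toBS φP) (B.toBS φP)).N i) := by
    rintro (_ | _) i <;> exact inferInstanceAs (IsEmpty (CompactManifold.empty d))
  let cA : Collar A.toCompactManifold V.W.M := V.c true
  let cB : Collar B.toCompactManifold V.W.M := V.c false
  obtain ⟨R, Φ, hΦ, hΦi, hΦc⟩ := hV
  obtain ⟨D, c, R', Φ', h4, h5, h6, h1, h2, h3⟩ := B.exists_add_faces V.map_compatible cB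
    (V.map_face false) hP (V.boundary_N_eq_empty he) (V.face_ne he false) hΦ hΦi
    (fun x v t s => (hΦc false x v t s).trans (congrArg (fun a : ℝ =>
      (snoc (B.framing.toLin x (v, s)).1 a, (B.framing.toLin x (v, s)).2)) (neg_one_mul t))) V.W.finite.toFinset
  obtain ⟨δ, hδ, hdis⟩ := cA.exists_contract_disjoint c (by
    intro x y hxy
    rcases h2 ▸ Set.mem_range_self y with ⟨b, hb⟩ | ⟨i, -, n, p, hb⟩
    · exact V.disjoint true false (by simp) (x, 0) (b, 0) (hxy.trans hb.symm)
    · exact V.face_ne he true x i n p (hxy.trans hb.symm))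
  have hb := V.boundary_eq h2 (by rintro _ ⟨x, rfl⟩; exact c.face_mem_boundary x)
  obtain ⟨φ, rfl⟩ := h4.exists_stableFraming
  have hA : ∀ x, φ.toLin (cA.face x) = Φ (cA.face x) := fun x => h5 _ fun i _ ⟨z, hz⟩ =>
    cA.face_ne_ι V.W (hP i) (V.boundary_N_eq_empty he i z.2.1) (fun x n p => V.face_ne he true x i n p)
      x z hz.symm
  have compat : ∀ {D : FramedSingular (k + (d + 1)) X} (c : Collar D.toCompactManifold V.W.M)
      (ε : ℝ), (∀ x v t s, φ.toLin (c.face x) (c.derivAt x 0 (v, t), s) =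
        (snoc (D.framing.toLin x (v, s)).1 (ε * t), (D.framing.toLin x (v, s)).2)) →
      (c.contract hδ).Compatible ε D.framing φ := by
    intro D c ε h x v t s
    have e1 : φ.toLin ((c.contract hδ).face x) = φ.toLin (c.face x) :=
      congrArg φ.toLin (congrFun (c.contract_face hδ) x)
    have e2 := ((c.contract hδ).derivAt_zero x v t).symm.trans (c.contract_derivAt hδ x v t)
    refine Eq.trans ?_ (h x v t s)
    exact (congrArg (fun L : Eucl (k + (d + 1) + 1) × (ℕ → ℝ) →ₗ[ℝ]
      Eucl (k + (d + 1) + 1) × (ℕ → ℝ) => L ((c.contract hδ).deriv x v t, s)) e1).trans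
      (congrArg (fun u : Eucl (k + (d + 1) + 1) => φ.toLin (c.face x) (u, s)) e2)
  have hAD : FramedSingular.Bordant A D :=
    ⟨{  W := V.W.M
        cA := cA.contract hδ
        cB := c.contract hδ
        disjoint := hdis
        boundary_eq := by rw [Collar.contract_face, Collar.contract_face]; exact hb }, V.map, φ,
      fun x => (congrArg V.map (congrFun (cA.contract_face hδ) x)).trans (V.map_face true x),
      fun x => (congrArg V.map (congrFun (c.contract_face hδ) x)).trans (h1 x),
      compat cA 1 fun x v t s => (congrArg (fun L : Eucl (k + (d + 1) + 1) × (ℕ → ℝ) →ₗ[ℝ]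
        Eucl (k + (d + 1) + 1) × (ℕ → ℝ) => L (cA.derivAt x 0 (v, t), s)) (hA x)).trans
          (hΦc true x v t s),
      compat c (-1) fun x v t s => (h6 x v t s).trans (by rw [neg_one_mul])⟩
  rw [BordismGroup.cls_eq_of_bordant hAD]
  exact h3

end Kernel

/-! ### Manifolds with one type of singularity -/

section Single

variable {k m : ℕ} {J : Type*} {P : J → CompactManifold k} {M : CompactManifold (k + (m + 1))}

open Classical in
/-- The singular face with a single non-empty component. -/
def singularData (i : J) (N : CompactManifold m) (f : N × P i × Ray → M) :
    ∀ j, Σ N : CompactManifold m, (N × P j × Ray → M) :=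
  Function.update (fun _ => ⟨CompactManifold.empty m,
    fun z => isEmptyElim (α := CompactManifold.empty m) z.1⟩) i ⟨N, f⟩

variable {i : J} {N : CompactManifold m} {f : N × P i × Ray → M}

/-- The type of the embedding depends on the manifold chosen at j, so `Function.update` can be
evaluated only in a motive that contains both together. -/
theorem singularData_induction
    {motive : ∀ j, (Σ N : CompactManifold m, (N × P j × Ray → M)) → Prop} (self : motive i ⟨N, f⟩)
    (other : ∀ j, j ≠ i → motive j ⟨CompactManifold.empty m,
      fun z => isEmptyElim (α := CompactManifold.empty m) z.1⟩) (j : J) :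
    motive j (singularData i N f j) := by
  classical
  by_cases h : j = i
  · subst h
    rw [singularData, Function.update_self]
    exact self
  · rw [singularData, Function.update_of_ne h]
    exact other j h

theorem singularData_eq (j : J) (x : (singularData i N f j).1) : j = i :=
  singularData_induction (motive := fun j t => t.1 → j = i) (fun _ => rfl)
    (fun _ _ x => isEmptyElim (α := CompactManifold.empty m) x) j x

/-- The manifold with singularities with a single non-empty component of the singular face. -/
def BSManifold.single (i : J) (N : CompactManifold m) (f : N × P i × Ray → M)
    (hf : IsLocalDiffeomorph ((Q m).prod ((Q k).prod (Q 1))) (Q (k + (m + 1))) ∞ f)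
    (hf' : Function.Injective f) : BSManifold P m where
  M := M
  N j := (singularData i N f j).1
  finite := (Set.finite_singleton i).subset fun j ⟨x⟩ => singularData_eq j x
  ι j := (singularData i N f j).2
  isLocalDiffeomorph := singularData_induction
    (motive := fun _ t => IsLocalDiffeomorph ((Q m).prod ((Q k).prod (Q 1))) (Q (k + (m + 1))) ∞ t.2)
    hf fun _ _ z => isEmptyElim (α := CompactManifold.empty m) z.1
  injective := by
    rintro ⟨j, z⟩ ⟨j', z'⟩ h
    obtain rfl := (singularData_eq j z.1).trans (singularData_eq j' z'.1).symm
    exact congrArg (Sigma.mk j) (singularData_induction (motive := fun _ t => Function.Injective t.2)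
      hf' (fun _ _ z => isEmptyElim (α := CompactManifold.empty m) z.1) j h)

theorem BSManifold.single_singularFace
    (hf : IsLocalDiffeomorph ((Q m).prod ((Q k).prod (Q 1))) (Q (k + (m + 1))) ∞ f)
    (hf' : Function.Injective f) : (BSManifold.single i N f hf hf').singularFace =
      {y | ∃ x p, f (x, p, 0) = y} := by
  refine Set.Subset.antisymm ?_ ?_
  · rintro _ ⟨j, x, p, rfl⟩
    exact singularData_induction (motive := fun _ t => ∀ x p, t.2 (x, p, 0) ∈ {y | ∃ x p, f (x, p, 0) = y})
      (fun x p => ⟨x, p, rfl⟩) (fun _ _ x => isEmptyElim (α := CompactManifold.empty m) x) j x p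
  · rintro _ ⟨x, p, rfl⟩
    refine ⟨i, ?_⟩
    exact singularData_induction (motive := fun j t => j = i → ∃ x' p', t.2 (x', p', 0) = f (x, p, 0))
      (fun _ => ⟨x, p, rfl⟩) (fun _ h h' => absurd h' h) i rfl

end Single

/-! ### Products bound, in the unoriented case -/

section Null

variable {k d : ℕ} {J : Type*} {P : J → CompactManifold k} {i : J} {N : CompactManifold (d + 1)}
  {C : CompactManifold (k + (d + 1))}
  (Φ : Diffeomorph ((Q k).prod (Q (d + 1))) (Q (k + (d + 1))) (P i × N) C ∞)

/-- The collar of the outgoing end of a cylinder on a product. -/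
def productEnd (z : N × P i × Ray) : C.cylinder := C.cylinderHi.toFun (Φ (z.2.1, z.1), z.2.2)

theorem isLocalDiffeomorph_productEnd : IsLocalDiffeomorph ((Q (d + 1)).prod ((Q k).prod (Q 1)))
    (Q (k + (d + 1) + 1)) ∞ (productEnd Φ) := fun z => by
  have h : IsLocalDiffeomorph ((Q (d + 1)).prod ((Q k).prod (Q 1)))
      (((Q k).prod (Q (d + 1))).prod (Q 1)) ∞
      fun z : N × P i × Ray => ((z.2.1, z.1), z.2.2) :=
    isLocalDiffeomorph_of_homeomorph
      { toFun := fun z : N × P i × Ray => ((z.2.1, z.1), z.2.2)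
        invFun := fun z : (P i × N) × Ray => (z.1.2, z.1.1, z.2)
        left_inv := fun _ => rfl
        right_inv := fun _ => rfl
        continuous_toFun := by fun_prop
        continuous_invFun := by fun_prop }
      ((contMDiff_snd.fst.prodMk contMDiff_fst).prodMk contMDiff_snd.snd)
      (contMDiff_fst.snd.prodMk (contMDiff_fst.fst.prodMk contMDiff_snd))
  exact ((h z).comp _ _ ((Φ.isLocalDiffeomorph _).prodMap (isLocalDiffeomorphAt_id _))).comp _ _
    (C.cylinderHi.isLocalDiffeomorph _)

theorem productEnd_injective : Function.Injective (productEnd Φ) := by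
  rintro ⟨x, p, r⟩ ⟨x', p', r'⟩ h
  obtain ⟨h1, rfl⟩ := Prod.ext_iff.1 (C.cylinderHi.injective h)
  obtain ⟨rfl, rfl⟩ := Prod.ext_iff.1 (Φ.injective h1)
  rfl

/-- The cylinder on a product, with the outgoing end as singular face. -/
def singularCylinder : BSManifold P (d + 1) :=
  BSManifold.single (M := C.cylinder) i N (productEnd Φ) (isLocalDiffeomorph_productEnd Φ)
    (productEnd_injective Φ)

theorem singularCylinder_singularFace :
    (singularCylinder Φ).singularFace = Set.range C.cylinderHi.face := by
  refine (BSManifold.single_singularFace _ _).trans (Set.Subset.antisymm ?_ ?_)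
  · rintro _ ⟨x, p, rfl⟩
    exact ⟨Φ (p, x), rfl⟩
  · rintro _ ⟨y, rfl⟩
    obtain ⟨⟨p, x⟩, rfl⟩ := Φ.surjective y
    exact ⟨x, p, rfl⟩

/-- A product bounds, as a manifold with singularities. -/
def singularCylinderBordism (hC : C.boundary = ∅) :
    (nonsingular P C).Bordism (nonsingular (d := d) P (CompactManifold.empty _)) where
  W := singularCylinder Φ
  cA := C.cylinderLo
  cB := Collar.ofEmpty _ _
  cNA _ := Collar.ofEmpty _ _
  cNB _ := Collar.ofEmpty _ _
  disjoint _ z' := isEmptyElim (α := CompactManifold.empty (k + (d + 1))) z'.1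
  disjoint_N _ z := isEmptyElim (α := CompactManifold.empty d) z.1
  corner_A _ x := isEmptyElim (α := CompactManifold.empty d) x
  corner_B _ x := isEmptyElim (α := CompactManifold.empty d) x
  essential_A a := by
    rw [nonsingular_singularFace, singularCylinder_singularFace]
    exact iff_of_false (fun ⟨y, hy⟩ => C.cylinder_disjoint (a, 0) (y, 0) hy.symm) id
  essential_B b := isEmptyElim (α := CompactManifold.empty (k + (d + 1))) b
  boundary_eq := by
    have h : Set.range (Collar.ofEmpty (k + (d + 1)) (singularCylinder Φ).M).face = ∅ :=
      Set.eq_empty_of_forall_notMem fun _ ⟨x, _⟩ =>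
        isEmptyElim (α := CompactManifold.empty (k + (d + 1))) x
    have e : C.cylinder.boundary = Set.range C.cylinderLo.face ∪
        Set.range (Collar.ofEmpty (k + (d + 1)) (singularCylinder Φ).M).face ∪
        Set.range C.cylinderHi.face := by
      refine (C.cylinder_boundary hC).trans (congrArg (· ∪ _) ?_)
      exact (Set.union_empty _).symm.trans (congrArg (_ ∪ ·) h.symm)
    exact e.trans (congrArg (_ ∪ ·) (singularCylinder_singularFace Φ).symm)

variable {X : Type*}

theorem singularCylinder_mapCompatible (F : C → X) (hF : ∀ p p' x, F (Φ (p, x)) = F (Φ (p', x))) :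
    (singularCylinder Φ).MapCompatible fun y => F ((C.toProd interval).symm y).1 := fun j x p p' =>
  have h (p x) : F ((C.toProd interval).symm (productEnd Φ (x, p, 0))).1 = F (Φ (p, x)) :=
    congrArg (fun z : C × interval => F z.1) ((C.toProd interval).symm_apply_apply _)
  singularData_induction (k := k) (m := d + 1) (P := P) (i := i) (N := N) (M := C.cylinder)
    (f := productEnd Φ) (motive := fun _ t => ∀ x p p',
      F ((C.toProd interval).symm (t.2 (x, p, 0))).1 =
        F ((C.toProd interval).symm (t.2 (x, p', 0))).1)
    (fun x p p' => (h _ _).trans ((hF p p' x).trans (h _ _).symm))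
    (fun _ _ x => isEmptyElim (α := CompactManifold.empty (d + 1)) x)
    j x p p'

variable [TopologicalSpace X]

/-- The empty manifold is the disjoint union of two copies of itself, so its class equals its
double. -/
theorem Singular.cls_empty : (BordismGroup.cls (Singular.empty (k + (d + 1)) X) :
    Omega (k + (d + 1)) X) = 0 := by
  have h : Singular.Union (Singular.empty (k + (d + 1)) X) (Singular.empty _ X)
      (Singular.empty _ X) :=
    ⟨DisjointUnion.ofEmpty _, fun _ => rfl, fun _ => rfl⟩
  have : (BordismGroup.cls (Singular.empty (k + (d + 1)) X) : Omega (k + (d + 1)) X) = _ + _ :=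
    BordismGroup.cls_eq_add h
  rwa [left_eq_add] at this

theorem FramedSingular.cls_empty : (BordismGroup.cls (FramedSingular.empty (k + (d + 1)) X) :
    FramedOmega (k + (d + 1)) X) = 0 := by
  have h : FramedSingular.Union (FramedSingular.empty (k + (d + 1)) X) (FramedSingular.empty _ X)
      (FramedSingular.empty _ X) :=
    ⟨DisjointUnion.ofEmpty _, fun _ => rfl, fun _ => rfl,
      fun x => isEmptyElim (α := CompactManifold.empty (k + (d + 1))) x,
      fun x => isEmptyElim (α := CompactManifold.empty (k + (d + 1))) x⟩
  have : (BordismGroup.cls (FramedSingular.empty (k + (d + 1)) X) : FramedOmega (k + (d + 1)) X) = _ + _ :=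
    BordismGroup.cls_eq_add h
  rwa [left_eq_add] at this

/-- The diffeomorphism from the representative P i is absorbed into the product structure of C. The
cylinder on C, with its upper end as singular face, then bounds C. -/
theorem products_le_ker_naturalMap (hP : ∀ Q : ClosedManifold k, ∃ i, Nonempty (Diffeomorph
      (BaasSullivan.Q k) (BaasSullivan.Q k) (P i) Q.toCompactManifold ∞)) :
    products k (d + 1) X ≤ (naturalMap P d X).ker := by
  refine (AddSubgroup.closure_le _).2 ?_
  rintro _ ⟨P', N, C, ⟨Φ, hΦ⟩, rfl⟩
  obtain ⟨i, ⟨δ⟩⟩ := hP P'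
  let Ψ : Diffeomorph ((Q k).prod (Q (d + 1))) (Q (k + (d + 1))) (P i × N.toCompactManifold)
    C.toCompactManifold ∞ := (δ.prodCongr (Diffeomorph.refl _ _ _)).trans Φ
  have hb : BSSingular.Bordant (C.toBS P : BSSingular P d X)
      ((Singular.empty (k + (d + 1)) X).toBS P) :=
    ⟨singularCylinderBordism Ψ C.boundary_eq,
      ⟨fun y => C.map ((C.toCompactManifold.toProd interval).symm y).1,
        C.map.continuous.comp (continuous_fst.comp (C.toCompactManifold.toProd interval).symm.continuous)⟩,
      singularCylinder_mapCompatible Ψ C.map fun p p' x => (hΦ _ _).trans (hΦ _ _).symm,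
      fun _ => rfl, fun x => isEmptyElim (α := CompactManifold.empty (k + (d + 1))) x⟩
  change naturalMap P d X (BordismGroup.cls C) = 0
  rw [← (naturalMap P d X).map_zero, ← Singular.cls_empty, naturalMap, BordismGroup.map_cls,
    BordismGroup.map_cls]
  exact BordismGroup.cls_eq_of_bordant hb

end Null

/-! ### Conjugation of framings by block rotations -/

section Conjugation

variable {V : Type*}

/-- The conjugate of a map `ℝ^ℕ → V × ℝ^ℕ` by a rotation of `ℝ^ℕ`. -/
def conj (J : (ℕ → ℝ) →ₗ[ℝ] (ℕ → ℝ)) (θ : ℝ) (D : (ℕ → ℝ) → V × (ℕ → ℝ)) (s : ℕ → ℝ) :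
    V × (ℕ → ℝ) :=
  ((D (rotation J (-θ) s)).1, rotation J θ (D (rotation J (-θ) s)).2)

theorem conj_neg_conj {J : (ℕ → ℝ) →ₗ[ℝ] (ℕ → ℝ)} (hJ : ∀ y, J (J (J y)) = -J y) (θ : ℝ)
    (D : (ℕ → ℝ) → V × (ℕ → ℝ)) : conj J (-θ) (conj J θ D) = D := by
  funext s
  simp only [conj, neg_neg, rotation_neg_rotation hJ]

/-- A map `ℝ^ℕ → V × ℝ^ℕ` that is the sum of a map defined on `ℝ^R` and the identity. -/
structure IsStabilised (R : ℕ) (f : (ℕ → ℝ) → V × (ℕ → ℝ)) : Prop where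
  fst_congr : ∀ s s' : ℕ → ℝ, (∀ i < R, s i = s' i) → (f s).1 = (f s').1
  snd_congr : ∀ s s' : ℕ → ℝ, (∀ i < R, s i = s' i) → ∀ i < R, (f s).2 i = (f s').2 i
  snd_apply : ∀ s i, R ≤ i → (f s).2 i = s i

theorem IsStable.isStabilised {V V' : Type*} [AddCommGroup V] [Module ℝ V] [AddCommGroup V']
    [Module ℝ V'] {R : ℕ} {L : V × (ℕ → ℝ) →ₗ[ℝ] V' × (ℕ → ℝ)} (h : IsStable R L) (v : V) :
    IsStabilised R fun s => L (v, s) := by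
  have key : ∀ s s' : ℕ → ℝ, (∀ i < R, s i = s' i) → L (v, s) = L (v, s') + (0, s - s') := by
    intro s s' hs
    rw [← h.apply_tail (s - s') fun i hi => sub_eq_zero.2 (hs i hi), ← map_add]
    simp
  refine ⟨fun s s' hs => ?_, fun s s' hs i hi => ?_, fun s => h.snd_apply _⟩
  · simp [key s s' hs]
  · simp [key s s' hs, hs i hi]

/-- The quarter turn exchanges the two blocks, up to a sign on one of them which drops out under
conjugation. -/
theorem rotation_half_pi_blockGenerator {a b m : ℕ} (h : a + m ≤ b) (s : ℕ → ℝ) (i : ℕ) :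
    rotation (blockGenerator a b m) (Real.pi / 2) s i = if a ≤ i ∧ i < a + m then -s (i - a + b)
      else if b ≤ i ∧ i < b + m then s (i - b + a) else s i := by
  rw [rotation_half_pi, Pi.add_apply, Pi.add_apply, blockGenerator_sq h, blockGenerator_apply]
  split_ifs <;> first | omega | simp

theorem rotation_neg_half_pi_blockGenerator {a b m : ℕ} (h : a + m ≤ b) (s : ℕ → ℝ) (i : ℕ) :
    rotation (blockGenerator a b m) (-(Real.pi / 2)) s i =
      if a ≤ i ∧ i < a + m then s (i - a + b)
      else if b ≤ i ∧ i < b + m then -s (i - b + a) else s i := by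
  rw [rotation_apply, Pi.add_apply, Pi.add_apply, Pi.smul_apply, Pi.smul_apply, blockGenerator_sq h,
    blockGenerator_apply, Real.sin_neg, Real.cos_neg, Real.sin_pi_div_two, Real.cos_pi_div_two]
  split_ifs <;> first | omega | simp

/-- Conjugation by a block rotation moves the position of the second summand of a direct sum. -/
theorem directSum_eq_conj {k m a b q : ℕ} (h : a + q ≤ b)
    {f : (ℕ → ℝ) → Eucl k × (ℕ → ℝ)} {g : (ℕ → ℝ) → Eucl m × (ℕ → ℝ)} (hf : IsStabilised a f)
    (hg : IsStabilised q g) : (fun s => directSum b (f s) (g (tail b s))) =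
      conj (blockGenerator a b q) (Real.pi / 2) fun s => directSum a (f s) (g (tail a s)) := by
  funext s
  have r := rotation_neg_half_pi_blockGenerator h s
  set u := rotation (blockGenerator a b q) (-(Real.pi / 2)) s with hu
  -- The vector u agrees with s below a, and its block at a is the block of s at b. So f and g
  -- receive the same relevant input on both sides; above their ranks both are the identity, and
  -- what remains is bookkeeping of positions.
  have h1 : ∀ i < a, s i = u i := fun i hi => by rw [r, if_neg (by omega), if_neg (by omega)]
  have h2 : ∀ i < q, tail b s i = tail a u i := fun i hi => by
    rw [tail, tail, r, if_pos (by omega)]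
    congr 1; omega
  refine Prod.ext ?_ (funext fun i => ?_)
  · exact congrArg₂ append (hf.fst_congr _ _ h1) (hg.fst_congr _ _ h2)
  · change (if i < b then (f s).2 i else (g (tail b s)).2 (i - b)) =
      rotation (blockGenerator a b q) (Real.pi / 2) (directSum a (f u) (g (tail a u))).2 i
    rw [rotation_half_pi_blockGenerator h]
    simp only [directSum]
    split_ifs <;> try omega
    · rw [hf.snd_apply _ _ (by omega), hg.snd_apply _ _ (by omega), tail, r, if_neg (by omega),
        if_pos (by omega), neg_neg]
      congr 1; omega
    · exact hf.snd_congr _ _ h1 _ ‹_›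
    · rw [hf.snd_apply _ _ (by omega), hg.snd_apply _ _ (by omega), tail, r, if_neg (by omega),
        if_neg (by omega)]
      congr 1; omega
    · rw [hg.snd_congr _ _ h2 _ (by omega)]
      exact congrArg (g (tail a u)).2 (by omega)
    · rw [hg.snd_apply _ _ (by omega), hg.snd_apply _ _ (by omega), tail, tail, r, if_neg (by omega),
        if_neg (by omega)]
      congr 1; omega

variable {n : ℕ} {X : Type*} [TopologicalSpace X]

/-- The conjugate of a stable framing by a block rotation is a framing in the same bordism class. -/
theorem FramedSingular.exists_conj (A : FramedSingular n X) {a b m : ℕ} (h : a + m ≤ b) (θ : ℝ) :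
    ∃ φ : StableFraming A.toCompactManifold,
      (∀ x v, φ.extend x v = conj (blockGenerator a b m) θ (A.framing.extend x v)) ∧
      (BordismGroup.cls { A with framing := φ } : FramedOmega n X) = BordismGroup.cls A := by
  let G := fun {V : Type} [AddCommGroup V] [Module ℝ V] (θ : ℝ) => LinearMap.prodMap
    (LinearMap.id : V →ₗ[ℝ] V) (rotation (blockGenerator a b m) θ)
  let R := max A.framing.rank (b + m)
  have hR : b + m ≤ R := le_max_right _ _
  have hA : IsFraming A.toCompactManifold R A.framing.toLin :=
    A.framing.isFraming.mono (le_max_left _ _)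
  have hc := continuous_blockGenerator a b m
  have h1 : IsFraming A.toCompactManifold R fun x => G θ ∘ₗ A.framing.toLin x ∘ₗ G (-θ) := by
    refine ⟨fun x => (isStable_rotation_blockGenerator h hR θ).comp
      ((hA.stable x).comp (isStable_rotation_blockGenerator h hR (-θ))), ?_⟩
    have h3 : Continuous fun z : TangentBundle (Q n) A.toCompactManifold × (ℕ → ℝ) =>
        A.framing.toLin z.1.proj (z.1.snd, rotation (blockGenerator a b m) (-θ) z.2) :=
      hA.comp_continuous continuous_fst (continuous_rotation hc continuous_const continuous_snd)
    exact (continuous_fst.comp h3).prodMk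
      (continuous_rotation hc continuous_const (continuous_snd.comp h3))
  obtain ⟨φ, hφ⟩ := h1.exists_stableFraming
  have hφ' : ∀ x v s, φ.toLin x (v, s) =
      conj (blockGenerator a b m) θ (A.framing.extend x v) s := fun x v s =>
    DFunLike.congr_fun (congrFun hφ x) (v, s)
  refine ⟨φ, fun x v => funext fun s => hφ' x v s, BordismGroup.cls_eq_of_bordant ?_⟩
  obtain ⟨Φ, h2, -, lo, hi⟩ := hA.exists_cylinder
  -- The angle of the conjugation runs from θ at the incoming end of the cylinder to 0 for r ≥ 1, so
  -- the other end keeps the original framing.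
  let τ : ℝ → ℝ := fun r => max 0 (1 - r)
  have hτ : Continuous τ := by fun_prop
  have τ1 : ∀ r, 1 ≤ r → τ r = 0 := fun r hr => max_eq_left (by linarith)
  have τ0 : τ 0 = 1 := by simp [τ]
  have cont : ∀ {V : Type} [NormedAddCommGroup V] [NormedSpace ℝ V] (θ : ℝ),
      Continuous fun z : ℝ × V × (ℕ → ℝ) => G (V := V) (θ * τ z.1) z.2 := fun θ =>
    (continuous_fst.comp continuous_snd).prodMk (continuous_rotation hc
      (continuous_const.mul (hτ.comp continuous_fst)) (continuous_snd.comp continuous_snd))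
  have one_le : ∀ {V : Type} [AddCommGroup V] [Module ℝ V] (θ r : ℝ), 1 ≤ r →
      G (V := V) (θ * τ r) = LinearMap.id := fun θ r hr => by
    rw [τ1 r hr, mul_zero]
    exact (congrArg (LinearMap.prodMap _) (rotation_zero _)).trans LinearMap.prodMap_id
  obtain ⟨Φ', h4, h5, h6⟩ := A.cylinderLo.exists_modification h2 (g := fun r => G (-θ * τ r))
    (g' := fun r => G (θ * τ r)) (fun r => isStable_rotation_blockGenerator h hR _)
    (fun r => isStable_rotation_blockGenerator h hR _) (cont _) (cont _) (one_le _) (one_le _)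
  obtain ⟨ψ, rfl⟩ := h4.exists_stableFraming
  refine ⟨⟨A.cylinder, A.cylinderLo, A.cylinderHi, A.cylinder_disjoint,
    A.cylinder_boundary A.boundary_eq⟩,
    ⟨fun y => A.map ((A.toCompactManifold.toProd interval).symm y).1, A.map.continuous.comp
      (continuous_fst.comp (A.toCompactManifold.toProd interval).symm.continuous)⟩, ψ,
    fun x => ?_, fun x => ?_, fun x v t s => ?_, fun x v t s => ?_⟩
  · exact congrArg (fun z : A.toCompactManifold × interval => A.map z.1)
      ((A.toCompactManifold.toProd interval).symm_apply_apply _)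
  · exact congrArg (fun z : A.toCompactManifold × interval => A.map z.1)
      ((A.toCompactManifold.toProd interval).symm_apply_apply _)
  · refine (congrArg (fun u => ψ.toLin (A.cylinderLo.face x) (u, s))
      (A.cylinderLo.derivAt_zero x v t).symm).trans ?_
    refine (h6 x 0 v t s).trans ?_
    have e : Ray.coord 0 = 0 := Ray.coord_zero
    have e1 : -θ * τ (Ray.coord 0) = -θ := by rw [e, τ0, mul_one]
    have e2 : θ * τ (Ray.coord 0) = θ := by rw [e, τ0, mul_one]
    rw [e1, e2]
    refine (congrArg (G θ) (lo x v t _)).trans ?_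
    have e3 := hφ' x v s
    rw [one_mul]
    exact congrArg (fun y : Eucl n × (ℕ → ℝ) => (snoc y.1 t, y.2)) e3.symm
  · refine (congrArg (fun u => ψ.toLin (A.cylinderHi.face x) (u, s))
      (A.cylinderHi.derivAt_zero x v t).symm).trans ?_
    have e1 := h5 (A.cylinderHi.face x) fun ⟨z, hz⟩ => A.cylinder_disjoint z (x, 0) hz
    refine (DFunLike.congr_fun e1 _).trans ((hi x v t s).trans ?_)
    rw [neg_one_mul]
    rfl

/-- A product with a framed manifold is bordant to a product with any isomorphic one. -/
theorem IsFramedProduct.exists_of_isomorphic {k m : ℕ} {P P' : FramedManifold k}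
    {N : FramedSingular m X} {C : FramedSingular (k + m) X} (h : IsFramedProduct P' N C)
    (hP : P.Isomorphic P') : ∃ C', IsFramedProduct P N C' ∧
      (BordismGroup.cls C' : FramedOmega (k + m) X) = BordismGroup.cls C := by
  obtain ⟨Φ, hΦ, hC⟩ := h
  obtain ⟨δ, hδ⟩ := hP
  let Ψ : Diffeomorph ((Q k).prod (Q m)) (Q (k + m)) (P.toCompactManifold × N.toCompactManifold)
    C.toCompactManifold ∞ := (δ.prodCongr (Diffeomorph.refl _ _ _)).trans Φ
  have hΨ : ∀ p x (w : Eucl k) (v : Eucl m), mfderiv ((Q k).prod (Q m)) (Q (k + m)) Ψ (p, x)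
      ((w, v) : Eucl k × Eucl m) = mfderiv ((Q k).prod (Q m)) (Q (k + m)) Φ (δ p, x)
        ((mfderiv (Q k) (Q k) δ p w, v) : Eucl k × Eucl m) := by
    intro p x w v
    have h1 := δ.mdifferentiable (by simp) p
    have h2 := mfderiv_comp (p, x) (Φ.mdifferentiable (by simp) (δ p, x))
      (h1.prodMap (mdifferentiableAt_id (x := x)))
    rw [mfderiv_prodMap h1 mdifferentiableAt_id, mfderiv_id] at h2
    exact DFunLike.congr_fun h2 ((w, v) : Eucl k × Eucl m)
  let r := P.framing.rank
  let r' := P'.framing.rank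
  let q := N.framing.rank
  -- A position so far out that the block of length q at B is disjoint from those at r and at r'.
  -- The stable coordinates of N are moved from r' to B, and from there back to r.
  let B := max r r' + q
  have hr : r + q ≤ B := by omega
  have hr' : r' + q ≤ B := by omega
  obtain ⟨φ₁, h1, e1⟩ := C.exists_conj hr' (Real.pi / 2)
  obtain ⟨φ₂, h2, e2⟩ := { C with framing := φ₁ : FramedSingular (k + m) X }.exists_conj hr
    (-(Real.pi / 2))
  refine ⟨{ C with framing := φ₂ }, ⟨Ψ, fun p x => hΦ (δ p) x, fun p x w v s => ?_⟩, e2.trans e1⟩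
  -- The extended framings of P and P' correspond under δ, so that of P is the identity beyond the
  -- rank of P' as well as beyond its own.
  have f1 : IsStabilised r' (P.framing.extend p w) := by
    have : P.framing.extend p w = P'.framing.extend (δ p) (mfderiv (Q k) (Q k) δ p w) :=
      funext fun s => (hδ p w s).symm
    rw [this]
    exact (P'.framing.isStable (δ p)).isStabilised _
  have f2 : IsStabilised r (P.framing.extend p w) := (P.framing.isStable p).isStabilised _
  have g : IsStabilised q (N.framing.extend x v) := (N.framing.isStable x).isStabilised _
  have h3 : C.framing.extend (Ψ (p, x)) (mfderiv ((Q k).prod (Q m)) (Q (k + m)) Ψ (p, x)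
      ((w, v) : Eucl k × Eucl m)) = fun s =>
        directSum r' (P.framing.extend p w s) (N.framing.extend x v (tail r' s)) := by
    refine (congrArg _ (hΨ p x w v)).trans (funext fun s => (hC (δ p) x _ v s).trans ?_)
    exact congrArg (fun y => directSum r' y _) (hδ p w s)
  refine (congrFun (h2 _ _) s).trans ?_
  have h4 := (h1 _ _).trans ((congrArg _ h3).trans (directSum_eq_conj hr' f1 g).symm)
  refine (congrFun (congrArg (conj _ _) (h4.trans (directSum_eq_conj hr f2 g))) s).trans ?_
  exact congrFun (conj_neg_conj (blockGenerator_cube hr) _ _) s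

end Conjugation

/-! ### Products bound, in the framed case -/

/-- The sum of an isomorphism and the reflection of a line. -/
def outgoingEquiv {m r : ℕ} (L : (Eucl m × Eucl r) ≃L[ℝ] (Eucl m × Eucl r)) :
    (Eucl m × ℝ × Eucl r) ≃L[ℝ] (Eucl (m + 1) × Eucl r) :=
  LinearEquiv.toContinuousLinearEquiv
    { toFun := fun z => (snocL m ((L (z.1, z.2.2)).1, -z.2.1), (L (z.1, z.2.2)).2)
      invFun := fun y =>
        (((L).symm (((snocL m).symm y.1).1, y.2)).1, -((snocL m).symm y.1).2,
          ((L).symm (((snocL m).symm y.1).1, y.2)).2)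
      map_add' := fun z z' => by
        have h := (L).map_add (z.1, z.2.2) (z'.1, z'.2.2)
        refine Prod.ext ?_ (congrArg Prod.snd h :)
        refine Eq.trans ?_ ((snocL m).map_add _ _)
        exact congrArg (snocL m) (Prod.ext (congrArg Prod.fst h :) (neg_add _ _))
      map_smul' := fun c z => by
        have h := (L).map_smul c (z.1, z.2.2)
        refine Prod.ext ?_ (congrArg Prod.snd h :)
        refine Eq.trans ?_ ((snocL m).map_smul c _)
        exact congrArg (snocL m) (Prod.ext (congrArg Prod.fst h :) (smul_neg _ _).symm)
      left_inv := fun z => by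
        have h := (L).symm_apply_apply (z.1, z.2.2)
        simp only [LinearEquiv.symm_apply_apply, Prod.mk.eta, neg_neg]
        exact Prod.ext (congrArg Prod.fst h :) (Prod.ext rfl (congrArg Prod.snd h :))
      right_inv := fun y => by
        have h := (L).apply_symm_apply (((snocL m).symm y.1).1, y.2)
        simp only [Prod.mk.eta, neg_neg]
        refine Prod.ext ?_ (congrArg Prod.snd h :)
        refine Eq.trans ?_ ((snocL m).apply_symm_apply _)
        exact congrArg (snocL m) (Prod.ext (congrArg Prod.fst h :) rfl) }

/-- The sum of a stable framing and the outgoing framing of the normal direction. -/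
def StableFraming.outgoing {m : ℕ} {N : CompactManifold m} (φ : StableFraming N) :
    FaceFraming N where
  rank := φ.rank
  iso x := outgoingEquiv (φ.iso x)
  continuous_iso := by
    have h : Continuous fun z : TangentBundle (Q m) N × ℝ × Eucl φ.rank =>
        φ.iso z.1.proj (z.1.snd, z.2.2) :=
      φ.continuous_iso.comp (continuous_fst.prodMk (continuous_snd.comp continuous_snd))
    exact (continuous_snoc (continuous_fst.comp h)
      (continuous_fst.comp continuous_snd).neg).prodMk (continuous_snd.comp h)

section Null

variable {k d : ℕ} {J : Type*} {P : J → CompactManifold k} {i : J} {N : CompactManifold (d + 1)}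
  {C : CompactManifold (k + (d + 1))}
  (Φ : Diffeomorph ((Q k).prod (Q (d + 1))) (Q (k + (d + 1))) (P i × N) C ∞)

theorem mfderiv_productEnd (x : N) (p : P i) (v : Eucl (d + 1)) (w : Eucl k) (t : ℝ) :
    mfderiv ((Q (d + 1)).prod ((Q k).prod (Q 1))) (Q (k + (d + 1) + 1)) (productEnd Φ) (x, p, 0)
      ((v, w, EuclideanSpace.single 0 t) : Eucl (d + 1) × Eucl k × Eucl 1) =
    C.cylinderHi.derivAt (Φ (p, x)) 0 (mfderiv ((Q k).prod (Q (d + 1))) (Q (k + (d + 1))) Φ (p, x)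
      ((w, v) : Eucl k × Eucl (d + 1)), t) := by
  refine Eq.trans ?_ (Collar.derivAt_apply _ _ _ _ _).symm
  let f : N × P i × Ray → C × Ray := fun z => (Φ (z.2.1, z.1), z.2.2)
  have hs := hasMFDerivAt_snd (I := Q (d + 1)) (I' := (Q k).prod (Q 1)) (x, p, (0 : Ray))
  have h1 : HasMFDerivAt ((Q (d + 1)).prod ((Q k).prod (Q 1))) ((Q k).prod (Q (d + 1)))
      (fun z : N × P i × Ray => (z.2.1, z.1)) (x, p, 0) _ :=
    ((hasMFDerivAt_fst (p, (0 : Ray))).comp (x, p, (0 : Ray)) hs).prodMk (hasMFDerivAt_fst _)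
  have hf : HasMFDerivAt ((Q (d + 1)).prod ((Q k).prod (Q 1))) ((Q (k + (d + 1))).prod (Q 1)) f
      (x, p, 0) _ :=
    ((Φ.mdifferentiable (by simp) (p, x)).hasMFDerivAt.comp (x, p, (0 : Ray)) h1).prodMk
      ((hasMFDerivAt_snd (p, (0 : Ray))).comp (x, p, (0 : Ray)) hs)
  have h2 := mfderiv_comp (x, p, (0 : Ray)) (f := f)
    (C.cylinderHi.isLocalDiffeomorph.mdifferentiable (by simp) (Φ (p, x), 0)) hf.mdifferentiableAt
  refine (DFunLike.congr_fun h2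
    ((v, w, EuclideanSpace.single 0 t) : Eucl (d + 1) × Eucl k × Eucl 1)).trans ?_
  rw [hf.mfderiv]
  rfl

/-- The framing of the cylinder on a framed product, with the outgoing end as singular face. -/
theorem singularCylinder_nonempty_framing (φP : ∀ i, StableFraming (P i)) (φN : StableFraming N)
    (φC : StableFraming C) (h : ∀ p x (w : (P i).Tangent p) (v : N.Tangent x) s,
      φC.extend (Φ (p, x)) (mfderiv ((Q k).prod (Q (d + 1))) (Q (k + (d + 1))) Φ (p, x)
        ((w, v) : Eucl k × Eucl (d + 1))) s =
      directSum (φP i).rank ((φP i).extend p w s) (φN.extend x v (tail (φP i).rank s))) :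
    ∃ φ : (singularCylinder Φ).Framing φP, C.cylinderLo.Compatible 1 φC φ.total := by
  obtain ⟨ψ, h1, -, lo, hi⟩ := φC.isFraming.exists_cylinder
  obtain ⟨ψ, rfl⟩ := h1.exists_stableFraming
  have key : ∀ j, ∃ ν : FaceFraming (singularData i N (productEnd Φ) j).1, ∀ x p v w t s,
      ψ.toLin ((singularData i N (productEnd Φ) j).2 (x, p, 0))
        (mfderiv ((Q (d + 1)).prod ((Q k).prod (Q 1))) (Q (k + (d + 1) + 1))
          (singularData i N (productEnd Φ) j).2 (x, p, 0)
          ((v, w, EuclideanSpace.single 0 t) : Eucl (d + 1) × Eucl k × Eucl 1), s) =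
      directSum (φP j).rank ((φP j).extend p w s) (ν.extend x v t (tail (φP j).rank s)) := by
    refine singularData_induction (k := k) (m := d + 1) (P := P) (i := i) (N := N) (M := C.cylinder)
      (f := productEnd Φ) (motive := fun j T => ∃ ν : FaceFraming T.1, ∀ x p v w t s,
        ψ.toLin (T.2 (x, p, 0)) (mfderiv ((Q (d + 1)).prod ((Q k).prod (Q 1))) (Q (k + (d + 1) + 1))
          T.2 (x, p, 0) ((v, w, EuclideanSpace.single 0 t) : Eucl (d + 1) × Eucl k × Eucl 1), s) =
        directSum (φP j).rank ((φP j).extend p w s) (ν.extend x v t (tail (φP j).rank s))) ?_ ?_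
    -- At the upper end the coordinate of [0,1] decreases along the inward normal, hence the
    -- outgoing framing of N ⊕ ℝσ; `append_snoc` moves this last coordinate into the normal summand.
    · refine ⟨φN.outgoing, fun x p v w t s => ?_⟩
      refine (congrArg (fun u : Eucl (k + (d + 1) + 1) => ψ.toLin _ (u, s))
        (mfderiv_productEnd Φ x p v w t)).trans ((hi _ _ t s).trans ?_)
      refine (congrArg (fun y : Eucl (k + (d + 1)) × (ℕ → ℝ) => (snoc y.1 (-t), y.2))
        (h p x w v s)).trans ?_
      exact Prod.ext (append_snoc ((φP i).extend p w s).1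
        (φN.extend x v (tail (φP i).rank s)).1 (-t)).symm rfl
    · exact fun _ _ => ⟨FaceFraming.ofEmpty (d + 1), fun x =>
        isEmptyElim (α := CompactManifold.empty (d + 1)) x⟩
  choose ν hν using key
  refine ⟨⟨ψ, ν, hν⟩, fun x v t s => ?_⟩
  rw [one_mul]
  exact (congrArg (fun u => ψ.toLin (C.cylinderLo.face x) (u, s))
      (C.cylinderLo.derivAt_zero x v t).symm).trans (lo x v t s)

variable {X : Type*} [TopologicalSpace X]

theorem framedProducts_le_ker_framedNaturalMap {P : J → FramedManifold k}
    (hP : ∀ Q, ∃ i, (P i).Isomorphic Q) : framedProducts k (d + 1) X ≤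
      (framedNaturalMap (P := fun i => (P i).toCompactManifold) (fun i => (P i).framing) d X).ker := by
  refine (AddSubgroup.closure_le _).2 ?_
  rintro _ ⟨P', N, C, h, rfl⟩
  obtain ⟨i, hi⟩ := hP P'
  -- From here on C is a product with the representative P i itself, stabilised at the rank of its
  -- own framing, and still in the given class.
  obtain ⟨C, ⟨Φ, hΦ, hC⟩, hcls⟩ := h.exists_of_isomorphic hi
  rw [← hcls]
  obtain ⟨φ, hφ⟩ := singularCylinder_nonempty_framing (P := fun i => (P i).toCompactManifold)
    (i := i) Φ (fun i => (P i).framing) N.framing C.framing hC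
  have hb : FramedBSSingular.Bordant
      (C.toBS fun i => (P i).framing : FramedBSSingular (fun i => (P i).framing) d X)
      ((FramedSingular.empty (k + (d + 1)) X).toBS fun i => (P i).framing) :=
    ⟨singularCylinderBordism (P := fun i => (P i).toCompactManifold) (i := i) Φ C.boundary_eq,
      ⟨fun y => C.map ((C.toCompactManifold.toProd interval).symm y).1,
        C.map.continuous.comp (continuous_fst.comp (C.toCompactManifold.toProd interval).symm.continuous)⟩,
      φ, singularCylinder_mapCompatible (P := fun i => (P i).toCompactManifold) (i := i) Φ C.map
        fun p p' x => (hΦ _ _).trans (hΦ _ _).symm,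
      fun x => congrArg (fun z : C.toCompactManifold × interval => C.map z.1)
        ((C.toCompactManifold.toProd interval).symm_apply_apply _),
      fun x => isEmptyElim (α := CompactManifold.empty (k + (d + 1))) x, hφ,
      fun x => isEmptyElim (α := CompactManifold.empty (k + (d + 1))) x⟩
  change framedNaturalMap _ d X (BordismGroup.cls C) = 0
  rw [← (framedNaturalMap _ d X).map_zero, ← FramedSingular.cls_empty, framedNaturalMap,
    BordismGroup.map_cls, BordismGroup.map_cls]
  exact BordismGroup.cls_eq_of_bordant hb

end Null

end BaasSullivan

end

/-! ### The proposition -/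

theorem mainTheorem12 (k : ℕ) (hk : 0 < k) (X : Type*) [TopologicalSpace X] :
    (∀ 𝕄 : Set (BaasSullivan.FramedManifold k),
      (∀ Q : BaasSullivan.FramedManifold k, ∃ P ∈ 𝕄, P.Isomorphic Q) →
      (BaasSullivan.framedNaturalMap
          (P := fun P : 𝕄 => P.1.toCompactManifold) (fun P => P.1.framing) 0 X).ker
        = BaasSullivan.framedProducts k 1 X) ∧
    (∀ 𝕄 : Set (BaasSullivan.ClosedManifold k),
      (∀ Q : BaasSullivan.ClosedManifold k, ∃ P ∈ 𝕄, Nonempty (Diffeomorph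
        (BaasSullivan.Q k) (BaasSullivan.Q k) P.toCompactManifold Q.toCompactManifold ∞)) →
      (BaasSullivan.naturalMap (fun P : 𝕄 => P.1.toCompactManifold) 0 X).ker
        = BaasSullivan.products k 1 X) := by
  -- The four inclusions hold for every d; the dimension k + 1 is the case d = 0.
  refine ⟨fun 𝕄 h𝕄 => le_antisymm ?_ ?_, fun 𝕄 h𝕄 => le_antisymm ?_ ?_⟩
  · exact BaasSullivan.ker_framedNaturalMap_le (fun P => P.1.boundary_eq)
  · exact BaasSullivan.framedProducts_le_ker_framedNaturalMap (P := fun P : 𝕄 => P.1)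
      fun Q => let ⟨P, hP, h⟩ := h𝕄 Q; ⟨⟨P, hP⟩, h⟩
  · exact BaasSullivan.ker_naturalMap_le (fun P => P.1.boundary_eq)
  · exact BaasSullivan.products_le_ker_naturalMap
      fun Q => let ⟨P, hP, h⟩ := h𝕄 Q; ⟨⟨P, hP⟩, h⟩
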